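/- Let $n\ge 1$. A reduced divisor $D\subseteq\mathbb{C}^n$ is a subset which near every point $p\in\mathbb C^n$ is the zero set of a holomorphic function $f$ with nonzero germ that generates the ideal of germs in $\mathcal{O}_p$ vanishing on $D$ (a reduced local equation of $D$ at $p$); $\mathrm{Der}(-\log D)$ is the sheaf of holomorphic vector fields $\delta$ with $\delta(f)\in\mathcal{O}\cdot f$ for such $f$. $D$ is a *linear free divisor* if the $\mathcal{O}$-module $\mathrm{Der}(-\log D)$ has a basis $\delta_1,\dots,\delta_n$ of global vector fields with linear coefficients, $\delta_k=\sum_{i,j}x_ia^{(k)}_{ij}\partial_j$. Let $G_D=\{A\in \mathrm{GL}_n(\mathbb{C})\mid A(D)=D\}$ and let $\mathfrak{g}_D\subseteq\mathfrak{gl}_n(\mathbb{C})$ be its Lie algebra, i.e. the set of all $A$ with $\exp(tA)\in G_D$ for all $t\in\mathbb{R}$. A Lie algebra of matrices is *reductive* if it is the direct sum of a semisimple ideal and an ideal of simultaneously diagonalizable matrices, and $D$ is called reductive if $\mathfrak{g}_D$ is. **Theorem.** For $1\le n\le 4$, a subset $D\subseteq\mathbb{C}^n$ is a linear free divisor if and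 only if it is the image under a linear automorphism of $\mathbb{C}^n$ of the zero set $\{\Delta=0\}$ of one of the polynomials $\Delta$ with that $n$ in the following list of nine, and the divisors in the list are pairwise not linearly isomorphic. For each entry, $\Delta$ is a reduced equation of $\{\Delta=0\}$ (at every point of $\mathbb{C}^n$), the rows of the given matrix (a row $(\ell_1,\dots,\ell_n)$ standing for $\sum_j\ell_j\partial_j$) form a basis of $\mathrm{Der}(-\log D)$ for $D=\{\Delta=0\}$, and $\mathfrak{g}_D$ is isomorphic to the given complex Lie algebra and is reductive or not, as stated. Coordinates are $x,y,z,w$. 1. $n=1$: $\Delta=x$; matrix $(x)$; $\mathfrak{g}_D\cong\mathbb{C}$; reductive. 2. $n=2$: $\Delta=xy$; $\mathrm{diag}(x,y)$; $\mathfrak{g}_D\cong\mathbb{C}^2$; reductive. 3. $n=3$: $\Delta=xyz$; $\mathrm{diag}(x,y,z)$; $\mathfrak{g}_D\cong\mathbb{C}^3$; reductive. 4. $n=3$: $\Delta=(y^2+xz)z$; $\begin{pmatrix}x&y&z\\4x&y&-2z\\-2y&z&0\end{pmatrix}$; $\mathfrak{g}_D\cong\mathfrak{b}_2$; not reductive.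 5. $n=4$: $\Delta=xyzw$; $\mathrm{diag}(x,y,z,w)$; $\mathfrak{g}_D\cong\mathbb{C}^4$; reductive. 6. $n=4$: $\Delta=(y^2+xz)zw$; $\begin{pmatrix}x&y&z&0\\4x&y&-2z&0\\-2y&z&0&0\\0&0&0&w\end{pmatrix}$; $\mathfrak{g}_D\cong\mathbb{C}\oplus\mathfrak{b}_2$; not reductive. 7. $n=4$: $\Delta=(yz+xw)zw$; $\begin{pmatrix}x&0&0&-w\\0&y&0&w\\0&0&z&w\\z&-w&0&0\end{pmatrix}$; $\mathfrak{g}_D\cong\mathbb{C}^2\oplus\mathfrak{g}_0$; not reductive. 8. $n=4$: $\Delta=x(y^3-3xyz+3x^2w)$; $\begin{pmatrix}x&y&z&w\\0&y&2z&3w\\0&x&y&z\\0&0&x&y\end{pmatrix}$; $\mathfrak{g}_D\cong\mathbb{C}\oplus\mathfrak{g}$; not reductive. 9. $n=4$ (the discriminant of binary cubics $xu^3+yu^2v+zuv^2+wv^3$): $\Delta=y^2z^2-4xz^3-4y^3w+18xyzw-27w^2x^2$; $\begin{pmatrix}3x&2y&z&0\\0&3x&2y&z\\y&2z&3w&0\\0&y&2z&3w\end{pmatrix}$;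 $\mathfrak{g}_D\cong\mathfrak{gl}_2(\mathbb{C})$; reductive. Here $\mathbb{C}^k$ denotes the abelian Lie algebra of dimension $k$, $\mathfrak{b}_2\subseteq\mathfrak{gl}_2(\mathbb{C})$ the upper triangular matrices, $\mathfrak{g}_0$ the non-abelian Lie algebra of dimension $2$, and $\mathfrak{g}$ the $3$-dimensional Lie algebra with $2$-dimensional abelian derived algebra $\mathfrak{g}'$ on which some element outside $\mathfrak{g}'$ acts semisimply with eigenvalues $1$ and $2$. -/

import Mathlib

open Filter Topology Matrix

attribute [local instance 100] LieRing.ofAssociativeRing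

/-- `f` is a reduced local equation of `D ⊆ ℂⁿ` at `p`: near `p` the set `D` is the zero set of the
holomorphic function `f`, the germ of `f` is not zero, and it generates the ideal of all germs of
holomorphic functions at `p` that vanish on `D`. -/
def IsReducedEquationAt {n : ℕ} (D : Set (Fin n → ℂ)) (p : Fin n → ℂ)
    (f : (Fin n → ℂ) → ℂ) : Prop :=
  AnalyticAt ℂ f p ∧
  (∀ᶠ x in 𝓝 p, x ∈ D ↔ f x = 0) ∧
  (¬ ∀ᶠ x in 𝓝 p, f x = 0) ∧
  ∀ g : (Fin n → ℂ) → ℂ, AnalyticAt ℂ g p → (∀ᶠ x in 𝓝 p, x ∈ D → g x = 0) →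
    ∃ h : (Fin n → ℂ) → ℂ, AnalyticAt ℂ h p ∧ ∀ᶠ x in 𝓝 p, g x = h x * f x

/-- Reduced divisors in `ℂⁿ`, identified with their supports: subsets which have, at every point
of `ℂⁿ`, a reduced local equation. -/
def IsReducedDivisor {n : ℕ} (D : Set (Fin n → ℂ)) : Prop :=
  ∀ p : Fin n → ℂ, ∃ f : (Fin n → ℂ) → ℂ, IsReducedEquationAt D p f

/-- The germ at `p` of the vector field `v = ∑ vⱼ ∂ⱼ` belongs to the stalk `Der(-log D)_p`:
`v` is holomorphic at `p` and `v(f)` is a multiple of `f` for the reduced local equations `f`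
of `D` at `p`. -/
def IsLogarithmicAt {n : ℕ} (D : Set (Fin n → ℂ)) (p : Fin n → ℂ)
    (v : (Fin n → ℂ) → (Fin n → ℂ)) : Prop :=
  AnalyticAt ℂ v p ∧
  ∀ f : (Fin n → ℂ) → ℂ, IsReducedEquationAt D p f →
    ∃ h : (Fin n → ℂ) → ℂ, AnalyticAt ℂ h p ∧ ∀ᶠ x in 𝓝 p, fderiv ℂ f x (v x) = h x * f x

/-- The vector fields `δ₁, …, δₙ` on `ℂⁿ` are a basis of the sheaf of `𝒪`-modules `Der(-log D)`:
at each point `p` their germs lie in the stalk, generate it over `𝒪_p`, and are linearly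
independent over `𝒪_p`. -/
def IsLogarithmicBasis {n : ℕ} (D : Set (Fin n → ℂ))
    (δ : Fin n → (Fin n → ℂ) → (Fin n → ℂ)) : Prop :=
  ∀ p : Fin n → ℂ,
    (∀ i, IsLogarithmicAt D p (δ i)) ∧
    (∀ v, IsLogarithmicAt D p v →
      ∃ c : Fin n → (Fin n → ℂ) → ℂ, (∀ i, AnalyticAt ℂ (c i) p) ∧
        ∀ᶠ x in 𝓝 p, v x = ∑ i, c i x • δ i x) ∧
    (∀ c : Fin n → (Fin n → ℂ) → ℂ, (∀ i, AnalyticAt ℂ (c i) p) →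
      (∀ᶠ x in 𝓝 p, ∑ i, c i x • δ i x = 0) → ∀ i, ∀ᶠ x in 𝓝 p, c i x = 0)

/-- Linear free divisors: reduced divisors `D` for which `Der(-log D)` has a global basis of
linear vector fields `∑ xᵢ aᵢⱼ ∂ⱼ`. -/
def IsLinearFreeDivisor {n : ℕ} (D : Set (Fin n → ℂ)) : Prop :=
  IsReducedDivisor D ∧
  ∃ A : Fin n → Matrix (Fin n) (Fin n) ℂ, IsLogarithmicBasis D (fun i x => x ᵥ* A i)

/-- A linear automorphism of `ℂⁿ` maps `D` onto `D'`. -/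
def LinearlyIsomorphic {n : ℕ} (D D' : Set (Fin n → ℂ)) : Prop :=
  ∃ e : (Fin n → ℂ) ≃ₗ[ℂ] (Fin n → ℂ), e '' D = D'

/-- The group `G_D` of all `A ∈ GLₙ(ℂ)` with `A(D) = D`. -/
def divisorGroup {n : ℕ} (D : Set (Fin n → ℂ)) : Subgroup (GL (Fin n) ℂ) where
  carrier := {A | (fun x => (A : Matrix (Fin n) (Fin n) ℂ) *ᵥ x) '' D = D}
  one_mem' := by simp
  mul_mem' := by
    intro A B hA hB
    simp only [Set.mem_ofPred_eq] at hA hB ⊢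
    have h : (fun x => ((A * B : GL (Fin n) ℂ) : Matrix (Fin n) (Fin n) ℂ) *ᵥ x) =
        (fun x => (A : Matrix (Fin n) (Fin n) ℂ) *ᵥ x) ∘
          (fun x => (B : Matrix (Fin n) (Fin n) ℂ) *ᵥ x) := by
      funext x
      simp [Matrix.mulVec_mulVec]
    rw [h, Set.image_comp, hB, hA]
  inv_mem' := by
    intro A hA
    simp only [Set.mem_ofPred_eq] at hA ⊢
    nth_rewrite 1 [← hA]
    rw [← Set.image_comp]
    have h : (fun x => ((A⁻¹ : GL (Fin n) ℂ) : Matrix (Fin n) (Fin n) ℂ) *ᵥ x) ∘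
        (fun x => (A : Matrix (Fin n) (Fin n) ℂ) *ᵥ x) = id := by
      funext x
      simp only [Function.comp_apply, Matrix.mulVec_mulVec, id]
      rw [← Units.val_mul, inv_mul_cancel, Units.val_one, Matrix.one_mulVec]
    rw [h, Set.image_id]

/-- `𝔤` is the Lie algebra `𝔤_D` of the linear group `G_D` (equivalently, of its identity
component): it consists of the matrices `A` whose one-parameter group `exp(tA)` lies in `G_D`. -/
def IsLieAlgebraOfDivisor {n : ℕ} (D : Set (Fin n → ℂ))
    (𝔤 : LieSubalgebra ℂ (Matrix (Fin n) (Fin n) ℂ)) : Prop :=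
  ∀ A : Matrix (Fin n) (Fin n) ℂ, A ∈ 𝔤 ↔
    ∀ t : ℝ, ∃ g ∈ divisorGroup D, (g : Matrix (Fin n) (Fin n) ℂ) = NormedSpace.exp ((t : ℂ) • A)

/-- A Lie algebra of matrices is reductive if it is the direct sum of a semisimple ideal
(one with radical zero) and an ideal of simultaneously diagonalizable matrices. -/
def IsReductiveMatrixAlgebra {n : ℕ} (𝔤 : LieSubalgebra ℂ (Matrix (Fin n) (Fin n) ℂ)) : Prop :=
  ∃ S Z : LieIdeal ℂ 𝔤, IsCompl S Z ∧ LieAlgebra.HasTrivialRadical ℂ S ∧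
    ∃ P : GL (Fin n) ℂ, ∀ A : 𝔤, A ∈ Z →
      ((P : Matrix (Fin n) (Fin n) ℂ) * (A : Matrix (Fin n) (Fin n) ℂ) *
        ((P⁻¹ : GL (Fin n) ℂ) : Matrix (Fin n) (Fin n) ℂ)).IsDiag

/-- The Lie algebra `𝔟₂` of upper triangular `2 × 2` matrices. -/
def borelTwo : LieSubalgebra ℂ (Matrix (Fin 2) (Fin 2) ℂ) where
  carrier := {A | A 1 0 = 0}
  add_mem' := by
    intro A B hA hB
    simp_all
  zero_mem' := by simp
  smul_mem' := by
    intro c A hA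
    simp_all
  lie_mem' := by
    intro A B hA hB
    simp_all [Ring.lie_def, Matrix.mul_apply, Fin.sum_univ_two]

/-- The non-abelian Lie algebra `𝔤₀` of dimension `2`, as the matrices `[[a, b], [0, 0]]`. -/
def nonabelianTwo : LieSubalgebra ℂ (Matrix (Fin 2) (Fin 2) ℂ) where
  carrier := {A | A 1 0 = 0 ∧ A 1 1 = 0}
  add_mem' := by
    intro A B hA hB
    simp_all
  zero_mem' := by simp
  smul_mem' := by
    intro c A hA
    simp_all
  lie_mem' := by
    intro A B hA hB
    simp_all [Ring.lie_def, Matrix.mul_apply, Fin.sum_univ_two]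

/-- The `3`-dimensional Lie algebra `𝔤` with `2`-dimensional abelian derived algebra `𝔤'`, on which
some element outside `𝔤'` acts semisimply with eigenvalues `1` and `2`, as the matrices
`[[t, 0, a], [0, 2t, b], [0, 0, 0]]`. -/
def solvableThree : LieSubalgebra ℂ (Matrix (Fin 3) (Fin 3) ℂ) where
  carrier := {A | ∃ t a b : ℂ, A = !![t, 0, a; 0, 2 * t, b; 0, 0, 0]}
  add_mem' := by
    rintro A B ⟨t, a, b, rfl⟩ ⟨t', a', b', rfl⟩
    refine ⟨t + t', a + a', b + b', ?_⟩
    ext i j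
    fin_cases i <;> fin_cases j <;> simp [mul_add]
  zero_mem' := by
    refine ⟨0, 0, 0, ?_⟩
    ext i j
    fin_cases i <;> fin_cases j <;> simp
  smul_mem' := by
    rintro c A ⟨t, a, b, rfl⟩
    refine ⟨c * t, c * a, c * b, ?_⟩
    ext i j
    fin_cases i <;> fin_cases j <;> simp [mul_left_comm]
  lie_mem' := by
    rintro A B ⟨t, a, b, rfl⟩ ⟨t', a', b', rfl⟩
    refine ⟨0, t * a' - t' * a, 2 * t * b' - 2 * t' * b, ?_⟩
    ext i j
    fin_cases i <;> fin_cases j <;>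
      simp [Ring.lie_def] <;> ring

/-- The nine rows of the table, indexed by the dimension of the ambient space. -/
inductive TableRow : ℕ → Type
  /-- `x` -/
  | normalCrossing₁ : TableRow 1
  /-- `xy` -/
  | normalCrossing₂ : TableRow 2
  /-- `xyz` -/
  | normalCrossing₃ : TableRow 3
  /-- `(y² + xz) z` -/
  | cone₃ : TableRow 3
  /-- `xyzw` -/
  | normalCrossing₄ : TableRow 4
  /-- `(y² + xz) zw` -/
  | cone₄ : TableRow 4
  /-- `(yz + xw) zw` -/
  | quadric : TableRow 4
  /-- `x (y³ - 3xyz + 3x²w)` -/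
  | cubic : TableRow 4
  /-- `y²z² - 4xz³ - 4y³w + 18xyzw - 27w²x²` -/
  | discriminant : TableRow 4

namespace TableRow

/-- The polynomial `Δ` in a row of the table, in the coordinates `x, y, z, w = v 0, v 1, v 2, v 3`. -/
def equation : {n : ℕ} → TableRow n → (Fin n → ℂ) → ℂ
  | _, normalCrossing₁ => fun v => v 0
  | _, normalCrossing₂ => fun v => v 0 * v 1
  | _, normalCrossing₃ => fun v => v 0 * v 1 * v 2
  | _, cone₃ => fun v => (v 1 ^ 2 + v 0 * v 2) * v 2
  | _, normalCrossing₄ => fun v => v 0 * v 1 * v 2 * v 3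
  | _, cone₄ => fun v => (v 1 ^ 2 + v 0 * v 2) * v 2 * v 3
  | _, quadric => fun v => (v 1 * v 2 + v 0 * v 3) * v 2 * v 3
  | _, cubic => fun v => v 0 * (v 1 ^ 3 - 3 * v 0 * v 1 * v 2 + 3 * v 0 ^ 2 * v 3)
  | _, discriminant => fun v =>
      v 1 ^ 2 * v 2 ^ 2 - 4 * v 0 * v 2 ^ 3 - 4 * v 1 ^ 3 * v 3
        + 18 * v 0 * v 1 * v 2 * v 3 - 27 * v 3 ^ 2 * v 0 ^ 2

/-- The divisor `D = {Δ = 0}` in a row of the table. -/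
def divisor {n : ℕ} (r : TableRow n) : Set (Fin n → ℂ) := {v | r.equation v = 0}

/-- The matrix of linear forms in a row of the table. -/
def matrix : {n : ℕ} → TableRow n → (Fin n → ℂ) → Matrix (Fin n) (Fin n) ℂ
  | _, normalCrossing₁ => fun v => !![v 0]
  | _, normalCrossing₂ => fun v =>
      !![v 0, 0;
         0, v 1]
  | _, normalCrossing₃ => fun v =>
      !![v 0, 0, 0;
         0, v 1, 0;
         0, 0, v 2]
  | _, cone₃ => fun v =>
      !![v 0, v 1, v 2;
         4 * v 0, v 1, -2 * v 2;
         -2 * v 1, v 2, 0]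
  | _, normalCrossing₄ => fun v =>
      !![v 0, 0, 0, 0;
         0, v 1, 0, 0;
         0, 0, v 2, 0;
         0, 0, 0, v 3]
  | _, cone₄ => fun v =>
      !![v 0, v 1, v 2, 0;
         4 * v 0, v 1, -2 * v 2, 0;
         -2 * v 1, v 2, 0, 0;
         0, 0, 0, v 3]
  | _, quadric => fun v =>
      !![v 0, 0, 0, -v 3;
         0, v 1, 0, v 3;
         0, 0, v 2, v 3;
         v 2, -v 3, 0, 0]
  | _, cubic => fun v =>
      !![v 0, v 1, v 2, v 3;
         0, v 1, 2 * v 2, 3 * v 3;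
         0, v 0, v 1, v 2;
         0, 0, v 0, v 1]
  | _, discriminant => fun v =>
      !![3 * v 0, 2 * v 1, v 2, 0;
         0, 3 * v 0, 2 * v 1, v 2;
         v 1, 2 * v 2, 3 * v 3, 0;
         0, v 1, 2 * v 2, 3 * v 3]

/-- `L` is isomorphic to the Lie algebra in the given row of the table. -/
def HasLieAlgebra (L : Type) [LieRing L] [LieAlgebra ℂ L] : {n : ℕ} → TableRow n → Prop
  | _, normalCrossing₁ => Nonempty (L ≃ₗ⁅ℂ⁆ ℂ)
  | _, normalCrossing₂ => Nonempty (L ≃ₗ⁅ℂ⁆ (Fin 2 → ℂ))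
  | _, normalCrossing₃ => Nonempty (L ≃ₗ⁅ℂ⁆ (Fin 3 → ℂ))
  | _, cone₃ => Nonempty (L ≃ₗ⁅ℂ⁆ borelTwo)
  | _, normalCrossing₄ => Nonempty (L ≃ₗ⁅ℂ⁆ (Fin 4 → ℂ))
  | _, cone₄ => Nonempty (L ≃ₗ⁅ℂ⁆ ℂ × borelTwo)
  | _, quadric => Nonempty (L ≃ₗ⁅ℂ⁆ (Fin 2 → ℂ) × nonabelianTwo)
  | _, cubic => Nonempty (L ≃ₗ⁅ℂ⁆ ℂ × solvableThree)
  | _, discriminant => Nonempty (L ≃ₗ⁅ℂ⁆ Matrix (Fin 2) (Fin 2) ℂ)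

/-- The last column of the table: `True` for the rows that are listed as reductive. -/
def ListedReductive : {n : ℕ} → TableRow n → Prop
  | _, normalCrossing₁ => True
  | _, normalCrossing₂ => True
  | _, normalCrossing₃ => True
  | _, cone₃ => False
  | _, normalCrossing₄ => True
  | _, cone₄ => False
  | _, quadric => False
  | _, cubic => False
  | _, discriminant => True

end TableRow

/-! For the nine rows everything rests on Saito's criterion: logarithmic vector fields whose
coefficient determinant is a nonzero constant times the reduced equation `f` form a basis of
Der(-log D). The criterion and the reducedness of Δ at every point of ℂⁿ both follow from one
division lemma, `AnalyticAt.exists_eventually_eq_mul`. If `f` has only simple zeros on general lines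
of a fixed direction, then a germ `g` that vanishes at the points of `f = 0` with `df ≠ 0` is
divisible by `f`, and the quotient is the average of `g / f` over small circles in these lines. What
remains are polynomial identities and, for each Δ, one line on which it is square-free.

Conversely, let D be a linear free divisor, g the span of its n linear fields and F their
coefficient determinant (`saitoDet`). Then D is the zero set of F (`IsLinearBasis.mem_iff`), so D is
determined by g, and it suffices to conjugate g to the Lie algebra of a row. Three facts drive this.
The space g has dimension n. It consists exactly of the linear fields of which F is an eigenvector
(`IsLinearBasis.mem_of_fderiv_eq`, `exists_fderiv_saitoDet_eq`); hence it contains the Euler field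
and the semisimple parts of its elements (`IsLinearBasis.diagonal_mem`,
`IsLinearBasis.mem_of_isSemisimple`). Finally, F is not divisible by the square of a reduced germ at
a smooth point of its zero set (`IsLinearBasis.not_eventually_eq_sq_mul`).

If g is solvable, Lie's theorem and a further triangular conjugation make it upper triangular and
closed under taking diagonal parts. The diagonal elements form a torus; its corank is made up by
strictly triangular elements. If the torus is everything, D is a normal crossing divisor. Otherwise
the torus weights of the nilpotent elements, together with the exclusion of squares of coordinates
from F, leave only the cones, the quadric and the cubic.

If g is not solvable, its derived algebra has trace zero and so has dimension less than n. As Lie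
algebras of dimension at most two are solvable, n is 4 and the derived algebra contains an
sl₂-triple. Among the possible four-dimensional representations, 2+1+1 and 3+1 make F vanish
identically and 2+2 makes F twice the square of a quadratic form. Only binary cubics remain, with
the discriminant as divisor.

The rows are told apart by the order of nilpotency of the commutators in their Lie algebras, which
is a conjugation invariant. The rows that are not reductive have solvable non-abelian Lie algebras.
-/

/-! ### Division of germs of holomorphic functions -/

/-- The ring of germs of analytic functions at a point is a domain. -/
theorem eventually_eq_zero_of_mul_eq_zero {E : Type*} [NormedAddCommGroup E] [NormedSpace ℂ E]
    {f g : E → ℂ} {p : E} (hf : AnalyticAt ℂ f p) (hg : AnalyticAt ℂ g p)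
    (hf0 : ¬ ∀ᶠ x in 𝓝 p, f x = 0) (h : ∀ᶠ x in 𝓝 p, f x * g x = 0) :
    ∀ᶠ x in 𝓝 p, g x = 0 := by
  obtain ⟨r, hr, hball⟩ := Metric.eventually_nhds_iff_ball.1
    ((hf.eventually_analyticAt.and hg.eventually_analyticAt).and h)
  -- Near such a point `g` vanishes, and the identity theorem on the ball carries this back to `p`.
  obtain ⟨q, hq, hfq⟩ : ∃ q ∈ Metric.ball p r, f q ≠ 0 := by
    by_contra! hcon
    exact hf0 (Metric.eventually_nhds_iff_ball.2 ⟨r, hr, hcon⟩)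
  have hgq : g =ᶠ[𝓝 q] 0 := by
    filter_upwards [(hball q hq).1.1.continuousAt.eventually_ne hfq,
      Metric.isOpen_ball.mem_nhds hq] with x hx hxb
    exact (mul_eq_zero.1 (hball x hxb).2).resolve_left hx
  have hgU : AnalyticOnNhd ℂ g (Metric.ball p r) := fun x hx => (hball x hx).1.2
  have := hgU.eqOn_zero_of_preconnected_of_eventuallyEq_zero
    ((convex_ball p r).isPreconnected) hq hgq
  exact Metric.eventually_nhds_iff_ball.2 ⟨r, hr, fun x hx => this hx⟩

/-! ### Circle averages and division along lines -/

/-- Pointwise application of a formal multilinear series to continuous functions. -/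
noncomputable def FormalMultilinearSeries.onContinuousMap (K : Type*) [TopologicalSpace K]
    [CompactSpace K] {E F : Type*} [NormedAddCommGroup E] [NormedSpace ℂ E] [NormedAddCommGroup F]
    [NormedSpace ℂ F] (p : FormalMultilinearSeries ℂ E F) :
    FormalMultilinearSeries ℂ C(K, E) C(K, F) := fun k =>
  MultilinearMap.mkContinuous
    { toFun := fun m => ⟨fun s => p k (fun i => m i s), by fun_prop⟩
      map_update_add' := by
        intro _ m i a b
        ext s
        have h : ∀ c : C(K, E), (fun j => (Function.update m i c j) s) =
            Function.update (fun j => m j s) i (c s) := by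
          intro c
          funext j
          by_cases hj : j = i
          · subst hj; simp
          · simp [hj]
        simp only [ContinuousMap.coe_mk, ContinuousMap.add_apply, h]
        rw [(p k).map_update_add]
      map_update_smul' := by
        intro _ m i a b
        ext s
        have h : ∀ c : C(K, E), (fun j => (Function.update m i c j) s) =
            Function.update (fun j => m j s) i (c s) := by
          intro c
          funext j
          by_cases hj : j = i
          · subst hj; simp
          · simp [hj]
        simp only [ContinuousMap.coe_mk, ContinuousMap.smul_apply, h]
        rw [(p k).map_update_smul] }
    ‖p k‖ (by
      intro m
      rw [ContinuousMap.norm_le _ (by positivity)]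
      intro s
      refine ((p k).le_opNorm _).trans ?_
      gcongr with i
      exact ContinuousMap.norm_coe_le_norm _ _)

/-- Composition of continuous functions on a compact space with a fixed analytic function is an
analytic operation. -/
theorem AnalyticAt.exists_analyticOnNhd_continuousMap (K : Type*) [TopologicalSpace K]
    [CompactSpace K] {E F : Type*} [NormedAddCommGroup E] [NormedSpace ℂ E]
    [NormedAddCommGroup F] [NormedSpace ℂ F] [CompleteSpace F] {g : E → F} {c : E}
    (hg : AnalyticAt ℂ g c) :
    ∃ R > 0, ∃ Φ : C(K, E) → C(K, F), AnalyticOnNhd ℂ Φ (Metric.ball 0 R) ∧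
      ∀ φ ∈ Metric.ball (0 : C(K, E)) R, ∀ s, Φ φ s = g (c + φ s) := by
  obtain ⟨p, r, hp⟩ := hg
  set P := p.onContinuousMap K
  -- The coefficients of the pointwise series are bounded in norm by those of `p`, so it converges
  -- at least as far.
  have hrad : p.radius ≤ P.radius := by
    refine FormalMultilinearSeries.radius_le_of_le (fun {n} => ?_)
    exact MultilinearMap.mkContinuous_norm_le _ (norm_nonneg _) _
  have hrP : r ≤ P.radius := hp.r_le.trans hrad
  have hP := P.hasFPowerSeriesOnBall (hp.r_pos.trans_le hrP)
  obtain ⟨R, hR0, hRr⟩ := ENNReal.lt_iff_exists_nnreal_btwn.1 hp.r_pos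
  have hsub : ∀ φ : C(K, E), φ ∈ Metric.ball (0 : C(K, E)) R → φ ∈ Metric.eball (0 : C(K, E)) r := by
    intro φ hφ
    refine Metric.eball_subset_eball hRr.le ?_
    rwa [Metric.eball_coe]
  refine ⟨R, by exact_mod_cast hR0, P.sum, ?_, ?_⟩
  · intro φ hφ
    exact hP.analyticAt_of_mem (Metric.eball_subset_eball hrP (hsub φ hφ))
  · intro φ hφ s
    have h1 := hP.hasSum (Metric.eball_subset_eball hrP (hsub φ hφ))
    rw [zero_add] at h1
    -- Evaluation at `s` is continuous and linear, so it turns the series in the function space into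
    -- the series of `g` at `φ s`.
    have h2 := h1.map (ContinuousMap.evalCLM ℂ s) (ContinuousMap.evalCLM ℂ s).continuous
    have hs : φ s ∈ Metric.eball (0 : E) r := by
      refine Metric.eball_subset_eball hRr.le ?_
      rw [Metric.eball_coe, mem_ball_zero_iff]
      exact (ContinuousMap.norm_coe_le_norm φ s).trans_lt (mem_ball_zero_iff.1 hφ)
    have h3 := hp.hasSum hs
    exact h2.unique h3

/-- The average over a parametrized circle, as a continuous linear functional. -/
noncomputable def circleAverageCLM : C(Set.Icc (0 : ℝ) (2 * Real.pi), ℂ) →L[ℂ] ℂ :=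
  LinearMap.mkContinuous
    { toFun := fun φ => ((2 * Real.pi)⁻¹ : ℝ) •
        ∫ θ in (0 : ℝ)..2 * Real.pi, Set.IccExtend Real.two_pi_pos.le φ θ
      map_add' := by
        intro φ ψ
        rw [← smul_add, ← intervalIntegral.integral_add]
        · rfl
        · exact (φ.continuous.Icc_extend' (h := Real.two_pi_pos.le)).intervalIntegrable _ _
        · exact (ψ.continuous.Icc_extend' (h := Real.two_pi_pos.le)).intervalIntegrable _ _
      map_smul' := by
        intro a φ
        simp only [RingHom.id_apply]
        rw [smul_comm a, ← intervalIntegral.integral_smul a]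
        rfl }
    1 (by
      intro φ
      have h : ‖∫ θ in (0 : ℝ)..2 * Real.pi, Set.IccExtend Real.two_pi_pos.le φ θ‖ ≤
          ‖φ‖ * |2 * Real.pi - 0| :=
        intervalIntegral.norm_integral_le_of_norm_le_const fun θ _ =>
          ContinuousMap.norm_coe_le_norm φ _
      rw [sub_zero, abs_of_pos Real.two_pi_pos] at h
      simp only [LinearMap.coe_mk, AddHom.coe_mk, norm_smul, one_mul, norm_inv, Real.norm_eq_abs,
        abs_of_pos Real.two_pi_pos]
      rw [inv_mul_le_iff₀ Real.two_pi_pos, mul_comm (2 * Real.pi)]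
      exact h)

/-- Circle averages of quotients of analytic functions depend analytically on the center. -/
theorem AnalyticAt.exists_analyticAt_circleAverage_div {E : Type*} [NormedAddCommGroup E]
    [NormedSpace ℂ E] {f g : E → ℂ} {p : E} (v : E) (hf : AnalyticAt ℂ f p)
    (hg : AnalyticAt ℂ g p) :
    ∃ r₀ > 0, ∀ r, 0 < r → r < r₀ → (∀ s : ℂ, ‖s‖ = r → f (p + s • v) ≠ 0) →
      AnalyticAt ℂ (fun x => Real.circleAverage (fun s => g (x + s • v) / f (x + s • v)) 0 r) p := by
  obtain ⟨R₁, hR₁, Φ, hΦ, hΦf⟩ :=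
    hf.exists_analyticOnNhd_continuousMap (Set.Icc (0 : ℝ) (2 * Real.pi))
  obtain ⟨R₂, hR₂, Ψ, hΨ, hΨg⟩ :=
    hg.exists_analyticOnNhd_continuousMap (Set.Icc (0 : ℝ) (2 * Real.pi))
  -- This bound keeps the whole circle of radius `r` in direction `v` inside both balls of
  -- convergence; the summand 1 covers `v = 0`.
  refine ⟨min R₁ R₂ / (‖v‖ + 1), by positivity, fun r hr hrr hfr => ?_⟩
  let ψ : C(Set.Icc (0 : ℝ) (2 * Real.pi), E) :=
    ⟨fun θ => circleMap 0 r θ • v, by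
      have := (continuous_circleMap 0 r).comp (continuous_subtype_val (p := (· ∈ Set.Icc (0 : ℝ) (2 * Real.pi))))
      exact this.smul continuous_const⟩
  let L : E →L[ℂ] C(Set.Icc (0 : ℝ) (2 * Real.pi), E) :=
    LinearMap.mkContinuous
      { toFun := fun x => ContinuousMap.const _ x
        map_add' := by intro x y; rfl
        map_smul' := by intro a x; rfl } 1 (by
          intro x
          rw [one_mul, ContinuousMap.norm_le _ (norm_nonneg _)]
          intro _
          exact le_rfl)
  -- The circle around `x`, relative to `p`, is an element of a function space depending affinely on
  -- `x`. Composition with `f` and `g`, inversion in the Banach algebra of continuous functions and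
  -- integration are analytic there.
  let A : E → C(Set.Icc (0 : ℝ) (2 * Real.pi), E) := fun x => L (x - p) + ψ
  have hAp : A p = ψ := by simp [A]
  have hA : AnalyticAt ℂ A p := by
    refine AnalyticAt.add ?_ analyticAt_const
    exact (L.analyticAt _).comp (analyticAt_id.sub analyticAt_const)
  have hψ : ‖ψ‖ < min R₁ R₂ := by
    have h1 : ‖ψ‖ ≤ r * ‖v‖ := by
      rw [ContinuousMap.norm_le _ (by positivity)]
      intro θ
      simp [ψ, norm_smul, abs_of_pos hr]
    have h2 : r * (‖v‖ + 1) < min R₁ R₂ := by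
      rwa [lt_div_iff₀ (by positivity)] at hrr
    nlinarith [norm_nonneg v]
  have hψ₁ : ψ ∈ Metric.ball 0 R₁ := mem_ball_zero_iff.2 (hψ.trans_le (min_le_left _ _))
  have hψ₂ : ψ ∈ Metric.ball 0 R₂ := mem_ball_zero_iff.2 (hψ.trans_le (min_le_right _ _))
  have hΦA : AnalyticAt ℂ (fun x => Φ (A x)) p := by
    refine AnalyticAt.comp (g := Φ) (f := A) ?_ hA
    rw [hAp]; exact hΦ ψ hψ₁
  have hΨA : AnalyticAt ℂ (fun x => Ψ (A x)) p := by
    refine AnalyticAt.comp (g := Ψ) (f := A) ?_ hA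
    rw [hAp]; exact hΨ ψ hψ₂
  have hunit : IsUnit (Φ (A p)) := by
    rw [ContinuousMap.isUnit_iff_forall_ne_zero, hAp]
    intro θ
    rw [hΦf ψ hψ₁]
    exact hfr _ (by simp [abs_of_pos hr])
  obtain ⟨u, hu⟩ := hunit
  have hinv : AnalyticAt ℂ (fun x => Ring.inverse (Φ (A x))) p := by
    refine AnalyticAt.comp (g := Ring.inverse) (f := fun x => Φ (A x)) ?_ hΦA
    rw [← hu]; exact analyticAt_inverse u
  have hmain : AnalyticAt ℂ
      (fun x => circleAverageCLM (Ψ (A x) * Ring.inverse (Φ (A x)))) p := by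
    exact (circleAverageCLM.analyticAt _).comp (hΨA.mul hinv)
  refine hmain.congr ?_
  have hA₁ : ∀ᶠ x in 𝓝 p, A x ∈ Metric.ball 0 R₁ :=
    hA.continuousAt.eventually_mem (Metric.isOpen_ball.mem_nhds (by rwa [hAp]))
  have hA₂ : ∀ᶠ x in 𝓝 p, A x ∈ Metric.ball 0 R₂ :=
    hA.continuousAt.eventually_mem (Metric.isOpen_ball.mem_nhds (by rwa [hAp]))
  have hU : ∀ᶠ x in 𝓝 p, IsUnit (Φ (A x)) := by
    have := hΦA.continuousAt.eventually_mem (Units.isOpen.mem_nhds (show Φ (A p) ∈ _ from ⟨u, hu⟩))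
    exact this
  filter_upwards [hA₁, hA₂, hU] with x hx₁ hx₂ hxU
  obtain ⟨w, hw⟩ := hxU
  have key : ∀ θ : Set.Icc (0 : ℝ) (2 * Real.pi), (Ψ (A x) * Ring.inverse (Φ (A x))) θ =
      g (x + circleMap 0 r θ • v) / f (x + circleMap 0 r θ • v) := by
    intro θ
    have e : p + (A x) θ = x + circleMap 0 r θ • v := by
      change p + ((x - p) + circleMap 0 r θ • v) = _
      abel
    have h1 := hΦf _ hx₁ θ
    have h2 := hΨg _ hx₂ θ
    rw [e] at h1 h2
    have h3 : (Φ (A x)) θ * (Ring.inverse (Φ (A x))) θ = 1 := by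
      rw [← ContinuousMap.mul_apply, Ring.mul_inverse_cancel _ ⟨w, hw⟩, ContinuousMap.one_apply]
    rw [ContinuousMap.mul_apply, h2, ← h1, eq_div_iff (left_ne_zero_of_mul_eq_one h3), mul_assoc,
      mul_comm _ ((Φ (A x)) θ), h3, mul_one]
  rw [Real.circleAverage_def]
  change (2 * Real.pi)⁻¹ • (∫ θ in (0 : ℝ)..2 * Real.pi, Set.IccExtend Real.two_pi_pos.le
    (Ψ (A x) * Ring.inverse (Φ (A x))) θ) = _
  congr 1
  refine intervalIntegral.integral_congr fun θ hθ => ?_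
  rw [Set.uIcc_of_le Real.two_pi_pos.le] at hθ
  rw [Set.IccExtend_of_mem _ _ hθ, key]

/-- The mean value property of the quotient of two holomorphic functions all of whose
singularities in a disc are removable because the zeros of the denominator are simple. -/
theorem circleAverage_div_of_simple_zeros {φ γ : ℂ → ℂ} {r : ℝ} (hr : 0 < r)
    (hφ : ∀ s, ‖s‖ ≤ r → AnalyticAt ℂ φ s) (hγ : ∀ s, ‖s‖ ≤ r → AnalyticAt ℂ γ s)
    (hbd : ∀ s, ‖s‖ = r → φ s ≠ 0)
    (hs : ∀ s, ‖s‖ ≤ r → φ s = 0 → deriv φ s ≠ 0 ∧ γ s = 0) (h0 : φ 0 ≠ 0) :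
    Real.circleAverage (fun s => γ s / φ s) 0 r = γ 0 / φ 0 := by
  classical
  -- The quotient with its removable singularities filled in by l'Hôpital's rule; near a zero of `φ`
  -- it is the quotient of the two divided slopes.
  let q : ℂ → ℂ := fun s => if φ s = 0 then deriv γ s / deriv φ s else γ s / φ s
  have hq : ∀ s, ‖s‖ ≤ r → DifferentiableAt ℂ q s := by
    intro a ha
    by_cases hfa : φ a = 0
    · obtain ⟨hd, hga⟩ := hs a ha hfa
      have hds : ∀ {f : ℂ → ℂ}, AnalyticAt ℂ f a → AnalyticAt ℂ (dslope f a) a :=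
        fun ⟨_, hp⟩ => ⟨_, hp.has_fpower_series_dslope_fslope⟩
      have hφ1 := hds (hφ a ha)
      have hγ1 := hds (hγ a ha)
      have hne : dslope φ a a ≠ 0 := by rwa [dslope_same]
      have : DifferentiableAt ℂ (fun s => dslope γ a s / dslope φ a s) a :=
        (hγ1.div hφ1 hne).differentiableAt
      refine this.congr_of_eventuallyEq ?_
      filter_upwards [hφ1.continuousAt.eventually_ne hne] with s hs1
      by_cases hsa : s = a
      · subst hsa
        simp [q, hfa, dslope_same]
      · have e1 : φ s = (s - a) * dslope φ a s := by
          have := sub_smul_dslope φ a s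
          rw [hfa, sub_zero, smul_eq_mul] at this
          exact this.symm
        have e2 : γ s = (s - a) * dslope γ a s := by
          have := sub_smul_dslope γ a s
          rw [hga, sub_zero, smul_eq_mul] at this
          exact this.symm
        have hsa' : s - a ≠ 0 := sub_ne_zero.2 hsa
        have hφs : φ s ≠ 0 := by rw [e1]; exact mul_ne_zero hsa' hs1
        simp only [q, if_neg hφs]
        rw [e1, e2, mul_div_mul_left _ _ hsa']
    · refine ((hγ a ha).div (hφ a ha) hfa).differentiableAt.congr_of_eventuallyEq ?_
      filter_upwards [(hφ a ha).continuousAt.eventually_ne hfa] with s hs1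
      simp [q, hs1]
  have hmean : Real.circleAverage q 0 r = q 0 := by
    refine circleAverage_of_differentiable_on_off_countable (s := ∅) Set.countable_empty ?_ ?_
    · intro s hs1
      rw [abs_of_pos hr, mem_closedBall_zero_iff] at hs1
      exact (hq s hs1).continuousAt.continuousWithinAt
    · rintro s ⟨hs1, -⟩
      rw [abs_of_pos hr, mem_ball_zero_iff] at hs1
      exact hq s hs1.le
  have hq0 : q 0 = γ 0 / φ 0 := by simp [q, h0]
  rw [← hq0, ← hmean]
  refine Real.circleAverage_congr_sphere fun s hs1 => ?_
  rw [abs_of_pos hr, mem_sphere_zero_iff_norm] at hs1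
  simp [q, hbd s hs1]

/-- Divisibility of germs of analytic functions can be tested on the points of general lines in a
fixed direction, provided that the divisor has simple zeros there. -/
theorem AnalyticAt.exists_eventually_eq_mul {E : Type*} [NormedAddCommGroup E] [NormedSpace ℂ E]
    {f g c : E → ℂ} {p v : E} (hf : AnalyticAt ℂ f p) (hg : AnalyticAt ℂ g p)
    (hc : AnalyticAt ℂ c p) (hc0 : ¬ ∀ᶠ x in 𝓝 p, c x = 0)
    (hline : ¬ ∀ᶠ s in 𝓝 (0 : ℂ), f (p + s • v) = 0)
    (hsimple : ∀ x, c x ≠ 0 → ∀ s : ℂ, f (x + s • v) = 0 → fderiv ℂ f (x + s • v) v ≠ 0)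
    (hvanish : ∀ᶠ y in 𝓝 p, f y = 0 → fderiv ℂ f y v ≠ 0 → g y = 0) :
    ∃ h : E → ℂ, AnalyticAt ℂ h p ∧ ∀ᶠ x in 𝓝 p, g x = h x * f x := by
  obtain ⟨r₀, hr₀, hh⟩ := hf.exists_analyticAt_circleAverage_div v hg
  have hlineA : ∀ x : E, ∀ s : ℂ, AnalyticAt ℂ (fun s : ℂ => x + s • v) s := fun x s =>
    analyticAt_const.add (analyticAt_id.smul analyticAt_const)
  have hlineC : Tendsto (fun s : ℂ => p + s • v) (𝓝 0) (𝓝 p) := by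
    have := (hlineA p 0).continuousAt
    simpa [ContinuousAt] using this
  have hφ : AnalyticAt ℂ (fun s : ℂ => f (p + s • v)) 0 := by
    refine AnalyticAt.comp (g := f) (f := fun s : ℂ => p + s • v) ?_ (hlineA p 0)
    simpa using hf
  have hne := hφ.eventually_eq_zero_or_eventually_ne_zero.resolve_left hline
  rw [eventually_nhdsWithin_iff, Metric.eventually_nhds_iff] at hne
  obtain ⟨r₁, hr₁, hne⟩ := hne
  obtain ⟨ρ, hρ, hball⟩ := Metric.eventually_nhds_iff.1
    ((hf.eventually_analyticAt.and hg.eventually_analyticAt).and hvanish)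
  -- Below `r₀` the circle average is analytic in the centre, below `r₁` the function `f` has no
  -- zeros on the punctured disc around `p`, and the third bound keeps all discs with centre near
  -- `p` inside the ball of radius `ρ`.
  set r := min (min r₀ r₁) (ρ / (2 * (‖v‖ + 1))) / 2 with hrdef
  have hmpos : 0 < min (min r₀ r₁) (ρ / (2 * (‖v‖ + 1))) := by positivity
  have hr : 0 < r := by positivity
  have hrm : r < min (min r₀ r₁) (ρ / (2 * (‖v‖ + 1))) := by rw [hrdef]; linarith
  have hrr₀ : r < r₀ := hrm.trans_le ((min_le_left _ _).trans (min_le_left _ _))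
  have hrr₁ : r < r₁ := hrm.trans_le ((min_le_left _ _).trans (min_le_right _ _))
  have hrv : r * ‖v‖ < ρ / 2 := by
    have h1 : r < ρ / (2 * (‖v‖ + 1)) := hrm.trans_le (min_le_right _ _)
    rw [lt_div_iff₀ (by positivity)] at h1
    nlinarith [norm_nonneg v]
  have hbd : ∀ s : ℂ, ‖s‖ = r → f (p + s • v) ≠ 0 := by
    intro s hs
    refine hne (by simpa [hs] using hrr₁) ?_
    simp only [Set.mem_compl_iff, Set.mem_singleton_iff]
    rintro rfl
    simp at hs
    exact hr.ne hs
  have hmem : ∀ x, dist x p < ρ / 2 → ∀ s : ℂ, ‖s‖ ≤ r → dist (x + s • v) p < ρ := by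
    intro x hx s hs
    have : dist (x + s • v) x ≤ r * ‖v‖ := by
      rw [dist_eq_norm, add_sub_cancel_left, norm_smul]
      gcongr
    linarith [dist_triangle (x + s • v) x p]
  -- Compactness of the circle makes nonvanishing on it an open condition on the centre.
  have hbd' : ∀ᶠ x in 𝓝 p, ∀ s ∈ Metric.sphere (0 : ℂ) r, f (x + s • v) ≠ 0 := by
    refine (isCompact_sphere (0 : ℂ) r).eventually_forall_of_forall_eventually fun s hs => ?_
    rw [mem_sphere_zero_iff_norm] at hs
    have h1 : ContinuousAt f (p + s • v) :=
      (hball (hmem p (by simpa using by positivity) s hs.le)).1.1.continuousAt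
    have h2 : ContinuousAt (fun z : E × ℂ => z.1 + z.2 • v) (p, s) := by fun_prop
    exact (ContinuousAt.comp (g := f) (f := fun z : E × ℂ => z.1 + z.2 • v) h1 h2).eventually_ne
      (hbd s hs)
  have hh' := hh r hr hrr₀ hbd
  set h : E → ℂ := fun x => Real.circleAverage (fun s => g (x + s • v) / f (x + s • v)) 0 r
  refine ⟨h, hh', ?_⟩
  have hf0 : ¬ ∀ᶠ x in 𝓝 p, f x = 0 := fun hcon => hline (hlineC.eventually hcon)
  -- The mean value property applies only where `c` and `f` do not vanish. The factors `c` and `f`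
  -- absorb the other points, and are cancelled afterwards because germs form a domain.
  have hprod : ∀ᶠ x in 𝓝 p, c x * (f x * (g x - h x * f x)) = 0 := by
    filter_upwards [hbd', Metric.ball_mem_nhds p (half_pos hρ)] with x hxb hxp
    by_cases hcx : c x = 0
    · simp [hcx]
    by_cases hfx : f x = 0
    · simp [hfx]
    have hana : ∀ {k : E → ℂ}, (∀ y, dist y p < ρ → AnalyticAt ℂ k y) → ∀ s : ℂ, ‖s‖ ≤ r →
        AnalyticAt ℂ (fun s : ℂ => k (x + s • v)) s := fun hk s hs =>
      AnalyticAt.comp (f := fun s : ℂ => x + s • v) (hk _ (hmem x hxp s hs)) (hlineA x s)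
    have hmean := circleAverage_div_of_simple_zeros (φ := fun s => f (x + s • v))
      (γ := fun s => g (x + s • v)) hr (hana fun y hy => (hball hy).1.1)
      (hana fun y hy => (hball hy).1.2)
      (fun s hs => hxb s (by simpa using hs))
      (by
        intro s hs hzero
        have hd := hsimple x hcx s hzero
        refine ⟨?_, (hball (hmem x hxp s hs)).2 hzero hd⟩
        have e : HasDerivAt (fun s : ℂ => x + s • v) v s := by
          have := ((hasDerivAt_id s).smul_const v).const_add x
          simpa using this
        have := ((hball (hmem x hxp s hs)).1.1.differentiableAt.hasFDerivAt).comp_hasDerivAt s e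
        have e2 := this.deriv
        change deriv (fun s => f (x + s • v)) s = _ at e2
        rwa [e2])
      (by simpa using hfx)
    have : h x = g x / f x := by simpa using hmean
    rw [this, div_mul_cancel₀ _ hfx, sub_self, mul_zero, mul_zero]
  have h1 := eventually_eq_zero_of_mul_eq_zero hc (hf.mul (hg.sub (hh'.mul hf))) hc0 hprod
  have h2 := eventually_eq_zero_of_mul_eq_zero hf (hg.sub (hh'.mul hf)) hf0 h1
  filter_upwards [h2] with x hx
  exact sub_eq_zero.1 hx

/-! ### Polynomials with simple zeros on general lines -/

/-- The restriction of a polynomial to the lines of direction `v`, with the base point as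
parameter. -/
noncomputable def linePolynomial {n : ℕ} (q : MvPolynomial (Fin n) ℂ) (v : Fin n → ℂ) :
    Polynomial (MvPolynomial (Fin n) ℂ) :=
  MvPolynomial.aeval (fun i => Polynomial.C (MvPolynomial.X i) +
    Polynomial.C (MvPolynomial.C (v i)) * Polynomial.X) q

theorem eval_linePolynomial {n : ℕ} (q : MvPolynomial (Fin n) ℂ) (v x : Fin n → ℂ) (s : ℂ) :
    ((linePolynomial q v).map (MvPolynomial.eval x)).eval s = MvPolynomial.eval (x + s • v) q := by
  unfold linePolynomial
  induction q using MvPolynomial.induction_on with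
  | C a =>
    rw [MvPolynomial.aeval_C, MvPolynomial.eval_C, Polynomial.algebraMap_apply,
      Polynomial.map_C, Polynomial.eval_C, MvPolynomial.algebraMap_eq, MvPolynomial.eval_C]
  | add p q hp hq => simp only [map_add, Polynomial.map_add, Polynomial.eval_add, hp, hq]
  | mul_X p i hp =>
    rw [map_mul, Polynomial.map_mul, Polynomial.eval_mul, hp, map_mul, MvPolynomial.aeval_X,
      MvPolynomial.eval_X]
    simp [mul_comm s]

theorem Polynomial.coeff_prod_sum_of_natDegree_le {R ι : Type*} [CommRing R] (s : Finset ι)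
    (f : ι → Polynomial R) (m : ι → ℕ) (h : ∀ i, (f i).natDegree ≤ m i) :
    (∏ i ∈ s, f i).coeff (∑ i ∈ s, m i) = ∏ i ∈ s, (f i).coeff (m i) := by
  classical
  induction s using Finset.induction_on with
  | empty => simp
  | insert a s ha ih =>
    rw [Finset.prod_insert ha, Finset.sum_insert ha, Finset.prod_insert ha,
      Polynomial.coeff_mul_add_eq_of_natDegree_le (h a)
        ((Polynomial.natDegree_prod_le _ _).trans (Finset.sum_le_sum fun i _ => h i)), ih]

/-- The top coefficient in the line parameter comes from the direction alone. Hence, when `q` does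
not vanish at `v`, the degree drops on no line, whatever its base point. -/
theorem linePolynomial_natDegree_le_and_coeff {n d : ℕ} {q : MvPolynomial (Fin n) ℂ}
    (hq : q.IsHomogeneous d) (v : Fin n → ℂ) :
    (linePolynomial q v).natDegree ≤ d ∧
      (linePolynomial q v).coeff d = MvPolynomial.C (MvPolynomial.eval v q) := by
  classical
  have hsum : linePolynomial q v = ∑ m ∈ q.support,
      Polynomial.C (MvPolynomial.C (q.coeff m)) * ∏ i, (Polynomial.C (MvPolynomial.X i) +
        Polynomial.C (MvPolynomial.C (v i)) * Polynomial.X) ^ m i := by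
    unfold linePolynomial
    rw [MvPolynomial.aeval_def, MvPolynomial.eval₂_eq']
    rfl
  have hlin : ∀ i, (Polynomial.C (MvPolynomial.X i : MvPolynomial (Fin n) ℂ) +
      Polynomial.C (MvPolynomial.C (v i)) * Polynomial.X).natDegree ≤ 1 := by
    intro i
    rw [add_comm]
    exact Polynomial.natDegree_linear_le
  have hpow : ∀ (m : Fin n →₀ ℕ) i, ((Polynomial.C (MvPolynomial.X i : MvPolynomial (Fin n) ℂ) +
      Polynomial.C (MvPolynomial.C (v i)) * Polynomial.X) ^ m i).natDegree ≤ m i := by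
    intro m i
    simpa using Polynomial.natDegree_pow_le_of_le (m i) (hlin i)
  have hm : ∀ m ∈ q.support, ∑ i, m i = d := by
    intro m hm
    have := hq (MvPolynomial.mem_support_iff.1 hm)
    rw [Finsupp.weight_apply, Finsupp.sum_fintype _ _ (by simp)] at this
    simpa using this
  have hprod : ∀ m ∈ q.support, (∏ i, (Polynomial.C (MvPolynomial.X i : MvPolynomial (Fin n) ℂ) +
      Polynomial.C (MvPolynomial.C (v i)) * Polynomial.X) ^ m i).natDegree ≤ d := by
    intro m hms
    refine (Polynomial.natDegree_prod_le _ _).trans ?_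
    rw [← hm m hms]
    exact Finset.sum_le_sum fun i _ => hpow m i
  constructor
  · rw [hsum]
    refine Polynomial.natDegree_sum_le_of_forall_le _ _ fun m hms => ?_
    exact (Polynomial.natDegree_C_mul_le _ _).trans (hprod m hms)
  · rw [hsum, Polynomial.finsetSum_coeff, MvPolynomial.eval_eq', map_sum]
    refine Finset.sum_congr rfl fun m hms => ?_
    rw [Polynomial.coeff_C_mul, map_mul, map_prod]
    congr 1
    rw [← hm m hms, Polynomial.coeff_prod_sum_of_natDegree_le _ _ _ fun i => hpow m i]
    refine Finset.prod_congr rfl fun i _ => ?_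
    have := Polynomial.coeff_pow_of_natDegree_le (hlin i) (m := m i)
    rw [mul_one] at this
    rw [this, map_pow]
    simp

/-- An analytic function whose restrictions to general lines of some fixed direction have only
simple zeros. -/
def HasSimpleZerosOnGeneralLines {E : Type*} [NormedAddCommGroup E] [NormedSpace ℂ E]
    (f : E → ℂ) : Prop :=
  (∀ p, AnalyticAt ℂ f p) ∧ ∃ (v : E) (c : E → ℂ), (∀ p, AnalyticAt ℂ c p) ∧
    (∀ p, ¬ ∀ᶠ x in 𝓝 p, c x = 0) ∧ (∀ p, ¬ ∀ᶠ s in 𝓝 (0 : ℂ), f (p + s • v) = 0) ∧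
    ∀ x, c x ≠ 0 → ∀ s : ℂ, f (x + s • v) = 0 → fderiv ℂ f (x + s • v) v ≠ 0

theorem MvPolynomial.analyticAt_eval {n : ℕ} (q : MvPolynomial (Fin n) ℂ) (p : Fin n → ℂ) :
    AnalyticAt ℂ (fun x => MvPolynomial.eval x q) p :=
  AnalyticOnNhd.eval_mvPolynomial q p (Set.mem_univ _)

theorem not_eventually_eq_zero_of_ne_zero {E : Type*} [NormedAddCommGroup E] [NormedSpace ℂ E]
    {f : E → ℂ} (hf : ∀ p, AnalyticAt ℂ f p) {x₀ : E} (h : f x₀ ≠ 0) (p : E) :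
    ¬ ∀ᶠ x in 𝓝 p, f x = 0 := fun hcon =>
  h ((show AnalyticOnNhd ℂ f Set.univ from fun p _ => hf p).eqOn_zero_of_preconnected_of_eventuallyEq_zero
    isPreconnected_univ (Set.mem_univ p) hcon (Set.mem_univ x₀))

/-- One good line suffices. The resultant of the restriction and its derivative is a polynomial in
the base point, nonzero at `x₀`; wherever it is nonzero the restriction has no multiple zero. -/
theorem hasSimpleZerosOnGeneralLines_of_exists {n d : ℕ} {q : MvPolynomial (Fin n) ℂ}
    (hq : q.IsHomogeneous d) (hd : d ≠ 0) {v x₀ : Fin n → ℂ} (hv : MvPolynomial.eval v q ≠ 0)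
    {P : Polynomial ℂ} (hP : ∀ s, P.eval s = MvPolynomial.eval (x₀ + s • v) q)
    (hP' : ∀ s, P.eval s = 0 → P.derivative.eval s ≠ 0) :
    HasSimpleZerosOnGeneralLines (fun x => MvPolynomial.eval x q) := by
  obtain ⟨hdeg, hcoeff⟩ := linePolynomial_natDegree_le_and_coeff hq v
  set L := linePolynomial q v with hL
  have hdegx : ∀ x, (L.map (MvPolynomial.eval x)).natDegree ≤ d := fun x =>
    Polynomial.natDegree_map_le.trans hdeg
  have hcoeffx : ∀ x, (L.map (MvPolynomial.eval x)).coeff d = MvPolynomial.eval v q := by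
    intro x
    rw [Polynomial.coeff_map, hcoeff, MvPolynomial.eval_C]
  have hnat : ∀ x, (L.map (MvPolynomial.eval x)).natDegree = d := fun x =>
    le_antisymm (hdegx x) (Polynomial.le_natDegree_of_ne_zero (by rwa [hcoeffx x]))
  -- The formal degrees are fixed as `d` and `d`, although the derivative has smaller degree, so
  -- that the resultant commutes with evaluation at every base point.
  set c := Polynomial.resultant L (Polynomial.derivative L) d d with hc
  have hcx : ∀ x, MvPolynomial.eval x c = Polynomial.resultant (L.map (MvPolynomial.eval x))
      (Polynomial.derivative (L.map (MvPolynomial.eval x))) d d := by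
    intro x
    rw [hc, ← Polynomial.resultant_map_map, Polynomial.derivative_map]
  have hder : ∀ x s, fderiv ℂ (fun x => MvPolynomial.eval x q) (x + s • v) v =
      (Polynomial.derivative (L.map (MvPolynomial.eval x))).eval s := by
    intro x s
    have e : HasDerivAt (fun s : ℂ => x + s • v) v s := by
      simpa using ((hasDerivAt_id s).smul_const v).const_add x
    have h1 := ((q.analyticAt_eval (x + s • v)).differentiableAt.hasFDerivAt).comp_hasDerivAt s e
    have h2 := (L.map (MvPolynomial.eval x)).hasDerivAt s
    have h3 : (fun s => (L.map (MvPolynomial.eval x)).eval s) =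
        (fun x => MvPolynomial.eval x q) ∘ fun s : ℂ => x + s • v := by
      funext s
      exact eval_linePolynomial q v x s
    rw [← h3] at h1
    exact h1.unique h2
  refine ⟨q.analyticAt_eval, v, fun x => MvPolynomial.eval x c, c.analyticAt_eval, ?_, ?_, ?_⟩
  · refine not_eventually_eq_zero_of_ne_zero c.analyticAt_eval (x₀ := x₀) ?_
    have hPL : L.map (MvPolynomial.eval x₀) = P := by
      refine Polynomial.funext fun s => ?_
      rw [hP, eval_linePolynomial]
    have hcop : IsCoprime P (Polynomial.derivative P) := by
      rw [Polynomial.isCoprime_iff_aeval_ne_zero_of_isAlgClosed ℂ ℂ]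
      intro a
      by_cases h : P.eval a = 0
      · right; simpa using hP' a h
      · left; simpa using h
    have hPd : P.natDegree = d := hPL ▸ hnat x₀
    have hPdd : P.derivative.natDegree + (d - P.derivative.natDegree) = d := by
      have := Polynomial.natDegree_derivative_le P
      omega
    rw [hcx, hPL]
    -- Passing from the formal degree `d` to the true degree of the derivative costs only a power of
    -- the leading coefficient of `P`, which is the nonzero value of `q` at `v`.
    have h1 := Polynomial.resultant_add_right_deg P P.derivative d P.derivative.natDegree
      (d - P.derivative.natDegree) le_rfl
    rw [hPdd] at h1
    rw [h1]
    refine mul_ne_zero (pow_ne_zero _ ?_) ?_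
    · rw [← hPL, hcoeffx]; exact hv
    · have := Polynomial.resultant_ne_zero P P.derivative hcop
      rwa [hPd] at this
  · intro p hcon
    have h0 : L.map (MvPolynomial.eval p) = 0 := by
      refine Polynomial.eq_zero_of_infinite_isRoot _ ?_
      refine infinite_of_mem_nhds (0 : ℂ) ?_
      filter_upwards [hcon] with s hs
      rw [← eval_linePolynomial] at hs
      exact hs
    have := hcoeffx p
    rw [h0, Polynomial.coeff_zero] at this
    exact hv this.symm
  · intro x hcx0 s hs hs'
    obtain ⟨a, b, -, -, hab⟩ := Polynomial.exists_mul_add_mul_eq_C_resultant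
      (L.map (MvPolynomial.eval x)) (Polynomial.derivative (L.map (MvPolynomial.eval x)))
      (m := d) (n := d) (hdegx x)
      ((Polynomial.natDegree_derivative_le _).trans ((Nat.sub_le _ _).trans (hdegx x))) (Or.inl hd)
    have h1 := congrArg (Polynomial.eval s) hab
    rw [Polynomial.eval_add, Polynomial.eval_mul, Polynomial.eval_mul, eval_linePolynomial,
      show MvPolynomial.eval (x + s • v) q = 0 from hs, ← hder, hs', Polynomial.eval_C, ← hcx] at h1
    simp at h1
    exact hcx0 h1.symm

/-- Divisibility by a function with simple zeros on general lines. -/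
theorem HasSimpleZerosOnGeneralLines.exists_eventually_eq_mul {E : Type*} [NormedAddCommGroup E]
    [NormedSpace ℂ E] {f g : E → ℂ} {p : E} (hf : HasSimpleZerosOnGeneralLines f)
    (hg : AnalyticAt ℂ g p)
    (h : ∀ᶠ y in 𝓝 p, f y = 0 → ∀ v, fderiv ℂ f y v ≠ 0 → g y = 0) :
    ∃ k : E → ℂ, AnalyticAt ℂ k p ∧ ∀ᶠ x in 𝓝 p, g x = k x * f x := by
  obtain ⟨hfa, v, c, hc, hc0, hline, hsimple⟩ := hf
  refine (hfa p).exists_eventually_eq_mul hg (hc p) (hc0 p) (hline p) hsimple ?_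
  filter_upwards [h] with y hy hfy hv using hy hfy v hv

theorem HasSimpleZerosOnGeneralLines.isReducedEquationAt {n : ℕ} {f : (Fin n → ℂ) → ℂ}
    (hf : HasSimpleZerosOnGeneralLines f) (p : Fin n → ℂ) :
    IsReducedEquationAt {x | f x = 0} p f := by
  refine ⟨hf.1 p, by simp, ?_, ?_⟩
  · obtain ⟨hfa, v, c, hc, hc0, hline, hsimple⟩ := hf
    intro hcon
    have h1 : Tendsto (fun s : ℂ => p + s • v) (𝓝 0) (𝓝 p) := by
      have : Continuous (fun s : ℂ => p + s • v) := by fun_prop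
      simpa using this.tendsto 0
    exact hline p (h1.eventually hcon)
  · intro g hg hgD
    refine hf.exists_eventually_eq_mul hg ?_
    filter_upwards [hgD] with y hy hfy _ _ using hy hfy

/-! ### Logarithmic vector fields -/

theorem AnalyticAt.fderiv_apply {E : Type*} [NormedAddCommGroup E] [NormedSpace ℂ E]
    {f : E → ℂ} {v : E → E} {p : E} (hf : AnalyticAt ℂ f p) (hv : AnalyticAt ℂ v p) :
    AnalyticAt ℂ (fun x => fderiv ℂ f x (v x)) p :=
  AnalyticAt.comp₂ (h := fun q : (E →L[ℂ] ℂ) × E => q.1 q.2)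
    ((ContinuousLinearMap.id ℂ (E →L[ℂ] ℂ)).analyticAt_bilinear _) hf.fderiv hv

theorem Filter.Eventually.fderiv_apply_eq_of_eq_mul {E : Type*} [NormedAddCommGroup E]
    [NormedSpace ℂ E] {f g h : E → ℂ} {v : E → E} {p : E} (hg : AnalyticAt ℂ g p)
    (hh : AnalyticAt ℂ h p) (H : ∀ᶠ x in 𝓝 p, f x = g x * h x) :
    ∀ᶠ x in 𝓝 p, fderiv ℂ f x (v x) =
      g x * fderiv ℂ h x (v x) + h x * fderiv ℂ g x (v x) := by
  have h1 : f =ᶠ[𝓝 p] fun x => g x * h x := H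
  filter_upwards [h1.fderiv (𝕜 := ℂ), hg.eventually_analyticAt, hh.eventually_analyticAt]
    with x hx hgx hhx
  have h2 := (hgx.differentiableAt.hasFDerivAt.mul hhx.differentiableAt.hasFDerivAt).fderiv
  rw [hx, show (fun x => g x * h x) = g * h from rfl, h2]
  simp

/-- It is enough to test one reduced equation: any other one `f'` divides it and is divided by it,
and the Leibniz rule for `f' = a f` together with `f = b f'` transfers the condition. -/
theorem IsReducedEquationAt.isLogarithmicAt {n : ℕ} {D : Set (Fin n → ℂ)} {p : Fin n → ℂ}
    {f : (Fin n → ℂ) → ℂ} {v : (Fin n → ℂ) → (Fin n → ℂ)} (hf : IsReducedEquationAt D p f)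
    (hv : AnalyticAt ℂ v p)
    (h : ∃ k : (Fin n → ℂ) → ℂ, AnalyticAt ℂ k p ∧
      ∀ᶠ x in 𝓝 p, fderiv ℂ f x (v x) = k x * f x) : IsLogarithmicAt D p v := by
  refine ⟨hv, fun f' hf' => ?_⟩
  obtain ⟨k, hk, hkf⟩ := h
  obtain ⟨a, ha, haf⟩ := hf.2.2.2 f' hf'.1 (hf'.2.1.mono fun x hx hxD => hx.1 hxD)
  obtain ⟨b, hb, hbf⟩ := hf'.2.2.2 f hf.1 (hf.2.1.mono fun x hx hxD => hx.1 hxD)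
  refine ⟨fun x => (a x * k x + fderiv ℂ a x (v x)) * b x,
    ((ha.mul hk).add (ha.fderiv_apply hv)).mul hb, ?_⟩
  filter_upwards [Filter.Eventually.fderiv_apply_eq_of_eq_mul (v := v) ha hf.1 haf, hkf, hbf]
    with x h1 h2 h3
  rw [h1, h2]
  linear_combination (a x * k x + fderiv ℂ a x (v x)) * h3

/-- Tangency along D is enough, since the ideal of germs vanishing on D is generated by `f`. -/
theorem IsReducedEquationAt.isLogarithmicAt_of_vanish {n : ℕ} {D : Set (Fin n → ℂ)}
    {p : Fin n → ℂ} {f : (Fin n → ℂ) → ℂ} {v : (Fin n → ℂ) → (Fin n → ℂ)}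
    (hf : IsReducedEquationAt D p f) (hv : AnalyticAt ℂ v p)
    (h : ∀ᶠ x in 𝓝 p, x ∈ D → fderiv ℂ f x (v x) = 0) : IsLogarithmicAt D p v :=
  hf.isLogarithmicAt hv (hf.2.2.2 _ (hf.1.fderiv_apply hv) h)

theorem AnalyticAt.matrix_det {n : ℕ} {E : Type*} [NormedAddCommGroup E] [NormedSpace ℂ E]
    {M : E → Matrix (Fin n) (Fin n) ℂ} {p : E}
    (hM : ∀ i j, AnalyticAt ℂ (fun x => M x i j) p) : AnalyticAt ℂ (fun x => (M x).det) p := by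
  simp only [Matrix.det_apply]
  refine Finset.analyticAt_fun_sum _ fun σ _ => ?_
  have : AnalyticAt ℂ (fun x => ∏ i, M x (σ i) i) p :=
    Finset.analyticAt_fun_prod _ fun i _ => hM _ _
  simp only [Units.smul_def, ← Int.cast_smul_eq_zsmul ℂ, smul_eq_mul]
  exact analyticAt_const.mul this

/-- Cramer's rule in a form suited to rows. -/
theorem Matrix.sum_det_updateRow_smul {n : ℕ} (M : Matrix (Fin n) (Fin n) ℂ) (v : Fin n → ℂ) :
    ∑ i, (M.updateRow i v).det • M i = M.det • v := by
  have h := Matrix.mulVec_cramer Mᵀ v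
  rw [Matrix.det_transpose] at h
  rw [← h]
  funext j
  simp only [Finset.sum_apply, Pi.smul_apply, smul_eq_mul, Matrix.mulVec, dotProduct,
    Matrix.cramer_transpose_apply, Matrix.transpose_apply]
  exact Finset.sum_congr rfl fun i _ => mul_comm _ _

/-- All rows lie in the hyperplane `L = 0`. In Saito's criterion `L` is the differential of `f` at a
smooth point of D and the rows are values of logarithmic fields. -/
theorem Matrix.det_eq_zero_of_forall_apply_eq_zero {n : ℕ} (M : Matrix (Fin n) (Fin n) ℂ)
    {L : (Fin n → ℂ) →L[ℂ] ℂ} {w : Fin n → ℂ} (hw : L w ≠ 0) (h : ∀ i, L (M i) = 0) :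
    M.det = 0 := by
  refine Matrix.exists_mulVec_eq_zero_iff.1 ⟨fun j => L (Pi.single j 1), ?_, ?_⟩
  · intro hL
    apply hw
    have : w = ∑ j, w j • (Pi.single j (1 : ℂ) : Fin n → ℂ) := by
      funext k
      simp [Finset.sum_apply, Pi.single_apply]
    rw [this, map_sum]
    refine Finset.sum_eq_zero fun j _ => ?_
    rw [map_smul, show L (Pi.single j 1) = 0 from congrFun hL j, smul_zero]
  · funext i
    have : M i = ∑ j, M i j • (Pi.single j (1 : ℂ) : Fin n → ℂ) := by
      funext k
      simp [Finset.sum_apply, Pi.single_apply]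
    have h2 := h i
    rw [this, map_sum] at h2
    simpa [Matrix.mulVec, dotProduct] using h2

/-- Saito's criterion. -/
theorem HasSimpleZerosOnGeneralLines.isLogarithmicBasis {n : ℕ} {f : (Fin n → ℂ) → ℂ}
    (hf : HasSimpleZerosOnGeneralLines f) {M : (Fin n → ℂ) → Matrix (Fin n) (Fin n) ℂ}
    (hM : ∀ p i j, AnalyticAt ℂ (fun x => M x i j) p) {c : ℂ} (hc : c ≠ 0)
    (hdet : ∀ x, (M x).det = c * f x) {k : Fin n → ℂ}
    (hk : ∀ i x, fderiv ℂ f x (M x i) = k i * f x) :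
    IsLogarithmicBasis {x | f x = 0} (fun i x => M x i) := by
  intro p
  have hred := hf.isReducedEquationAt p
  have hrow : ∀ i, AnalyticAt ℂ (fun x => M x i) p := fun i => analyticAt_pi_iff.2 (hM p i)
  have hdetA : AnalyticAt ℂ (fun x => (M x).det) p := AnalyticAt.matrix_det (hM p)
  have hdet0 : ¬ ∀ᶠ x in 𝓝 p, (M x).det = 0 := by
    intro hcon
    refine hred.2.2.1 (hcon.mono fun x hx => ?_)
    rw [hdet] at hx
    exact (mul_eq_zero.1 hx).resolve_left hc
  refine ⟨fun i => hred.isLogarithmicAt (hrow i) ⟨fun _ => k i, analyticAt_const,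
    Eventually.of_forall (hk i)⟩, ?_, ?_⟩
  · rintro v ⟨hv, hlog⟩
    obtain ⟨h, hh, hhf⟩ := hlog f hred
    have hupd : ∀ i, AnalyticAt ℂ (fun x => ((M x).updateRow i (v x)).det) p := by
      intro i
      refine AnalyticAt.matrix_det fun a b => ?_
      by_cases hai : a = i
      · subst hai
        simpa using analyticAt_pi_iff.1 hv b
      · simpa [Matrix.updateRow_ne hai] using hM p a b
    -- The numerators in Cramer's rule. Where `f = 0` and `df ≠ 0`, the rows of `M` and `v` are all
    -- killed by `df`, so the numerator vanishes and `f` divides it.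
    have hdiv : ∀ i, ∃ q : (Fin n → ℂ) → ℂ, AnalyticAt ℂ q p ∧
        ∀ᶠ x in 𝓝 p, ((M x).updateRow i (v x)).det = q x * f x := by
      intro i
      refine hf.exists_eventually_eq_mul (hupd i) ?_
      filter_upwards [hhf] with y hy hfy w hw
      refine Matrix.det_eq_zero_of_forall_apply_eq_zero _ hw fun a => ?_
      by_cases hai : a = i
      · subst hai
        rw [Matrix.updateRow_self, hy, hfy, mul_zero]
      · rw [Matrix.updateRow_ne hai, hk, hfy, mul_zero]
    choose q hq hqf using hdiv
    -- Numerator `q i * f` over determinant `c * f`. The identity is proved after multiplication by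
    -- the determinant, which is then cancelled as a germ.
    refine ⟨fun i x => c⁻¹ * q i x, fun i => analyticAt_const.mul (hq i), ?_⟩
    have hcomp : ∀ j, ∀ᶠ x in 𝓝 p, v x j - (∑ i, (c⁻¹ * q i x) • M x i) j = 0 := by
      intro j
      refine eventually_eq_zero_of_mul_eq_zero hdetA ?_ hdet0 ?_
      · refine (analyticAt_pi_iff.1 hv j).sub ?_
        simp only [Finset.sum_apply, Pi.smul_apply, smul_eq_mul]
        exact Finset.analyticAt_fun_sum _ fun i _ => (analyticAt_const.mul (hq i)).mul (hM p i j)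
      · filter_upwards [eventually_all.2 hqf] with x hx
        have h1 := congrFun (Matrix.sum_det_updateRow_smul (M x) (v x)) j
        simp only [Finset.sum_apply, Pi.smul_apply, smul_eq_mul, hx] at h1 ⊢
        rw [mul_sub, ← h1, hdet, Finset.mul_sum, ← Finset.sum_sub_distrib]
        refine Finset.sum_eq_zero fun i _ => ?_
        field_simp
        ring
    filter_upwards [eventually_all.2 hcomp] with x hx
    funext j
    exact sub_eq_zero.1 (hx j)
  · intro a ha hsum i
    refine eventually_eq_zero_of_mul_eq_zero hdetA (ha i) hdet0 ?_
    filter_upwards [hsum] with x hx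
    have h1 : (fun i => a i x) ᵥ* M x = 0 := by
      rw [Matrix.vecMul_eq_sum]; exact hx
    have h2 := congrArg (fun u => u ᵥ* (M x).adjugate) h1
    simp only [Matrix.vecMul_vecMul, Matrix.mul_adjugate, Matrix.zero_vecMul,
      Matrix.vecMul_smul, Matrix.vecMul_one] at h2
    exact congrFun h2 i

/-! ### Linear changes of coordinates -/

theorem ContinuousLinearEquiv.eventually_nhds_apply {n : ℕ}
    (e : (Fin n → ℂ) ≃L[ℂ] (Fin n → ℂ)) {p : Fin n → ℂ} {φ : (Fin n → ℂ) → Prop} :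
    (∀ᶠ y in 𝓝 (e p), φ y) ↔ ∀ᶠ x in 𝓝 p, φ (e x) := by
  constructor
  · intro h
    exact (e.continuous.tendsto p).eventually h
  · intro h
    have := (e.symm.continuous.tendsto (e p)).eventually (p := fun x => φ (e x)) (by simpa using h)
    simpa using this

theorem AnalyticAt.comp_clEquiv {n : ℕ} {F : Type*} [NormedAddCommGroup F] [NormedSpace ℂ F]
    (e : (Fin n → ℂ) ≃L[ℂ] (Fin n → ℂ)) {p : Fin n → ℂ} {g : (Fin n → ℂ) → F}
    (hg : AnalyticAt ℂ g (e p)) : AnalyticAt ℂ (fun x => g (e x)) p :=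
  AnalyticAt.comp (g := g) (f := fun x => e x) hg (e.toContinuousLinearMap.analyticAt p)

theorem IsReducedEquationAt.image {n : ℕ} {D : Set (Fin n → ℂ)} {p : Fin n → ℂ}
    {f : (Fin n → ℂ) → ℂ} (hf : IsReducedEquationAt D p f)
    (e : (Fin n → ℂ) ≃L[ℂ] (Fin n → ℂ)) :
    IsReducedEquationAt (e '' D) (e p) (fun y => f (e.symm y)) := by
  have hsymm : e.symm (e p) = p := e.symm_apply_apply p
  have mem : ∀ x, e x ∈ e '' D ↔ x ∈ D := fun x => e.injective.mem_set_image
  refine ⟨?_, ?_, ?_, ?_⟩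
  · refine AnalyticAt.comp_clEquiv e.symm ?_
    rw [hsymm]; exact hf.1
  · rw [e.eventually_nhds_apply]
    simpa [mem] using hf.2.1
  · rw [e.eventually_nhds_apply]
    simpa using hf.2.2.1
  · intro g hg hgD
    rw [e.eventually_nhds_apply] at hgD
    obtain ⟨h, hh, hhf⟩ := hf.2.2.2 (fun x => g (e x)) (hg.comp_clEquiv e)
      (hgD.mono fun x hx hxD => hx ((mem x).2 hxD))
    refine ⟨fun y => h (e.symm y), ?_, ?_⟩
    · refine AnalyticAt.comp_clEquiv e.symm ?_
      rw [hsymm]; exact hh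
    · rw [e.eventually_nhds_apply]
      simpa using hhf

theorem IsLogarithmicAt.image {n : ℕ} {D : Set (Fin n → ℂ)} {p : Fin n → ℂ}
    {v : (Fin n → ℂ) → (Fin n → ℂ)} (hv : IsLogarithmicAt D p v)
    (e : (Fin n → ℂ) ≃L[ℂ] (Fin n → ℂ)) :
    IsLogarithmicAt (e '' D) (e p) (fun y => e (v (e.symm y))) := by
  have hsymm : e.symm (e p) = p := e.symm_apply_apply p
  refine ⟨?_, ?_⟩
  · refine (e.toContinuousLinearMap.analyticAt _).comp (f := fun y => v (e.symm y)) ?_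
    refine AnalyticAt.comp_clEquiv e.symm ?_
    rw [hsymm]; exact hv.1
  · intro f hf
    have hf' := hf.image e.symm
    rw [hsymm, ← Set.image_comp] at hf'
    simp only [ContinuousLinearEquiv.symm_symm] at hf'
    rw [show (⇑e.symm ∘ ⇑e) = id from by ext; simp, Set.image_id] at hf'
    obtain ⟨h, hh, hhf⟩ := hv.2 _ hf'
    refine ⟨fun y => h (e.symm y), ?_, ?_⟩
    · refine AnalyticAt.comp_clEquiv e.symm ?_
      rw [hsymm]; exact hh
    · rw [e.eventually_nhds_apply]
      have hfa := (e.continuous.tendsto p).eventually hf.1.eventually_analyticAt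
      filter_upwards [hhf, hfa] with x hx hfx
      have h1 : fderiv ℂ (fun x => f (e x)) x = (fderiv ℂ f (e x)).comp e.toContinuousLinearMap := by
        have := (hfx.differentiableAt.hasFDerivAt).comp x e.hasFDerivAt
        exact this.fderiv
      rw [h1] at hx
      simpa using hx

theorem IsLogarithmicBasis.image {n : ℕ} {D : Set (Fin n → ℂ)}
    {δ : Fin n → (Fin n → ℂ) → (Fin n → ℂ)} (hδ : IsLogarithmicBasis D δ)
    (e : (Fin n → ℂ) ≃L[ℂ] (Fin n → ℂ)) :
    IsLogarithmicBasis (e '' D) (fun i y => e (δ i (e.symm y))) := by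
  intro q
  obtain ⟨p, rfl⟩ := e.surjective q
  have hsymm : e.symm (e p) = p := e.symm_apply_apply p
  obtain ⟨h1, h2, h3⟩ := hδ p
  refine ⟨fun i => (h1 i).image e, ?_, ?_⟩
  · intro v hv
    have hv' := hv.image e.symm
    rw [hsymm, ← Set.image_comp] at hv'
    simp only [ContinuousLinearEquiv.symm_symm] at hv'
    rw [show (⇑e.symm ∘ ⇑e) = id from by ext; simp, Set.image_id] at hv'
    obtain ⟨c, hc, hcv⟩ := h2 _ hv'
    refine ⟨fun i y => c i (e.symm y), fun i => ?_, ?_⟩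
    · refine AnalyticAt.comp_clEquiv e.symm ?_
      rw [hsymm]; exact hc i
    · rw [e.eventually_nhds_apply]
      filter_upwards [hcv] with x hx
      have := congrArg e hx
      simpa using this
  · intro c hc hsum i
    rw [e.eventually_nhds_apply] at hsum ⊢
    refine h3 (fun i x => c i (e x)) (fun i => (hc i).comp_clEquiv e) ?_ i
    filter_upwards [hsum] with x hx
    apply e.injective
    simpa using hx

theorem IsLinearFreeDivisor.of_linearlyIsomorphic {n : ℕ} {D D' : Set (Fin n → ℂ)}
    (h : IsLinearFreeDivisor D) (hDD : LinearlyIsomorphic D D') : IsLinearFreeDivisor D' := by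
  obtain ⟨e', rfl⟩ := hDD
  let e : (Fin n → ℂ) ≃L[ℂ] (Fin n → ℂ) := e'.toContinuousLinearEquiv
  obtain ⟨hred, A, hA⟩ := h
  -- Transposes occur because vector fields act on row vectors while `LinearMap.toMatrix'` acts on
  -- columns.
  refine ⟨fun q => ?_, fun i => (LinearMap.toMatrix' e'.symm.toLinearMap)ᵀ * A i *
    (LinearMap.toMatrix' e'.toLinearMap)ᵀ, ?_⟩
  · obtain ⟨p, rfl⟩ := e.surjective q
    obtain ⟨f, hf⟩ := hred p
    exact ⟨_, hf.image e⟩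
  · have hδ : (fun i x => x ᵥ* ((LinearMap.toMatrix' e'.symm.toLinearMap)ᵀ * A i *
        (LinearMap.toMatrix' e'.toLinearMap)ᵀ)) = fun i y => e (e.symm y ᵥ* A i) := by
      funext i y
      rw [← Matrix.vecMul_vecMul, ← Matrix.vecMul_vecMul, Matrix.vecMul_transpose,
        Matrix.vecMul_transpose, LinearMap.toMatrix'_mulVec, LinearMap.toMatrix'_mulVec]
      rfl
    rw [hδ]
    exact hA.image e

theorem LinearlyIsomorphic.symm {n : ℕ} {D D' : Set (Fin n → ℂ)} (h : LinearlyIsomorphic D D') :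
    LinearlyIsomorphic D' D := by
  obtain ⟨e, rfl⟩ := h
  refine ⟨e.symm, ?_⟩
  rw [← Set.image_comp]
  simp

theorem LinearlyIsomorphic.trans {n : ℕ} {D D' D'' : Set (Fin n → ℂ)}
    (h : LinearlyIsomorphic D D') (h' : LinearlyIsomorphic D' D'') :
    LinearlyIsomorphic D D'' := by
  obtain ⟨e, rfl⟩ := h
  obtain ⟨e', rfl⟩ := h'
  refine ⟨e.trans e', ?_⟩
  rw [← Set.image_comp]
  rfl

/-! ### Linear vector fields and their flows -/

/-- The linear vector field of a matrix, acting on row vectors. -/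
noncomputable def vecMulCLM {n : ℕ} (B : Matrix (Fin n) (Fin n) ℂ) :
    (Fin n → ℂ) →L[ℂ] (Fin n → ℂ) := LinearMap.toContinuousLinearMap (Matrix.vecMulLinear B)

@[simp]
theorem vecMulCLM_apply {n : ℕ} (B : Matrix (Fin n) (Fin n) ℂ) (x : Fin n → ℂ) :
    vecMulCLM B x = x ᵥ* B := rfl

theorem analyticAt_vecMul {n : ℕ} (B : Matrix (Fin n) (Fin n) ℂ) (p : Fin n → ℂ) :
    AnalyticAt ℂ (fun x => x ᵥ* B) p := (vecMulCLM B).analyticAt p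

open scoped Norms.Operator in
theorem hasDerivAt_vecMul_exp {n : ℕ} (B : Matrix (Fin n) (Fin n) ℂ) (x : Fin n → ℂ) (t : ℂ) :
    HasDerivAt (fun t : ℂ => x ᵥ* NormedSpace.exp (t • B))
      (x ᵥ* NormedSpace.exp (t • B) ᵥ* B) t := by
  have h := hasDerivAt_exp_smul_const B t
  let L : Matrix (Fin n) (Fin n) ℂ →ₗ[ℂ] (Fin n → ℂ) :=
    { toFun := fun M => x ᵥ* M
      map_add' := fun M N => Matrix.vecMul_add _ _ _
      map_smul' := fun a M => Matrix.vecMul_smul _ _ _ }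
  have h2 := (LinearMap.toContinuousLinearMap L).hasFDerivAt.comp_hasDerivAt t h
  refine h2.congr_deriv ?_
  change x ᵥ* (NormedSpace.exp (t • B) * B) = _
  rw [Matrix.vecMul_vecMul]

theorem vecMul_exp_zero {n : ℕ} (B : Matrix (Fin n) (Fin n) ℂ) (x : Fin n → ℂ) :
    x ᵥ* NormedSpace.exp ((0 : ℂ) • B) = x := by
  rw [zero_smul, NormedSpace.exp_zero, Matrix.vecMul_one]

/-- A function which is an eigenvector of a linear vector field is an eigenvector of its flow. -/
theorem apply_vecMul_exp {n : ℕ} {F : (Fin n → ℂ) → ℂ} (hF : ∀ x, DifferentiableAt ℂ F x)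
    {B : Matrix (Fin n) (Fin n) ℂ} {c : ℂ} (h : ∀ x, fderiv ℂ F x (x ᵥ* B) = c * F x)
    (x : Fin n → ℂ) (t : ℂ) :
    F (x ᵥ* NormedSpace.exp (t • B)) = Complex.exp (c * t) * F x := by
  -- The expected exponential growth is divided out; what is left is constant along the flow.
  have hd : ∀ t : ℂ, HasDerivAt (fun t : ℂ => Complex.exp (-(c * t)) *
      F (x ᵥ* NormedSpace.exp (t • B))) 0 t := by
    intro t
    have h1 := (hF (x ᵥ* NormedSpace.exp (t • B))).hasFDerivAt.comp_hasDerivAt t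
      (hasDerivAt_vecMul_exp B x t)
    rw [h] at h1
    have h2 : HasDerivAt (fun t : ℂ => Complex.exp (-(c * t))) (Complex.exp (-(c * t)) * (-c)) t := by
      have := ((hasDerivAt_id t).const_mul c).neg.cexp
      simpa using this
    have h3 := h2.mul h1
    refine h3.congr_deriv ?_
    simp only [Function.comp_apply]
    ring
  have h4 := is_const_of_deriv_eq_zero (fun t => (hd t).differentiableAt)
    (fun t => (hd t).deriv) t 0
  rw [vecMul_exp_zero] at h4
  simp only [mul_zero, neg_zero, Complex.exp_zero, one_mul] at h4
  rw [← h4, ← mul_assoc, ← Complex.exp_add, add_neg_cancel, Complex.exp_zero, one_mul]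

/-- A linear vector field whose flow preserves `D` is logarithmic. -/
theorem IsReducedEquationAt.isLogarithmicAt_of_exp {n : ℕ} {D : Set (Fin n → ℂ)} {p : Fin n → ℂ}
    {f : (Fin n → ℂ) → ℂ} (hf : IsReducedEquationAt D p f) {B : Matrix (Fin n) (Fin n) ℂ}
    (h : ∀ x ∈ D, ∀ t : ℝ, x ᵥ* NormedSpace.exp ((t : ℂ) • B) ∈ D) :
    IsLogarithmicAt D p (fun x => x ᵥ* B) := by
  refine hf.isLogarithmicAt_of_vanish (analyticAt_vecMul B p) ?_
  filter_upwards [hf.2.1.eventually_nhds, hf.1.eventually_analyticAt] with x hx hfx hxD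
  have h0 : HasDerivAt (fun t : ℝ => x ᵥ* NormedSpace.exp ((t : ℂ) • B)) (x ᵥ* B) 0 := by
    have h1 := HasDerivAt.scomp (0 : ℝ) (hasDerivAt_vecMul_exp B x ((0 : ℝ) : ℂ))
      Complex.ofRealCLM.hasDerivAt
    rw [Complex.ofReal_zero, vecMul_exp_zero] at h1
    exact h1.congr_deriv (by simp)
  have hfx' : HasFDerivAt f ((fderiv ℂ f x).restrictScalars ℝ)
      ((fun t : ℝ => x ᵥ* NormedSpace.exp ((t : ℂ) • B)) 0) := by
    simp only [Complex.ofReal_zero, vecMul_exp_zero]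
    exact hfx.differentiableAt.hasFDerivAt.restrictScalars ℝ
  have h2 := hfx'.comp_hasDerivAt (0 : ℝ) h0
  -- The orbit stays in D, where `f` vanishes, so the derivative of `f` along the field is zero at
  -- `x`. Real times are enough.
  have h3 : (f ∘ fun t : ℝ => x ᵥ* NormedSpace.exp ((t : ℂ) • B)) =ᶠ[𝓝 0] fun _ => 0 := by
    have hc : Tendsto (fun t : ℝ => x ᵥ* NormedSpace.exp ((t : ℂ) • B)) (𝓝 0) (𝓝 x) := by
      have := h0.continuousAt.tendsto
      simpa only [Complex.ofReal_zero, vecMul_exp_zero] using this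
    filter_upwards [hc.eventually hx] with t ht
    exact ht.1 (h x hxD t)
  exact h2.unique ((hasDerivAt_const (0 : ℝ) (0 : ℂ)).congr_of_eventuallyEq h3)

/-- The linear logarithmic vector fields are the constant linear combinations of a linear
basis. -/
theorem IsLogarithmicBasis.mem_span {n : ℕ} {D : Set (Fin n → ℂ)}
    {A : Fin n → Matrix (Fin n) (Fin n) ℂ} (hA : IsLogarithmicBasis D (fun i x => x ᵥ* A i))
    {B : Matrix (Fin n) (Fin n) ℂ} (hB : IsLogarithmicAt D 0 (fun x => x ᵥ* B)) :
    B ∈ Submodule.span ℂ (Set.range A) := by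
  obtain ⟨c, hc, hcB⟩ := (hA 0).2.1 _ hB
  -- Comparison of first-order terms at the origin: on `t • u` both sides are divisible by `t`, and
  -- letting `t` tend to 0 replaces the coefficient functions by their values at 0.
  have key : B = ∑ i, c i 0 • A i := by
    refine Matrix.ext_of_single_vecMul fun j => ?_
    set u : Fin n → ℂ := Pi.single j 1
    have hu : Tendsto (fun t : ℂ => t • u) (𝓝 0) (𝓝 0) := by
      have : Continuous (fun t : ℂ => t • u) := by fun_prop
      simpa using this.tendsto 0
    have h1 : ∀ᶠ t in 𝓝[≠] (0 : ℂ), u ᵥ* B = ∑ i, c i (t • u) • (u ᵥ* A i) := by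
      filter_upwards [nhdsWithin_le_nhds (hu.eventually hcB), self_mem_nhdsWithin] with t ht ht0
      have ht0' : t ≠ 0 := ht0
      simp only [Matrix.smul_vecMul, smul_comm _ t] at ht
      rw [← Finset.smul_sum] at ht
      exact smul_right_injective _ ht0' ht
    have h2 : Tendsto (fun t : ℂ => ∑ i, c i (t • u) • (u ᵥ* A i)) (𝓝[≠] 0)
        (𝓝 (∑ i, c i 0 • (u ᵥ* A i))) := by
      refine tendsto_finsetSum _ fun i _ => ?_
      exact (((hc i).continuousAt.tendsto.comp hu).mono_left nhdsWithin_le_nhds).smul_const _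
    have h3 : u ᵥ* B = ∑ i, c i 0 • (u ᵥ* A i) :=
      tendsto_nhds_unique (tendsto_const_nhds.congr' h1) h2
    rw [h3, Matrix.vecMul_sum]
    simp only [Matrix.vecMul_smul]
  rw [key]
  exact Submodule.sum_mem _ fun i _ => Submodule.smul_mem _ _ (Submodule.subset_span ⟨i, rfl⟩)

theorem IsLogarithmicAt.sum_smul {n : ℕ} {D : Set (Fin n → ℂ)} {p : Fin n → ℂ} {ι : Type*}
    [Fintype ι] {v : ι → (Fin n → ℂ) → (Fin n → ℂ)} (hv : ∀ i, IsLogarithmicAt D p (v i))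
    {c : ι → (Fin n → ℂ) → ℂ} (hc : ∀ i, AnalyticAt ℂ (c i) p) :
    IsLogarithmicAt D p (fun x => ∑ i, c i x • v i x) := by
  refine ⟨Finset.analyticAt_fun_sum _ fun i _ => (hc i).smul (hv i).1, fun f hf => ?_⟩
  choose k hk hkf using fun i => (hv i).2 f hf
  refine ⟨fun x => ∑ i, c i x * k i x, Finset.analyticAt_fun_sum _ fun i _ => (hc i).mul (hk i), ?_⟩
  filter_upwards [eventually_all.2 hkf] with x hx
  rw [map_sum, Finset.sum_mul]
  refine Finset.sum_congr rfl fun i _ => ?_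
  rw [map_smul, hx, smul_eq_mul, mul_assoc]

theorem IsLogarithmicBasis.isLogarithmicAt_of_mem_span {n : ℕ} {D : Set (Fin n → ℂ)}
    {A : Fin n → Matrix (Fin n) (Fin n) ℂ} (hA : IsLogarithmicBasis D (fun i x => x ᵥ* A i))
    {B : Matrix (Fin n) (Fin n) ℂ} (hB : B ∈ Submodule.span ℂ (Set.range A)) (p : Fin n → ℂ) :
    IsLogarithmicAt D p (fun x => x ᵥ* B) := by
  obtain ⟨a, rfl⟩ := (Submodule.mem_span_range_iff_exists_fun ℂ).1 hB
  have := IsLogarithmicAt.sum_smul (fun i => (hA p).1 i) (c := fun i _ => a i)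
    fun i => analyticAt_const
  simpa only [Matrix.vecMul_sum, Matrix.vecMul_smul] using this

/-- Antisymmetrized in `A` and `B`, the second-derivative term drops out by symmetry and the
commutator field remains. -/
theorem fderiv_fderiv_vecMul {n : ℕ} {f : (Fin n → ℂ) → ℂ} {x : Fin n → ℂ}
    (hf : AnalyticAt ℂ f x) (A B : Matrix (Fin n) (Fin n) ℂ) :
    fderiv ℂ (fun x => fderiv ℂ f x (x ᵥ* B)) x (x ᵥ* A) =
      fderiv ℂ (fderiv ℂ f) x (x ᵥ* A) (x ᵥ* B) + fderiv ℂ f x (x ᵥ* A ᵥ* B) := by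
  have h1 : HasFDerivAt (fun x : Fin n → ℂ => x ᵥ* B) (vecMulCLM B) x := (vecMulCLM B).hasFDerivAt
  have h2 := hf.fderiv.differentiableAt.hasFDerivAt.clm_apply h1
  rw [h2.fderiv]
  simp [add_comm]

/-- Linear logarithmic vector fields are closed under commutators. -/
theorem IsReducedEquationAt.isLogarithmicAt_commutator {n : ℕ} {D : Set (Fin n → ℂ)}
    {p : Fin n → ℂ} {f : (Fin n → ℂ) → ℂ} (hf : IsReducedEquationAt D p f)
    {A B : Matrix (Fin n) (Fin n) ℂ} (hA : IsLogarithmicAt D p (fun x => x ᵥ* A))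
    (hB : IsLogarithmicAt D p (fun x => x ᵥ* B)) :
    IsLogarithmicAt D p (fun x => x ᵥ* (A * B - B * A)) := by
  refine hf.isLogarithmicAt (analyticAt_vecMul _ _) ?_
  obtain ⟨h, hh, hhf⟩ := hA.2 f hf
  obtain ⟨k, hk, hkf⟩ := hB.2 f hf
  -- If the fields of `A` and `B` multiply `f` by `h` and `k`, their bracket multiplies it by the
  -- derivative of `k` along the first minus that of `h` along the second; the products `h k`
  -- cancel.
  refine ⟨fun x => fderiv ℂ k x (x ᵥ* A) - fderiv ℂ h x (x ᵥ* B),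
    (hk.fderiv_apply (analyticAt_vecMul A p)).sub (hh.fderiv_apply (analyticAt_vecMul B p)), ?_⟩
  filter_upwards [Filter.Eventually.fderiv_apply_eq_of_eq_mul (v := fun x => x ᵥ* A) hk hf.1 hkf,
    Filter.Eventually.fderiv_apply_eq_of_eq_mul (v := fun x => x ᵥ* B) hh hf.1 hhf, hhf, hkf,
    hf.1.eventually_analyticAt] with x h1 h2 h3 h4 h5
  rw [fderiv_fderiv_vecMul h5] at h1 h2
  have hs : IsSymmSndFDerivAt ℂ f x :=
    ContDiffAt.isSymmSndFDerivAt_of_omega h5.contDiffAt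
  rw [hs.eq] at h1
  rw [Matrix.vecMul_sub, map_sub, ← Matrix.vecMul_vecMul, ← Matrix.vecMul_vecMul]
  linear_combination h1 - h2 - k x * h3 * (-1) - h x * h4

/-- The Lie algebra of linear logarithmic vector fields, acting on column vectors. -/
def IsLogarithmicBasis.lieSubalgebra {n : ℕ} {D : Set (Fin n → ℂ)}
    {A : Fin n → Matrix (Fin n) (Fin n) ℂ} (hA : IsLogarithmicBasis D (fun i x => x ᵥ* A i))
    {f : (Fin n → ℂ) → ℂ} (hf : IsReducedEquationAt D 0 f) :
    LieSubalgebra ℂ (Matrix (Fin n) (Fin n) ℂ) where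
  carrier := {B | Bᵀ ∈ Submodule.span ℂ (Set.range A)}
  add_mem' := by
    intro B C hB hC
    simp only [Set.mem_ofPred_eq, Matrix.transpose_add] at *
    exact add_mem hB hC
  zero_mem' := by simp
  smul_mem' := by
    intro c B hB
    simp only [Set.mem_ofPred_eq, Matrix.transpose_smul] at *
    exact Submodule.smul_mem _ _ hB
  lie_mem' := by
    intro B C hB hC
    simp only [Set.mem_ofPred_eq] at *
    -- The two elements are swapped because transposition reverses products.
    have := hA.mem_span (hf.isLogarithmicAt_commutator (hA.isLogarithmicAt_of_mem_span hC 0)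
      (hA.isLogarithmicAt_of_mem_span hB 0))
    rwa [Ring.lie_def, Matrix.transpose_sub, Matrix.transpose_mul, Matrix.transpose_mul]

/-- Fields with `f` as eigenvector have flows that multiply `f` by exponentials, hence preserve its
zero set. Conversely a one-parameter group preserving D is generated by a linear logarithmic field,
and these are the constant combinations of the basis. -/
theorem isLieAlgebraOfDivisor_of_fderiv_eq {n : ℕ} {f : (Fin n → ℂ) → ℂ}
    (hf : ∀ x, DifferentiableAt ℂ f x) (hred : IsReducedEquationAt {x | f x = 0} 0 f)
    {A : Fin n → Matrix (Fin n) (Fin n) ℂ}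
    (hA : IsLogarithmicBasis {x | f x = 0} (fun i x => x ᵥ* A i)) {k : Fin n → ℂ}
    (hk : ∀ i x, fderiv ℂ f x (x ᵥ* A i) = k i * f x) :
    IsLieAlgebraOfDivisor {x | f x = 0} (hA.lieSubalgebra hred) := by
  have hexp : ∀ (B : Matrix (Fin n) (Fin n) ℂ) (t : ℂ) (x : Fin n → ℂ),
      NormedSpace.exp (t • B) *ᵥ x = x ᵥ* NormedSpace.exp (t • Bᵀ) := by
    intro B t x
    rw [← Matrix.vecMul_transpose, ← Matrix.exp_transpose, Matrix.transpose_smul]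
  intro B
  constructor
  · intro hB t
    obtain ⟨a, ha⟩ := (Submodule.mem_span_range_iff_exists_fun ℂ).1 hB
    have hBf : ∀ x, fderiv ℂ f x (x ᵥ* Bᵀ) = (∑ i, a i * k i) * f x := by
      intro x
      rw [← ha, Matrix.vecMul_sum, map_sum, Finset.sum_mul]
      refine Finset.sum_congr rfl fun i _ => ?_
      rw [Matrix.vecMul_smul, map_smul, hk, smul_eq_mul, mul_assoc]
    have hflow := apply_vecMul_exp hf hBf
    obtain ⟨g, hg⟩ := Matrix.isUnit_exp ((t : ℂ) • B)
    refine ⟨g, ?_, hg⟩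
    change (fun x => (g : Matrix (Fin n) (Fin n) ℂ) *ᵥ x) '' {x | f x = 0} = {x | f x = 0}
    have hmem : ∀ x, f ((g : Matrix (Fin n) (Fin n) ℂ) *ᵥ x) = 0 ↔ f x = 0 := by
      intro x
      rw [hg, hexp, hflow]
      simp [Complex.exp_ne_zero]
    ext y
    constructor
    · rintro ⟨x, hx, rfl⟩
      exact (hmem x).2 hx
    · intro hy
      have e : (g : Matrix (Fin n) (Fin n) ℂ) *ᵥ
          (((g⁻¹ : GL (Fin n) ℂ) : Matrix (Fin n) (Fin n) ℂ) *ᵥ y) = y := by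
        rw [Matrix.mulVec_mulVec, ← Units.val_mul, mul_inv_cancel, Units.val_one, Matrix.one_mulVec]
      refine ⟨_, (hmem _).1 ?_, e⟩
      rw [e]; exact hy
  · intro h
    refine hA.mem_span (hred.isLogarithmicAt_of_exp fun x hx t => ?_)
    obtain ⟨g, hg, hge⟩ := h t
    have : (g : Matrix (Fin n) (Fin n) ℂ) *ᵥ x ∈ {x | f x = 0} := by
      have hgD : (fun x => (g : Matrix (Fin n) (Fin n) ℂ) *ᵥ x) '' {x | f x = 0} =
        {x | f x = 0} := hg
      rw [← hgD]
      exact ⟨x, hx, rfl⟩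
    rwa [hge, hexp] at this

/-! ### The table: equations and bases -/

theorem MvPolynomial.fderiv_eval_apply {n : ℕ} (q : MvPolynomial (Fin n) ℂ) (x w : Fin n → ℂ) :
    fderiv ℂ (fun x => MvPolynomial.eval x q) x w =
      ∑ i, w i * MvPolynomial.eval x (MvPolynomial.pderiv i q) := by
  induction q using MvPolynomial.induction_on with
  | C a => simp
  | add p q hp hq =>
    have h1 := ((p.analyticAt_eval x).differentiableAt.hasFDerivAt.add
      (q.analyticAt_eval x).differentiableAt.hasFDerivAt).fderiv
    have h2 : (fun x => MvPolynomial.eval x (p + q)) =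
        (fun x => MvPolynomial.eval x p) + fun x => MvPolynomial.eval x q := by
      funext x; simp
    rw [h2, h1, _root_.add_apply, hp, hq, ← Finset.sum_add_distrib]
    simp [mul_add]
  | mul_X p i hp =>
    have hX : HasFDerivAt (fun x : Fin n → ℂ => x i)
        (ContinuousLinearMap.proj (R := ℂ) (φ := fun _ : Fin n => ℂ) i) x :=
      (ContinuousLinearMap.proj (R := ℂ) (φ := fun _ : Fin n => ℂ) i).hasFDerivAt
    have h1 := ((p.analyticAt_eval x).differentiableAt.hasFDerivAt.mul hX).fderiv
    have h2 : (fun x => MvPolynomial.eval x (p * MvPolynomial.X i)) =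
        (fun x => MvPolynomial.eval x p) * fun x => x i := by
      funext x; simp
    rw [h2, h1]
    simp only [_root_.add_apply, _root_.smul_apply, smul_eq_mul, hp,
      Derivation.leibniz, MvPolynomial.pderiv_X, map_add, map_mul, MvPolynomial.eval_X, mul_add,
      Finset.sum_add_distrib]
    congr 1
    · simp [Pi.single_apply, Finset.sum_ite_eq, mul_comm]
    · rw [Finset.mul_sum]
      exact Finset.sum_congr rfl fun j _ => by ring

namespace TableRow

open MvPolynomial in
/-- The polynomial in a row of the table, as a formal polynomial. -/
noncomputable def poly : {n : ℕ} → TableRow n → MvPolynomial (Fin n) ℂ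
  | _, normalCrossing₁ => X 0
  | _, normalCrossing₂ => X 0 * X 1
  | _, normalCrossing₃ => X 0 * X 1 * X 2
  | _, cone₃ => (X 1 ^ 2 + X 0 * X 2) * X 2
  | _, normalCrossing₄ => X 0 * X 1 * X 2 * X 3
  | _, cone₄ => (X 1 ^ 2 + X 0 * X 2) * X 2 * X 3
  | _, quadric => (X 1 * X 2 + X 0 * X 3) * X 2 * X 3
  | _, cubic => X 0 * (X 1 ^ 3 - C 3 * X 0 * X 1 * X 2 + C 3 * X 0 ^ 2 * X 3)
  | _, discriminant => X 1 ^ 2 * X 2 ^ 2 - C 4 * X 0 * X 2 ^ 3 - C 4 * X 1 ^ 3 * X 3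
        + C 18 * X 0 * X 1 * X 2 * X 3 - C 27 * X 3 ^ 2 * X 0 ^ 2

theorem eval_poly {n : ℕ} (r : TableRow n) (x : Fin n → ℂ) :
    MvPolynomial.eval x r.poly = r.equation x := by
  cases r <;> simp [poly, equation]

theorem isHomogeneous_poly {n : ℕ} (r : TableRow n) : r.poly.IsHomogeneous n := by
  have hX : ∀ {m : ℕ} (i : Fin m), (MvPolynomial.X i : MvPolynomial (Fin m) ℂ).IsHomogeneous 1 :=
    fun i => MvPolynomial.isHomogeneous_X ℂ i
  have hC : ∀ {m : ℕ} (c : ℂ), (MvPolynomial.C c : MvPolynomial (Fin m) ℂ).IsHomogeneous 0 :=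
    fun c => MvPolynomial.isHomogeneous_C _ c
  cases r
  · exact hX 0
  · exact (hX 0).mul (hX 1)
  · exact ((hX 0).mul (hX 1)).mul (hX 2)
  · exact (((hX 1).pow 2).add ((hX 0).mul (hX 2))).mul (hX 2)
  · exact (((hX 0).mul (hX 1)).mul (hX 2)).mul (hX 3)
  · exact ((((hX 1).pow 2).add ((hX 0).mul (hX 2))).mul (hX 2)).mul (hX 3)
  · exact ((((hX 1).mul (hX 2)).add ((hX 0).mul (hX 3))).mul (hX 2)).mul (hX 3)
  · exact (hX 0).mul ((((hX 1).pow 3).sub ((((hC 3).mul (hX 0)).mul (hX 1)).mul (hX 2))).add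
      (((hC 3).mul ((hX 0).pow 2)).mul (hX 3)))
  · exact ((((((hX 1).pow 2).mul ((hX 2).pow 2)).sub
      (((hC 4).mul (hX 0)).mul ((hX 2).pow 3))).sub
      (((hC 4).mul ((hX 1).pow 3)).mul (hX 3))).add
      (((((hC 18).mul (hX 0)).mul (hX 1)).mul (hX 2)).mul (hX 3))).sub
      (((hC 27).mul ((hX 3).pow 2)).mul ((hX 0).pow 2))

-- Each row comes with a direction `v` outside the divisor and a base point `x₀` for which Δ
-- restricts to a square-free polynomial `P`. A Bézout identity `U P + W P' = 1` certifies this.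
open Polynomial in
theorem hasSimpleZerosOnGeneralLines {n : ℕ} (r : TableRow n) :
    HasSimpleZerosOnGeneralLines r.equation := by
  have he : r.equation = fun x => MvPolynomial.eval x r.poly := by
    funext x
    rw [eval_poly]
  have key : ∀ (v x₀ : Fin n → ℂ) (P U W : ℂ[X]), n ≠ 0 → r.equation v ≠ 0 →
      (∀ s : ℂ, P.eval s = r.equation (x₀ + s • v)) →
      (∀ s : ℂ, U.eval s * P.eval s + W.eval s * P.derivative.eval s = 1) →
      HasSimpleZerosOnGeneralLines r.equation := by
    intro v x₀ P U W hn hv hP hPU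
    rw [he]
    refine hasSimpleZerosOnGeneralLines_of_exists r.isHomogeneous_poly hn (v := v) (x₀ := x₀)
      (P := P) ?_ ?_ ?_
    · rwa [eval_poly]
    · intro s; rw [eval_poly, hP]
    · intro s h0 h1
      have := hPU s
      simp [h0, h1] at this
  clear he
  cases r
  · refine key ![1] ![0] X 0 1 (by simp) ?_ ?_ ?_ <;> simp [equation]
  · refine key ![1, 1] ![0, 1] (X ^ 2 + X) (C (-4)) (1 + C 2 * X) (by simp) ?_ ?_ ?_
    · simp [equation]
    · intro s; simp [equation]; ring
    · intro s; simp; ring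
  · refine key ![1, 1, 1] ![0, 1, 2] (X ^ 3 + C 3 * X ^ 2 + C 2 * X) (C (-9 / 2) + C (-9 / 2) * X)
      (C (1 / 2) + C 3 * X + C (3 / 2) * X ^ 2) (by simp) ?_ ?_ ?_
    · simp [equation]
    · intro s; simp [equation]; ring
    · intro s; simp; ring
  · refine key ![1, 0, 1] ![0, 1, 0] (X ^ 3 + X) (C (-9 / 2) * X) (1 + C (3 / 2) * X ^ 2)
      (by simp) ?_ ?_ ?_
    · simp [equation]
    · intro s; simp [equation]; ring
    · intro s; simp; ring
  · refine key ![1, 1, 1, 1] ![0, 1, 2, 3] (X ^ 4 + C 6 * X ^ 3 + C 11 * X ^ 2 + C 6 * X)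
      (C (-29 / 9) + C (-20 / 3) * X + C (-20 / 9) * X ^ 2)
      (C (1 / 6) + C (47 / 18) * X + C (5 / 2) * X ^ 2 + C (5 / 9) * X ^ 3) (by simp) ?_ ?_ ?_
    · simp [equation]
    · intro s; simp [equation]; ring
    · intro s; simp; ring
  · refine key ![1, 0, 1, 1] ![0, 1, 0, 1] (X ^ 4 + X ^ 3 + X ^ 2 + X)
      (C (-7 / 2) + C (-15 / 4) * X + C (-5) * X ^ 2)
      (1 + C (3 / 2) * X + C (5 / 4) * X ^ 2 + C (5 / 4) * X ^ 3) (by simp) ?_ ?_ ?_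
    · simp [equation]
    · intro s; simp [equation]; ring
    · intro s; simp; ring
  · refine key ![1, 0, 1, 1] ![1, -2, 0, 1] (X ^ 4 + X ^ 3 + X ^ 2 + X)
      (C (-7 / 2) + C (-15 / 4) * X + C (-5) * X ^ 2)
      (1 + C (3 / 2) * X + C (5 / 4) * X ^ 2 + C (5 / 4) * X ^ 3) (by simp) ?_ ?_ ?_
    · simp [equation]
    · intro s; simp [equation]; ring
    · intro s; simp; ring
  · refine key ![1, 0, 0, 1] ![0, 1, 0, 0] (C 3 * X ^ 4 + X) (C (-16) * X ^ 2) (1 + C 4 * X ^ 3)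
      (by simp) ?_ ?_ ?_
    · simp [equation]
    · intro s; simp [equation]; ring
    · intro s; simp; ring
  · refine key ![0, 1, 1, 0] ![1, 0, 0, -1] (X ^ 4 - C 18 * X ^ 2 - C 27)
      (C (-1 / 27) + C (1 / 324) * X ^ 2) (C (7 / 432) * X + C (-1 / 1296) * X ^ 3)
      (by simp) ?_ ?_ ?_
    · simp [equation]
    · intro s; simp [equation]; ring
    · intro s; simp; ring

/-- The elements of the Lie algebra `𝔤_D` of a row of the table, acting on column vectors. -/
def element : {n : ℕ} → TableRow n → (Fin n → ℂ) → Matrix (Fin n) (Fin n) ℂ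
  | _, normalCrossing₁ => fun a => !![a 0]
  | _, normalCrossing₂ => fun a =>
      !![a 0, 0;
         0, a 1]
  | _, normalCrossing₃ => fun a =>
      !![a 0, 0, 0;
         0, a 1, 0;
         0, 0, a 2]
  | _, cone₃ => fun a =>
      !![a 0 + 4 * a 1, -2 * a 2, 0;
         0, a 0 + a 1, a 2;
         0, 0, a 0 - 2 * a 1]
  | _, normalCrossing₄ => fun a =>
      !![a 0, 0, 0, 0;
         0, a 1, 0, 0;
         0, 0, a 2, 0;
         0, 0, 0, a 3]
  | _, cone₄ => fun a =>
      !![a 0 + 4 * a 1, -2 * a 2, 0, 0;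
         0, a 0 + a 1, a 2, 0;
         0, 0, a 0 - 2 * a 1, 0;
         0, 0, 0, a 3]
  | _, quadric => fun a =>
      !![a 0, 0, a 3, 0;
         0, a 1, 0, -a 3;
         0, 0, a 2, 0;
         0, 0, 0, -a 0 + a 1 + a 2]
  | _, cubic => fun a =>
      !![a 0, 0, 0, 0;
         a 2, a 0 + a 1, 0, 0;
         a 3, a 2, a 0 + 2 * a 1, 0;
         0, a 3, a 2, a 0 + 3 * a 1]
  | _, discriminant => fun a =>
      !![3 * a 0, a 2, 0, 0;
         3 * a 1, 2 * a 0 + a 3, 2 * a 2, 0;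
         0, 2 * a 1, a 0 + 2 * a 3, 3 * a 2;
         0, 0, a 1, 3 * a 3]

/-- The characters by which the rows of the matrix act on the equation. -/
def character : {n : ℕ} → TableRow n → Fin n → ℂ
  | _, normalCrossing₁ => ![1]
  | _, normalCrossing₂ => ![1, 1]
  | _, normalCrossing₃ => ![1, 1, 1]
  | _, cone₃ => ![3, 0, 0]
  | _, normalCrossing₄ => ![1, 1, 1, 1]
  | _, cone₄ => ![3, 0, 0, 1]
  | _, quadric => ![-1, 2, 3, 0]
  | _, cubic => ![4, 3, 0, 0]
  | _, discriminant => ![6, 0, 0, 6]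

theorem exists_det_matrix {n : ℕ} (r : TableRow n) :
    ∃ c : ℂ, c ≠ 0 ∧ ∀ x, (r.matrix x).det = c * r.equation x := by
  cases r
  · exact ⟨1, by norm_num, fun x => by simp [matrix, equation]⟩
  · exact ⟨1, by norm_num, fun x => by simp [matrix, equation]⟩
  · exact ⟨1, by norm_num, fun x => by simp [matrix, equation, Matrix.det_fin_three]⟩
  · exact ⟨6, by norm_num, fun x => by simp [matrix, equation, Matrix.det_fin_three]; ring⟩
  · exact ⟨1, by norm_num, fun x => by
      simp [matrix, equation, Matrix.det_succ_row_zero, Fin.sum_univ_succ, Fin.succAbove]; try ring⟩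
  · exact ⟨6, by norm_num, fun x => by
      simp [matrix, equation, Matrix.det_succ_row_zero, Fin.sum_univ_succ, Fin.succAbove]; ring⟩
  · exact ⟨1, by norm_num, fun x => by
      simp [matrix, equation, Matrix.det_succ_row_zero, Fin.sum_univ_succ, Fin.succAbove]; ring⟩
  · exact ⟨1, by norm_num, fun x => by
      simp [matrix, equation, Matrix.det_succ_row_zero, Fin.sum_univ_succ, Fin.succAbove,
        -mul_eq_mul_left_iff]; ring⟩
  · exact ⟨-3, by norm_num, fun x => by
      simp [matrix, equation, Matrix.det_succ_row_zero, Fin.sum_univ_succ, Fin.succAbove]; ring⟩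

theorem fderiv_equation {n : ℕ} (r : TableRow n) (i : Fin n) (x : Fin n → ℂ) :
    fderiv ℂ r.equation x (r.matrix x i) = r.character i * r.equation x := by
  have he : r.equation = fun x => MvPolynomial.eval x r.poly := by
    funext x
    rw [eval_poly]
  rw [he, MvPolynomial.fderiv_eval_apply, ← he]
  clear he
  cases r <;> fin_cases i <;>
    simp [poly, equation, matrix, character, Fin.sum_univ_succ, Pi.single_apply] <;> ring

/-- The matrices of the linear vector fields in a row of the table. -/
def basis {n : ℕ} (r : TableRow n) (i : Fin n) : Matrix (Fin n) (Fin n) ℂ :=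
  (r.element (Pi.single i 1))ᵀ

theorem element_mulVec {n : ℕ} (r : TableRow n) (a x : Fin n → ℂ) :
    r.element a *ᵥ x = ∑ i, a i • r.matrix x i := by
  funext j
  cases r <;> fin_cases j <;>
    simp [matrix, element, Matrix.mulVec, dotProduct, Fin.sum_univ_succ] <;> ring

theorem vecMul_basis {n : ℕ} (r : TableRow n) (i : Fin n) (x : Fin n → ℂ) :
    x ᵥ* r.basis i = r.matrix x i := by
  rw [basis, Matrix.vecMul_transpose, element_mulVec, Finset.sum_eq_single i]
  · simp
  · intro j _ hj
    simp [Pi.single_eq_of_ne hj]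
  · simp

theorem sum_smul_basis {n : ℕ} (r : TableRow n) (a : Fin n → ℂ) :
    ∑ i, a i • r.basis i = (r.element a)ᵀ := by
  refine Matrix.ext_of_single_vecMul fun j => ?_
  rw [Matrix.vecMul_transpose, element_mulVec, Matrix.vecMul_sum]
  simp only [Matrix.vecMul_smul, vecMul_basis]

theorem isReducedEquationAt {n : ℕ} (r : TableRow n) (p : Fin n → ℂ) :
    IsReducedEquationAt r.divisor p r.equation :=
  r.hasSimpleZerosOnGeneralLines.isReducedEquationAt p

theorem isLogarithmicBasis {n : ℕ} (r : TableRow n) :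
    IsLogarithmicBasis r.divisor (fun i v => r.matrix v i) := by
  obtain ⟨c, hc, hdet⟩ := r.exists_det_matrix
  refine r.hasSimpleZerosOnGeneralLines.isLogarithmicBasis (fun p i j => ?_) hc hdet
    r.fderiv_equation
  simp only [← vecMul_basis]
  exact analyticAt_pi_iff.1 (analyticAt_vecMul _ p) j

theorem isLinearFreeDivisor {n : ℕ} (r : TableRow n) : IsLinearFreeDivisor r.divisor := by
  refine ⟨fun p => ⟨_, r.isReducedEquationAt p⟩, r.basis, ?_⟩
  simp only [vecMul_basis]
  exact r.isLogarithmicBasis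

theorem exists_isLieAlgebraOfDivisor {n : ℕ} (r : TableRow n) :
    ∃ 𝔤 : LieSubalgebra ℂ (Matrix (Fin n) (Fin n) ℂ), IsLieAlgebraOfDivisor r.divisor 𝔤 ∧
      ∀ B, B ∈ 𝔤 ↔ ∃ a, B = r.element a := by
  have hA : IsLogarithmicBasis {x | r.equation x = 0} (fun i x => x ᵥ* r.basis i) := by
    simp only [vecMul_basis]
    exact r.isLogarithmicBasis
  refine ⟨hA.lieSubalgebra (r.isReducedEquationAt 0), ?_, ?_⟩
  · refine isLieAlgebraOfDivisor_of_fderiv_eq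
      (fun x => (r.hasSimpleZerosOnGeneralLines.1 x).differentiableAt) (r.isReducedEquationAt 0)
      (k := r.character) hA fun i x => ?_
    rw [vecMul_basis]
    exact r.fderiv_equation i x
  · intro B
    change Bᵀ ∈ Submodule.span ℂ (Set.range r.basis) ↔ _
    rw [Submodule.mem_span_range_iff_exists_fun]
    simp only [sum_smul_basis, Matrix.transpose_inj, eq_comm]

end TableRow

/-! ### The table: Lie algebras -/

namespace TableRow

theorem element_eq {n : ℕ} (r : TableRow n) (a : Fin n → ℂ) :
    r.element a = ∑ i, a i • (r.basis i)ᵀ := by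
  rw [← Matrix.transpose_inj, ← sum_smul_basis, Matrix.transpose_sum]
  simp only [Matrix.transpose_smul, Matrix.transpose_transpose]

/-- The parametrization of `𝔤_D` as a linear map. -/
noncomputable def elementLM {n : ℕ} (r : TableRow n) :
    (Fin n → ℂ) →ₗ[ℂ] Matrix (Fin n) (Fin n) ℂ where
  toFun := r.element
  map_add' a b := by simp only [element_eq, Pi.add_apply, add_smul, Finset.sum_add_distrib]
  map_smul' c a := by
    simp only [element_eq, Pi.smul_apply, smul_eq_mul, mul_smul, Finset.smul_sum, RingHom.id_apply]

@[simp]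
theorem elementLM_apply {n : ℕ} (r : TableRow n) (a : Fin n → ℂ) : r.elementLM a = r.element a :=
  rfl

/-- A linear relation with constant coefficients is a special relation over germs, excluded by
freeness. -/
theorem elementLM_injective {n : ℕ} (r : TableRow n) : Function.Injective r.elementLM := by
  refine (injective_iff_map_eq_zero _).2 fun a ha => ?_
  funext i
  have h := (r.isLogarithmicBasis 0).2.2 (fun i _ => a i) (fun i => analyticAt_const) ?_ i
  · exact h.self_of_nhds
  · refine Eventually.of_forall fun x => ?_
    rw [← element_mulVec, ← elementLM_apply, ha, Matrix.zero_mulVec]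

/-- The Lie bracket of `𝔤_D` in coordinates. -/
def bracket : {n : ℕ} → TableRow n → (Fin n → ℂ) → (Fin n → ℂ) → (Fin n → ℂ)
  | _, cone₃ => fun a b => ![0, 0, 3 * (a 1 * b 2 - b 1 * a 2)]
  | _, cone₄ => fun a b => ![0, 0, 3 * (a 1 * b 2 - b 1 * a 2), 0]
  | _, quadric => fun a b => ![0, 0, 0, (a 0 - a 2) * b 3 - (b 0 - b 2) * a 3]
  | _, cubic => fun a b => ![0, 0, a 1 * b 2 - b 1 * a 2, 2 * (a 1 * b 3 - b 1 * a 3)]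
  | _, discriminant => fun a b => ![a 2 * b 1 - b 2 * a 1,
      a 1 * b 0 + a 3 * b 1 - b 1 * a 0 - b 3 * a 1,
      a 0 * b 2 + a 2 * b 3 - b 0 * a 2 - b 2 * a 3, a 1 * b 2 - b 1 * a 2]
  | _, normalCrossing₁ => fun _ _ => 0
  | _, normalCrossing₂ => fun _ _ => 0
  | _, normalCrossing₃ => fun _ _ => 0
  | _, normalCrossing₄ => fun _ _ => 0

set_option maxHeartbeats 2000000 in
theorem lie_element {n : ℕ} (r : TableRow n) (a b : Fin n → ℂ) :
    r.element a * r.element b - r.element b * r.element a = r.element (r.bracket a b) := by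
  cases r <;> ext i j <;> fin_cases i <;> fin_cases j <;>
    simp [element, bracket, Matrix.mul_apply, Fin.sum_univ_succ] <;> ring

/-- This reduces each isomorphism of the table to finding linear coordinates on the model in which
its bracket becomes `bracket`. -/
theorem nonempty_lieEquiv {n : ℕ} (r : TableRow n)
    {𝔤 : LieSubalgebra ℂ (Matrix (Fin n) (Fin n) ℂ)} (h𝔤 : ∀ B, B ∈ 𝔤 ↔ ∃ a, B = r.element a)
    {X : Type*} [LieRing X] [LieAlgebra ℂ X] (e : X ≃ₗ[ℂ] (Fin n → ℂ))
    (he : ∀ x y, e ⁅x, y⁆ = r.bracket (e x) (e y)) : Nonempty (𝔤 ≃ₗ⁅ℂ⁆ X) := by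
  let φ : X →ₗ⁅ℂ⁆ Matrix (Fin n) (Fin n) ℂ :=
    { r.elementLM ∘ₗ e.toLinearMap with
      map_lie' := by
        intro x y
        simp [he, Ring.lie_def, lie_element] }
  have hφ : Function.Injective φ := r.elementLM_injective.comp e.injective
  have hr : φ.range = 𝔤 := by
    ext B
    rw [LieHom.mem_range, h𝔤]
    constructor
    · rintro ⟨x, rfl⟩
      exact ⟨e x, rfl⟩
    · rintro ⟨a, rfl⟩
      refine ⟨e.symm a, ?_⟩
      change r.element (e (e.symm a)) = _
      rw [e.apply_symm_apply]
  exact ⟨((LieEquiv.ofInjective φ hφ).trans (LieEquiv.ofEq _ _ (by rw [hr]))).symm⟩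

/-- Coordinates on upper triangular matrices adapted to the cone. -/
noncomputable def borelTwoCoords : borelTwo ≃ₗ[ℂ] (Fin 3 → ℂ) where
  -- The semisimple generator of the cone acts on the nilpotent one with eigenvalue 3, whence the
  -- factor one third.
  toFun A := ![A.1 1 1, (A.1 0 0 - A.1 1 1) / 3, A.1 0 1]
  map_add' A B := by
    funext i; fin_cases i <;> simp; ring
  map_smul' c A := by
    funext i; fin_cases i <;> simp; ring
  invFun a := ⟨!![a 0 + 3 * a 1, a 2; 0, a 0], rfl⟩
  left_inv A := by
    have h : A.1 1 0 = 0 := A.2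
    ext i j; fin_cases i <;> fin_cases j <;> simp [h]; ring
  right_inv a := by
    funext i; fin_cases i <;> simp

theorem hasLieAlgebra {n : ℕ} (r : TableRow n)
    {𝔤 : LieSubalgebra ℂ (Matrix (Fin n) (Fin n) ℂ)} (h𝔤 : ∀ B, B ∈ 𝔤 ↔ ∃ a, B = r.element a) :
    r.HasLieAlgebra 𝔤 := by
  cases r
  · refine nonempty_lieEquiv normalCrossing₁ h𝔤 (LinearEquiv.funUnique (Fin 1) ℂ ℂ).symm ?_
    intro x y
    simp [bracket, Ring.lie_def, mul_comm]
  · refine nonempty_lieEquiv normalCrossing₂ h𝔤 (LinearEquiv.refl ℂ _) ?_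
    intro x y
    simp [bracket, Ring.lie_def, mul_comm]
  · refine nonempty_lieEquiv normalCrossing₃ h𝔤 (LinearEquiv.refl ℂ _) ?_
    intro x y
    simp [bracket, Ring.lie_def, mul_comm]
  · refine nonempty_lieEquiv cone₃ h𝔤 borelTwoCoords ?_
    intro x y
    have hx : x.1 1 0 = 0 := x.2
    have hy : y.1 1 0 = 0 := y.2
    funext i
    fin_cases i <;>
      simp [bracket, borelTwoCoords, Ring.lie_def, Matrix.mul_apply, hx, hy] <;> ring
  · refine nonempty_lieEquiv normalCrossing₄ h𝔤 (LinearEquiv.refl ℂ _) ?_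
    intro x y
    simp [bracket, Ring.lie_def, mul_comm]
  · let e : (ℂ × borelTwo) ≃ₗ[ℂ] (Fin 4 → ℂ) :=
      { toFun := fun z => ![borelTwoCoords z.2 0, borelTwoCoords z.2 1, borelTwoCoords z.2 2, z.1]
        map_add' := by intro z w; funext i; fin_cases i <;> simp
        map_smul' := by intro c z; funext i; fin_cases i <;> simp
        invFun := fun a => (a 3, borelTwoCoords.symm ![a 0, a 1, a 2])
        left_inv := by
          rintro ⟨s, A⟩
          refine Prod.ext rfl ?_
          rw [LinearEquiv.symm_apply_eq]
          funext i; fin_cases i <;> simp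
        right_inv := by intro a; funext i; fin_cases i <;> simp }
    refine nonempty_lieEquiv cone₄ h𝔤 e ?_
    rintro ⟨s, x⟩ ⟨t, y⟩
    have hx : x.1 1 0 = 0 := x.2
    have hy : y.1 1 0 = 0 := y.2
    funext i
    fin_cases i <;>
      simp [e, bracket, borelTwoCoords, Ring.lie_def, Matrix.mul_apply, hx, hy] <;> ring
  · let e : ((Fin 2 → ℂ) × nonabelianTwo) ≃ₗ[ℂ] (Fin 4 → ℂ) :=
      -- Only the difference of the coordinates 0 and 2 acts on the nilpotent element, so that
      -- difference must be the semisimple coordinate of `nonabelianTwo`; the rest is central.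
      { toFun := fun z => ![z.2.1 0 0 + z.1 0, z.1 1, z.1 0, z.2.1 0 1]
        map_add' := by intro z w; funext i; fin_cases i <;> simp; ring
        map_smul' := by intro c z; funext i; fin_cases i <;> simp; ring
        invFun := fun a => (![a 2, a 1], ⟨!![a 0 - a 2, a 3; 0, 0], rfl, rfl⟩)
        left_inv := by
          rintro ⟨s, A⟩
          have h1 : A.1 1 0 = 0 := A.2.1
          have h2 : A.1 1 1 = 0 := A.2.2
          refine Prod.ext ?_ ?_
          · funext i; fin_cases i <;> simp
          · ext i j; fin_cases i <;> fin_cases j <;> simp [h1, h2]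
        right_inv := by intro a; funext i; fin_cases i <;> simp }
    refine nonempty_lieEquiv quadric h𝔤 e ?_
    rintro ⟨s, x⟩ ⟨t, y⟩
    have h1 : x.1 1 0 = 0 := x.2.1
    have h2 : x.1 1 1 = 0 := x.2.2
    have h3 : y.1 1 0 = 0 := y.2.1
    have h4 : y.1 1 1 = 0 := y.2.2
    funext i
    fin_cases i <;>
      simp [e, bracket, Ring.lie_def, Matrix.mul_apply, h1, h2, h3, h4, mul_comm]
  · let e : (ℂ × solvableThree) ≃ₗ[ℂ] (Fin 4 → ℂ) :=
      { toFun := fun z => ![z.1, z.2.1 0 0, z.2.1 0 2, z.2.1 1 2]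
        map_add' := by intro z w; funext i; fin_cases i <;> simp
        map_smul' := by intro c z; funext i; fin_cases i <;> simp
        invFun := fun a => (a 0, ⟨!![a 1, 0, a 2; 0, 2 * a 1, a 3; 0, 0, 0], a 1, a 2, a 3, rfl⟩)
        left_inv := by
          rintro ⟨s, A, t, a, b, rfl⟩
          rfl
        right_inv := by intro a; funext i; fin_cases i <;> simp }
    refine nonempty_lieEquiv cubic h𝔤 e ?_
    rintro ⟨s, A, t, a, b, rfl⟩ ⟨s', A', t', a', b', rfl⟩
    funext i
    fin_cases i <;> (simp [e, bracket, Ring.lie_def, mul_comm]; try ring)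
  · let e : Matrix (Fin 2) (Fin 2) ℂ ≃ₗ[ℂ] (Fin 4 → ℂ) :=
      { toFun := fun A => ![A 0 0, A 1 0, A 0 1, A 1 1]
        map_add' := by intro z w; funext i; fin_cases i <;> simp
        map_smul' := by intro c z; funext i; fin_cases i <;> simp
        invFun := fun a => !![a 0, a 2; a 1, a 3]
        left_inv := by intro A; ext i j; fin_cases i <;> fin_cases j <;> simp
        right_inv := by intro a; funext i; fin_cases i <;> simp }
    refine nonempty_lieEquiv discriminant h𝔤 e ?_
    intro A B
    funext i
    fin_cases i <;> simp [e, bracket, Ring.lie_def, Matrix.mul_apply, Fin.sum_univ_two] <;> ring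

end TableRow

/-! ### The table: reductivity -/

/-- The identity says that the derived algebra is abelian, because it is spanned by brackets. -/
theorem LieAlgebra.isSolvable_of_lie_lie_eq_zero {L : Type*} [LieRing L] [LieAlgebra ℂ L]
    (h : ∀ a b c d : L, ⁅⁅a, b⁆, ⁅c, d⁆⁆ = 0) : LieAlgebra.IsSolvable L := by
  refine LieAlgebra.IsSolvable.mk (R := ℂ) (k := 2) ?_
  have h1 : ∀ x ∈ LieAlgebra.derivedSeries ℂ L 1, ∀ c d : L, ⁅x, ⁅c, d⁆⁆ = 0 := by
    intro x hx c d
    rw [LieAlgebra.derivedSeries_def, LieAlgebra.derivedSeriesOfIdeal_succ,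
      LieAlgebra.derivedSeriesOfIdeal_zero, ← LieSubmodule.mem_toSubmodule,
      LieSubmodule.lieIdeal_oper_eq_linear_span'] at hx
    induction hx using Submodule.span_induction with
    | mem x hx =>
      obtain ⟨a, -, b, -, rfl⟩ := hx
      exact h a b c d
    | zero => simp
    | add x y _ _ hx hy => rw [add_lie, hx, hy, add_zero]
    | smul t x _ hx => rw [smul_lie, hx, smul_zero]
  have h2 : ∀ x ∈ LieAlgebra.derivedSeries ℂ L 1, ∀ y ∈ LieAlgebra.derivedSeries ℂ L 1,
      ⁅x, y⁆ = 0 := by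
    intro x hx y hy
    rw [LieAlgebra.derivedSeries_def, LieAlgebra.derivedSeriesOfIdeal_succ,
      LieAlgebra.derivedSeriesOfIdeal_zero, ← LieSubmodule.mem_toSubmodule,
      LieSubmodule.lieIdeal_oper_eq_linear_span'] at hy
    induction hy using Submodule.span_induction with
    | mem y hy =>
      obtain ⟨c, -, d, -, rfl⟩ := hy
      exact h1 x hx c d
    | zero => simp
    | add y z _ _ hy hz => rw [lie_add, hy, hz, add_zero]
    | smul t y _ hy => rw [lie_smul, hy, smul_zero]
  rw [LieAlgebra.derivedSeries_def, LieAlgebra.derivedSeriesOfIdeal_succ,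
    LieSubmodule.lie_eq_bot_iff]
  exact h2

/-- A solvable reductive Lie algebra of matrices is abelian. -/
theorem IsReductiveMatrixAlgebra.mul_comm_of_isSolvable {n : ℕ}
    {𝔤 : LieSubalgebra ℂ (Matrix (Fin n) (Fin n) ℂ)} (h : IsReductiveMatrixAlgebra 𝔤)
    (hs : LieAlgebra.IsSolvable 𝔤) {A B : Matrix (Fin n) (Fin n) ℂ} (hA : A ∈ 𝔤) (hB : B ∈ 𝔤) :
    A * B = B * A := by
  obtain ⟨S, Z, hSZ, hS, P, hP⟩ := h
  have hSs : LieAlgebra.IsSolvable S :=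
    Function.Injective.lieAlgebra_isSolvable (f := S.incl) Subtype.val_injective
  -- The ideal `S` is both solvable and of trivial radical, hence zero. Everything is then in `Z`,
  -- and simultaneously diagonalizable matrices commute.
  have hrad : LieAlgebra.radical ℂ S = ⊥ := hS.radical_eq_bot
  have htop : (⊤ : LieIdeal ℂ S) = ⊥ := by
    rw [← hrad]
    exact (LieAlgebra.radical_eq_top_of_isSolvable ℂ S).symm
  have hSbot : S = ⊥ := by
    rw [LieSubmodule.eq_bot_iff]
    intro x hx
    have : (⟨x, hx⟩ : S) ∈ (⊥ : LieIdeal ℂ S) := htop ▸ LieSubmodule.mem_top _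
    rw [LieSubmodule.mem_bot] at this
    exact congrArg Subtype.val this
  have hZ : Z = ⊤ := by
    have := hSZ.sup_eq_top
    rwa [hSbot, bot_sup_eq] at this
  have hdiag : ∀ A ∈ 𝔤, ∃ d : Fin n → ℂ, (P : Matrix (Fin n) (Fin n) ℂ) * A *
      ((P⁻¹ : GL (Fin n) ℂ) : Matrix (Fin n) (Fin n) ℂ) = Matrix.diagonal d := by
    intro A hA
    exact ⟨_, (Matrix.isDiag_iff_diagonal_diag _).1
      (hP ⟨A, hA⟩ (by rw [hZ]; exact LieSubmodule.mem_top _)) |>.symm⟩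
  obtain ⟨a, ha⟩ := hdiag A hA
  obtain ⟨b, hb⟩ := hdiag B hB
  have hPP : ((P⁻¹ : GL (Fin n) ℂ) : Matrix (Fin n) (Fin n) ℂ) * (P : Matrix (Fin n) (Fin n) ℂ) = 1 := by
    rw [← Units.val_mul, inv_mul_cancel, Units.val_one]
  have hrec : ∀ (A : Matrix (Fin n) (Fin n) ℂ) (d), (P : Matrix (Fin n) (Fin n) ℂ) * A *
      ((P⁻¹ : GL (Fin n) ℂ) : Matrix (Fin n) (Fin n) ℂ) = Matrix.diagonal d →
      A = ((P⁻¹ : GL (Fin n) ℂ) : Matrix (Fin n) (Fin n) ℂ) * Matrix.diagonal d * P := by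
    intro A d h
    rw [← h]
    calc A = 1 * A * 1 := by simp
      _ = _ := by rw [← hPP]; noncomm_ring
  have hPP' : (P : Matrix (Fin n) (Fin n) ℂ) * ((P⁻¹ : GL (Fin n) ℂ) : Matrix (Fin n) (Fin n) ℂ) = 1 := by
    rw [← Units.val_mul, mul_inv_cancel, Units.val_one]
  have hmul : ∀ c d : Fin n → ℂ, ((P⁻¹ : GL (Fin n) ℂ) : Matrix (Fin n) (Fin n) ℂ) *
      Matrix.diagonal c * P * (((P⁻¹ : GL (Fin n) ℂ) : Matrix (Fin n) (Fin n) ℂ) *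
      Matrix.diagonal d * P) = ((P⁻¹ : GL (Fin n) ℂ) : Matrix (Fin n) (Fin n) ℂ) *
      Matrix.diagonal (c * d) * P := by
    intro c d
    rw [show Matrix.diagonal (c * d) = Matrix.diagonal c * 1 * Matrix.diagonal d by simp, ← hPP']
    noncomm_ring
  rw [hrec A a ha, hrec B b hb, hmul, hmul, mul_comm a b]

theorem isReductiveMatrixAlgebra_of_isDiag {n : ℕ}
    {𝔤 : LieSubalgebra ℂ (Matrix (Fin n) (Fin n) ℂ)} (h : ∀ A ∈ 𝔤, A.IsDiag) :
    IsReductiveMatrixAlgebra 𝔤 := by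
  refine ⟨⊥, ⊤, isCompl_bot_top, ⟨?_⟩, 1, fun A _ => by simpa using h A.1 A.2⟩
  rw [LieSubmodule.eq_bot_iff]
  intro x _
  exact Subsingleton.elim _ _

namespace TableRow

/-- The splitting of gl₂ into sl₂ and the scalars, here cut out by the trace of 4 × 4 matrices.
Semisimplicity of the first summand is shown through the absence of nonzero abelian ideals. -/
theorem isReductive_discriminant {𝔤 : LieSubalgebra ℂ (Matrix (Fin 4) (Fin 4) ℂ)}
    (h𝔤 : ∀ B, B ∈ 𝔤 ↔ ∃ a, B = discriminant.element a) : IsReductiveMatrixAlgebra 𝔤 := by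
  have hlie : ∀ x y : 𝔤, ((⁅x, y⁆ : 𝔤) : Matrix (Fin 4) (Fin 4) ℂ) = x.1 * y.1 - y.1 * x.1 :=
    fun x y => rfl
  have htr : ∀ x y : 𝔤, Matrix.trace ((⁅x, y⁆ : 𝔤) : Matrix (Fin 4) (Fin 4) ℂ) = 0 := by
    intro x y
    rw [hlie, Matrix.trace_sub, Matrix.trace_mul_comm, sub_self]
  let S : LieIdeal ℂ 𝔤 :=
    { carrier := {x | Matrix.trace (x : Matrix (Fin 4) (Fin 4) ℂ) = 0}
      add_mem' := by
        intro x y hx hy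
        simp only [Set.mem_ofPred_eq] at *
        simp [hx, hy]
      zero_mem' := by simp
      smul_mem' := by
        intro c x hx
        simp only [Set.mem_ofPred_eq] at *
        simp [hx]
      lie_mem := by
        intro x m _
        exact htr x m }
  let Z : LieIdeal ℂ 𝔤 :=
    { carrier := {x | ∃ c : ℂ, (x : Matrix (Fin 4) (Fin 4) ℂ) = c • (1 : Matrix (Fin 4) (Fin 4) ℂ)}
      add_mem' := by
        rintro x y ⟨c, hc⟩ ⟨d, hd⟩
        exact ⟨c + d, by rw [add_smul, ← hc, ← hd]; rfl⟩
      zero_mem' := ⟨0, by simp⟩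
      smul_mem' := by
        rintro c x ⟨d, hd⟩
        exact ⟨c * d, by rw [mul_smul, ← hd]; rfl⟩
      lie_mem := by
        rintro x m ⟨c, hc⟩
        refine ⟨0, ?_⟩
        rw [hlie, hc]
        simp }
  have hS : ∀ x, x ∈ S ↔ Matrix.trace (x : Matrix (Fin 4) (Fin 4) ℂ) = 0 := fun _ => Iff.rfl
  have hZ : ∀ x, x ∈ Z ↔ ∃ c : ℂ, (x : Matrix (Fin 4) (Fin 4) ℂ) =
    c • (1 : Matrix (Fin 4) (Fin 4) ℂ) := fun _ => Iff.rfl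
  have h1 : (1 : Matrix (Fin 4) (Fin 4) ℂ) ∈ 𝔤 := by
    refine (h𝔤 1).2 ⟨![1 / 3, 0, 0, 1 / 3], ?_⟩
    ext i j
    fin_cases i <;> fin_cases j <;> simp [element] <;> norm_num
  refine ⟨S, Z, ⟨?_, ?_⟩, ?_, 1, ?_⟩
  · rw [disjoint_iff, LieSubmodule.eq_bot_iff]
    rintro x ⟨hxS, c, hc⟩
    have hx0 : Matrix.trace (x : Matrix (Fin 4) (Fin 4) ℂ) = 0 := hxS
    rw [hc, Matrix.trace_smul, Matrix.trace_one] at hx0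
    have hc0 : c = 0 := by simpa using hx0
    apply Subtype.ext
    rw [hc, hc0, zero_smul]
    rfl
  · rw [codisjoint_iff, eq_top_iff]
    intro x _
    rw [LieSubmodule.mem_sup]
    set c := Matrix.trace (x : Matrix (Fin 4) (Fin 4) ℂ) / 4 with hc
    refine ⟨x - c • ⟨1, h1⟩, ?_, c • ⟨1, h1⟩, ⟨c, rfl⟩, by abel⟩
    rw [hS]
    change Matrix.trace ((x : Matrix (Fin 4) (Fin 4) ℂ) - c • 1) = 0
    rw [Matrix.trace_sub, Matrix.trace_smul, Matrix.trace_one, hc]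
    simp
  · rw [LieAlgebra.hasTrivialRadical_iff_no_abelian_ideals]
    intro I hI
    rw [LieSubmodule.eq_bot_iff]
    intro x hx
    -- An element `x` of an abelian ideal satisfies `(ad x)² = 0`. In coordinates, applied to the
    -- two root vectors of sl₂, this makes the squares of the coordinates of `x` vanish.
    have key : ∀ y : S, ⁅x, ⁅x, y⁆⁆ = 0 := by
      intro y
      have h2 : ⁅x, y⁆ ∈ I := by
        rw [← lie_skew]
        exact neg_mem (I.lie_mem hx)
      have h3 := hI.trivial ⟨x, hx⟩ ⟨_, h2⟩
      exact congrArg Subtype.val h3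
    have key' : ∀ b, b 0 + b 3 = 0 → ∀ a, (x.1.1 : Matrix (Fin 4) (Fin 4) ℂ) = discriminant.element a →
        discriminant.bracket a (discriminant.bracket a b) = 0 := by
      intro b hb a ha
      have hbS : (⟨discriminant.element b, (h𝔤 _).2 ⟨b, rfl⟩⟩ : 𝔤) ∈ S := by
        rw [hS]
        simp only [element, Matrix.trace, Matrix.diag, Fin.sum_univ_four]
        simp
        linear_combination 6 * hb
      have h4 := congrArg (fun z : S => (z.1.1 : Matrix (Fin 4) (Fin 4) ℂ)) (key ⟨_, hbS⟩)
      have h5 : x.1.1 * (x.1.1 * discriminant.element b - discriminant.element b * x.1.1) -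
          (x.1.1 * discriminant.element b - discriminant.element b * x.1.1) * x.1.1 = 0 := h4
      rw [ha, lie_element, lie_element] at h5
      exact (map_eq_zero_iff _ discriminant.elementLM_injective).1 h5
    obtain ⟨a, ha⟩ := (h𝔤 x.1.1).1 x.1.2
    have htrace : a 0 + a 3 = 0 := by
      have h6 : Matrix.trace (x.1.1 : Matrix (Fin 4) (Fin 4) ℂ) = 0 := x.2
      rw [ha] at h6
      simp only [element, Matrix.trace, Matrix.diag, Fin.sum_univ_four] at h6
      simp at h6
      linear_combination h6 / 6
    have e1 := congrFun (key' ![0, 1, 0, 0] (by simp) a ha) 2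
    have e2 := congrFun (key' ![0, 0, 1, 0] (by simp) a ha) 1
    have e3 := congrFun (key' ![0, 0, 1, 0] (by simp) a ha) 2
    simp [bracket] at e1 e2 e3
    have ha2 : a 2 = 0 := by
      have : (2 : ℂ) * a 2 ^ 2 = 0 := by first | linear_combination e1 | linear_combination -e1
      simpa using this
    have ha1 : a 1 = 0 := by
      have : (2 : ℂ) * a 1 ^ 2 = 0 := by first | linear_combination e2 | linear_combination -e2
      simpa using this
    have ha3 : a 3 = 0 := by
      have h7 : a 0 = - a 3 := by linear_combination htrace
      rw [ha1, ha2, h7] at e3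
      have : (4 : ℂ) * a 3 ^ 2 = 0 := by linear_combination e3
      simpa using this
    have ha0 : a 0 = 0 := by linear_combination htrace - ha3
    have ha' : a = 0 := by
      funext i; fin_cases i <;> simp [ha0, ha1, ha2, ha3]
    apply Subtype.ext
    apply Subtype.ext
    rw [ha, ha', ← elementLM_apply, map_zero]
    rfl
  · rintro A ⟨c, hc⟩
    rw [hc]
    simp only [Units.val_one, one_mul, inv_one, mul_one]
    exact (Matrix.isDiag_one).smul c

/-- Diagonal algebras are reductive with zero semisimple part. The rows listed as not reductive have
abelian derived algebra but are not abelian themselves, which is impossible for a solvable reductive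
algebra. -/
theorem isReductive_iff {n : ℕ} (r : TableRow n)
    {𝔤 : LieSubalgebra ℂ (Matrix (Fin n) (Fin n) ℂ)} (h𝔤 : ∀ B, B ∈ 𝔤 ↔ ∃ a, B = r.element a) :
    IsReductiveMatrixAlgebra 𝔤 ↔ r.ListedReductive := by
  have hnon : (∀ a b c d, r.bracket (r.bracket a b) (r.bracket c d) = 0) →
      (∃ a b, r.bracket a b ≠ 0) → ¬ IsReductiveMatrixAlgebra 𝔤 := by
    rintro hm ⟨a, b, hab⟩ hred
    have hs : LieAlgebra.IsSolvable 𝔤 := by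
      refine LieAlgebra.isSolvable_of_lie_lie_eq_zero fun x y z w => ?_
      obtain ⟨a, ha⟩ := (h𝔤 _).1 x.2
      obtain ⟨b, hb⟩ := (h𝔤 _).1 y.2
      obtain ⟨c, hc⟩ := (h𝔤 _).1 z.2
      obtain ⟨d, hd⟩ := (h𝔤 _).1 w.2
      apply Subtype.ext
      change (x.1 * y.1 - y.1 * x.1) * (z.1 * w.1 - w.1 * z.1) -
        (z.1 * w.1 - w.1 * z.1) * (x.1 * y.1 - y.1 * x.1) = 0
      rw [ha, hb, hc, hd, lie_element, lie_element, lie_element, hm, ← elementLM_apply, map_zero]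
    have h := hred.mul_comm_of_isSolvable hs ((h𝔤 _).2 ⟨a, rfl⟩) ((h𝔤 _).2 ⟨b, rfl⟩)
    rw [← sub_eq_zero, lie_element, ← elementLM_apply] at h
    exact hab ((map_eq_zero_iff _ r.elementLM_injective).1 h)
  have hdiag : (∀ a, (r.element a).IsDiag) → IsReductiveMatrixAlgebra 𝔤 := by
    intro hd
    refine isReductiveMatrixAlgebra_of_isDiag fun A hA => ?_
    obtain ⟨a, rfl⟩ := (h𝔤 _).1 hA
    exact hd a
  have hne : ∀ (a b : Fin n → ℂ) (i : Fin n), r.bracket a b i ≠ 0 → ∃ a b, r.bracket a b ≠ 0 :=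
    fun a b i h => ⟨a, b, fun h' => h (by rw [h']; rfl)⟩
  cases r
  · refine iff_of_true (hdiag fun a i j hij => ?_) trivial
    exact absurd (Subsingleton.elim i j) hij
  · refine iff_of_true (hdiag fun a i j hij => ?_) trivial
    fin_cases i <;> fin_cases j <;> simp [element] at hij ⊢
  · refine iff_of_true (hdiag fun a i j hij => ?_) trivial
    fin_cases i <;> fin_cases j <;> simp [element] at hij ⊢
  · refine iff_of_false (hnon ?_ (hne ![0, 1, 0] ![0, 0, 1] 2 (by simp [bracket]))) id
    intro a b c d
    simp [bracket]
  · refine iff_of_true (hdiag fun a i j hij => ?_) trivial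
    fin_cases i <;> fin_cases j <;> simp [element] at hij ⊢
  · refine iff_of_false (hnon ?_ (hne ![0, 1, 0, 0] ![0, 0, 1, 0] 2 (by simp [bracket]))) id
    intro a b c d
    simp [bracket]
  · refine iff_of_false (hnon ?_ (hne ![1, 0, 0, 0] ![0, 0, 0, 1] 3 (by simp [bracket]))) id
    intro a b c d
    simp [bracket]
  · refine iff_of_false (hnon ?_ (hne ![0, 1, 0, 0] ![0, 0, 1, 0] 2 (by simp [bracket]))) id
    intro a b c d
    simp [bracket]
  · exact iff_of_true (isReductive_discriminant h𝔤) trivial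

end TableRow

/-! ### Linearly isomorphic divisors of the table -/

/-- Conjugation by the matrix of the isomorphism carries the group of D to that of D', and it
commutes with the exponential. -/
theorem LinearlyIsomorphic.exists_conj_mem {n : ℕ} {D D' : Set (Fin n → ℂ)}
    (h : LinearlyIsomorphic D D') {𝔤 𝔤' : LieSubalgebra ℂ (Matrix (Fin n) (Fin n) ℂ)}
    (h𝔤 : IsLieAlgebraOfDivisor D 𝔤) (h𝔤' : IsLieAlgebraOfDivisor D' 𝔤') :
    ∃ U : GL (Fin n) ℂ, ∀ A ∈ 𝔤, (U : Matrix (Fin n) (Fin n) ℂ) * A *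
      ((U⁻¹ : GL (Fin n) ℂ) : Matrix (Fin n) (Fin n) ℂ) ∈ 𝔤' := by
  obtain ⟨e, rfl⟩ := h
  let U : GL (Fin n) ℂ :=
    ⟨LinearMap.toMatrix' e.toLinearMap, LinearMap.toMatrix' e.symm.toLinearMap,
      by rw [← LinearMap.toMatrix'_comp]; simp, by rw [← LinearMap.toMatrix'_comp]; simp⟩
  have hU : ∀ x, (U : Matrix (Fin n) (Fin n) ℂ) *ᵥ x = e x := fun x =>
    LinearMap.toMatrix'_mulVec e.toLinearMap x
  have hU' : ∀ x, ((U⁻¹ : GL (Fin n) ℂ) : Matrix (Fin n) (Fin n) ℂ) *ᵥ x = e.symm x := fun x =>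
    LinearMap.toMatrix'_mulVec e.symm.toLinearMap x
  refine ⟨U, fun A hA => (h𝔤' _).2 fun t => ?_⟩
  obtain ⟨g, hg, hge⟩ := (h𝔤 A).1 hA t
  refine ⟨U * g * U⁻¹, ?_, ?_⟩
  · have hg' : (fun x => (g : Matrix (Fin n) (Fin n) ℂ) *ᵥ x) '' D = D := hg
    change (fun x => ((U * g * U⁻¹ : GL (Fin n) ℂ) : Matrix (Fin n) (Fin n) ℂ) *ᵥ x) ''
      (e '' D) = e '' D
    rw [← Set.image_comp]
    conv_rhs => rw [← hg', ← Set.image_comp]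
    refine Set.image_congr fun x _ => ?_
    simp only [Function.comp_apply, Units.val_mul, ← Matrix.mulVec_mulVec, hU', hU,
      LinearEquiv.symm_apply_apply]
  · rw [Units.val_mul, Units.val_mul, hge, ← Matrix.exp_units_conj, Matrix.mul_smul, Matrix.smul_mul]

namespace TableRow

/-- The nilpotency index of the commutators of elements of `𝔤_D`, with value `5` if they are not
nilpotent. -/
def commutatorIndex : {n : ℕ} → TableRow n → ℕ
  | _, normalCrossing₁ => 1
  | _, normalCrossing₂ => 1
  | _, normalCrossing₃ => 1
  | _, cone₃ => 3
  | _, normalCrossing₄ => 1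
  | _, cone₄ => 3
  | _, quadric => 2
  | _, cubic => 4
  | _, discriminant => 5

theorem bracket_pow_eq_zero {n : ℕ} (r : TableRow n) (hr : r.commutatorIndex ≤ 4)
    (a b : Fin n → ℂ) : r.element (r.bracket a b) ^ r.commutatorIndex = 0 := by
  cases r <;> simp only [commutatorIndex, pow_succ, pow_zero, one_mul]
  case discriminant => simp [commutatorIndex] at hr
  all_goals
    ext i j
    fin_cases i <;> fin_cases j <;>
      simp [element, bracket, Matrix.mul_apply, Fin.sum_univ_succ]

theorem exists_bracket_pow_ne_zero {n : ℕ} (r : TableRow n) :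
    ∃ a b, r.element (r.bracket a b) ^ (r.commutatorIndex - 1) ≠ 0 := by
  cases r
  case cone₃ =>
    refine ⟨![0, 1, 0], ![0, 0, 1], fun h => ?_⟩
    have := congrFun (congrFun h 0) 2
    simp [commutatorIndex, pow_succ, element, bracket, Matrix.mul_apply, Fin.sum_univ_succ] at this
  case cone₄ =>
    refine ⟨![0, 1, 0, 0], ![0, 0, 1, 0], fun h => ?_⟩
    have := congrFun (congrFun h 0) 2
    simp [commutatorIndex, pow_succ, element, bracket, Matrix.mul_apply, Fin.sum_univ_succ] at this
  case quadric =>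
    refine ⟨![1, 0, 0, 0], ![0, 0, 0, 1], fun h => ?_⟩
    have := congrFun (congrFun h 0) 2
    simp [commutatorIndex, pow_succ, element, bracket] at this
  case cubic =>
    refine ⟨![0, 1, 0, 0], ![0, 0, 1, 0], fun h => ?_⟩
    have := congrFun (congrFun h 3) 0
    simp [commutatorIndex, pow_succ, element, bracket, Matrix.mul_apply, Fin.sum_univ_succ] at this
  case discriminant =>
    refine ⟨![0, 1, 0, 0], ![0, 0, 1, 0], fun h => ?_⟩
    have := congrFun (congrFun h 0) 0
    simp [commutatorIndex, pow_succ, element, bracket, Matrix.mul_apply, Fin.sum_univ_succ] at this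
  -- In the abelian rows the exponent is zero, so the power is the identity matrix.
  all_goals exact ⟨0, 0, by simp [commutatorIndex]⟩

/-- Conjugation takes commutators to commutators and preserves their nilpotency. The index 5 is
never used as an exponent that kills: if it is the larger one, only the nonvanishing of a fourth
power matters. -/
theorem commutatorIndex_le_of_linearlyIsomorphic {n : ℕ} {r s : TableRow n}
    (h : LinearlyIsomorphic r.divisor s.divisor) : r.commutatorIndex ≤ s.commutatorIndex := by
  obtain ⟨𝔤, h𝔤, hr⟩ := r.exists_isLieAlgebraOfDivisor
  obtain ⟨𝔤', h𝔤', hs⟩ := s.exists_isLieAlgebraOfDivisor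
  obtain ⟨U, hU⟩ := h.exists_conj_mem h𝔤 h𝔤'
  by_contra! hlt
  have hr5 : r.commutatorIndex ≤ 5 := by cases r <;> simp [commutatorIndex]
  obtain ⟨a, b, hab⟩ := r.exists_bracket_pow_ne_zero
  obtain ⟨a', ha'⟩ := (hs _).1 (hU _ ((hr _).2 ⟨a, rfl⟩))
  obtain ⟨b', hb'⟩ := (hs _).1 (hU _ ((hr _).2 ⟨b, rfl⟩))
  have h1 := s.bracket_pow_eq_zero (by omega) a' b'
  have hconj : ∀ M N : Matrix (Fin n) (Fin n) ℂ,
      (U : Matrix (Fin n) (Fin n) ℂ) * M * ((U⁻¹ : GL (Fin n) ℂ) : Matrix (Fin n) (Fin n) ℂ) *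
      ((U : Matrix (Fin n) (Fin n) ℂ) * N * ((U⁻¹ : GL (Fin n) ℂ) : Matrix (Fin n) (Fin n) ℂ)) =
      (U : Matrix (Fin n) (Fin n) ℂ) * (M * N) *
        ((U⁻¹ : GL (Fin n) ℂ) : Matrix (Fin n) (Fin n) ℂ) := by
    intro M N
    simp only [Matrix.mul_assoc, Units.inv_mul_cancel_left]
  rw [← lie_element, ← ha', ← hb', hconj, hconj, ← Matrix.sub_mul, ← Matrix.mul_sub, lie_element,
    Units.conj_pow] at h1
  have h2 : r.element (r.bracket a b) ^ s.commutatorIndex = 0 := by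
    rwa [Units.mul_left_eq_zero, Units.mul_right_eq_zero] at h1
  exact hab (pow_eq_zero_of_le (by omega) h2)

/-- Among rows with the same `n` the index takes distinct values: 1 and 3 for `n = 3`, and 1, 3, 2,
4, 5 for `n = 4`. -/
theorem eq_of_linearlyIsomorphic {n : ℕ} {r s : TableRow n}
    (h : LinearlyIsomorphic r.divisor s.divisor) : r = s := by
  have h1 := le_antisymm (commutatorIndex_le_of_linearlyIsomorphic h)
    (commutatorIndex_le_of_linearlyIsomorphic h.symm)
  cases r <;> cases s <;> first | rfl | simp [commutatorIndex] at h1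

end TableRow

/-! ### Linear free divisors -/

/-- The determinant of the coefficient matrix of linear vector fields. -/
noncomputable def saitoDet {n : ℕ} (A : Fin n → Matrix (Fin n) (Fin n) ℂ) (x : Fin n → ℂ) : ℂ :=
  (Matrix.of fun i => x ᵥ* A i).det

/-- The matrices `A i` define a basis of linear logarithmic vector fields of the reduced divisor
`D`. -/
structure IsLinearBasis {n : ℕ} (D : Set (Fin n → ℂ)) (A : Fin n → Matrix (Fin n) (Fin n) ℂ) :
    Prop where
  reduced : IsReducedDivisor D
  basis : IsLogarithmicBasis D fun i x => x ᵥ* A i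

theorem analyticAt_saitoDet {n : ℕ} (A : Fin n → Matrix (Fin n) (Fin n) ℂ) (p : Fin n → ℂ) :
    AnalyticAt ℂ (saitoDet A) p :=
  AnalyticAt.matrix_det fun i j => analyticAt_pi_iff.1 (analyticAt_vecMul (A i) p) j

/-- Gronwall's inequality on segments from `p`: along each of them the derivative of `f` is bounded
by a constant times `f`, and `f` starts from zero. -/
theorem AnalyticAt.eventually_eq_zero_of_fderiv_eq_mul {n : ℕ} {f : (Fin n → ℂ) → ℂ}
    {p : Fin n → ℂ} (hf : AnalyticAt ℂ f p) (hfp : f p = 0) {h : Fin n → (Fin n → ℂ) → ℂ}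
    (hh : ∀ j, AnalyticAt ℂ (h j) p)
    (H : ∀ᶠ x in 𝓝 p, ∀ j, fderiv ℂ f x (Pi.single j 1) = h j x * f x) :
    ∀ᶠ x in 𝓝 p, f x = 0 := by
  have hbd : ∀ j, ∀ᶠ x in 𝓝 p, ‖h j x‖ < ‖h j p‖ + 1 := fun j =>
    (hh j).continuousAt.norm.eventually_lt_const (lt_add_one _)
  obtain ⟨r, hr, hball⟩ := Metric.eventually_nhds_iff_ball.1
    (H.and ((eventually_all.2 hbd).and hf.eventually_analyticAt))
  refine Metric.eventually_nhds_iff_ball.2 ⟨r, hr, fun x hx => ?_⟩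
  set v := x - p with hv
  have hmem : ∀ t ∈ Set.Icc (0 : ℝ) 1, p + (t : ℂ) • v ∈ Metric.ball p r := by
    intro t ht
    rw [mem_ball_iff_norm] at hx ⊢
    rw [add_sub_cancel_left, norm_smul, Complex.norm_real, Real.norm_of_nonneg ht.1]
    exact lt_of_le_of_lt (mul_le_of_le_one_left (norm_nonneg _) ht.2) hx
  have hder : ∀ t ∈ Set.Icc (0 : ℝ) 1, HasDerivAt (fun t : ℝ => f (p + (t : ℂ) • v))
      (fderiv ℂ f (p + (t : ℂ) • v) v) t := by
    intro t ht
    have h1 : HasDerivAt (fun t : ℝ => p + (t : ℂ) • v) v t := by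
      have := (Complex.ofRealCLM.hasDerivAt (x := t)).smul_const v
      simpa using this.const_add p
    exact ((hball _ (hmem t ht)).2.2.differentiableAt.hasFDerivAt.restrictScalars ℝ).comp_hasDerivAt
      t h1
  have key := eq_zero_of_abs_deriv_le_mul_abs_self_of_eq_zero_right
    (f := fun t : ℝ => f (p + (t : ℂ) • v)) (f' := fun t => fderiv ℂ f (p + (t : ℂ) • v) v)
    (K := ∑ j, ‖v j‖ * (‖h j p‖ + 1)) (a := 0) (b := 1)
    (fun t ht => (hder t ht).continuousAt.continuousWithinAt)
    (fun t ht => (hder t ⟨ht.1, ht.2.le⟩).hasDerivWithinAt) (by simpa using hfp) ?_ 1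
    (Set.right_mem_Icc.2 zero_le_one)
  · simpa [hv] using key
  · intro t ht
    obtain ⟨h1, h2, -⟩ := hball _ (hmem t ⟨ht.1, ht.2.le⟩)
    have h3 : v = ∑ j, v j • (Pi.single j (1 : ℂ) : Fin n → ℂ) := by
      funext k
      simp [Finset.sum_apply, Pi.single_apply]
    have h4 : fderiv ℂ f (p + (t : ℂ) • v) v =
        ∑ j, v j * h j (p + (t : ℂ) • v) * f (p + (t : ℂ) • v) := by
      conv_lhs => rw [h3, map_sum]
      refine Finset.sum_congr rfl fun j _ => ?_
      rw [map_smul, ← h3, h1, smul_eq_mul, mul_assoc]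
    rw [h4, ← Finset.sum_mul, norm_mul]
    refine mul_le_mul_of_nonneg_right ((norm_sum_le _ _).trans (Finset.sum_le_sum fun j _ => ?_))
      (norm_nonneg _)
    rw [norm_mul]
    exact mul_le_mul_of_nonneg_left (h2 j).le (norm_nonneg _)

theorem IsReducedEquationAt.mem_iff {n : ℕ} {D : Set (Fin n → ℂ)} {p : Fin n → ℂ}
    {f : (Fin n → ℂ) → ℂ} (hf : IsReducedEquationAt D p f) : p ∈ D ↔ f p = 0 :=
  hf.2.1.self_of_nhds

theorem isLogarithmicAt_of_notMem {n : ℕ} {D : Set (Fin n → ℂ)} {p : Fin n → ℂ} (hp : p ∉ D)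
    {v : (Fin n → ℂ) → (Fin n → ℂ)} (hv : AnalyticAt ℂ v p) : IsLogarithmicAt D p v := by
  refine ⟨hv, fun f hf => ?_⟩
  have h0 : f p ≠ 0 := fun h => hp (hf.mem_iff.2 h)
  refine ⟨fun x => fderiv ℂ f x (v x) / f x, (hf.1.fderiv_apply hv).div hf.1 h0, ?_⟩
  filter_upwards [hf.1.continuousAt.eventually_ne h0] with x hx
  rw [div_mul_cancel₀ _ hx]

namespace IsLinearBasis

variable {n : ℕ} {D : Set (Fin n → ℂ)} {A : Fin n → Matrix (Fin n) (Fin n) ℂ}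

theorem linearIndependent (hA : IsLinearBasis D A) : LinearIndependent ℂ A := by
  rw [Fintype.linearIndependent_iff]
  intro c hc i
  refine ((hA.basis 0).2.2 (fun i _ => c i) (fun _ => analyticAt_const) ?_ i).self_of_nhds
  refine Eventually.of_forall fun x => ?_
  have := congrArg (fun B => x ᵥ* B) hc
  simpa only [Matrix.vecMul_sum, Matrix.vecMul_smul, Matrix.vecMul_zero] using this

/-- Two bases of the same span differ by a constant invertible matrix, so generation and
independence over germs carry over. -/
theorem of_span_eq (hA : IsLinearBasis D A) {A' : Fin n → Matrix (Fin n) (Fin n) ℂ}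
    (h : Submodule.span ℂ (Set.range A') = Submodule.span ℂ (Set.range A)) :
    IsLinearBasis D A' := by
  have h1 : ∀ i, ∃ c : Fin n → ℂ, ∑ j, c j • A j = A' i := fun i =>
    (Submodule.mem_span_range_iff_exists_fun ℂ).1 (h ▸ Submodule.subset_span ⟨i, rfl⟩)
  have h2 : ∀ i, ∃ c : Fin n → ℂ, ∑ j, c j • A' j = A i := fun i =>
    (Submodule.mem_span_range_iff_exists_fun ℂ).1 (h ▸ Submodule.subset_span ⟨i, rfl⟩)
  choose P hP using h1
  choose Q hQ using h2
  have hPQ : Matrix.of Q * Matrix.of P = 1 := by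
    ext i k
    have h3 : ∑ k, (∑ j, Q i j * P j k - (1 : Matrix (Fin n) (Fin n) ℂ) i k) • A k = 0 := by
      simp only [sub_smul, Finset.sum_sub_distrib, Finset.sum_smul, Matrix.one_apply, ite_smul,
        one_smul, zero_smul, Finset.sum_ite_eq, Finset.mem_univ, if_true]
      rw [Finset.sum_comm]
      simp only [mul_smul, ← Finset.smul_sum, hP, hQ, sub_self]
    exact sub_eq_zero.1 (Fintype.linearIndependent_iff.1 hA.linearIndependent _ h3 k)
  have hQP : Matrix.of P * Matrix.of Q = 1 := mul_eq_one_comm.1 hPQ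
  have hvP : ∀ i x, x ᵥ* A' i = ∑ j, P i j • (x ᵥ* A j) := by
    intro i x
    rw [← hP, Matrix.vecMul_sum]
    simp only [Matrix.vecMul_smul]
  have hvQ : ∀ i x, x ᵥ* A i = ∑ j, Q i j • (x ᵥ* A' j) := by
    intro i x
    rw [← hQ, Matrix.vecMul_sum]
    simp only [Matrix.vecMul_smul]
  refine ⟨hA.reduced, fun p => ⟨fun i => hA.basis.isLogarithmicAt_of_mem_span
    (h ▸ Submodule.subset_span ⟨i, rfl⟩) p, fun v hv => ?_, fun c hc hsum => ?_⟩⟩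
  · obtain ⟨c, hc, hcv⟩ := (hA.basis p).2.1 v hv
    refine ⟨fun j x => ∑ i, c i x * Q i j,
      fun j => Finset.analyticAt_fun_sum _ fun i _ => (hc i).mul analyticAt_const, ?_⟩
    filter_upwards [hcv] with x hx
    rw [hx]
    simp only [hvQ, Finset.smul_sum, Finset.sum_smul, mul_smul]
    exact Finset.sum_comm
  · have h4 := (hA.basis p).2.2 (fun j x => ∑ i, c i x * P i j)
      (fun j => Finset.analyticAt_fun_sum _ fun i _ => (hc i).mul analyticAt_const) (by
        filter_upwards [hsum] with x hx
        simp only [hvP, Finset.smul_sum] at hx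
        simp only [Finset.sum_smul, mul_smul]
        rw [← hx]
        exact Finset.sum_comm)
    intro i
    filter_upwards [eventually_all.2 h4] with x hx
    have h5 : (fun i => c i x) ᵥ* Matrix.of P = 0 := funext hx
    have h6 := congrArg (fun u => u ᵥ* Matrix.of Q) h5
    simp only [Matrix.vecMul_vecMul, hQP, Matrix.vecMul_one, Matrix.zero_vecMul] at h6
    exact congrFun h6 i

/-- A linear free divisor is the zero set of its Saito determinant. -/
theorem mem_iff (hA : IsLinearBasis D A) (p : Fin n → ℂ) : p ∈ D ↔ saitoDet A p = 0 := by
  constructor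
  · intro hp
    by_contra h0
    obtain ⟨f, hf⟩ := hA.reduced p
    -- If the determinant were nonzero at a point of D, Cramer's rule would make every ∂ⱼ
    -- logarithmic there. All partial derivatives of `f` would be multiples of `f`, and `f` would
    -- have zero germ.
    have hlog : ∀ j, IsLogarithmicAt D p (fun _ => (Pi.single j 1 : Fin n → ℂ)) := by
      intro j
      set M : (Fin n → ℂ) → Matrix (Fin n) (Fin n) ℂ := fun x => Matrix.of fun i => x ᵥ* A i
      have hM : ∀ i k, AnalyticAt ℂ (fun x => M x i k) p := fun i k =>
        analyticAt_pi_iff.1 (analyticAt_vecMul (A i) p) k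
      have h1 := IsLogarithmicAt.sum_smul (fun i => (hA.basis p).1 i)
        (c := fun i x => ((M x).updateRow i (Pi.single j 1)).det / saitoDet A x) fun i => by
          refine AnalyticAt.div (AnalyticAt.matrix_det fun a b => ?_) (analyticAt_saitoDet A p) h0
          by_cases hai : a = i
          · subst hai
            simpa using analyticAt_const
          · simpa [Matrix.updateRow_ne hai] using hM a b
      obtain ⟨h2, h3⟩ := h1
      have h4 : ∀ᶠ x in 𝓝 p, ∑ i, (((M x).updateRow i (Pi.single j 1)).det / saitoDet A x) •
          (x ᵥ* A i) = Pi.single j 1 := by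
        filter_upwards [(analyticAt_saitoDet A p).continuousAt.eventually_ne h0] with x hx
        have h5 := Matrix.sum_det_updateRow_smul (M x) (Pi.single j 1)
        have h6 : ∑ i, (((M x).updateRow i (Pi.single j 1)).det / saitoDet A x) • (x ᵥ* A i) =
            (saitoDet A x)⁻¹ • ∑ i, ((M x).updateRow i (Pi.single j 1)).det • M x i := by
          rw [Finset.smul_sum]
          refine Finset.sum_congr rfl fun i _ => ?_
          rw [smul_smul, div_eq_inv_mul]
          rfl
        rw [h6, h5, smul_smul]
        change ((saitoDet A x)⁻¹ * saitoDet A x) • _ = _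
        rw [inv_mul_cancel₀ hx, one_smul]
      refine ⟨analyticAt_const, fun f hf => ?_⟩
      obtain ⟨h, hh, hhf⟩ := h3 f hf
      refine ⟨h, hh, ?_⟩
      filter_upwards [hhf, h4] with x hx hx4
      rw [← hx, hx4]
    choose h hh hhf using fun j => (hlog j).2 f hf
    exact hf.2.2.1 (hf.1.eventually_eq_zero_of_fderiv_eq_mul (hf.mem_iff.1 hp) hh
      (eventually_all.2 hhf))
  · intro h0
    by_contra hp
    -- Outside D every holomorphic field is logarithmic. Expressing the fields ∂ⱼ in the basis at
    -- `p` inverts the coefficient matrix.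
    have h1 : ∀ j, ∃ c : Fin n → ℂ, (Pi.single j 1 : Fin n → ℂ) = ∑ i, c i • (p ᵥ* A i) := by
      intro j
      obtain ⟨c, hc, hcv⟩ := (hA.basis p).2.1 (fun _ => Pi.single j 1)
        (isLogarithmicAt_of_notMem hp analyticAt_const)
      exact ⟨fun i => c i p, hcv.self_of_nhds⟩
    choose c hc using h1
    have h2 : Matrix.of c * Matrix.of (fun i => p ᵥ* A i) = 1 := by
      ext j k
      have := congrFun (hc j) k
      simp only [Finset.sum_apply, Pi.smul_apply, smul_eq_mul] at this
      rw [Matrix.one_eq_pi_single, this, Matrix.mul_apply]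
      rfl
    have h3 := congrArg Matrix.det h2
    rw [Matrix.det_mul, Matrix.det_one] at h3
    change _ * saitoDet A p = 1 at h3
    rw [h0, mul_zero] at h3
    exact zero_ne_one h3

/-- Otherwise D would be all of ℂⁿ, and its reduced equations would have zero germs. -/
theorem exists_saitoDet_ne_zero (hA : IsLinearBasis D A) : ∃ x, saitoDet A x ≠ 0 := by
  by_contra! h
  obtain ⟨f, hf⟩ := hA.reduced 0
  exact hf.2.2.1 (hf.2.1.mono fun x hx => hx.1 ((hA.mem_iff x).2 (h x)))

theorem commutator_mem (hA : IsLinearBasis D A) {B C : Matrix (Fin n) (Fin n) ℂ}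
    (hB : B ∈ Submodule.span ℂ (Set.range A)) (hC : C ∈ Submodule.span ℂ (Set.range A)) :
    B * C - C * B ∈ Submodule.span ℂ (Set.range A) := by
  obtain ⟨f, hf⟩ := hA.reduced 0
  exact hA.basis.mem_span (hf.isLogarithmicAt_commutator
    (hA.basis.isLogarithmicAt_of_mem_span hB 0) (hA.basis.isLogarithmicAt_of_mem_span hC 0))

/-- A linear vector field for which the Saito determinant is an eigenvector is logarithmic. -/
theorem mem_of_fderiv_eq (hA : IsLinearBasis D A) {B : Matrix (Fin n) (Fin n) ℂ} {c : ℂ}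
    (h : ∀ x, fderiv ℂ (saitoDet A) x (x ᵥ* B) = c * saitoDet A x) :
    B ∈ Submodule.span ℂ (Set.range A) := by
  obtain ⟨f, hf⟩ := hA.reduced 0
  refine hA.basis.mem_span (hf.isLogarithmicAt_of_exp fun x hx t => ?_)
  rw [hA.mem_iff] at hx ⊢
  rw [apply_vecMul_exp (fun x => (analyticAt_saitoDet A x).differentiableAt) h, hx, mul_zero]

theorem saitoDet_smul (A : Fin n → Matrix (Fin n) (Fin n) ℂ) (t : ℂ) (x : Fin n → ℂ) :
    saitoDet A (t • x) = t ^ n * saitoDet A x := by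
  have : (Matrix.of fun i => (t • x) ᵥ* A i) = t • Matrix.of fun i => x ᵥ* A i := by
    ext i j
    simp [Matrix.smul_vecMul]
  rw [saitoDet, this, Matrix.det_smul, Fintype.card_fin]
  rfl

/-- The Euler field: the determinant is homogeneous of degree `n`, so it is an eigenvector of this
field. -/
theorem one_mem (hA : IsLinearBasis D A) :
    (1 : Matrix (Fin n) (Fin n) ℂ) ∈ Submodule.span ℂ (Set.range A) := by
  refine hA.mem_of_fderiv_eq (c := n) fun x => ?_
  rw [Matrix.vecMul_one]
  have h1 : HasDerivAt (fun t : ℂ => t • x) x 1 := by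
    simpa using (hasDerivAt_id (1 : ℂ)).smul_const x
  have hF : HasFDerivAt (saitoDet A) (fderiv ℂ (saitoDet A) x) ((fun t : ℂ => t • x) 1) := by
    simp only [one_smul]
    exact (analyticAt_saitoDet A x).differentiableAt.hasFDerivAt
  have h2 := hF.comp_hasDerivAt (1 : ℂ) h1
  have h3 : HasDerivAt (fun t : ℂ => t ^ n * saitoDet A x) (n * saitoDet A x) 1 := by
    simpa using (hasDerivAt_pow n (1 : ℂ)).mul_const (saitoDet A x)
  refine h2.unique (h3.congr_of_eventuallyEq (Eventually.of_forall fun t => ?_))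
  exact saitoDet_smul A t x

theorem finrank_span (hA : IsLinearBasis D A) :
    Module.finrank ℂ (Submodule.span ℂ (Set.range A)) = n := by
  rw [finrank_span_eq_card hA.linearIndependent, Fintype.card_fin]

end IsLinearBasis

/-- Jacobi's formula. The determinant is multilinear in the rows, and the determinant with one row
replaced is an expansion in cofactors. -/
theorem Matrix.hasFDerivAt_det {n : ℕ} (M : Matrix (Fin n) (Fin n) ℂ) :
    ∃ L : (Fin n → Fin n → ℂ) →L[ℂ] ℂ,
      HasFDerivAt (fun N : Fin n → Fin n → ℂ => (Matrix.of N).det) L M ∧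
      ∀ Y : Matrix (Fin n) (Fin n) ℂ, L Y = (Y * M.adjugate).trace := by
  let φ : ContinuousMultilinearMap ℂ (fun _ : Fin n => Fin n → ℂ) ℂ :=
    { toMultilinearMap := (Matrix.detRowAlternating (n := Fin n) (R := ℂ)).toMultilinearMap
      cont := Continuous.matrix_det (A := fun N : Fin n → Fin n → ℂ => Matrix.of N) continuous_id }
  refine ⟨φ.linearDeriv M, φ.hasFDerivAt M, fun Y => ?_⟩
  refine (ContinuousMultilinearMap.linearDeriv_apply φ M Y).trans ?_
  rw [Matrix.trace]
  refine Finset.sum_congr rfl fun i _ => ?_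
  change (M.updateRow i (Y i)).det = _
  rw [← Matrix.cramer_transpose_apply, Matrix.cramer_eq_adjugate_mulVec, ← Matrix.adjugate_transpose,
    Matrix.diag_apply, Matrix.mul_apply, Matrix.mulVec, dotProduct]
  exact Finset.sum_congr rfl fun k _ => mul_comm _ _

/-- If `B` normalizes the span, with `G` the matrix of commutation with `B`, the coefficient matrix
`M` changes along the field of `B` by `M B - G M`. Jacobi's formula turns this into the eigenvalue
`tr B - tr G`. -/
theorem exists_fderiv_saitoDet_eq {n : ℕ} {A : Fin n → Matrix (Fin n) (Fin n) ℂ}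
    {B : Matrix (Fin n) (Fin n) ℂ}
    (h : ∀ i, A i * B - B * A i ∈ Submodule.span ℂ (Set.range A)) :
    ∃ c : ℂ, ∀ x, fderiv ℂ (saitoDet A) x (x ᵥ* B) = c * saitoDet A x := by
  choose G hG using fun i => (Submodule.mem_span_range_iff_exists_fun ℂ).1 (h i)
  refine ⟨B.trace - (Matrix.of G).trace, fun x => ?_⟩
  set M : Matrix (Fin n) (Fin n) ℂ := Matrix.of fun i => x ᵥ* A i with hM
  obtain ⟨L, hL, hLY⟩ := Matrix.hasFDerivAt_det M
  have h1 : HasFDerivAt (fun x : Fin n → ℂ => fun i => x ᵥ* A i)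
      (ContinuousLinearMap.pi fun i => vecMulCLM (A i)) x :=
    hasFDerivAt_pi.2 fun i => (vecMulCLM (A i)).hasFDerivAt
  have h2 : HasFDerivAt (saitoDet A) (L.comp (ContinuousLinearMap.pi fun i => vecMulCLM (A i))) x :=
    HasFDerivAt.comp x hL h1
  rw [h2.fderiv]
  have h3 : (L.comp (ContinuousLinearMap.pi fun i => vecMulCLM (A i))) (x ᵥ* B) =
      L (M * B - Matrix.of G * M) := by
    refine congrArg L ?_
    funext i
    change x ᵥ* B ᵥ* A i = M i ᵥ* B - G i ᵥ* M
    have h4 : M i = x ᵥ* A i := rfl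
    rw [h4]
    have h5 : G i ᵥ* M = x ᵥ* (A i * B - B * A i) := by
      rw [← hG, Matrix.vecMul_sum, Matrix.vecMul_eq_sum]
      simp only [Matrix.vecMul_smul]
      rfl
    rw [h5, Matrix.vecMul_sub, Matrix.vecMul_vecMul, Matrix.vecMul_vecMul]
    abel
  rw [h3, hLY, Matrix.sub_mul, Matrix.trace_sub, Matrix.mul_assoc, Matrix.trace_mul_comm,
    Matrix.mul_assoc, Matrix.adjugate_mul, Matrix.mul_assoc, Matrix.mul_adjugate]
  simp only [Matrix.mul_smul, Matrix.mul_one, Matrix.trace_smul, smul_eq_mul]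
  rw [show saitoDet A x = M.det from rfl]
  ring

theorem IsLinearBasis.exists_fderiv_saitoDet_eq {n : ℕ} {D : Set (Fin n → ℂ)}
    {A : Fin n → Matrix (Fin n) (Fin n) ℂ} (hA : IsLinearBasis D A)
    {B : Matrix (Fin n) (Fin n) ℂ} (hB : B ∈ Submodule.span ℂ (Set.range A)) :
    ∃ c : ℂ, ∀ x, fderiv ℂ (saitoDet A) x (x ᵥ* B) = c * saitoDet A x :=
  _root_.exists_fderiv_saitoDet_eq fun i => hA.commutator_mem (Submodule.subset_span ⟨i, rfl⟩) hB

/-! ### Linear changes of coordinates -/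

/-- The linear automorphism `x ↦ x P` of the space of row vectors. -/
noncomputable def vecMulEquiv {n : ℕ} (P : GL (Fin n) ℂ) : (Fin n → ℂ) ≃ₗ[ℂ] (Fin n → ℂ) where
  toFun x := x ᵥ* (P : Matrix (Fin n) (Fin n) ℂ)
  map_add' x y := Matrix.add_vecMul _ _ _
  map_smul' c x := Matrix.smul_vecMul _ _ _
  invFun x := x ᵥ* ((P⁻¹ : GL (Fin n) ℂ) : Matrix (Fin n) (Fin n) ℂ)
  left_inv x := by
    change x ᵥ* _ ᵥ* _ = x
    rw [Matrix.vecMul_vecMul, Units.mul_inv, Matrix.vecMul_one]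
  right_inv x := by
    change x ᵥ* _ ᵥ* _ = x
    rw [Matrix.vecMul_vecMul, Units.inv_mul, Matrix.vecMul_one]

theorem IsLinearBasis.conj {n : ℕ} {D : Set (Fin n → ℂ)} {A : Fin n → Matrix (Fin n) (Fin n) ℂ}
    (hA : IsLinearBasis D A) (P : GL (Fin n) ℂ) :
    IsLinearBasis (vecMulEquiv P '' D) (fun i =>
      ((P⁻¹ : GL (Fin n) ℂ) : Matrix (Fin n) (Fin n) ℂ) * A i *
        (P : Matrix (Fin n) (Fin n) ℂ)) := by
  let e : (Fin n → ℂ) ≃L[ℂ] (Fin n → ℂ) := (vecMulEquiv P).toContinuousLinearEquiv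
  refine ⟨fun q => ?_, ?_⟩
  · obtain ⟨p, rfl⟩ := e.surjective q
    obtain ⟨f, hf⟩ := hA.reduced p
    exact ⟨_, hf.image e⟩
  · have hδ : (fun i x => x ᵥ* (((P⁻¹ : GL (Fin n) ℂ) : Matrix (Fin n) (Fin n) ℂ) * A i *
        (P : Matrix (Fin n) (Fin n) ℂ))) = fun i y => e (e.symm y ᵥ* A i) := by
      funext i y
      rw [← Matrix.vecMul_vecMul, ← Matrix.vecMul_vecMul]
      rfl
    rw [hδ]
    exact hA.basis.image e

theorem mem_span_conj_iff {n : ℕ} {A : Fin n → Matrix (Fin n) (Fin n) ℂ} (P : GL (Fin n) ℂ)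
    (B : Matrix (Fin n) (Fin n) ℂ) :
    B ∈ Submodule.span ℂ (Set.range fun i => ((P⁻¹ : GL (Fin n) ℂ) : Matrix (Fin n) (Fin n) ℂ) *
      A i * (P : Matrix (Fin n) (Fin n) ℂ)) ↔
    (P : Matrix (Fin n) (Fin n) ℂ) * B * ((P⁻¹ : GL (Fin n) ℂ) : Matrix (Fin n) (Fin n) ℂ) ∈
      Submodule.span ℂ (Set.range A) := by
  rw [Submodule.mem_span_range_iff_exists_fun, Submodule.mem_span_range_iff_exists_fun]
  refine exists_congr fun c => ?_
  have : ∑ i, c i • (((P⁻¹ : GL (Fin n) ℂ) : Matrix (Fin n) (Fin n) ℂ) * A i *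
      (P : Matrix (Fin n) (Fin n) ℂ)) = ((P⁻¹ : GL (Fin n) ℂ) : Matrix (Fin n) (Fin n) ℂ) *
      (∑ i, c i • A i) * (P : Matrix (Fin n) (Fin n) ℂ) := by
    simp only [Matrix.mul_sum, Matrix.sum_mul, Matrix.mul_smul, Matrix.smul_mul]
  rw [this]
  constructor
  · rintro rfl
    simp only [Matrix.mul_assoc, Units.mul_inv_cancel_left, Units.mul_inv, mul_one]
  · intro h
    rw [h]
    simp only [Matrix.mul_assoc, Units.inv_mul_cancel_left, Units.inv_mul, mul_one]

theorem TableRow.isLinearBasis {n : ℕ} (r : TableRow n) : IsLinearBasis r.divisor r.basis := by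
  refine ⟨fun p => ⟨_, r.isReducedEquationAt p⟩, ?_⟩
  simp only [vecMul_basis]
  exact r.isLogarithmicBasis

/-- Both spans have dimension `n`, so they coincide, and a divisor is recovered from its span as the
zero set of a determinant. -/
theorem IsLinearBasis.eq_of_span_le {n : ℕ} {D D' : Set (Fin n → ℂ)}
    {A A' : Fin n → Matrix (Fin n) (Fin n) ℂ} (hA : IsLinearBasis D A) (hA' : IsLinearBasis D' A')
    (h : ∀ i, A' i ∈ Submodule.span ℂ (Set.range A)) : D = D' := by
  have h1 : Submodule.span ℂ (Set.range A') = Submodule.span ℂ (Set.range A) := by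
    refine Submodule.eq_of_le_of_finrank_eq (Submodule.span_le.2 (Set.range_subset_iff.2 h)) ?_
    rw [hA.finrank_span, hA'.finrank_span]
  ext x
  rw [(hA.of_span_eq h1).mem_iff, hA'.mem_iff]

/-- A linear free divisor whose Lie algebra takes the form of that of a row of the table in
suitable coordinates is linearly isomorphic to the divisor of that row. -/
theorem IsLinearBasis.linearlyIsomorphic {n : ℕ} {D : Set (Fin n → ℂ)}
    {A : Fin n → Matrix (Fin n) (Fin n) ℂ} (hA : IsLinearBasis D A) (r : TableRow n)
    (P : GL (Fin n) ℂ)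
    (h : ∀ i, ∃ B ∈ Submodule.span ℂ (Set.range A),
      (P : Matrix (Fin n) (Fin n) ℂ) * r.basis i = B * (P : Matrix (Fin n) (Fin n) ℂ)) :
    LinearlyIsomorphic D r.divisor := by
  refine ⟨vecMulEquiv P, (hA.conj P).eq_of_span_le r.isLinearBasis fun i => ?_⟩
  obtain ⟨B, hB, hPB⟩ := h i
  rw [mem_span_conj_iff, hPB, Matrix.mul_assoc, Units.mul_inv, mul_one]
  exact hB

/-! ### The diagonalizable parts of elements of the Lie algebra -/

section Derivations

variable {n : ℕ}

open MvPolynomial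

/-- The linear form with the given column of coefficients. -/
noncomputable def linearForm (B : Matrix (Fin n) (Fin n) ℂ) (j : Fin n) : MvPolynomial (Fin n) ℂ :=
  ∑ k, B k j • X k

theorem eval_linearForm (B : Matrix (Fin n) (Fin n) ℂ) (j : Fin n) (x : Fin n → ℂ) :
    eval x (linearForm B j) = (x ᵥ* B) j := by
  simp only [linearForm, map_sum, smul_eval, eval_X, Matrix.vecMul, dotProduct]
  exact Finset.sum_congr rfl fun i _ => mul_comm _ _

/-- The derivation of the polynomial ring given by a linear vector field. -/
noncomputable def linearDerivation (B : Matrix (Fin n) (Fin n) ℂ) :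
    Derivation ℂ (MvPolynomial (Fin n) ℂ) (MvPolynomial (Fin n) ℂ) :=
  mkDerivation ℂ (linearForm B)

theorem linearDerivation_X (B : Matrix (Fin n) (Fin n) ℂ) (j : Fin n) :
    linearDerivation B (X j) = linearForm B j := mkDerivation_X _ _ _

theorem linearDerivation_linearForm (B C : Matrix (Fin n) (Fin n) ℂ) (j : Fin n) :
    linearDerivation B (linearForm C j) = linearForm (B * C) j := by
  simp only [linearForm, map_sum, Derivation.map_smul, linearDerivation_X, Matrix.mul_apply, Finset.sum_smul,
    Finset.smul_sum, smul_smul]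
  rw [Finset.sum_comm]
  exact Finset.sum_congr rfl fun i _ => Finset.sum_congr rfl fun k _ => by rw [mul_comm]

theorem eval_linearDerivation (B : Matrix (Fin n) (Fin n) ℂ) (q : MvPolynomial (Fin n) ℂ)
    (x : Fin n → ℂ) :
    eval x (linearDerivation B q) = fderiv ℂ (fun x => eval x q) x (x ᵥ* B) := by
  have h : linearDerivation B q = ∑ i, linearForm B i * pderiv i q := by
    let E : Derivation ℂ (MvPolynomial (Fin n) ℂ) (MvPolynomial (Fin n) ℂ) :=
      ∑ i, linearForm B i • pderiv i
    have hE : ∀ q, E q = ∑ i, linearForm B i * pderiv i q := by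
      intro q
      have := congrFun (map_sum (Derivation.coeFnAddMonoidHom (R := ℂ)
        (A := MvPolynomial (Fin n) ℂ) (M := MvPolynomial (Fin n) ℂ))
        (fun i => linearForm B i • pderiv i) Finset.univ) q
      rw [Finset.sum_apply] at this
      exact this
    have hBE : linearDerivation B = E := by
      refine MvPolynomial.derivation_ext fun j => ?_
      rw [linearDerivation_X, hE]
      simp [pderiv_X, Pi.single_apply]
    rw [hBE, hE]
  rw [MvPolynomial.fderiv_eval_apply, h, map_sum]
  refine Finset.sum_congr rfl fun i _ => ?_
  rw [map_mul, eval_linearForm]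

theorem commute_linearDerivation {B C : Matrix (Fin n) (Fin n) ℂ} (h : Commute B C) :
    Commute (linearDerivation B).toLinearMap (linearDerivation C).toLinearMap := by
  refine LinearMap.ext fun q => ?_
  change linearDerivation B (linearDerivation C q) = linearDerivation C (linearDerivation B q)
  induction q using MvPolynomial.induction_on with
  | C a => simp only [MvPolynomial.derivation_C, map_zero]
  | add p q hp hq => rw [map_add, map_add, map_add, map_add, hp, hq]
  | mul_X p i hp =>
    simp only [Derivation.leibniz, map_add, smul_eq_mul, linearDerivation_X,
      linearDerivation_linearForm, hp, h.eq]
    ring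

/-- After `k + l` applications of the Leibniz rule, each term has differentiated the first factor at
least `k` times or the second at least `l` times. -/
theorem Derivation.iterate_mul_eq_zero {R A : Type*} [CommRing R] [CommRing A] [Algebra R A]
    (δ : Derivation R A A) (k l : ℕ) {a b : A} (ha : δ^[k] a = 0) (hb : δ^[l] b = 0) :
    δ^[k + l] (a * b) = 0 := by
  have h0 : ∀ m, δ^[m] 0 = 0 := fun m => Function.iterate_fixed (map_zero δ) m
  have hadd : ∀ m (a b : A), δ^[m] (a + b) = δ^[m] a + δ^[m] b := by
    intro m
    induction m with
    | zero => intro a b; rfl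
    | succ m ih => intro a b; simp only [Function.iterate_succ, Function.comp_apply, map_add, ih]
  induction k generalizing l a b with
  | zero =>
    rw [Function.iterate_zero, id] at ha
    rw [ha, zero_mul, h0]
  | succ k ih =>
    induction l generalizing a b with
    | zero =>
      rw [Function.iterate_zero, id] at hb
      rw [hb, mul_zero, h0]
    | succ l ih' =>
      rw [← add_assoc, Function.iterate_succ, Function.comp_apply, Derivation.leibniz, hadd,
        smul_eq_mul, smul_eq_mul, ih' ha hb, mul_comm b]
      rw [show k + 1 + l = k + (l + 1) by ring, ih (l + 1) ha hb, add_zero]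

/-- The derivation is nilpotent on linear forms, and local nilpotency passes to sums and products.
-/
theorem exists_iterate_linearDerivation_eq_zero {N : Matrix (Fin n) (Fin n) ℂ}
    (hN : IsNilpotent N) (q : MvPolynomial (Fin n) ℂ) : ∃ k, (linearDerivation N)^[k] q = 0 := by
  have h0 : ∀ m, (linearDerivation N)^[m] 0 = 0 := fun m => Function.iterate_fixed (map_zero _) m
  have hmono : ∀ {k l : ℕ} {q}, k ≤ l → (linearDerivation N)^[k] q = 0 →
      (linearDerivation N)^[l] q = 0 := by
    intro k l q hkl h
    rw [← Nat.sub_add_cancel hkl, Function.iterate_add_apply, h, h0]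
  have hadd : ∀ m (a b : MvPolynomial (Fin n) ℂ), (linearDerivation N)^[m] (a + b) =
      (linearDerivation N)^[m] a + (linearDerivation N)^[m] b := by
    intro m
    induction m with
    | zero => intro a b; rfl
    | succ m ih => intro a b; simp only [Function.iterate_succ, Function.comp_apply, map_add, ih]
  induction q using MvPolynomial.induction_on with
  | C a => exact ⟨1, by simp⟩
  | add p q hp hq =>
    obtain ⟨k, hk⟩ := hp
    obtain ⟨l, hl⟩ := hq
    refine ⟨k + l, ?_⟩
    rw [hadd, hmono (Nat.le_add_right k l) hk, hmono (Nat.le_add_left l k) hl, add_zero]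
  | mul_X p i hp =>
    obtain ⟨k, hk⟩ := hp
    obtain ⟨l, hl⟩ := hN
    have hX : ∀ m, (linearDerivation N)^[m] (X i) = linearForm (N ^ m) i := by
      intro m
      induction m with
      | zero => simp [linearForm, Matrix.one_apply]
      | succ m ih =>
        rw [Function.iterate_succ_apply', ih, linearDerivation_linearForm, pow_succ']
    refine ⟨k + l, Derivation.iterate_mul_eq_zero _ k l hk ?_⟩
    rw [hX, hl]
    simp [linearForm]

theorem coeff_linearDerivation_diagonal (d : Fin n → ℂ) (q : MvPolynomial (Fin n) ℂ)
    (m : Fin n →₀ ℕ) : coeff m (linearDerivation (Matrix.diagonal d) q) =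
      (∑ i, m i * d i) * coeff m q := by
  induction q using MvPolynomial.induction_on' with
  | monomial u a =>
    have h1 : linearDerivation (Matrix.diagonal d) (monomial u a) =
        monomial u ((∑ i, u i * d i) * a) := by
      rw [linearDerivation, mkDerivation_monomial, Finsupp.sum_fintype _ _ (by simp)]
      have h2 : ∀ i, linearForm (Matrix.diagonal d) i = d i • X i := by
        intro i
        simp [linearForm, Matrix.diagonal_apply]
      simp only [h2, smul_eq_mul]
      rw [Finset.smul_sum, Finset.sum_mul, map_sum]
      refine Finset.sum_congr rfl fun i _ => ?_
      by_cases hi : u i = 0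
      · simp [hi]
      · rw [mul_smul_comm, X, monomial_mul, smul_monomial, smul_monomial,
          tsub_add_cancel_of_le (Finsupp.single_le_iff.2 (Nat.one_le_iff_ne_zero.2 hi))]
        congr 1
        simp only [smul_eq_mul]
        ring
    rw [h1, coeff_monomial, coeff_monomial]
    split_ifs with h
    · rw [h]
    · simp
  | add p q hp hq => rw [map_add, coeff_add, coeff_add, hp, hq]; ring

/-- If a polynomial is an eigenvector of `diag(d) + N` with `N` nilpotent and commuting with
`diag(d)`, then it is an eigenvector of `diag(d)`. -/
theorem linearDerivation_diagonal_eq_smul {d : Fin n → ℂ} {N : Matrix (Fin n) (Fin n) ℂ}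
    (hN : IsNilpotent N) (hd : Commute (Matrix.diagonal d) N) {q : MvPolynomial (Fin n) ℂ} {c : ℂ}
    (h : linearDerivation (Matrix.diagonal d + N) q = c • q) :
    linearDerivation (Matrix.diagonal d) q = c • q := by
  set S : Module.End ℂ (MvPolynomial (Fin n) ℂ) :=
    (linearDerivation (Matrix.diagonal d)).toLinearMap - c • 1 with hS
  set T : Module.End ℂ (MvPolynomial (Fin n) ℂ) := (linearDerivation N).toLinearMap with hT
  have hST : Commute S T := (commute_linearDerivation hd).sub_left
    ((Commute.one_left T).smul_left c)
  -- On `q` the operators `S` and `-T` agree; since they commute, so do their powers, and `T` is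
  -- locally nilpotent. Hence some power of `S` kills `q`.
  have hq : S q = (-T) q := by
    have h1 : linearDerivation (Matrix.diagonal d + N) q =
        linearDerivation (Matrix.diagonal d) q + linearDerivation N q := by
      have : linearDerivation (Matrix.diagonal d + N) =
          linearDerivation (Matrix.diagonal d) + linearDerivation N := by
        refine MvPolynomial.derivation_ext fun j => ?_
        simp [linearDerivation_X, linearForm, add_smul, Finset.sum_add_distrib]
      rw [this]; rfl
    rw [h1] at h
    change linearDerivation (Matrix.diagonal d) q - c • q = - linearDerivation N q
    rw [← h]; abel
  have hpow : ∀ k, (S ^ k) q = ((-T) ^ k) q := by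
    intro k
    induction k with
    | zero => rfl
    | succ k ih =>
      rw [pow_succ, Module.End.mul_apply, hq, ← Module.End.mul_apply,
        ((hST.neg_right).pow_left k).eq, Module.End.mul_apply, ih, ← Module.End.mul_apply, pow_succ']
  obtain ⟨k, hk⟩ := exists_iterate_linearDerivation_eq_zero hN q
  have hk0 : (S ^ k) q = 0 := by
    have hTk : (T ^ k) q = 0 := by rw [Module.End.pow_apply]; exact hk
    rw [hpow]
    have hneg : (-T) ^ k = (-1) ^ k * T ^ k := neg_pow T k
    rw [hneg, Module.End.mul_apply, hTk, map_zero]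
  -- Monomials are eigenvectors of `S`, so a power of `S` can kill `q` only if `S` does.
  have hcoeff : ∀ k m, coeff m ((S ^ k) q) = (∑ i, m i * d i - c) ^ k * coeff m q := by
    intro k m
    induction k with
    | zero => simp
    | succ k ih =>
      rw [pow_succ', Module.End.mul_apply]
      change coeff m (linearDerivation (Matrix.diagonal d) ((S ^ k) q) - c • (S ^ k) q) = _
      rw [coeff_sub, coeff_smul, coeff_linearDerivation_diagonal, ih, smul_eq_mul]
      ring
  ext m
  have h2 := hcoeff k m
  rw [hk0, coeff_zero, eq_comm, mul_eq_zero] at h2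
  rw [coeff_linearDerivation_diagonal, coeff_smul, smul_eq_mul]
  rcases h2 with h2 | h2
  · rw [sub_eq_zero.1 (eq_zero_of_pow_eq_zero h2)]
  · rw [h2, mul_zero, mul_zero]

end Derivations

theorem exists_eval_eq_saitoDet {n : ℕ} (A : Fin n → Matrix (Fin n) (Fin n) ℂ) :
    ∃ q : MvPolynomial (Fin n) ℂ, ∀ x, MvPolynomial.eval x q = saitoDet A x := by
  refine ⟨(Matrix.of fun i j => linearForm (A i) j).det, fun x => ?_⟩
  rw [RingHom.map_det, saitoDet]
  congr 1
  ext i j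
  exact eval_linearForm _ _ _

/-- The determinant is an eigenvector of the element, hence of its semisimple part with the same
eigenvalue; and every linear field with this property belongs to the Lie algebra. -/
theorem IsLinearBasis.diagonal_mem {n : ℕ} {D : Set (Fin n → ℂ)}
    {A : Fin n → Matrix (Fin n) (Fin n) ℂ} (hA : IsLinearBasis D A) {d : Fin n → ℂ}
    {N : Matrix (Fin n) (Fin n) ℂ} (hN : IsNilpotent N) (hd : Commute (Matrix.diagonal d) N)
    (h : Matrix.diagonal d + N ∈ Submodule.span ℂ (Set.range A)) :
    Matrix.diagonal d ∈ Submodule.span ℂ (Set.range A) := by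
  obtain ⟨q, hq⟩ := exists_eval_eq_saitoDet A
  have hq' : (fun x => MvPolynomial.eval x q) = saitoDet A := funext hq
  obtain ⟨c, hc⟩ := hA.exists_fderiv_saitoDet_eq h
  have h1 : linearDerivation (Matrix.diagonal d + N) q = c • q := by
    refine MvPolynomial.funext fun x => ?_
    rw [eval_linearDerivation, hq', hc, MvPolynomial.smul_eval, hq]
  refine hA.mem_of_fderiv_eq (c := c) fun x => ?_
  rw [← hq', ← eval_linearDerivation, linearDerivation_diagonal_eq_smul hN hd h1,
    MvPolynomial.smul_eval]

/-! ### The Saito determinant of a linear free divisor is reduced -/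

/-- With `g` the partial derivatives of `f`, the rows are the obvious logarithmic fields `f ∂ⱼ` and
`(∂ⱼf) ∂ₖ - (∂ₖf) ∂ⱼ`; the matrix is block triangular with a scalar block. -/
theorem Matrix.det_ite_row {n : ℕ} (j : Fin n) (f : ℂ) (g : Fin n → ℂ) :
    (Matrix.of fun k l : Fin n => if k = j then (if l = j then f else 0) else
      if l = k then g j else if l = j then -g k else 0).det = f * g j ^ (n - 1) := by
  rw [Matrix.twoBlockTriangular_det' _ (fun i => i = j)]
  · have h2 : (Matrix.toSquareBlockProp (Matrix.of fun k l : Fin n =>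
        if k = j then (if l = j then f else 0) else
        if l = k then g j else if l = j then -g k else 0) fun i => ¬ i = j) = g j • 1 := by
      ext k l
      have hk := k.2
      have hl := l.2
      simp [Matrix.toSquareBlockProp, Matrix.one_apply, hk, hl, Subtype.ext_iff, eq_comm (a := l.1)]
    rw [h2, Matrix.det_smul, Matrix.det_one]
    refine (congrArg (· * _) (@Matrix.det_eq_elem_of_card_eq_one _ (_) (_) _ _ _ ?_ ⟨j, rfl⟩)).trans ?_
    · exact (@Fintype.card_eq_one_iff _ (_)).2 ⟨⟨j, rfl⟩, fun y => Subtype.ext y.2⟩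
    · simp [Matrix.toSquareBlockProp]
  · intro k hk l hl
    simp [hk, hl]

theorem fderiv_eq_zero_of_forall_single {n : ℕ} {L : (Fin n → ℂ) →L[ℂ] ℂ}
    (h : ∀ j, L (Pi.single j 1) = 0) (v : Fin n → ℂ) : L v = 0 := by
  have h3 : v = ∑ j, v j • (Pi.single j (1 : ℂ) : Fin n → ℂ) := by
    funext k
    simp [Finset.sum_apply, Pi.single_apply]
  rw [h3, map_sum]
  exact Finset.sum_eq_zero fun j _ => by rw [map_smul, h, smul_zero]

namespace IsLinearBasis

variable {n : ℕ} {D : Set (Fin n → ℂ)} {A : Fin n → Matrix (Fin n) (Fin n) ℂ} {p : Fin n → ℂ}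

/-- The obvious fields `f ∂ⱼ` and `(∂ⱼf) ∂ₖ - (∂ₖf) ∂ⱼ` are combinations of the basis, so their
determinant `f (∂ⱼf)ⁿ⁻¹` is a multiple of `h f`, and `f` cancels. The use of this is that `df`
vanishes wherever the superfluous factor `h` does. -/
theorem exists_partial_pow_eq_mul (hA : IsLinearBasis D A) {f h : (Fin n → ℂ) → ℂ}
    (hf : IsReducedEquationAt D p f) (hh : AnalyticAt ℂ h p)
    (hF : ∀ᶠ x in 𝓝 p, saitoDet A x = h x * f x) (j : Fin n) :
    ∃ c : (Fin n → ℂ) → ℂ,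
      ∀ᶠ x in 𝓝 p, fderiv ℂ f x (Pi.single j 1) ^ (n - 1) = c x * h x := by
  set g : Fin n → (Fin n → ℂ) → ℂ := fun k x => fderiv ℂ f x (Pi.single k 1) with hg
  have hga : ∀ k, AnalyticAt ℂ (g k) p := fun k => hf.1.fderiv_apply analyticAt_const
  set V : (Fin n → ℂ) → Matrix (Fin n) (Fin n) ℂ := fun x => Matrix.of fun k l =>
    if k = j then (if l = j then f x else 0) else
      if l = k then g j x else if l = j then -g k x else 0 with hV
  have hrow : ∀ k x, V x k = if k = j then f x • (Pi.single j 1 : Fin n → ℂ) else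
      g j x • (Pi.single k 1 : Fin n → ℂ) - g k x • (Pi.single j 1 : Fin n → ℂ) := by
    intro k x
    funext l
    by_cases hk : k = j
    · simp [hV, hk, Pi.single_apply]
    · by_cases hl : l = k
      · subst hl
        simp [hV, hk]
      · by_cases hl' : l = j
        · subst hl'
          simp [hV, hk, hl]
        · simp [hV, hk, hl, hl']
  have hlog : ∀ k, IsLogarithmicAt D p (fun x => V x k) := by
    intro k
    simp only [hrow]
    by_cases hk : k = j
    · simp only [hk, if_true]
      refine hf.isLogarithmicAt (hf.1.smul analyticAt_const) ⟨g j, hga j, ?_⟩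
      refine Eventually.of_forall fun x => ?_
      rw [map_smul, smul_eq_mul, mul_comm]
    · simp only [hk, if_false]
      refine hf.isLogarithmicAt (((hga j).smul analyticAt_const).sub
        ((hga k).smul analyticAt_const)) ⟨fun _ => 0, analyticAt_const, ?_⟩
      refine Eventually.of_forall fun x => ?_
      rw [map_sub, map_smul, map_smul, smul_eq_mul, smul_eq_mul]
      simp only [hg]
      ring
  choose c hc hcV using fun k => (hA.basis p).2.1 _ (hlog k)
  have hca : AnalyticAt ℂ (fun x => (Matrix.of fun k i => c k i x).det) p :=
    AnalyticAt.matrix_det fun k i => hc k i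
  refine ⟨fun x => (Matrix.of fun k i => c k i x).det, ?_⟩
  have key : ∀ᶠ x in 𝓝 p, f x * (g j x ^ (n - 1) -
      (Matrix.of fun k i => c k i x).det * h x) = 0 := by
    filter_upwards [eventually_all.2 hcV, hF] with x hx hFx
    have h1 : V x = (Matrix.of fun k i => c k i x) * Matrix.of fun i => x ᵥ* A i := by
      ext k l
      have := congrFun (hx k) l
      simp only [Finset.sum_apply, Pi.smul_apply, smul_eq_mul] at this
      rw [this, Matrix.mul_apply]
      rfl
    have h2 := congrArg Matrix.det h1
    rw [Matrix.det_mul, hV, Matrix.det_ite_row j (f x) (fun k => g k x)] at h2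
    change _ = _ * saitoDet A x at h2
    rw [hFx] at h2
    linear_combination h2
  filter_upwards [eventually_eq_zero_of_mul_eq_zero hf.1
    (((hga j).pow _).sub (hca.mul hh)) hf.2.2.1 key] with x hx
  exact sub_eq_zero.1 hx

/-- The Saito determinant of a linear free divisor is not divisible by the square of a reduced
germ vanishing at the point with nonzero differential. -/
theorem not_eventually_eq_sq_mul (hA : IsLinearBasis D A) {q k : (Fin n → ℂ) → ℂ}
    (hq : IsReducedEquationAt {x | q x = 0} p q) (hqp : q p = 0) {w : Fin n → ℂ}
    (hdq : fderiv ℂ q p w ≠ 0) (hk : AnalyticAt ℂ k p) :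
    ¬ ∀ᶠ x in 𝓝 p, saitoDet A x = q x ^ 2 * k x := by
  intro hsq
  obtain ⟨f, hf⟩ := hA.reduced p
  obtain ⟨h, hh, hhf⟩ := hf.2.2.2 _ (analyticAt_saitoDet A p)
    (Eventually.of_forall fun x hx => (hA.mem_iff x).1 hx)
  obtain ⟨a, ha, haq⟩ := hq.2.2.2 f hf.1 (by
    filter_upwards [hf.2.1, hsq] with x h1 h2 hx
    have hx' : q x = 0 := hx
    rw [hx'] at h2
    exact h1.1 ((hA.mem_iff x).2 (by simpa using h2)))
  -- The determinant is `h f` and `f = a q`; equating with `q² k` and cancelling `q` gives `h a = q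
  -- k`.
  have hhak : ∀ᶠ x in 𝓝 p, h x * a x - q x * k x = 0 := by
    refine eventually_eq_zero_of_mul_eq_zero hq.1 ((hh.mul ha).sub (hq.1.mul hk)) hq.2.2.1 ?_
    filter_upwards [hsq, hhf, haq] with x h1 h2 h3
    rw [h3, h1] at h2
    linear_combination -h2
  choose c hc using fun j => hA.exists_partial_pow_eq_mul hf hh hhf j
  -- On `q = 0` one has `df = a dq`, and `h a = 0`. If `h = 0`, the previous lemma gives `df = 0`;
  -- if `a = 0`, this is clear.
  have hdf : ∀ᶠ x in 𝓝 p, q x = 0 → ∀ v, fderiv ℂ f x v = a x * fderiv ℂ q x v ∧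
      fderiv ℂ f x v = 0 := by
    have hlin : ∀ᶠ x in 𝓝 p, ∀ v, fderiv ℂ f x v = a x * fderiv ℂ q x v + q x * fderiv ℂ a x v := by
      have h1 : ∀ j, ∀ᶠ x in 𝓝 p, fderiv ℂ f x (Pi.single j 1) =
          a x * fderiv ℂ q x (Pi.single j 1) + q x * fderiv ℂ a x (Pi.single j 1) := fun j =>
        Filter.Eventually.fderiv_apply_eq_of_eq_mul (v := fun _ => Pi.single j 1) ha hq.1 haq
      filter_upwards [eventually_all.2 h1] with x hx v
      have := fderiv_eq_zero_of_forall_single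
        (L := fderiv ℂ f x - (a x • fderiv ℂ q x + q x • fderiv ℂ a x)) (fun j => by
          simpa [sub_eq_zero] using hx j) v
      simpa [sub_eq_zero] using this
    filter_upwards [hlin, hhak, eventually_all.2 hc] with x h1 h2 h3 hqx v
    have h4 := h1 v
    rw [hqx, zero_mul, add_zero] at h4
    refine ⟨h4, ?_⟩
    rw [hqx, zero_mul, sub_zero, mul_eq_zero] at h2
    rcases h2 with h2 | h2
    · refine fderiv_eq_zero_of_forall_single (fun j => ?_) v
      have := h3 j
      rw [h2, mul_zero] at this
      exact eq_zero_of_pow_eq_zero this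
    · rw [h4, h2, zero_mul]
  have hdqc : ∀ᶠ x in 𝓝 p, fderiv ℂ q x w ≠ 0 :=
    (hq.1.fderiv_apply (v := fun _ => w) analyticAt_const).continuousAt.eventually_ne hdq
  -- Since `dq ≠ 0`, the factor `a` vanishes on `q = 0`, so `q` divides it.
  obtain ⟨b, hb, hbq⟩ := hq.2.2.2 a ha (by
    filter_upwards [hdf, hdqc] with x h1 h2 hx
    obtain ⟨h3, h4⟩ := h1 hx w
    rw [h4] at h3
    exact (mul_eq_zero.1 h3.symm).resolve_right h2)
  -- Now `f = b q²` while `a = b q` vanishes on D, so `f` divides `a`. From `a = e f = e q a` and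
  -- `q(p) = 0` it follows that `a`, hence `f`, is zero near `p`: a contradiction.
  obtain ⟨e, he, hef⟩ := hf.2.2.2 a ha (by
    filter_upwards [hf.2.1, haq, hbq] with x h1 h2 h3 hx
    have h4 := h1.1 hx
    rw [h2, mul_eq_zero] at h4
    rcases h4 with h4 | h4
    · exact h4
    · rw [h3, h4, mul_zero])
  have hunit : ∀ᶠ x in 𝓝 p, 1 - e x * q x ≠ 0 := by
    refine ((analyticAt_const.sub (he.mul hq.1)).continuousAt).eventually_ne ?_
    simp [hqp]
  refine hf.2.2.1 ?_
  filter_upwards [hunit, hef, haq] with x h1 h2 h3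
  have h4 : (1 - e x * q x) * a x = 0 := by
    rw [h3] at h2
    linear_combination h2
  rw [h3, (mul_eq_zero.1 h4).resolve_left h1, zero_mul]

end IsLinearBasis

/-! ### Lie's theorem -/

/-- Modules over solvable Lie algebras have triangularizing bases. -/
theorem LieModule.exists_basis_lie_mem_span (L : Type) [LieRing L] [LieAlgebra ℂ L]
    [LieAlgebra.IsSolvable L] (n : ℕ) (V : Type) [AddCommGroup V] [Module ℂ V]
    [FiniteDimensional ℂ V] [LieRingModule L V] [LieModule ℂ L V] (hn : Module.finrank ℂ V = n) :
    ∃ b : Module.Basis (Fin n) ℂ V, ∀ (x : L) (i : Fin n),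
      ⁅x, b i⁆ ∈ Submodule.span ℂ (b '' Set.Iic i) := by
  induction n generalizing V with
  | zero => exact ⟨Module.finBasisOfFinrankEq ℂ V hn, fun x i => i.elim0⟩
  | succ n ih =>
    have : Nontrivial V := Module.nontrivial_of_finrank_pos (R := ℂ) (by omega)
    have hdual : Nontrivial (V →ₗ[ℂ] ℂ) := by
      change Nontrivial (Module.Dual ℂ V)
      infer_instance
    -- A weight vector of the dual module has an invariant hyperplane as kernel. Induction applies
    -- to it, and any vector outside it can be appended as the last basis vector.
    obtain ⟨χ, hχ⟩ := LieModule.exists_nontrivial_weightSpace_of_isSolvable ℂ L (V →ₗ[ℂ] ℂ)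
    obtain ⟨⟨φ, hφ⟩, hφ0⟩ := exists_ne (0 : LieModule.weightSpace (V →ₗ[ℂ] ℂ) χ)
    have hφ0' : φ ≠ 0 := fun h => hφ0 (Subtype.ext h)
    rw [LieModule.mem_weightSpace] at hφ
    let N : LieSubmodule ℂ L V :=
      { LinearMap.ker φ with
        lie_mem := by
          intro x m hm
          have hm' : φ m = 0 := hm
          have h1 := congrArg (fun ψ : V →ₗ[ℂ] ℂ => ψ m) (hφ x)
          have h2 : -φ ⁅x, m⁆ = χ x * φ m := h1
          rw [hm', mul_zero, neg_eq_zero] at h2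
          exact h2 }
    have hN : Module.finrank ℂ N = n := by
      have h1 := Module.Dual.finrank_ker_add_one_of_ne_zero (f := φ) hφ0'
      rw [hn] at h1
      exact Nat.succ_injective h1
    obtain ⟨b, hb⟩ := ih N hN
    obtain ⟨y, hy⟩ : ∃ y, φ y ≠ 0 := by
      by_contra! h
      exact hφ0' (LinearMap.ext h)
    let b' : Module.Basis (Fin n) ℂ (N : Submodule ℂ V) := b
    let c : Module.Basis (Fin (n + 1)) ℂ V := Module.Basis.mkFinSnoc b' y (by
        intro c x hx h
        have hx' : φ x = 0 := hx
        have h1 := congrArg φ h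
        simp only [map_add, map_smul, hx', add_zero, smul_eq_mul, map_zero, mul_eq_zero] at h1
        exact h1.resolve_right hy) (by
        intro z
        refine ⟨-(φ z / φ y), ?_⟩
        change φ _ = 0
        simp [hy])
    have hc : (c : Fin (n + 1) → V) = Fin.snoc (fun i => (b i : V)) y :=
      Module.Basis.coe_mkFinSnoc _ _ _ _
    refine ⟨c, fun x i => ?_⟩
    induction i using Fin.lastCases with
    | last =>
      have : c '' Set.Iic (Fin.last n) = Set.range c := by
        rw [show Set.Iic (Fin.last n) = Set.univ from Set.eq_univ_of_forall fun i => Fin.le_last i,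
          Set.image_univ]
      rw [this, c.span_eq]
      trivial
    | cast i =>
      have h1 := Submodule.mem_map_of_mem (f := (N : Submodule ℂ V).subtype) (hb x i)
      rw [Submodule.map_span, ← Set.image_comp] at h1
      have h2 : ⁅x, c i.castSucc⁆ = ((⁅x, b i⁆ : N) : V) := by
        rw [hc, Fin.snoc_castSucc]; rfl
      rw [h2]
      refine Submodule.span_mono ?_ h1
      rintro _ ⟨j, hj, rfl⟩
      refine ⟨j.castSucc, Fin.castSucc_le_castSucc_iff.2 hj, ?_⟩
      rw [hc, Fin.snoc_castSucc]; rfl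

/-- The linear logarithmic vector fields of a linear free divisor as a Lie algebra of linear
endomorphisms. -/
def IsLinearBasis.lieSubalgebra {n : ℕ} {D : Set (Fin n → ℂ)}
    {A : Fin n → Matrix (Fin n) (Fin n) ℂ} (hA : IsLinearBasis D A) :
    LieSubalgebra ℂ (Module.End ℂ (Fin n → ℂ)) :=
  { (Submodule.span ℂ (Set.range A)).comap
      (LinearMap.toMatrix' : ((Fin n → ℂ) →ₗ[ℂ] (Fin n → ℂ)) ≃ₗ[ℂ] _).toLinearMap with
    lie_mem' := by
      intro f g hf hg
      have := hA.commutator_mem (B := LinearMap.toMatrix' f) (C := LinearMap.toMatrix' g) hf hg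
      change LinearMap.toMatrix' (f * g - g * f) ∈ Submodule.span ℂ (Set.range A)
      rwa [map_sub, LinearMap.toMatrix'_mul, LinearMap.toMatrix'_mul] }

theorem IsLinearBasis.mem_lieSubalgebra {n : ℕ} {D : Set (Fin n → ℂ)}
    {A : Fin n → Matrix (Fin n) (Fin n) ℂ} (hA : IsLinearBasis D A)
    (f : Module.End ℂ (Fin n → ℂ)) :
    f ∈ hA.lieSubalgebra ↔ LinearMap.toMatrix' f ∈ Submodule.span ℂ (Set.range A) := Iff.rfl

/-- The matrix whose columns are the vectors of a basis. -/
noncomputable def Module.Basis.toGL {n : ℕ} (b : Module.Basis (Fin n) ℂ (Fin n → ℂ)) :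
    GL (Fin n) ℂ where
  val := (Pi.basisFun ℂ (Fin n)).toMatrix b
  inv := b.toMatrix (Pi.basisFun ℂ (Fin n))
  val_inv := Module.Basis.toMatrix_mul_toMatrix_flip _ _
  inv_val := Module.Basis.toMatrix_mul_toMatrix_flip _ _

theorem Module.Basis.toGL_conj {n : ℕ} (b : Module.Basis (Fin n) ℂ (Fin n → ℂ))
    (B : Matrix (Fin n) (Fin n) ℂ) :
    ((b.toGL⁻¹ : GL (Fin n) ℂ) : Matrix (Fin n) (Fin n) ℂ) * B *
      (b.toGL : Matrix (Fin n) (Fin n) ℂ) = LinearMap.toMatrix b b (Matrix.toLin' B) := by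
  change b.toMatrix (Pi.basisFun ℂ (Fin n)) * B * (Pi.basisFun ℂ (Fin n)).toMatrix b = _
  have h := basis_toMatrix_mul_linearMap_toMatrix_mul_basis_toMatrix b (Pi.basisFun ℂ (Fin n)) b
    (Pi.basisFun ℂ (Fin n)) (Matrix.toLin' B)
  rwa [LinearMap.toMatrix_eq_toMatrix', LinearMap.toMatrix'_toLin'] at h

/-- Lie's theorem for the tautological representation on ℂⁿ. -/
theorem IsLinearBasis.exists_conj_blockTriangular {n : ℕ} {D : Set (Fin n → ℂ)}
    {A : Fin n → Matrix (Fin n) (Fin n) ℂ} (hA : IsLinearBasis D A)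
    (hsol : LieAlgebra.IsSolvable hA.lieSubalgebra) :
    ∃ P : GL (Fin n) ℂ, ∀ B ∈ Submodule.span ℂ (Set.range fun i =>
      ((P⁻¹ : GL (Fin n) ℂ) : Matrix (Fin n) (Fin n) ℂ) * A i * (P : Matrix (Fin n) (Fin n) ℂ)),
      B.BlockTriangular id := by
  obtain ⟨b, hb⟩ := LieModule.exists_basis_lie_mem_span hA.lieSubalgebra n (Fin n → ℂ) (by simp)
  refine ⟨b.toGL, fun B hB => ?_⟩
  rw [mem_span_conj_iff] at hB
  set C := (b.toGL : Matrix (Fin n) (Fin n) ℂ) * B *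
    ((b.toGL⁻¹ : GL (Fin n) ℂ) : Matrix (Fin n) (Fin n) ℂ) with hC
  have hBC : B = LinearMap.toMatrix b b (Matrix.toLin' C) := by
    rw [← Module.Basis.toGL_conj, hC]
    simp only [Matrix.mul_assoc, Units.inv_mul_cancel_left, Units.inv_mul, mul_one]
  intro i j hij
  have h1 := hb ⟨Matrix.toLin' C, by rw [hA.mem_lieSubalgebra, LinearMap.toMatrix'_toLin']; exact hB⟩ j
  rw [Module.Basis.mem_span_image] at h1
  rw [hBC, LinearMap.toMatrix_apply]
  by_contra h0
  have h2 : i ∈ Set.Iic j := h1 (Finsupp.mem_support_iff.2 h0)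
  exact absurd h2 (not_le.2 hij)

/-! ### The diagonal part of a triangular Lie algebra -/

section Triangular

variable {n : ℕ}

theorem Matrix.BlockTriangular.mul_diag {M N : Matrix (Fin n) (Fin n) ℂ}
    (hM : M.BlockTriangular id) (hN : N.BlockTriangular id) (i : Fin n) :
    (M * N) i i = M i i * N i i := by
  rw [Matrix.mul_apply]
  refine Finset.sum_eq_single i (fun j _ hj => ?_) (by simp)
  rcases lt_or_gt_of_ne hj with h | h
  · rw [hM h, zero_mul]
  · rw [hN h, mul_zero]

theorem Matrix.BlockTriangular.aeval {M : Matrix (Fin n) (Fin n) ℂ} (hM : M.BlockTriangular id)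
    (p : Polynomial ℂ) : (Polynomial.aeval M p).BlockTriangular id ∧
      ∀ i, Polynomial.aeval M p i i = p.eval (M i i) := by
  induction p using Polynomial.induction_on with
  | C a =>
    rw [Polynomial.aeval_C, Matrix.algebraMap_eq_diagonal]
    exact ⟨Matrix.blockTriangular_diagonal _, by simp⟩
  | add p q hp hq =>
    rw [map_add]
    exact ⟨hp.1.add hq.1, fun i => by rw [Matrix.add_apply, hp.2, hq.2, Polynomial.eval_add]⟩
  | monomial m a h =>
    have h1 : Polynomial.aeval M (Polynomial.C a * Polynomial.X ^ (m + 1)) =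
        Polynomial.aeval M (Polynomial.C a * Polynomial.X ^ m) * M := by
      rw [pow_succ, ← mul_assoc, map_mul, Polynomial.aeval_X]
    rw [h1]
    refine ⟨h.1.mul hM, fun i => ?_⟩
    rw [h.1.mul_diag hM, h.2]
    simp
    ring

/-- The characteristic polynomial is `Xⁿ`; the Cayley–Hamilton theorem does the rest. -/
theorem Matrix.isNilpotent_of_forall_le {N : Matrix (Fin n) (Fin n) ℂ}
    (h : ∀ i j, j ≤ i → N i j = 0) : IsNilpotent N := by
  refine ⟨n, ?_⟩
  have hN : N.BlockTriangular id := fun i j hij => h i j (le_of_lt hij)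
  have h1 := Matrix.aeval_self_charpoly N
  rw [Matrix.charpoly_of_isUpperTriangular N hN] at h1
  simpa [h] using h1

/-- Idempotent polynomials for the eigenvalues of a triangular matrix. -/
theorem exists_spectral_polynomials (l : Fin n → ℂ) :
    ∃ p : Fin n → Polynomial ℂ, (∀ i j, (p i).eval (l j) = if l i = l j then 1 else 0) ∧
      (∀ i j, l i = l j → p i = p j) ∧
      (∀ i j, ∏ k, (Polynomial.X - Polynomial.C (l k)) ∣
        p i * p j - if l i = l j then p i else 0) := by
  -- Here `R a` collects the factors for the eigenvalue `a` and `Q a` the others. From `u R + v Q =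
  -- 1` the product `v Q` is idempotent modulo `R Q`: the Chinese remainder theorem.
  set R : ℂ → Polynomial ℂ := fun a =>
    ∏ k with l k = a, (Polynomial.X - Polynomial.C (l k)) with hR
  set Q : ℂ → Polynomial ℂ := fun a =>
    ∏ k with ¬ l k = a, (Polynomial.X - Polynomial.C (l k)) with hQ
  have hRQ : ∀ a, R a * Q a = ∏ k, (Polynomial.X - Polynomial.C (l k)) := fun a =>
    Finset.prod_filter_mul_prod_filter_not _ _ _
  have hcop : ∀ a, IsCoprime (R a) (Q a) := by
    intro a
    refine IsCoprime.prod_left fun i hi => IsCoprime.prod_right fun j hj => ?_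
    refine Polynomial.isCoprime_X_sub_C_of_isUnit_sub (sub_ne_zero.2 ?_).isUnit
    rw [(Finset.mem_filter.1 hi).2]
    exact fun h => (Finset.mem_filter.1 hj).2 h.symm
  choose u v huv using hcop
  refine ⟨fun i => v (l i) * Q (l i), fun i j => ?_, fun i j h => by simp only [h],
    fun i j => ?_⟩
  · split_ifs with h
    · have h1 := congrArg (Polynomial.eval (l j)) (huv (l i))
      have h2 : (R (l i)).eval (l j) = 0 := by
        rw [hR, Polynomial.eval_prod]
        exact Finset.prod_eq_zero (Finset.mem_filter.2 ⟨Finset.mem_univ j, h.symm⟩) (by simp)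
      rw [Polynomial.eval_add, Polynomial.eval_mul, h2, mul_zero, zero_add] at h1
      simpa using h1
    · have h2 : (Q (l i)).eval (l j) = 0 := by
        rw [hQ, Polynomial.eval_prod]
        exact Finset.prod_eq_zero (Finset.mem_filter.2 ⟨Finset.mem_univ j, fun h' => h h'.symm⟩)
          (by simp)
      rw [Polynomial.eval_mul, h2, mul_zero]
  · simp only
    split_ifs with h
    · rw [← h, ← hRQ (l i)]
      refine ⟨-(u (l i) * v (l i)), ?_⟩
      linear_combination (v (l i) * Q (l i)) * huv (l i)
    · rw [sub_zero, ← hRQ (l i)]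
      have h1 : R (l i) ∣ Q (l j) := by
        refine Finset.prod_dvd_prod_of_subset _ _ _ fun k hk => ?_
        rw [Finset.mem_filter] at hk ⊢
        refine ⟨hk.1, ?_⟩
        rw [hk.2]
        exact h
      obtain ⟨w, hw⟩ := h1
      refine ⟨v (l i) * v (l j) * w, ?_⟩
      rw [hw]
      ring

/-- A triangular matrix is conjugate under a triangular matrix to a triangular matrix that
preserves the eigenspaces of its diagonal part. -/
theorem exists_triangular_conj {H : Matrix (Fin n) (Fin n) ℂ} (hH : H.BlockTriangular id) :
    ∃ U : GL (Fin n) ℂ, (U : Matrix (Fin n) (Fin n) ℂ).BlockTriangular id ∧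
      ((U⁻¹ : GL (Fin n) ℂ) : Matrix (Fin n) (Fin n) ℂ).BlockTriangular id ∧
      ∀ a b, H a a ≠ H b b → (((U⁻¹ : GL (Fin n) ℂ) : Matrix (Fin n) (Fin n) ℂ) * H *
        (U : Matrix (Fin n) (Fin n) ℂ)) a b = 0 := by
  obtain ⟨p, hp1, hp2, hp3⟩ := exists_spectral_polynomials fun i => H i i
  set E : Fin n → Matrix (Fin n) (Fin n) ℂ := fun i => Polynomial.aeval H (p i) with hE
  have hEt : ∀ i, (E i).BlockTriangular id := fun i => (hH.aeval (p i)).1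
  have hEd : ∀ i j, E i j j = if H i i = H j j then 1 else 0 := fun i j => by
    rw [show E i = Polynomial.aeval H (p i) from rfl, (hH.aeval (p i)).2, hp1]
  have hEE : ∀ i j, E i * E j = if H i i = H j j then E i else 0 := by
    intro i j
    obtain ⟨w, hw⟩ := hp3 i j
    have h1 := congrArg (Polynomial.aeval H) hw
    rw [map_mul _ (∏ k, _) w, ← Matrix.charpoly_of_isUpperTriangular H hH,
      Matrix.aeval_self_charpoly, zero_mul, map_sub, map_mul, sub_eq_zero] at h1
    rw [hE]
    change Polynomial.aeval H (p i) * Polynomial.aeval H (p j) = _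
    rw [h1]
    split_ifs <;> simp
  -- Column `j` of `U` is column `j` of the spectral projection for the eigenvalue `H j j`. So `U`
  -- is triangular with ones on the diagonal and its columns lie in generalized eigenspaces of `H`.
  set U : Matrix (Fin n) (Fin n) ℂ := Matrix.of fun a j => E j a j with hU
  have hUt : U.BlockTriangular id := fun a j h => hEt j h
  have hUd : ∀ j, U j j = 1 := fun j => by
    change E j j j = 1
    rw [hEd, if_pos rfl]
  have hdet : U.det = 1 := by
    rw [Matrix.det_of_isUpperTriangular hUt]
    exact Finset.prod_eq_one fun j _ => hUd j
  have hunit : IsUnit U.det := by rw [hdet]; exact isUnit_one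
  have hEU : ∀ i, E i * U = U * Matrix.diagonal fun j => if H i i = H j j then 1 else 0 := by
    intro i
    ext a j
    have h1 := congrFun (congrFun (hEE i j) a) j
    rw [Matrix.mul_diagonal]
    change (E i * E j) a j = E j a j * _
    rw [h1]
    split_ifs with h
    · have : E i = E j := by rw [hE]; exact congrArg _ (hp2 i j h)
      rw [this, mul_one]
    · rw [mul_zero]; rfl
  refine ⟨Matrix.GeneralLinearGroup.mkOfDetNeZero U hunit.ne_zero, hUt, ?_, ?_⟩
  · let := Matrix.invertibleOfIsUnitDet U hunit
    rw [Matrix.coe_units_inv]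
    exact Matrix.blockTriangular_inv_of_blockTriangular hUt
  · intro a b hab
    set G := Matrix.GeneralLinearGroup.mkOfDetNeZero U hunit.ne_zero
    have hG : (G : Matrix (Fin n) (Fin n) ℂ) = U := rfl
    set K := ((G⁻¹ : GL (Fin n) ℂ) : Matrix (Fin n) (Fin n) ℂ) * H * (G : Matrix (Fin n) (Fin n) ℂ)
      with hK
    set d := Matrix.diagonal fun j => if H a a = H j j then (1 : ℂ) else 0 with hd
    have h1 : ((G⁻¹ : GL (Fin n) ℂ) : Matrix (Fin n) (Fin n) ℂ) * E a *
        (G : Matrix (Fin n) (Fin n) ℂ) = d := by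
      rw [Matrix.mul_assoc, hG, hEU, ← hG, Units.inv_mul_cancel_left]
    have h2 : E a * H = H * E a := by
      have h5 := congrArg (Polynomial.aeval H) (mul_comm (p a) Polynomial.X)
      rwa [map_mul, map_mul, Polynomial.aeval_X] at h5
    -- The projection `E a` becomes the 0/1 diagonal matrix `d`. It commutes with the conjugate `K`
    -- of `H`, which kills the entries of `K` between different eigenvalues.
    have h3 : d * K = K * d := by
      rw [← h1, hK]
      simp only [Matrix.mul_assoc, Units.mul_inv_cancel_left]
      rw [← Matrix.mul_assoc (E a), h2, Matrix.mul_assoc]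
    have h4 := congrFun (congrFun h3 a) b
    rw [hd, Matrix.diagonal_mul, Matrix.mul_diagonal, if_pos rfl, if_neg hab, one_mul,
      mul_zero] at h4
    exact h4

end Triangular

theorem IsLinearBasis.linearlyIsomorphic_conj {n : ℕ} (D : Set (Fin n → ℂ)) (P : GL (Fin n) ℂ) :
    LinearlyIsomorphic D (vecMulEquiv P '' D) := ⟨vecMulEquiv P, rfl⟩

/-- A diagonal matrix in the Lie algebra splits it into weight spaces. -/
theorem IsLinearBasis.weight_mem {n : ℕ} {D : Set (Fin n → ℂ)}
    {A : Fin n → Matrix (Fin n) (Fin n) ℂ} (hA : IsLinearBasis D A) {d : Fin n → ℂ}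
    (hd : Matrix.diagonal d ∈ Submodule.span ℂ (Set.range A)) {B : Matrix (Fin n) (Fin n) ℂ}
    (hB : B ∈ Submodule.span ℂ (Set.range A)) (p : Polynomial ℂ) :
    (Matrix.of fun a b => p.eval (d a - d b) * B a b) ∈ Submodule.span ℂ (Set.range A) := by
  induction p using Polynomial.induction_on with
  | C c =>
    have : (Matrix.of fun a b => (Polynomial.C c).eval (d a - d b) * B a b) = c • B := by
      ext a b
      simp
    rw [this]
    exact Submodule.smul_mem _ _ hB
  | add p q hp hq =>
    have : (Matrix.of fun a b => (p + q).eval (d a - d b) * B a b) =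
        (Matrix.of fun a b => p.eval (d a - d b) * B a b) +
          Matrix.of fun a b => q.eval (d a - d b) * B a b := by
      ext a b
      simp [add_mul]
    rw [this]
    exact add_mem hp hq
  | monomial m c h =>
    -- Commutation with `diag(d)` multiplies the entry `(a, b)` by `d a - d b`, which raises the
    -- degree of the polynomial by one.
    have : (Matrix.of fun a b =>
        (Polynomial.C c * Polynomial.X ^ (m + 1)).eval (d a - d b) * B a b) =
        Matrix.diagonal d * (Matrix.of fun a b =>
          (Polynomial.C c * Polynomial.X ^ m).eval (d a - d b) * B a b) -
        (Matrix.of fun a b =>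
          (Polynomial.C c * Polynomial.X ^ m).eval (d a - d b) * B a b) * Matrix.diagonal d := by
      ext a b
      simp only [Matrix.sub_apply, Matrix.diagonal_mul, Matrix.mul_diagonal, Matrix.of_apply,
        Polynomial.eval_mul, Polynomial.eval_C, Polynomial.eval_pow, Polynomial.eval_X]
      ring
    rw [this]
    exact hA.commutator_mem hd h

/-- The component of an element of the Lie algebra of a given weight. -/
theorem IsLinearBasis.weight_component_mem {n : ℕ} {D : Set (Fin n → ℂ)}
    {A : Fin n → Matrix (Fin n) (Fin n) ℂ} (hA : IsLinearBasis D A) {d : Fin n → ℂ}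
    (hd : Matrix.diagonal d ∈ Submodule.span ℂ (Set.range A)) {B : Matrix (Fin n) (Fin n) ℂ}
    (hB : B ∈ Submodule.span ℂ (Set.range A)) (w : ℂ) :
    (Matrix.of fun a b => if d a - d b = w then B a b else 0) ∈
      Submodule.span ℂ (Set.range A) := by
  classical
  set s : Finset ℂ := (Finset.univ.image fun ab : Fin n × Fin n => d ab.1 - d ab.2).erase w
  -- Up to normalization, the interpolation polynomial that is 1 at `w` and 0 at all other weights.
  set q : Polynomial ℂ := ∏ c ∈ s, (Polynomial.X - Polynomial.C c) with hq
  have hqw : q.eval w ≠ 0 := by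
    rw [hq, Polynomial.eval_prod, Finset.prod_ne_zero_iff]
    intro c hc
    simpa [sub_eq_zero] using (Finset.ne_of_mem_erase hc).symm
  have h := hA.weight_mem hd hB (Polynomial.C (q.eval w)⁻¹ * q)
  convert h using 1
  ext a b
  simp only [Matrix.of_apply]
  split_ifs with hab
  · rw [hab, Polynomial.eval_mul, Polynomial.eval_C, inv_mul_cancel₀ hqw, one_mul]
  · have : q.eval (d a - d b) = 0 := by
      rw [hq, Polynomial.eval_prod]
      exact Finset.prod_eq_zero (Finset.mem_erase.2 ⟨hab, Finset.mem_image.2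
        ⟨(a, b), Finset.mem_univ _, rfl⟩⟩) (by simp)
    rw [Polynomial.eval_mul, this, mul_zero, zero_mul]

/-- A complex vector space is not a finite union of proper subspaces, so some element avoids the
kernels of all nonzero functionals `B a a - B b b`. -/
theorem exists_generic_diagonal {n : ℕ} (g : Submodule ℂ (Matrix (Fin n) (Fin n) ℂ)) :
    ∃ H ∈ g, ∀ a b, H a a = H b b → ∀ B ∈ g, B a a = B b b := by
  let φ : Fin n → Fin n → g →ₗ[ℂ] ℂ := fun a b =>
    { toFun := fun B => B.1 a a - B.1 b b
      map_add' := fun B C => by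
        simp only [Submodule.coe_add, Matrix.add_apply]; ring
      map_smul' := fun c B => by
        simp only [Submodule.coe_smul, Matrix.smul_apply, smul_eq_mul, RingHom.id_apply]; ring }
  by_contra! hcon
  let ι := {ab : Fin n × Fin n // φ ab.1 ab.2 ≠ 0}
  have hcover : ⋃ i : ι, (LinearMap.ker (φ i.1.1 i.1.2) : Set g) = Set.univ := by
    refine Set.eq_univ_of_forall fun H => ?_
    obtain ⟨a, b, hab, B, hB, hne⟩ := hcon H.1 H.2
    refine Set.mem_iUnion.2 ⟨⟨(a, b), fun h => hne ?_⟩, ?_⟩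
    · exact sub_eq_zero.1 (LinearMap.congr_fun h ⟨B, hB⟩)
    · exact sub_eq_zero.2 hab
  obtain ⟨i, hi⟩ := Subspace.exists_eq_top_of_iUnion_eq_univ hcover
  exact i.2 (LinearMap.ker_eq_top.1 hi)

/-- In suitable coordinates, the Lie algebra of a linear free divisor, if it is solvable, consists
of upper triangular matrices and contains their diagonal parts. -/
structure IsTriangularBasis {n : ℕ} (D : Set (Fin n → ℂ)) (A : Fin n → Matrix (Fin n) (Fin n) ℂ) :
    Prop extends IsLinearBasis D A where
  blockTriangular : ∀ B ∈ Submodule.span ℂ (Set.range A), B.BlockTriangular id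
  diagonal_mem' : ∀ B ∈ Submodule.span ℂ (Set.range A),
    Matrix.diagonal (fun i => B i i) ∈ Submodule.span ℂ (Set.range A)

/-- After Lie's theorem, a generic element `H` is conjugated by a triangular matrix until its
semisimple part is its diagonal. That part lies in the algebra, and its weight decomposition yields
the diagonal parts of all other elements. -/
theorem IsLinearBasis.exists_isTriangularBasis {n : ℕ} {D : Set (Fin n → ℂ)}
    {A : Fin n → Matrix (Fin n) (Fin n) ℂ} (hA : IsLinearBasis D A)
    (hsol : LieAlgebra.IsSolvable hA.lieSubalgebra) :
    ∃ D' A', LinearlyIsomorphic D D' ∧ IsTriangularBasis D' A' := by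
  obtain ⟨P, hP⟩ := hA.exists_conj_blockTriangular hsol
  have hA₁ := hA.conj P
  obtain ⟨H, hH, hgen⟩ := exists_generic_diagonal (Submodule.span ℂ (Set.range fun i =>
      ((P⁻¹ : GL (Fin n) ℂ) : Matrix (Fin n) (Fin n) ℂ) * A i * (P : Matrix (Fin n) (Fin n) ℂ)))
  obtain ⟨U, hU, hU', hUH⟩ := exists_triangular_conj (hP H hH)
  have hA₂ := hA₁.conj U
  refine ⟨_, _, (IsLinearBasis.linearlyIsomorphic_conj D P).trans
    (IsLinearBasis.linearlyIsomorphic_conj _ U), (?_ : IsTriangularBasis _ fun i =>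
      ((U⁻¹ : GL (Fin n) ℂ) : Matrix (Fin n) (Fin n) ℂ) *
    (((P⁻¹ : GL (Fin n) ℂ) : Matrix (Fin n) (Fin n) ℂ) * A i * (P : Matrix (Fin n) (Fin n) ℂ)) *
    (U : Matrix (Fin n) (Fin n) ℂ))⟩
  set A₂ := fun i => ((U⁻¹ : GL (Fin n) ℂ) : Matrix (Fin n) (Fin n) ℂ) *
    (((P⁻¹ : GL (Fin n) ℂ) : Matrix (Fin n) (Fin n) ℂ) * A i * (P : Matrix (Fin n) (Fin n) ℂ)) *
    (U : Matrix (Fin n) (Fin n) ℂ) with hA₂def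
  have hdiag1 : ∀ i, ((U⁻¹ : GL (Fin n) ℂ) : Matrix (Fin n) (Fin n) ℂ) i i *
      (U : Matrix (Fin n) (Fin n) ℂ) i i = 1 := by
    intro i
    rw [← hU'.mul_diag hU, Units.inv_mul, Matrix.one_apply_eq]
  have hback : ∀ C : Matrix (Fin n) (Fin n) ℂ, C.BlockTriangular id →
      (((U⁻¹ : GL (Fin n) ℂ) : Matrix (Fin n) (Fin n) ℂ) * C *
        (U : Matrix (Fin n) (Fin n) ℂ)).BlockTriangular id ∧
      ∀ i, (((U⁻¹ : GL (Fin n) ℂ) : Matrix (Fin n) (Fin n) ℂ) * C *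
        (U : Matrix (Fin n) (Fin n) ℂ)) i i = C i i := by
    intro C hC
    refine ⟨(hU'.mul hC).mul hU, fun i => ?_⟩
    rw [(hU'.mul hC).mul_diag hU, hU'.mul_diag hC]
    linear_combination C i i * hdiag1 i
  have hmem : ∀ B ∈ Submodule.span ℂ (Set.range A₂), B.BlockTriangular id ∧
      ∀ a b, H a a = H b b → B a a = B b b := by
    intro B hB
    have hB' := (mem_span_conj_iff U B).1 hB
    have h1 : B = ((U⁻¹ : GL (Fin n) ℂ) : Matrix (Fin n) (Fin n) ℂ) *
        ((U : Matrix (Fin n) (Fin n) ℂ) * B * ((U⁻¹ : GL (Fin n) ℂ) : Matrix (Fin n) (Fin n) ℂ)) *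
        (U : Matrix (Fin n) (Fin n) ℂ) := by
      simp only [Matrix.mul_assoc, Units.inv_mul_cancel_left, Units.inv_mul, mul_one]
    obtain ⟨h2, h3⟩ := hback _ (hP _ hB')
    rw [← h1] at h2 h3
    refine ⟨h2, fun a b hab => ?_⟩
    rw [h3, h3]
    exact hgen a b hab _ hB'
  set K := ((U⁻¹ : GL (Fin n) ℂ) : Matrix (Fin n) (Fin n) ℂ) * H *
    (U : Matrix (Fin n) (Fin n) ℂ) with hK
  have hKmem : K ∈ Submodule.span ℂ (Set.range A₂) := by
    refine (mem_span_conj_iff U K).2 ?_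
    have h1 : (U : Matrix (Fin n) (Fin n) ℂ) * K *
        ((U⁻¹ : GL (Fin n) ℂ) : Matrix (Fin n) (Fin n) ℂ) = H := by
      rw [hK]
      simp only [Matrix.mul_assoc, Units.mul_inv_cancel_left, Units.mul_inv, mul_one]
    rw [h1]
    exact hH
  obtain ⟨hKt, hKd⟩ := hback H (hP H hH)
  rw [← hK] at hKt hKd
  -- If `B` has no entries between different eigenvalues of `H`, then by genericity its diagonal
  -- part is constant on each eigenvalue block. So it commutes with the strictly triangular rest,
  -- and `diagonal_mem` applies.
  have hdecomp : ∀ B : Matrix (Fin n) (Fin n) ℂ, B ∈ Submodule.span ℂ (Set.range A₂) →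
      (∀ a b, H a a ≠ H b b → B a b = 0) →
      Matrix.diagonal (fun i => B i i) ∈ Submodule.span ℂ (Set.range A₂) := by
    intro B hB h0
    obtain ⟨hBt, hBd⟩ := hmem B hB
    set N := B - Matrix.diagonal (fun i => B i i) with hN
    refine hA₂.diagonal_mem (N := N) (Matrix.isNilpotent_of_forall_le fun i j hij => ?_) ?_ ?_
    · rcases hij.lt_or_eq with h | h
      · rw [hN, Matrix.sub_apply, hBt h, Matrix.diagonal_apply_ne _ h.ne', sub_zero]
      · subst h
        rw [hN, Matrix.sub_apply, Matrix.diagonal_apply_eq, sub_self]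
    · change Matrix.diagonal _ * N = N * Matrix.diagonal _
      ext a b
      rw [Matrix.diagonal_mul, Matrix.mul_diagonal]
      by_cases hab : H a a = H b b
      · rw [hBd a b hab, mul_comm]
      · have : N a b = 0 := by
          rw [hN, Matrix.sub_apply, h0 a b hab, Matrix.diagonal_apply_ne _ (fun h => hab (by rw [h])),
            sub_zero]
        rw [this, mul_zero, zero_mul]
    · rw [hN, add_sub_cancel]
      exact hB
  have hT : Matrix.diagonal (fun i => H i i) ∈ Submodule.span ℂ (Set.range A₂) := by
    have := hdecomp K hKmem hUH
    simpa only [hKd] using this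
  refine ⟨hA₂, fun B hB => (hmem B hB).1, fun B hB => ?_⟩
  have h1 := hdecomp _ (hA₂.weight_component_mem hT hB 0) (fun a b hab => by
    simp [sub_eq_zero, hab])
  simpa using h1

/-! ### Tools for the classification -/

theorem IsLinearBasis.of_linearIndependent {n : ℕ} {D : Set (Fin n → ℂ)}
    {A A' : Fin n → Matrix (Fin n) (Fin n) ℂ} (hA : IsLinearBasis D A)
    (h : ∀ i, A' i ∈ Submodule.span ℂ (Set.range A)) (hli : LinearIndependent ℂ A') :
    Submodule.span ℂ (Set.range A') = Submodule.span ℂ (Set.range A) ∧ IsLinearBasis D A' := by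
  have h1 : Submodule.span ℂ (Set.range A') = Submodule.span ℂ (Set.range A) := by
    refine Submodule.eq_of_le_of_finrank_eq (Submodule.span_le.2 (Set.range_subset_iff.2 h)) ?_
    rw [hA.finrank_span, finrank_span_eq_card hli, Fintype.card_fin]
  exact ⟨h1, hA.of_span_eq h1⟩

/-- A criterion for the Lie algebra of a linear free divisor to take the form of that of a row of
the table after permuting and rescaling the coordinates. -/
theorem IsLinearBasis.linearlyIsomorphic_of_perm {n : ℕ} {D : Set (Fin n → ℂ)}
    {A : Fin n → Matrix (Fin n) (Fin n) ℂ} (hA : IsLinearBasis D A) (r : TableRow n)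
    (σ : Equiv.Perm (Fin n)) (c : Fin n → ℂ) (hc : ∀ i, c i ≠ 0)
    (h : ∀ i, (Matrix.of fun a b => c (σ.symm a) * r.basis i (σ.symm a) (σ.symm b) /
      c (σ.symm b)) ∈ Submodule.span ℂ (Set.range A)) :
    LinearlyIsomorphic D r.divisor := by
  let P : GL (Fin n) ℂ :=
    { val := Matrix.of fun a j => if a = σ j then c j else 0
      inv := Matrix.of fun j a => if a = σ j then (c j)⁻¹ else 0
      val_inv := by
        ext a b
        simp only [Matrix.mul_apply, Matrix.of_apply, Matrix.one_apply]
        rw [Finset.sum_eq_single (σ.symm a)]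
        · by_cases hab : a = b
          · subst hab
            simp [hc]
          · simp [hab, Ne.symm hab]
        · intro j _ hj
          rw [if_neg, zero_mul]
          rintro rfl
          simp at hj
        · simp
      inv_val := by
        ext i j
        simp only [Matrix.mul_apply, Matrix.of_apply, Matrix.one_apply]
        rw [Finset.sum_eq_single (σ i)]
        · by_cases hij : i = j
          · subst hij
            simp [hc]
          · simp [hij]
        · intro a _ ha
          rw [if_neg ha, zero_mul]
        · simp }
  refine hA.linearlyIsomorphic r P fun i => ⟨_, h i, ?_⟩
  ext a j
  change ((Matrix.of fun a j => if a = σ j then c j else 0) * r.basis i) a j =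
    ((Matrix.of fun a b => c (σ.symm a) * r.basis i (σ.symm a) (σ.symm b) / c (σ.symm b)) *
      (Matrix.of fun a j => if a = σ j then c j else 0)) a j
  rw [Matrix.mul_apply, Matrix.mul_apply, Finset.sum_eq_single (σ.symm a),
    Finset.sum_eq_single (σ j)]
  · simp [hc]
  · intro b _ hb
    simp [hb]
  · simp
  · intro k _ hk
    have : a ≠ σ k := by
      rintro rfl
      simp at hk
    simp [this]
  · simp

theorem hasSimpleZerosOnGeneralLines_coord {n : ℕ} (i : Fin n) :
    HasSimpleZerosOnGeneralLines fun x : Fin n → ℂ => x i := by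
  have := hasSimpleZerosOnGeneralLines_of_exists (q := MvPolynomial.X (R := ℂ) i) (d := 1)
    (v := Pi.single i 1) (x₀ := 0) (P := Polynomial.X) (MvPolynomial.isHomogeneous_X ℂ i)
    one_ne_zero (by simp) (by simp) (by simp)
  simpa using this

/-- The obstruction used throughout the triangular classification: each degenerate choice of entries
would make the square of a coordinate divide the determinant. -/
theorem IsLinearBasis.saitoDet_ne_sq_mul {n : ℕ} {D : Set (Fin n → ℂ)}
    {A : Fin n → Matrix (Fin n) (Fin n) ℂ} (hA : IsLinearBasis D A) (i : Fin n)
    {K : (Fin n → ℂ) → ℂ} (hK : AnalyticAt ℂ K 0) : ¬ ∀ x, saitoDet A x = x i ^ 2 * K x := by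
  intro h
  refine hA.not_eventually_eq_sq_mul (p := 0) (q := fun x => x i) (w := Pi.single i 1)
    ((hasSimpleZerosOnGeneralLines_coord i).isReducedEquationAt 0) rfl ?_ hK (Eventually.of_forall h)
  have hX : HasFDerivAt (fun x : Fin n → ℂ => x i)
      (ContinuousLinearMap.proj (R := ℂ) (φ := fun _ : Fin n => ℂ) i) 0 :=
    (ContinuousLinearMap.proj (R := ℂ) (φ := fun _ : Fin n => ℂ) i).hasFDerivAt
  rw [hX.fderiv]
  simp

namespace IsTriangularBasis

variable {n : ℕ} {D : Set (Fin n → ℂ)} {A : Fin n → Matrix (Fin n) (Fin n) ℂ}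

theorem diagonal_one_mem (hA : IsTriangularBasis D A) :
    Matrix.diagonal (1 : Fin n → ℂ) ∈ Submodule.span ℂ (Set.range A) := by
  have := hA.one_mem
  rwa [← Matrix.diagonal_one] at this

/-- The strictly triangular part of the Lie algebra has the expected dimension. -/
theorem exists_strict (hA : IsTriangularBasis D A) {s : ℕ} {t : Fin s → Fin n → ℂ}
    (ht : ∀ d : Fin n → ℂ, Matrix.diagonal d ∈ Submodule.span ℂ (Set.range A) →
      d ∈ Submodule.span ℂ (Set.range t)) :
    ∃ 𝔫 : Submodule ℂ (Matrix (Fin n) (Fin n) ℂ), 𝔫 ≤ Submodule.span ℂ (Set.range A) ∧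
      (∀ N ∈ 𝔫, ∀ i j, j ≤ i → N i j = 0) ∧ n ≤ s + Module.finrank ℂ 𝔫 := by
  set g := Submodule.span ℂ (Set.range A) with hg
  let φ : g →ₗ[ℂ] (Fin n → ℂ) := (Matrix.diagLinearMap (Fin n) ℂ ℂ).domRestrict g
  refine ⟨(LinearMap.ker φ).map g.subtype, Submodule.map_subtype_le _ _, ?_, ?_⟩
  · rintro _ ⟨N, hN, rfl⟩ i j hij
    rcases hij.lt_or_eq with h | h
    · exact hA.blockTriangular N.1 N.2 h
    · subst h
      exact congrFun (show Matrix.diag N.1 = 0 from hN) j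
  · have h1 := LinearMap.finrank_range_add_finrank_ker φ
    rw [hA.finrank_span] at h1
    have h2 : Module.finrank ℂ ((LinearMap.ker φ).map g.subtype) =
        Module.finrank ℂ (LinearMap.ker φ) :=
      Submodule.finrank_map_subtype_eq g _
    have h3 : Module.finrank ℂ (LinearMap.range φ) ≤ s := by
      have h4 : LinearMap.range φ ≤ Submodule.span ℂ (Set.range t) := by
        rintro _ ⟨B, rfl⟩
        exact ht _ (hA.diagonal_mem' B.1 B.2)
      refine (Submodule.finrank_mono h4).trans ?_
      have h5 := finrank_range_le_card (R := ℂ) t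
      rwa [Fintype.card_fin] at h5
    omega

end IsTriangularBasis

/-- The first two weights of a triangular linear free divisor are different. -/
theorem IsTriangularBasis.exists_weight_ne {m : ℕ} {D : Set (Fin (m + 2) → ℂ)}
    {A : Fin (m + 2) → Matrix (Fin (m + 2)) (Fin (m + 2)) ℂ} (hA : IsTriangularBasis D A) :
    ∃ S : Fin (m + 2) → ℂ, Matrix.diagonal S ∈ Submodule.span ℂ (Set.range A) ∧ S 0 = 0 ∧
      S 1 = 1 := by
  by_cases h : ∃ B ∈ Submodule.span ℂ (Set.range A), B 0 0 ≠ B 1 1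
  · obtain ⟨B, hB, hne⟩ := h
    refine ⟨(B 1 1 - B 0 0)⁻¹ • ((fun i => B i i) - B 0 0 • 1), ?_, by simp, ?_⟩
    · have h1 : Matrix.diagonal ((B 1 1 - B 0 0)⁻¹ • ((fun i => B i i) - B 0 0 • 1)) =
          (B 1 1 - B 0 0)⁻¹ • (Matrix.diagonal (fun i => B i i) -
            B 0 0 • Matrix.diagonal (1 : Fin (m + 2) → ℂ)) := by
        ext i j
        by_cases hij : i = j
        · subst hij
          simp
        · simp [hij]
      rw [h1]
      exact Submodule.smul_mem _ _ (sub_mem (hA.diagonal_mem' B hB)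
        (Submodule.smul_mem _ _ hA.diagonal_one_mem))
    · have : B 1 1 - B 0 0 ≠ 0 := sub_ne_zero.2 hne.symm
      simp [this]
  · exfalso
    push Not at h
    set M : (Fin (m + 2) → ℂ) → Matrix (Fin (m + 2)) (Fin (m + 2)) ℂ :=
      fun x => Matrix.of fun i => x ᵥ* A i
    have hmem : ∀ i, A i ∈ Submodule.span ℂ (Set.range A) := fun i => Submodule.subset_span ⟨i, rfl⟩
    have h0 : ∀ x i, M x i 0 = x 0 * A i 0 0 := by
      intro x i
      change ∑ k, x k * A i k 0 = _
      refine Finset.sum_eq_single 0 (fun k _ hk => ?_) (by simp)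
      rw [hA.blockTriangular _ (hmem i) (Fin.pos_of_ne_zero hk), mul_zero]
    have h1 : ∀ x i, M x i 1 = x 0 * A i 0 1 + x 1 * A i 0 0 := by
      intro x i
      rw [h _ (hmem i)]
      change ∑ k, x k * A i k 1 = _
      rw [Fin.sum_univ_succ, Fin.sum_univ_succ]
      have h2 : ∑ k : Fin m, x k.succ.succ * A i k.succ.succ 1 = 0 := by
        refine Finset.sum_eq_zero fun k _ => ?_
        rw [hA.blockTriangular _ (hmem i), mul_zero]
        change (1 : Fin (m + 2)) < k.succ.succ
        rw [Fin.lt_def]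
        simp
      rw [h2, add_zero]
      rfl
    set l : Fin (m + 2) → ℂ := fun i => A i 0 0
    set b : Fin (m + 2) → ℂ := fun i => A i 0 1
    -- With equal weights the first two columns are `x₀ l` and `x₀ b + x₁ l`. Subtracting a multiple
    -- of `l` leaves a factor `x₀` in each of them.
    have key : ∀ x, saitoDet A x = x 0 ^ 2 * (((M x).updateCol 0 l).updateCol 1 b).det := by
      intro x
      have e0 : (M x).updateCol 0 (x 0 • l) = M x := by
        ext i j
        by_cases hj : j = 0
        · subst hj; simp [h0, l]
        · simp [hj]
      have e1 : ((M x).updateCol 0 l).updateCol 1 (x 0 • b + x 1 • l) = (M x).updateCol 0 l := by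
        ext i j
        by_cases hj : j = 1
        · subst hj; simp [h1, l, b]
        · simp [hj]
      have e2 : (((M x).updateCol 0 l).updateCol 1 l).det = 0 :=
        Matrix.det_zero_of_column_eq (i := 0) (j := 1) (by simp) (fun k => by simp)
      change (M x).det = _
      have e3 := congrArg Matrix.det e0
      have e4 := congrArg Matrix.det e1
      rw [Matrix.det_updateCol_smul] at e3
      rw [Matrix.det_updateCol_add, Matrix.det_updateCol_smul, Matrix.det_updateCol_smul, e2] at e4
      rw [← e3, ← e4]
      ring
    refine hA.saitoDet_ne_sq_mul 0 (AnalyticAt.matrix_det fun i j => ?_) key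
    by_cases hj : j = 1
    · subst hj
      simpa using analyticAt_const
    · by_cases hj' : j = 0
      · subst hj'
        simpa using analyticAt_const
      · refine (analyticAt_pi_iff.1 (analyticAt_vecMul (A i) 0) j).congr (Eventually.of_forall
          fun x => ?_)
        simp [hj, hj', M]

/-! ### Recognizing the divisors of the table -/

namespace IsLinearBasis

theorem linearlyIsomorphic_of_forall_diagonal {n : ℕ} {D : Set (Fin n → ℂ)}
    {A : Fin n → Matrix (Fin n) (Fin n) ℂ} (hA : IsLinearBasis D A)
    (h : ∀ d, Matrix.diagonal d ∈ Submodule.span ℂ (Set.range A)) (hn : 1 ≤ n) (hn' : n ≤ 4) :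
    ∃ r : TableRow n, LinearlyIsomorphic D r.divisor := by
  have key : ∀ r : TableRow n, (∀ i, r.basis i = Matrix.diagonal (Pi.single i 1)) →
      ∃ r : TableRow n, LinearlyIsomorphic D r.divisor := by
    intro r hr
    refine ⟨r, hA.linearlyIsomorphic r 1 fun i => ⟨_, h (Pi.single i 1), ?_⟩⟩
    rw [hr, Units.val_one, one_mul, mul_one]
  interval_cases n
  · refine key .normalCrossing₁ fun i => ?_
    ext a b
    fin_cases i; fin_cases a; fin_cases b
    simp [TableRow.basis, TableRow.element]
  · refine key .normalCrossing₂ fun i => ?_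
    ext a b
    fin_cases i <;> fin_cases a <;> fin_cases b <;> simp [TableRow.basis, TableRow.element]
  · refine key .normalCrossing₃ fun i => ?_
    ext a b
    fin_cases i <;> fin_cases a <;> fin_cases b <;> simp [TableRow.basis, TableRow.element]
  · refine key .normalCrossing₄ fun i => ?_
    ext a b
    fin_cases i <;> fin_cases a <;> fin_cases b <;> simp [TableRow.basis, TableRow.element]

theorem linearlyIsomorphic_cone₃ {D : Set (Fin 3 → ℂ)} {A : Fin 3 → Matrix (Fin 3) (Fin 3) ℂ}
    (hA : IsLinearBasis D A) {p q : ℂ} (hp : p ≠ 0) (hq : q ≠ 0)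
    (hd : ∀ d : Fin 3 → ℂ, d 0 - 2 * d 1 + d 2 = 0 →
      Matrix.diagonal d ∈ Submodule.span ℂ (Set.range A))
    (hN : Matrix.single 0 1 p + Matrix.single 1 2 q ∈ Submodule.span ℂ (Set.range A)) :
    LinearlyIsomorphic D TableRow.cone₃.divisor := by
  -- The fields of this row are lower triangular as matrices on row vectors, so the coordinates are
  -- reversed; the scaling turns the entries 1 and -2 of the nilpotent field into `p` and `q`.
  refine hA.linearlyIsomorphic_of_perm .cone₃ Fin.revPerm ![-2 / q, 1, p] ?_ ?_
  · intro i
    fin_cases i <;> simp [hp, hq]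
  · intro i
    fin_cases i
    · convert hd ![1, 1, 1] (by simp; norm_num) using 1
      ext a b
      fin_cases a <;> fin_cases b <;>
        simp [TableRow.basis, TableRow.element, hp, hq, Fin.rev]
    · convert hd ![-2, 1, 4] (by simp; norm_num) using 1
      ext a b
      fin_cases a <;> fin_cases b <;>
        simp [TableRow.basis, TableRow.element, hq, Fin.rev] <;> field_simp
    · convert hN using 1
      ext a b
      fin_cases a <;> fin_cases b <;>
        simp [TableRow.basis, TableRow.element, Fin.rev]

theorem linearlyIsomorphic_cone₄ {D : Set (Fin 4 → ℂ)} {A : Fin 4 → Matrix (Fin 4) (Fin 4) ℂ}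
    (hA : IsLinearBasis D A) (σ : Equiv.Perm (Fin 4)) {p q : ℂ} (hp : p ≠ 0) (hq : q ≠ 0)
    (hd : ∀ d : Fin 4 → ℂ, d (σ 0) - 2 * d (σ 1) + d (σ 2) = 0 →
      Matrix.diagonal d ∈ Submodule.span ℂ (Set.range A))
    (hN : Matrix.single (σ 0) (σ 1) p + Matrix.single (σ 1) (σ 2) q ∈
      Submodule.span ℂ (Set.range A)) :
    LinearlyIsomorphic D TableRow.cone₄.divisor := by
  refine hA.linearlyIsomorphic_of_perm .cone₄ ((Equiv.swap 0 2).trans σ) ![-2 / q, 1, p, 1] ?_ ?_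
  · intro i
    fin_cases i <;> simp [hp, hq]
  · have h0 : (Equiv.swap (0 : Fin 4) 2) 0 = 2 := by decide
    have h1 : (Equiv.swap (0 : Fin 4) 2) 1 = 1 := by decide
    have h2 : (Equiv.swap (0 : Fin 4) 2) 2 = 0 := by decide
    have h3 : (Equiv.swap (0 : Fin 4) 2) 3 = 3 := by decide
    intro i
    fin_cases i
    · convert hd (![1, 1, 1, 0] ∘ σ.symm) (by simp; norm_num) using 1
      ext a b
      obtain ⟨a, rfl⟩ := σ.surjective a
      obtain ⟨b, rfl⟩ := σ.surjective b
      fin_cases a <;> fin_cases b <;>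
        simp [TableRow.basis, TableRow.element, hp, hq, h0, h1, h2, h3]
    · convert hd (![-2, 1, 4, 0] ∘ σ.symm) (by simp; norm_num) using 1
      ext a b
      obtain ⟨a, rfl⟩ := σ.surjective a
      obtain ⟨b, rfl⟩ := σ.surjective b
      fin_cases a <;> fin_cases b <;>
        simp [TableRow.basis, TableRow.element, hq, h0, h1, h2, h3] <;>
        field_simp
    · convert hN using 1
      ext a b
      obtain ⟨a, rfl⟩ := σ.surjective a
      obtain ⟨b, rfl⟩ := σ.surjective b
      fin_cases a <;> fin_cases b <;>
        simp [TableRow.basis, TableRow.element, h0, h1, h2, h3]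
    · convert hd (![0, 0, 0, 1] ∘ σ.symm) (by simp) using 1
      ext a b
      obtain ⟨a, rfl⟩ := σ.surjective a
      obtain ⟨b, rfl⟩ := σ.surjective b
      fin_cases a <;> fin_cases b <;>
        simp [TableRow.basis, TableRow.element, h0, h1, h2, h3]

/-- In contrast to the cone, where the two nilpotent entries form a chain, they join disjoint pairs
of indices here. In both cases the torus is the full set of weights equal on the two entries. -/
theorem linearlyIsomorphic_quadric {D : Set (Fin 4 → ℂ)} {A : Fin 4 → Matrix (Fin 4) (Fin 4) ℂ}
    (hA : IsLinearBasis D A) (σ : Equiv.Perm (Fin 4)) {p q : ℂ} (hp : p ≠ 0) (hq : q ≠ 0)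
    (hd : ∀ d : Fin 4 → ℂ, d (σ 0) - d (σ 1) = d (σ 2) - d (σ 3) →
      Matrix.diagonal d ∈ Submodule.span ℂ (Set.range A))
    (hN : Matrix.single (σ 0) (σ 1) p + Matrix.single (σ 2) (σ 3) q ∈
      Submodule.span ℂ (Set.range A)) :
    LinearlyIsomorphic D TableRow.quadric.divisor := by
  -- the coordinates `x, y, z, w` are, up to factors, those with indices `σ 1, σ 3, σ 0, σ 2`
  let τ : Equiv.Perm (Fin 4) := ⟨![1, 3, 0, 2], ![2, 0, 3, 1], by decide, by decide⟩
  have h0 : τ.symm 0 = 2 := rfl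
  have h1 : τ.symm 1 = 0 := rfl
  have h2 : τ.symm 2 = 3 := rfl
  have h3 : τ.symm 3 = 1 := rfl
  refine hA.linearlyIsomorphic_of_perm .quadric (τ.trans σ) ![1, 1, p, -q] ?_ ?_
  · intro i
    fin_cases i <;> simp [hp, hq]
  · intro i
    fin_cases i
    · convert hd (![0, 1, -1, 0] ∘ σ.symm) (by simp) using 1
      ext a b
      obtain ⟨a, rfl⟩ := σ.surjective a
      obtain ⟨b, rfl⟩ := σ.surjective b
      fin_cases a <;> fin_cases b <;>
        simp [TableRow.basis, TableRow.element, hq, h0, h1, h2, h3]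
    · convert hd (![0, 0, 1, 1] ∘ σ.symm) (by simp) using 1
      ext a b
      obtain ⟨a, rfl⟩ := σ.surjective a
      obtain ⟨b, rfl⟩ := σ.surjective b
      fin_cases a <;> fin_cases b <;>
        simp [TableRow.basis, TableRow.element, hq, h0, h1, h2, h3]
    · convert hd (![1, 0, 1, 0] ∘ σ.symm) (by simp) using 1
      ext a b
      obtain ⟨a, rfl⟩ := σ.surjective a
      obtain ⟨b, rfl⟩ := σ.surjective b
      fin_cases a <;> fin_cases b <;>
        simp [TableRow.basis, TableRow.element, hp, hq, h0, h1, h2, h3]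
    · convert hN using 1
      ext a b
      obtain ⟨a, rfl⟩ := σ.surjective a
      obtain ⟨b, rfl⟩ := σ.surjective b
      fin_cases a <;> fin_cases b <;>
        simp [TableRow.basis, TableRow.element, h0, h1, h2, h3]

theorem linearlyIsomorphic_cubic {D : Set (Fin 4 → ℂ)} {A : Fin 4 → Matrix (Fin 4) (Fin 4) ℂ}
    (hA : IsLinearBasis D A) {p q : ℂ} (hp : p ≠ 0) (hq : q ≠ 0)
    (h1 : Matrix.diagonal (1 : Fin 4 → ℂ) ∈ Submodule.span ℂ (Set.range A))
    (hS : Matrix.diagonal ![0, 1, 2, 3] ∈ Submodule.span ℂ (Set.range A))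
    (hN : Matrix.single 0 1 1 + Matrix.single 1 2 p + Matrix.single 2 3 q ∈
      Submodule.span ℂ (Set.range A))
    (hN' : Matrix.single 0 2 1 + Matrix.single 1 3 q ∈ Submodule.span ℂ (Set.range A)) :
    LinearlyIsomorphic D TableRow.cubic.divisor := by
  refine hA.linearlyIsomorphic_of_perm .cubic (Equiv.refl _) ![1, 1, p⁻¹, (p * q)⁻¹] ?_ ?_
  · intro i
    fin_cases i <;> simp [hp, hq]
  · intro i
    fin_cases i
    · convert h1 using 1
      ext a b
      fin_cases a <;> fin_cases b <;> simp [TableRow.basis, TableRow.element, hp, hq]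
    · convert hS using 1
      ext a b
      fin_cases a <;> fin_cases b <;> simp [TableRow.basis, TableRow.element, hp, hq] <;> field_simp
    · convert hN using 1
      ext a b
      fin_cases a <;> fin_cases b <;> simp [TableRow.basis, TableRow.element] <;> field_simp
    -- The factor `p` compensates for the rescaling of the third and fourth coordinates.
    · convert Submodule.smul_mem _ p hN' using 1
      ext a b
      fin_cases a <;> fin_cases b <;> simp [TableRow.basis, TableRow.element]

end IsLinearBasis

namespace IsLinearBasis

variable {n : ℕ} {D : Set (Fin n → ℂ)} {A : Fin n → Matrix (Fin n) (Fin n) ℂ}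

/-- If the strictly triangular part is a line, it is a weight space. -/
theorem sub_eq_sub_of_strict (hA : IsLinearBasis D A) {N : Matrix (Fin n) (Fin n) ℂ}
    (hN : N ∈ Submodule.span ℂ (Set.range A)) (hNs : ∀ i j, j ≤ i → N i j = 0)
    (h : ∀ N' ∈ Submodule.span ℂ (Set.range A), (∀ i j, j ≤ i → N' i j = 0) → ∃ c : ℂ, N' = c • N)
    {d : Fin n → ℂ} (hd : Matrix.diagonal d ∈ Submodule.span ℂ (Set.range A)) {i j k l : Fin n}
    (hij : N i j ≠ 0) (hkl : N k l ≠ 0) : d i - d j = d k - d l := by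
  -- The weight component of `N` through the entry `(i, j)` is a multiple of `N`. That entry shows
  -- that the multiple is `N` itself, so all nonzero entries have this weight.
  obtain ⟨c, hc⟩ := h _ (hA.weight_component_mem hd hN (d i - d j)) fun a b hab => by
    simp [hNs a b hab]
  have h1 := congrFun (congrFun hc i) j
  have h2 := congrFun (congrFun hc k) l
  simp only [Matrix.of_apply, if_true, Matrix.smul_apply, smul_eq_mul] at h1 h2
  have h3 : c = 1 := mul_right_cancel₀ hij (by rw [one_mul, ← h1])
  by_contra hne
  rw [if_neg (Ne.symm hne), h3, one_mul] at h2
  exact hkl h2.symm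

end IsLinearBasis

/-! ### Triangular classification in dimensions one to three -/

theorem IsLinearBasis.exists_row₁ {D : Set (Fin 1 → ℂ)} {A : Fin 1 → Matrix (Fin 1) (Fin 1) ℂ}
    (hA : IsLinearBasis D A) : ∃ r : TableRow 1, LinearlyIsomorphic D r.divisor := by
  refine hA.linearlyIsomorphic_of_forall_diagonal (fun d => ?_) le_rfl (by norm_num)
  convert Submodule.smul_mem _ (d 0) hA.one_mem using 1
  ext i j
  fin_cases i; fin_cases j
  simp

namespace IsTriangularBasis

theorem exists_row₂ {D : Set (Fin 2 → ℂ)} {A : Fin 2 → Matrix (Fin 2) (Fin 2) ℂ}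
    (hA : IsTriangularBasis D A) : ∃ r : TableRow 2, LinearlyIsomorphic D r.divisor := by
  obtain ⟨S, hS, h0, h1⟩ := hA.exists_weight_ne (m := 0)
  refine hA.linearlyIsomorphic_of_forall_diagonal (fun d => ?_) (by norm_num) (by norm_num)
  convert add_mem (Submodule.smul_mem _ (d 0) hA.one_mem)
    (Submodule.smul_mem _ (d 1 - d 0) hS) using 1
  ext i j
  fin_cases i <;> fin_cases j <;> simp [h0, h1]

/-- If the torus is not everything, it is spanned by 1 and `S`, and one strictly triangular `N`
completes the basis. Excluding `x₀²` gives `N 1 2 ≠ 0`, equality of weights then gives `N 0 2 = 0`,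
and excluding `x₁²` gives `N 0 1 ≠ 0`. The weights are now 0, 1, 2: the cone. -/
theorem exists_row₃ {D : Set (Fin 3 → ℂ)} {A : Fin 3 → Matrix (Fin 3) (Fin 3) ℂ}
    (hA : IsTriangularBasis D A) : ∃ r : TableRow 3, LinearlyIsomorphic D r.divisor := by
  obtain ⟨S, hS, hS0, hS1⟩ := hA.exists_weight_ne (m := 1)
  set g := Submodule.span ℂ (Set.range A) with hg
  let T : Submodule ℂ (Fin 3 → ℂ) := g.comap (Matrix.diagonalLinearMap (Fin 3) ℂ ℂ)
  have h1T : (1 : Fin 3 → ℂ) ∈ T := hA.diagonal_one_mem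
  have hST : S ∈ T := hS
  by_cases hu : ∃ u : ℂ, u ≠ 0 ∧ ![0, 0, u] ∈ T
  · obtain ⟨u, hu0, hu⟩ := hu
    refine hA.linearlyIsomorphic_of_forall_diagonal (fun d => ?_) (by norm_num) (by norm_num)
    change d ∈ T
    convert add_mem (add_mem (T.smul_mem (d 0) h1T) (T.smul_mem (d 1 - d 0) hST))
      (T.smul_mem ((d 2 - d 0 - (d 1 - d 0) * S 2) / u) hu) using 1
    ext i
    fin_cases i <;> simp [hS0, hS1, hu0]
  push Not at hu
  obtain ⟨𝔫, h𝔫, hs, hdim⟩ := hA.exists_strict (s := 2) (t := ![1, S]) fun d hd => by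
    have hdT : d ∈ T := hd
    have h2 : ![0, 0, d 2 - d 0 - (d 1 - d 0) * S 2] ∈ T := by
      convert sub_mem (sub_mem hdT (T.smul_mem (d 0) h1T)) (T.smul_mem (d 1 - d 0) hST) using 1
      ext i
      fin_cases i <;> simp [hS0, hS1]
    have h3 : d 2 - d 0 - (d 1 - d 0) * S 2 = 0 := by
      by_contra h
      exact hu _ h h2
    refine (Submodule.mem_span_range_iff_exists_fun ℂ).2 ⟨![d 0, d 1 - d 0], ?_⟩
    ext i
    fin_cases i
    · simp [Fin.sum_univ_succ, hS0]
    · simp [Fin.sum_univ_succ, hS1]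
    · simp [Fin.sum_univ_succ]
      linear_combination -h3
  have : Nontrivial 𝔫 := Module.nontrivial_of_finrank_pos (R := ℂ) (by omega)
  obtain ⟨⟨N, hN𝔫⟩, hN0⟩ := exists_ne (0 : 𝔫)
  have hN : N ∈ g := h𝔫 hN𝔫
  have hNs := hs N hN𝔫
  replace hN0 : ∃ i j, N i j ≠ 0 := by
    by_contra! h
    exact hN0 (Subtype.ext (Matrix.ext h))
  have hNd : ∀ i, N i i = 0 := fun i => hNs i i le_rfl
  have h10 : N 1 0 = 0 := hNs 1 0 (by decide)
  have h20 : N 2 0 = 0 := hNs 2 0 (by decide)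
  have h21 : N 2 1 = 0 := hNs 2 1 (by decide)
  have hli : LinearIndependent ℂ ![1, Matrix.diagonal S, N] := by
    rw [Fintype.linearIndependent_iff]
    intro c hc
    have e : ∀ i j, c 0 * (1 : Matrix (Fin 3) (Fin 3) ℂ) i j + c 1 * Matrix.diagonal S i j +
        c 2 * N i j = 0 := fun i j => by
      have := congrFun (congrFun hc i) j
      simpa [Fin.sum_univ_succ, add_assoc] using this
    have e0 : c 0 = 0 := by simpa [hS0, hNd] using e 0 0
    have e1 : c 1 = 0 := by simpa [hS1, hNd, e0] using e 1 1
    obtain ⟨i, j, hij⟩ := hN0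
    have e2 : c 2 = 0 := by simpa [e0, e1, hij] using e i j
    intro k
    fin_cases k <;> assumption
  obtain ⟨hspan, hA'⟩ := hA.of_linearIndependent (A' := ![1, Matrix.diagonal S, N])
    (fun i => by fin_cases i <;> [exact hA.one_mem; exact hS; exact hN]) hli
  have hline : ∀ N' ∈ g, (∀ i j, j ≤ i → N' i j = 0) → ∃ c : ℂ, N' = c • N := by
    intro N' hN' hs'
    rw [hg, ← hspan, Submodule.mem_span_range_iff_exists_fun] at hN'
    obtain ⟨c, hc⟩ := hN'
    have e : ∀ i j, c 0 * (1 : Matrix (Fin 3) (Fin 3) ℂ) i j + c 1 * Matrix.diagonal S i j +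
        c 2 * N i j = N' i j := fun i j => by
      have := congrFun (congrFun hc i) j
      simpa [Fin.sum_univ_succ, add_assoc] using this
    have e0 : c 0 = 0 := by simpa [hS0, hNd, hs'] using e 0 0
    have e1 : c 1 = 0 := by simpa [hS1, hNd, hs', e0] using e 1 1
    refine ⟨c 2, ?_⟩
    ext i j
    simpa [e0, e1] using (e i j).symm
  have hw : ∀ {i j k l : Fin 3}, N i j ≠ 0 → N k l ≠ 0 → S i - S j = S k - S l :=
    fun hij hkl => hA.sub_eq_sub_of_strict hN hNs hline hS hij hkl
  have hx : ∀ i, AnalyticAt ℂ (fun x : Fin 3 → ℂ => x i) 0 := fun i =>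
    (ContinuousLinearMap.proj (R := ℂ) (φ := fun _ : Fin 3 => ℂ) i).analyticAt 0
  have hF : ∀ x, saitoDet ![1, Matrix.diagonal S, N] x =
      x 0 * (N 1 2 * x 1 ^ 2 + N 0 2 * x 0 * x 1 - S 2 * N 0 1 * x 0 * x 2) := by
    intro x
    have e : ∀ j, (x ᵥ* N) j = x 0 * N 0 j + x 1 * N 1 j + x 2 * N 2 j := fun j => by
      simp only [Matrix.vecMul, dotProduct, Fin.sum_univ_three]
    rw [saitoDet, Matrix.det_fin_three]
    simp only [Matrix.of_apply, Matrix.cons_val, Matrix.vecMul_one, Matrix.vecMul_diagonal, e, h10,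
      h20, h21, hNd, hS0, hS1]
    ring
  have h12 : N 1 2 ≠ 0 := by
    intro h
    refine hA'.saitoDet_ne_sq_mul 0 (K := fun x => N 0 2 * x 1 - S 2 * N 0 1 * x 2)
      ((analyticAt_const.mul (hx 1)).sub (analyticAt_const.mul (hx 2))) fun x => ?_
    rw [hF, h]
    ring
  have h02 : N 0 2 = 0 := by
    by_contra h
    have := hw h h12
    rw [hS0, hS1] at this
    exact zero_ne_one (sub_left_injective this)
  have h012 : S 2 * N 0 1 ≠ 0 := by
    intro h
    refine hA'.saitoDet_ne_sq_mul 1 (K := fun x => N 1 2 * x 0) (analyticAt_const.mul (hx 0)) fun x => ?_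
    rw [hF, h, h02]
    ring
  have h01 : N 0 1 ≠ 0 := right_ne_zero_of_mul h012
  have hS2 : S 2 = 2 := by
    have := hw h01 h12
    rw [hS0, hS1] at this
    linear_combination this
  refine ⟨_, hA.linearlyIsomorphic_cone₃ h01 h12 (fun d hd => ?_) ?_⟩
  · change d ∈ T
    convert add_mem (T.smul_mem (d 0) h1T) (T.smul_mem (d 1 - d 0) hST) using 1
    ext i
    fin_cases i
    · simp [hS0]
    · simp [hS1]
    · simp [hS2]
      linear_combination hd
  · convert hN using 1
    ext i j
    fin_cases i <;> fin_cases j <;> simp [hNd, h10, h20, h21, h02]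

end IsTriangularBasis

/-! ### Triangular classification in dimension four -/

theorem Matrix.det_fin_four {R : Type*} [CommRing R] (M : Matrix (Fin 4) (Fin 4) R) :
    M.det =
      M 0 0 * (M 1 1 * (M 2 2 * M 3 3 - M 2 3 * M 3 2) - M 1 2 * (M 2 1 * M 3 3 - M 2 3 * M 3 1) +
        M 1 3 * (M 2 1 * M 3 2 - M 2 2 * M 3 1)) -
      M 0 1 * (M 1 0 * (M 2 2 * M 3 3 - M 2 3 * M 3 2) - M 1 2 * (M 2 0 * M 3 3 - M 2 3 * M 3 0) +
        M 1 3 * (M 2 0 * M 3 2 - M 2 2 * M 3 0)) +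
      M 0 2 * (M 1 0 * (M 2 1 * M 3 3 - M 2 3 * M 3 1) - M 1 1 * (M 2 0 * M 3 3 - M 2 3 * M 3 0) +
        M 1 3 * (M 2 0 * M 3 1 - M 2 1 * M 3 0)) -
      M 0 3 * (M 1 0 * (M 2 1 * M 3 2 - M 2 2 * M 3 1) - M 1 1 * (M 2 0 * M 3 2 - M 2 2 * M 3 0) +
        M 1 2 * (M 2 0 * M 3 1 - M 2 1 * M 3 0)) := by
  rw [Matrix.det_succ_row_zero]
  simp [Fin.sum_univ_succ, Matrix.det_fin_three, Matrix.submatrix_apply, Fin.succAbove]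
  ring

/-- A functional vanishing on the kernel of another one is a multiple of it. -/
theorem LinearMap.apply_eq_zero_of_ker_le {K V : Type*} [Field K] [AddCommGroup V] [Module K V]
    {α ρ : V →ₗ[K] K} (h : ∀ d, α d = 0 → ρ d = 0) (hρ : ∃ e, ρ e ≠ 0) {d : V} (hd : ρ d = 0) :
    α d = 0 := by
  by_contra hα
  obtain ⟨e, he⟩ := hρ
  have h1 := h (e - (α e / α d) • d) (by simp [hα])
  rw [map_sub, map_smul, hd, smul_zero, sub_zero] at h1
  exact he h1

namespace IsTriangularBasis

variable {D : Set (Fin 4 → ℂ)} {A : Fin 4 → Matrix (Fin 4) (Fin 4) ℂ}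

/-- The solvable linear free divisors of dimension four with a torus of dimension at least
three. -/
theorem exists_row₄_of_weight (hA : IsTriangularBasis D A) {S : Fin 4 → ℂ}
    (hS : Matrix.diagonal S ∈ Submodule.span ℂ (Set.range A)) (hS0 : S 0 = 0) (hS1 : S 1 = 1)
    {u v : ℂ} (huv : ¬ (u = 0 ∧ v = 0))
    (hU : Matrix.diagonal ![0, 0, u, v] ∈ Submodule.span ℂ (Set.range A)) :
    ∃ r : TableRow 4, LinearlyIsomorphic D r.divisor := by
  set g := Submodule.span ℂ (Set.range A) with hg
  let T : Submodule ℂ (Fin 4 → ℂ) := g.comap (Matrix.diagonalLinearMap (Fin 4) ℂ ℂ)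
  have h1T : (1 : Fin 4 → ℂ) ∈ T := hA.diagonal_one_mem
  have hST : S ∈ T := hS
  have hUT : ![0, 0, u, v] ∈ T := hU
  have hT : ∀ d : Fin 4 → ℂ,
      ![0, 0, d 2 - d 0 - (d 1 - d 0) * S 2, d 3 - d 0 - (d 1 - d 0) * S 3] =
        d - d 0 • (1 : Fin 4 → ℂ) - (d 1 - d 0) • S := by
    intro d
    ext i
    fin_cases i <;> simp [hS0, hS1]
  have hT' : ∀ d : Fin 4 → ℂ,
      ![0, 0, d 2 - d 0 - (d 1 - d 0) * S 2, d 3 - d 0 - (d 1 - d 0) * S 3] ∈ T → d ∈ T := by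
    intro d hd
    rw [hT] at hd
    convert add_mem hd (add_mem (T.smul_mem (d 0) h1T) (T.smul_mem (d 1 - d 0) hST)) using 1
    abel
  by_cases hpq : ∃ p q : ℂ, ![0, 0, p, q] ∈ T ∧ u * q - v * p ≠ 0
  · obtain ⟨p, q, hpqT, hne⟩ := hpq
    refine hA.linearlyIsomorphic_of_forall_diagonal (fun d => ?_) (by norm_num) (by norm_num)
    refine hT' d ?_
    generalize d 2 - d 0 - (d 1 - d 0) * S 2 = a
    generalize d 3 - d 0 - (d 1 - d 0) * S 3 = b
    have hk : (u * q - v * p)⁻¹ * (u * q - v * p) = 1 := inv_mul_cancel₀ hne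
    convert add_mem (T.smul_mem ((u * q - v * p)⁻¹ * (a * q - b * p)) hUT)
      (T.smul_mem ((u * q - v * p)⁻¹ * (u * b - v * a)) hpqT) using 1
    ext i
    fin_cases i
    · simp
    · simp
    · simp
      linear_combination -a * hk
    · simp
      linear_combination -b * hk
  push Not at hpq
  -- the torus is the kernel of the functional with the following coefficients
  set a1 : ℂ := v * S 2 - u * S 3 with ha1
  let α : (Fin 4 → ℂ) →ₗ[ℂ] ℂ := Fintype.linearCombination ℂ ![-(a1 - v + u), a1, -v, u]
  have hα : ∀ d, α d = -(a1 - v + u) * d 0 + a1 * d 1 - v * d 2 + u * d 3 := by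
    intro d
    simp only [α, Fintype.linearCombination_apply, Fin.sum_univ_four, smul_eq_mul, Matrix.cons_val]
    ring
  have hTα : ∀ d ∈ T, α d = 0 := by
    intro d hd
    have h1 := hpq _ _ (by
      rw [hT d]
      exact sub_mem (sub_mem hd (T.smul_mem _ h1T)) (T.smul_mem _ hST))
    rw [hα, ha1]
    linear_combination h1
  have hUmul : ∀ a b : ℂ, u * b - v * a = 0 → ∃ c : ℂ, a = c * u ∧ b = c * v := by
    intro a b hab
    by_cases hu : u = 0
    · have hv : v ≠ 0 := fun hv => huv ⟨hu, hv⟩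
      refine ⟨b / v, ?_, by field_simp⟩
      rw [hu, zero_mul, zero_sub, neg_eq_zero] at hab
      rw [(mul_eq_zero.1 hab).resolve_left hv, hu, mul_zero]
    · refine ⟨a / u, by field_simp, ?_⟩
      field_simp
      linear_combination hab
  have hαT' : ∀ d, α d = 0 → ∃ c : ℂ, d = d 0 • (1 : Fin 4 → ℂ) + (d 1 - d 0) • S +
      c • ![0, 0, u, v] := by
    intro d hd
    obtain ⟨c, hc1, hc2⟩ := hUmul (d 2 - d 0 - (d 1 - d 0) * S 2) (d 3 - d 0 - (d 1 - d 0) * S 3)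
      (by rw [hα, ha1] at hd; linear_combination hd)
    refine ⟨c, ?_⟩
    ext i
    fin_cases i
    · simp [hS0]
    · simp [hS1]
    · simp
      linear_combination hc1
    · simp
      linear_combination hc2
  have hαT : ∀ d, α d = 0 → d ∈ T := by
    intro d hd
    obtain ⟨c, hc⟩ := hαT' d hd
    rw [hc]
    exact add_mem (add_mem (T.smul_mem _ h1T) (T.smul_mem _ hST)) (T.smul_mem _ hUT)
  obtain ⟨𝔫, h𝔫, hs, hdim⟩ := hA.exists_strict (s := 3) (t := ![1, S, ![0, 0, u, v]])
    fun d hd => by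
      obtain ⟨c, hc⟩ := hαT' d (hTα d hd)
      refine (Submodule.mem_span_range_iff_exists_fun ℂ).2 ⟨![d 0, d 1 - d 0, c], ?_⟩
      rw [Fin.sum_univ_three]
      exact hc.symm
  have : Nontrivial 𝔫 := Module.nontrivial_of_finrank_pos (R := ℂ) (by omega)
  obtain ⟨⟨N, hN𝔫⟩, hN0⟩ := exists_ne (0 : 𝔫)
  have hN : N ∈ g := h𝔫 hN𝔫
  have hNs := hs N hN𝔫
  replace hN0 : ∃ i j, N i j ≠ 0 := by
    by_contra! h
    exact hN0 (Subtype.ext (Matrix.ext h))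
  have hNd : ∀ i, N i i = 0 := fun i => hNs i i le_rfl
  have h10 : N 1 0 = 0 := hNs 1 0 (by decide)
  have h20 : N 2 0 = 0 := hNs 2 0 (by decide)
  have h21 : N 2 1 = 0 := hNs 2 1 (by decide)
  have h30 : N 3 0 = 0 := hNs 3 0 (by decide)
  have h31 : N 3 1 = 0 := hNs 3 1 (by decide)
  have h32 : N 3 2 = 0 := hNs 3 2 (by decide)
  set A' : Fin 4 → Matrix (Fin 4) (Fin 4) ℂ :=
    ![1, Matrix.diagonal S, Matrix.diagonal ![0, 0, u, v], N] with hA'def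
  have hsum : ∀ (c : Fin 4 → ℂ) (i j : Fin 4), (∑ k, c k • A' k) i j =
      c 0 * (1 : Matrix (Fin 4) (Fin 4) ℂ) i j + c 1 * Matrix.diagonal S i j +
        c 2 * Matrix.diagonal ![0, 0, u, v] i j + c 3 * N i j := by
    intro c i j
    rw [Fin.sum_univ_four]
    rfl
  have hcoef : ∀ c : Fin 4 → ℂ, (∀ i, (∑ k, c k • A' k) i i = 0) → c 0 = 0 ∧ c 1 = 0 ∧ c 2 = 0 := by
    intro c hc
    have e0 : c 0 = 0 := by simpa [hS0, hNd] using (hsum c 0 0).symm.trans (hc 0)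
    have e1 : c 1 = 0 := by simpa [hS1, hNd, e0] using (hsum c 1 1).symm.trans (hc 1)
    have e2 := (hsum c 2 2).symm.trans (hc 2)
    have e3 := (hsum c 3 3).symm.trans (hc 3)
    simp only [e0, e1, hNd, Matrix.diagonal_apply_eq, Matrix.cons_val, zero_mul, mul_zero, zero_add,
      add_zero, mul_eq_zero] at e2 e3
    refine ⟨e0, e1, ?_⟩
    by_contra h
    exact huv ⟨e2.resolve_left h, e3.resolve_left h⟩
  have hli : LinearIndependent ℂ A' := by
    rw [Fintype.linearIndependent_iff]
    intro c hc
    obtain ⟨e0, e1, e2⟩ := hcoef c fun i => by rw [hc]; rfl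
    obtain ⟨i, j, hij⟩ := hN0
    have e3 : c 3 = 0 := by
      have := hsum c i j
      rw [hc] at this
      simpa [e0, e1, e2, hij] using this.symm
    intro k
    fin_cases k <;> assumption
  obtain ⟨hspan, hA'⟩ := hA.of_linearIndependent (A' := A')
    (fun i => by fin_cases i <;> [exact hA.one_mem; exact hS; exact hU; exact hN]) hli
  have hline : ∀ N' ∈ g, (∀ i j, j ≤ i → N' i j = 0) → ∃ c : ℂ, N' = c • N := by
    intro N' hN' hs'
    rw [hg, ← hspan, Submodule.mem_span_range_iff_exists_fun] at hN'
    obtain ⟨c, rfl⟩ := hN'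
    obtain ⟨e0, e1, e2⟩ := hcoef c fun i => hs' i i le_rfl
    refine ⟨c 3, ?_⟩
    ext i j
    rw [hsum, e0, e1, e2, zero_mul, zero_mul, zero_mul, zero_add, zero_add, zero_add]
    rfl
  have hw : ∀ {i j k l : Fin 4}, N i j ≠ 0 → N k l ≠ 0 → ∀ d, α d = 0 → d i - d j = d k - d l :=
    fun hij hkl d hd => hA.sub_eq_sub_of_strict hN hNs hline (hαT d hd) hij hkl
  -- The torus, the kernel of `α`, lies in the kernel of the functional comparing the weights of two
  -- nonzero entries. If that functional is not zero, the kernels coincide, so two entries determine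
  -- the torus.
  have hw' : ∀ {i j k l : Fin 4}, N i j ≠ 0 → N k l ≠ 0 →
      (∃ e : Fin 4 → ℂ, e i - e j ≠ e k - e l) → ∀ d : Fin 4 → ℂ, d i - d j = d k - d l →
      α d = 0 := by
    rintro i j k l hij hkl ⟨e, he⟩ d hd
    let p : Fin 4 → (Fin 4 → ℂ) →ₗ[ℂ] ℂ := fun i => LinearMap.proj i
    let ρ : (Fin 4 → ℂ) →ₗ[ℂ] ℂ := (p i - p j) - (p k - p l)
    exact LinearMap.apply_eq_zero_of_ker_le (ρ := ρ)
      (fun d hd => sub_eq_zero.2 (hw hij hkl d hd)) ⟨e, sub_ne_zero.2 he⟩ (sub_eq_zero.2 hd)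
  -- A test element `d` of the torus with weight -1 on two nonzero entries has weight -1 on every
  -- nonzero entry. The numbers 10 and 11 in the test elements below keep all other differences away
  -- from -1.
  have hkill : ∀ {i j k l : Fin 4}, N i j ≠ 0 → N k l ≠ 0 →
      (∃ e : Fin 4 → ℂ, e i - e j ≠ e k - e l) → ∀ d : Fin 4 → ℂ, d i - d j = -1 →
      d k - d l = -1 → ∀ p q, d p - d q ≠ -1 → N p q = 0 := by
    intro i j k l hij hkl he d hd hd' p q hpq
    by_contra h
    exact hpq ((hw h hkl d (hw' hij hkl he d (hd.trans hd'.symm))).trans hd')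
  have hx : ∀ i, AnalyticAt ℂ (fun x : Fin 4 → ℂ => x i) 0 := fun i =>
    (ContinuousLinearMap.proj (R := ℂ) (φ := fun _ : Fin 4 => ℂ) i).analyticAt 0
  have hF : ∀ x, saitoDet A' x =
      x 0 * (a1 * N 0 1 * x 0 * x 2 * x 3 - v * N 0 2 * x 0 * x 1 * x 3 -
        v * N 1 2 * x 1 ^ 2 * x 3 + u * N 0 3 * x 0 * x 1 * x 2 + u * N 1 3 * x 1 ^ 2 * x 2 +
        u * N 2 3 * x 1 * x 2 ^ 2) := by
    intro x
    have e : ∀ j, (x ᵥ* N) j = x 0 * N 0 j + x 1 * N 1 j + x 2 * N 2 j + x 3 * N 3 j := fun j => by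
      simp only [Matrix.vecMul, dotProduct, Fin.sum_univ_four]
    rw [saitoDet, Matrix.det_fin_four, ha1]
    simp only [hA'def, Matrix.of_apply, Matrix.cons_val, Matrix.vecMul_one, Matrix.vecMul_diagonal,
      e, h10, h20, h21, h30, h31, h32, hNd, hS0, hS1]
    ring
  have hNe : ∀ {i j k l : Fin 4}, N i j ≠ 0 → N k l ≠ 0 → (i, j) ≠ (k, l) →
      (∃ e : Fin 4 → ℂ, e i - e j ≠ e k - e l) → ∀ d : Fin 4 → ℤ, d i - d j = -1 →
      d k - d l = -1 → (∀ a b, a < b → (a, b) ≠ (i, j) → (a, b) ≠ (k, l) → d a - d b ≠ -1) →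
      Matrix.single i j (N i j) + Matrix.single k l (N k l) ∈ g := by
    intro i j k l hij hkl hne he d hd hd' hd''
    convert hN using 1
    ext a b
    rw [Matrix.add_apply, Matrix.single_apply, Matrix.single_apply]
    by_cases h1 : i = a ∧ j = b
    · obtain ⟨rfl, rfl⟩ := h1
      rw [if_pos ⟨rfl, rfl⟩, if_neg, add_zero]
      rintro ⟨rfl, rfl⟩
      exact hne rfl
    rw [if_neg h1, zero_add]
    by_cases h2 : k = a ∧ l = b
    · obtain ⟨rfl, rfl⟩ := h2
      rw [if_pos ⟨rfl, rfl⟩]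
    rw [if_neg h2]
    rcases le_or_gt b a with hab | hab
    · exact (hNs a b hab).symm
    · refine (hkill hij hkl he (fun i => d i) (by exact_mod_cast hd) (by exact_mod_cast hd') a b
        ?_).symm
      have := hd'' a b hab (fun h => h1 (by simpa [eq_comm] using h))
        (fun h => h2 (by simpa [eq_comm] using h))
      exact_mod_cast this
  have cone : ∀ σ : Equiv.Perm (Fin 4), N (σ 0) (σ 1) ≠ 0 → N (σ 1) (σ 2) ≠ 0 →
      ∀ d : Fin 4 → ℤ, d (σ 0) - d (σ 1) = -1 → d (σ 1) - d (σ 2) = -1 →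
      (∀ a b, a < b → (a, b) ≠ (σ 0, σ 1) → (a, b) ≠ (σ 1, σ 2) → d a - d b ≠ -1) →
      ∃ r : TableRow 4, LinearlyIsomorphic D r.divisor := by
    intro σ hp hq d hd hd' hd''
    have he : ∃ e : Fin 4 → ℂ, e (σ 0) - e (σ 1) ≠ e (σ 1) - e (σ 2) :=
      ⟨Pi.single (σ 0) 1, by simp⟩
    refine ⟨_, hA.linearlyIsomorphic_cone₄ σ hp hq (fun d hd => ?_)
      (hNe hp hq (by simp) he d hd hd' hd'')⟩
    exact hαT d (hw' hp hq he d (by linear_combination hd))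
  have quadric : ∀ σ : Equiv.Perm (Fin 4), N (σ 0) (σ 1) ≠ 0 → N (σ 2) (σ 3) ≠ 0 →
      ∀ d : Fin 4 → ℤ, d (σ 0) - d (σ 1) = -1 → d (σ 2) - d (σ 3) = -1 →
      (∀ a b, a < b → (a, b) ≠ (σ 0, σ 1) → (a, b) ≠ (σ 2, σ 3) → d a - d b ≠ -1) →
      ∃ r : TableRow 4, LinearlyIsomorphic D r.divisor := by
    intro σ hp hq d hd hd' hd''
    have he : ∃ e : Fin 4 → ℂ, e (σ 0) - e (σ 1) ≠ e (σ 2) - e (σ 3) :=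
      ⟨Pi.single (σ 0) 1, by simp⟩
    exact ⟨_, hA.linearlyIsomorphic_quadric σ hp hq (fun d hd => hαT d (hw' hp hq he d hd))
      (hNe hp hq (by simp) he d hd hd' hd'')⟩
  -- Without the terms in `N 1 2`, `N 1 3` and `N 2 3` the determinant would contain `x₀²`. Given
  -- one of these entries, a second nonzero entry must exist or another square appears; a chain of
  -- two entries gives the cone, two disjoint ones the quadric.
  by_cases c12 : v * N 1 2 = 0
  · by_cases c23 : u * N 2 3 = 0
    · by_cases c13 : u * N 1 3 = 0
      · refine absurd (fun x => ?_) (hA'.saitoDet_ne_sq_mul 0 (K := fun x =>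
          a1 * N 0 1 * x 2 * x 3 - v * N 0 2 * x 1 * x 3 + u * N 0 3 * x 1 * x 2)
          ((((analyticAt_const.mul (hx 2)).mul (hx 3)).sub
            ((analyticAt_const.mul (hx 1)).mul (hx 3))).add
            ((analyticAt_const.mul (hx 1)).mul (hx 2))))
        rw [hF, c12, c23, c13]
        ring
      · have n13 : N 1 3 ≠ 0 := right_ne_zero_of_mul c13
        by_cases n01 : N 0 1 = 0
        · by_cases n02 : N 0 2 = 0
          · have n03 : N 0 3 = 0 := by
              by_contra n03
              have := hw n03 n13 S (hTα S hST)
              rw [hS0, hS1] at this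
              exact zero_ne_one (sub_left_injective this)
            refine absurd (fun x => ?_) (hA'.saitoDet_ne_sq_mul 1 (K := fun x =>
              u * N 1 3 * x 0 * x 2) ((analyticAt_const.mul (hx 0)).mul (hx 2)))
            rw [hF, c12, c23, n01, n02, n03]
            ring
          · exact quadric ⟨![0, 2, 1, 3], ![0, 2, 1, 3], by decide, by decide⟩ n02 n13
              ![0, 10, 1, 11] rfl rfl (by decide)
        · exact cone ⟨![0, 1, 3, 2], ![0, 1, 3, 2], by decide, by decide⟩ n01 n13
            ![0, 1, 10, 2] rfl rfl (by decide)
    · have n23 : N 2 3 ≠ 0 := right_ne_zero_of_mul c23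
      have hu : u ≠ 0 := left_ne_zero_of_mul c23
      by_cases n01 : N 0 1 = 0
      · by_cases n02 : N 0 2 = 0
        · have n03 : N 0 3 = 0 := by
            by_contra n03
            have := hw' n03 n23 ⟨Pi.single 0 1, by simp⟩ (Pi.single 3 1) (by simp)
            exact hu (by simpa [hα] using this)
          have n13 : N 1 3 = 0 := by
            by_contra n13
            have := hw' n13 n23 ⟨Pi.single 1 1, by simp⟩ (Pi.single 3 1) (by simp)
            exact hu (by simpa [hα] using this)
          refine absurd (fun x => ?_) (hA'.saitoDet_ne_sq_mul 2 (K := fun x =>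
            u * N 2 3 * x 0 * x 1) ((analyticAt_const.mul (hx 0)).mul (hx 1)))
          rw [hF, c12, n01, n02, n03, n13]
          ring
        · exact cone ⟨![0, 2, 3, 1], ![0, 3, 1, 2], by decide, by decide⟩ n02 n23
            ![0, 10, 1, 2] rfl rfl (by decide)
      · exact quadric ⟨![0, 1, 2, 3], ![0, 1, 2, 3], by decide, by decide⟩ n01 n23
          ![0, 1, 10, 11] rfl rfl (by decide)
  · have n12 : N 1 2 ≠ 0 := right_ne_zero_of_mul c12
    by_cases n01 : N 0 1 = 0
    · by_cases n03 : N 0 3 = 0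
      · by_cases n23 : N 2 3 = 0
        · have n02 : N 0 2 = 0 := by
            by_contra n02
            have := hw n02 n12 S (hTα S hST)
            rw [hS0, hS1] at this
            exact zero_ne_one (sub_left_injective this)
          refine absurd (fun x => ?_) (hA'.saitoDet_ne_sq_mul 1 (K := fun x =>
            u * N 1 3 * x 0 * x 2 - v * N 1 2 * x 0 * x 3)
            (((analyticAt_const.mul (hx 0)).mul (hx 2)).sub
              ((analyticAt_const.mul (hx 0)).mul (hx 3))))
          rw [hF, n01, n02, n03, n23]
          ring
        · exact cone ⟨![1, 2, 3, 0], ![3, 0, 1, 2], by decide, by decide⟩ n12 n23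
            ![10, 0, 1, 2] rfl rfl (by decide)
      · exact quadric ⟨![1, 2, 0, 3], ![2, 0, 1, 3], by decide, by decide⟩ n12 n03
          ![0, 10, 11, 1] rfl rfl (by decide)
    · exact cone ⟨![0, 1, 2, 3], ![0, 1, 2, 3], by decide, by decide⟩ n01 n12
        ![0, 1, 2, 10] rfl rfl (by decide)

end IsTriangularBasis

theorem fderiv_apply_eq_zero_of_forall_add_smul {n : ℕ} {F : (Fin n → ℂ) → ℂ} {x w : Fin n → ℂ}
    (hF : DifferentiableAt ℂ F x) (h : ∀ t : ℂ, F (x + t • w) = F x) : fderiv ℂ F x w = 0 := by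
  rw [← hF.lineDeriv_eq_fderiv]
  simp [lineDeriv, h]

theorem Matrix.mul_apply_eq_zero_of_strict {n : ℕ} {N₁ N₂ : Matrix (Fin n) (Fin n) ℂ}
    (h₁ : ∀ i j, j ≤ i → N₁ i j = 0) (h₂ : ∀ i j, j ≤ i → N₂ i j = 0) {i j : Fin n} (hij : j ≤ i) :
    (N₁ * N₂) i j = 0 := by
  rw [Matrix.mul_apply]
  refine Finset.sum_eq_zero fun k _ => ?_
  rcases le_total k i with h | h
  · rw [h₁ _ _ h, zero_mul]
  · rw [h₂ _ _ (hij.trans h), mul_zero]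

/-- A nonzero `κ` would kill `N₂` one superdiagonal after the other, as commutation with `N₁` moves
entries away from the diagonal. Hence `κ = 0`, and the entries (0,2), (1,3) and (0,3) of the
commutator are the three relations. -/
theorem commutator_strict {N₁ N₂ : Matrix (Fin 4) (Fin 4) ℂ} (h₁ : ∀ i j, j ≤ i → N₁ i j = 0)
    (h₂ : ∀ i j, j ≤ i → N₂ i j = 0) (ha₁ : N₁ 0 1 = 1) (ha₂ : N₂ 0 1 = 0) (h0 : N₂ ≠ 0) {κ : ℂ}
    (hκ : N₁ * N₂ - N₂ * N₁ = κ • N₂) :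
    N₂ 1 2 = 0 ∧ N₁ 1 2 * N₂ 2 3 = 0 ∧ N₂ 1 3 = N₁ 2 3 * N₂ 0 2 - N₁ 0 2 * N₂ 2 3 := by
  have hent : ∀ i j, N₁ i 0 * N₂ 0 j + N₁ i 1 * N₂ 1 j + N₁ i 2 * N₂ 2 j + N₁ i 3 * N₂ 3 j -
      (N₂ i 0 * N₁ 0 j + N₂ i 1 * N₁ 1 j + N₂ i 2 * N₁ 2 j + N₂ i 3 * N₁ 3 j) = κ * N₂ i j := by
    intro i j
    have := congrFun (congrFun hκ i) j
    simpa only [Matrix.sub_apply, Matrix.mul_apply, Fin.sum_univ_four, Matrix.smul_apply, smul_eq_mul] using this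
  have z₁ : ∀ i, N₁ i i = 0 := fun i => h₁ i i le_rfl
  have z₂ : ∀ i, N₂ i i = 0 := fun i => h₂ i i le_rfl
  have h02 := hent 0 2
  have h03 := hent 0 3
  have h12 := hent 1 2
  have h13 := hent 1 3
  have h23 := hent 2 3
  simp only [z₁, z₂, ha₁, ha₂, h₁ 1 0 (by decide), h₁ 2 0 (by decide),
    h₁ 2 1 (by decide), h₁ 3 2 (by decide), h₂ 1 0 (by decide),
    h₂ 2 0 (by decide), h₂ 2 1 (by decide),
    h₂ 3 2 (by decide), zero_mul, mul_zero, one_mul, zero_add, add_zero, sub_zero, sub_self]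
    at h02 h03 h12 h13 h23
  by_cases hκ0 : κ = 0
  · rw [hκ0, zero_mul] at h02 h03 h13
    rw [h02, zero_mul, sub_zero] at h13
    exact ⟨h02, h13, by linear_combination h03⟩
  · exfalso
    have k12 : N₂ 1 2 = 0 := (mul_eq_zero.1 h12.symm).resolve_left hκ0
    have k23 : N₂ 2 3 = 0 := (mul_eq_zero.1 h23.symm).resolve_left hκ0
    rw [k12] at h02
    have k02 : N₂ 0 2 = 0 := (mul_eq_zero.1 h02.symm).resolve_left hκ0
    rw [k12, k23, mul_zero, zero_mul, sub_zero] at h13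
    have k13 : N₂ 1 3 = 0 := (mul_eq_zero.1 h13.symm).resolve_left hκ0
    rw [k13, k23, k02, mul_zero, zero_mul, add_zero, sub_zero] at h03
    have k03 : N₂ 0 3 = 0 := (mul_eq_zero.1 h03.symm).resolve_left hκ0
    apply h0
    ext i j
    rcases le_or_gt j i with hij | hij
    · exact h₂ i j hij
    · revert hij
      fin_cases i <;> fin_cases j <;> simp [ha₂, k12, k23, k02, k13, k03]

theorem saitoDet_strict {S : Fin 4 → ℂ} (hS0 : S 0 = 0) (hS1 : S 1 = 1)
    {N₁ N₂ : Matrix (Fin 4) (Fin 4) ℂ} (h₁ : ∀ i j, j ≤ i → N₁ i j = 0)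
    (h₂ : ∀ i j, j ≤ i → N₂ i j = 0) (x : Fin 4 → ℂ) :
    saitoDet ![1, Matrix.diagonal S, N₁, N₂] x = x 0 *
      (x 1 * ((x 0 * N₁ 0 2 + x 1 * N₁ 1 2) * (x 0 * N₂ 0 3 + x 1 * N₂ 1 3 + x 2 * N₂ 2 3) -
          (x 0 * N₂ 0 2 + x 1 * N₂ 1 2) * (x 0 * N₁ 0 3 + x 1 * N₁ 1 3 + x 2 * N₁ 2 3)) -
        S 2 * x 2 * x 0 * (N₁ 0 1 * (x 0 * N₂ 0 3 + x 1 * N₂ 1 3 + x 2 * N₂ 2 3) -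
          N₂ 0 1 * (x 0 * N₁ 0 3 + x 1 * N₁ 1 3 + x 2 * N₁ 2 3)) +
        S 3 * x 3 * x 0 * (N₁ 0 1 * (x 0 * N₂ 0 2 + x 1 * N₂ 1 2) -
          N₂ 0 1 * (x 0 * N₁ 0 2 + x 1 * N₁ 1 2))) := by
  have e : ∀ N : Matrix (Fin 4) (Fin 4) ℂ, (∀ i j, j ≤ i → N i j = 0) →
      (x ᵥ* N) 0 = 0 ∧ (x ᵥ* N) 1 = x 0 * N 0 1 ∧ (x ᵥ* N) 2 = x 0 * N 0 2 + x 1 * N 1 2 ∧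
      (x ᵥ* N) 3 = x 0 * N 0 3 + x 1 * N 1 3 + x 2 * N 2 3 := by
    intro N h
    simp only [Matrix.vecMul, dotProduct, Fin.sum_univ_four, h 0 0 (by decide), h 1 0 (by decide),
      h 2 0 (by decide), h 3 0 (by decide), h 1 1 (by decide), h 2 1 (by decide),
      h 3 1 (by decide), h 2 2 (by decide), h 3 2 (by decide), h 3 3 (by decide), mul_zero,
      add_zero, and_self]
  obtain ⟨a0, a1, a2, a3⟩ := e N₁ h₁
  obtain ⟨b0, b1, b2, b3⟩ := e N₂ h₂
  rw [saitoDet, Matrix.det_fin_four]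
  simp only [Matrix.of_apply, Matrix.cons_val, Matrix.vecMul_one, Matrix.vecMul_diagonal, a0, a1,
    a2, a3, b0, b1, b2, b3, hS0, hS1]
  ring

namespace IsTriangularBasis

variable {D : Set (Fin 4 → ℂ)} {A : Fin 4 → Matrix (Fin 4) (Fin 4) ℂ}

/-- The solvable linear free divisors of dimension four with a torus of dimension two. -/
theorem exists_row₄_of_forall_weight (hA : IsTriangularBasis D A) {S : Fin 4 → ℂ}
    (hS : Matrix.diagonal S ∈ Submodule.span ℂ (Set.range A)) (hS0 : S 0 = 0) (hS1 : S 1 = 1)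
    (hU : ∀ u v : ℂ, Matrix.diagonal ![0, 0, u, v] ∈ Submodule.span ℂ (Set.range A) →
      u = 0 ∧ v = 0) :
    ∃ r : TableRow 4, LinearlyIsomorphic D r.divisor := by
  set g := Submodule.span ℂ (Set.range A) with hg
  let T : Submodule ℂ (Fin 4 → ℂ) := g.comap (Matrix.diagonalLinearMap (Fin 4) ℂ ℂ)
  have h1T : (1 : Fin 4 → ℂ) ∈ T := hA.diagonal_one_mem
  have hST : S ∈ T := hS
  obtain ⟨𝔫, h𝔫, hs, hdim⟩ := hA.exists_strict (s := 2) (t := ![1, S]) fun d hd => by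
    have hdT : d ∈ T := hd
    have h2 : ![0, 0, d 2 - d 0 - (d 1 - d 0) * S 2, d 3 - d 0 - (d 1 - d 0) * S 3] ∈ T := by
      convert sub_mem (sub_mem hdT (T.smul_mem (d 0) h1T)) (T.smul_mem (d 1 - d 0) hST) using 1
      ext i
      fin_cases i <;> simp [hS0, hS1]
    obtain ⟨h3, h4⟩ := hU _ _ h2
    refine (Submodule.mem_span_range_iff_exists_fun ℂ).2 ⟨![d 0, d 1 - d 0], ?_⟩
    ext i
    fin_cases i
    · simp [Fin.sum_univ_succ, hS0]
    · simp [Fin.sum_univ_succ, hS1]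
    · simp [Fin.sum_univ_succ]
      linear_combination -h3
    · simp [Fin.sum_univ_succ]
      linear_combination -h4
  have hsum : ∀ (N₁ N₂ : Matrix (Fin 4) (Fin 4) ℂ) (c : Fin 4 → ℂ) (i j : Fin 4),
      (∑ k, c k • (![1, Matrix.diagonal S, N₁, N₂] : Fin 4 → Matrix (Fin 4) (Fin 4) ℂ) k) i j =
      c 0 * (1 : Matrix (Fin 4) (Fin 4) ℂ) i j + c 1 * Matrix.diagonal S i j +
        c 2 * N₁ i j + c 3 * N₂ i j := by
    intro N₁ N₂ c i j
    rw [Fin.sum_univ_four]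
    rfl
  have hcoef : ∀ N₁ N₂ : Matrix (Fin 4) (Fin 4) ℂ, (∀ i, N₁ i i = 0) → (∀ i, N₂ i i = 0) →
      ∀ c : Fin 4 → ℂ,
      (∀ i, (∑ k, c k • (![1, Matrix.diagonal S, N₁, N₂] :
        Fin 4 → Matrix (Fin 4) (Fin 4) ℂ) k) i i = 0) → c 0 = 0 ∧ c 1 = 0 := by
    intro N₁ N₂ h₁ h₂ c hc
    have e0 : c 0 = 0 := by simpa [hS0, h₁, h₂] using (hsum N₁ N₂ c 0 0).symm.trans (hc 0)
    exact ⟨e0, by simpa [hS1, h₁, h₂, e0] using (hsum N₁ N₂ c 1 1).symm.trans (hc 1)⟩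
  have hbasis : ∀ N₁ ∈ g, ∀ N₂ ∈ g, (∀ i, N₁ i i = 0) → (∀ i, N₂ i i = 0) →
      LinearIndependent ℂ ![N₁, N₂] →
      Submodule.span ℂ (Set.range (![1, Matrix.diagonal S, N₁, N₂] :
        Fin 4 → Matrix (Fin 4) (Fin 4) ℂ)) = g ∧
        IsLinearBasis D ![1, Matrix.diagonal S, N₁, N₂] := by
    intro N₁ hN₁ N₂ hN₂ h₁ h₂ hli
    refine hA.of_linearIndependent
      (fun i => by fin_cases i <;> [exact hA.one_mem; exact hS; exact hN₁; exact hN₂]) ?_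
    rw [Fintype.linearIndependent_iff]
    intro c hc
    obtain ⟨e0, e1⟩ := hcoef N₁ N₂ h₁ h₂ c fun i => by rw [hc]; rfl
    rw [LinearIndependent.pair_iff] at hli
    obtain ⟨e2, e3⟩ := hli (c 2) (c 3) (by
      ext i j
      have := hsum N₁ N₂ c i j
      rw [hc] at this
      simpa [e0, e1] using this.symm)
    intro k
    fin_cases k <;> assumption
  have hfin : 1 < Module.finrank ℂ 𝔫 := by omega
  have : Nontrivial 𝔫 := Module.nontrivial_of_finrank_pos (R := ℂ) (by omega)
  by_cases ha : ∀ N ∈ 𝔫, N 0 1 = 0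
  · exfalso
    obtain ⟨N₁, hN₁0⟩ := exists_ne (0 : 𝔫)
    obtain ⟨N₂, hli⟩ := exists_linearIndependent_pair_of_one_lt_finrank hfin hN₁0
    obtain ⟨hspan, hA'⟩ := hbasis N₁ (h𝔫 N₁.2) N₂ (h𝔫 N₂.2) (fun i => hs _ N₁.2 i i le_rfl)
      (fun i => hs _ N₂.2 i i le_rfl) (by
        rw [LinearIndependent.pair_iff] at hli ⊢
        exact fun s t hst => hli s t (Subtype.ext hst))
    -- In the determinant `x₃` is accompanied by entries (0,1). If these all vanish, `x₃ ∂₃`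
    -- annihilates the determinant and so lies in the algebra, against the assumption on the torus.
    have h3 : Matrix.diagonal ![0, 0, 0, 1] ∈ g := by
      rw [← hspan]
      refine hA'.mem_of_fderiv_eq (c := 0) fun x => ?_
      rw [zero_mul]
      refine fderiv_apply_eq_zero_of_forall_add_smul (analyticAt_saitoDet _ x).differentiableAt
        fun t => ?_
      rw [saitoDet_strict hS0 hS1 (hs _ N₁.2) (hs _ N₂.2), ha _ N₁.2, ha _ N₂.2,
        saitoDet_strict hS0 hS1 (hs _ N₁.2) (hs _ N₂.2), ha _ N₁.2, ha _ N₂.2]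
      simp only [Pi.add_apply, Pi.smul_apply, smul_eq_mul, Matrix.vecMul_diagonal, Matrix.cons_val,
        mul_zero, zero_mul, add_zero, sub_zero]
    obtain ⟨-, h⟩ := hU 0 1 h3
    exact one_ne_zero h
  push Not at ha
  obtain ⟨M₁, hM₁, hM₁a⟩ := ha
  have hM₁0 : (⟨M₁, hM₁⟩ : 𝔫) ≠ 0 := fun h => hM₁a (by
    rw [show M₁ = 0 from congrArg Subtype.val h]; rfl)
  obtain ⟨⟨M₂, hM₂⟩, hli⟩ := exists_linearIndependent_pair_of_one_lt_finrank hfin hM₁0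
  -- The entry (0,1) has weight `S 0 - S 1 = -1`, so the component of that weight keeps it.
  obtain ⟨N₁, hN₁, hN₁s, ha₁, hN₁w⟩ : ∃ N₁ ∈ g, (∀ i j, j ≤ i → N₁ i j = 0) ∧ N₁ 0 1 = 1 ∧
      ∀ i j, N₁ i j ≠ 0 → S i - S j = -1 := by
    refine ⟨(M₁ 0 1)⁻¹ • _, g.smul_mem _ (hA.weight_component_mem hS (h𝔫 hM₁) (-1)), ?_, ?_, ?_⟩
    · intro i j hij
      simp [hs _ hM₁ i j hij]
    · simp [hS0, hS1, hM₁a]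
    · intro i j hij
      by_contra h
      simp [h] at hij
  obtain ⟨N₂, hN₂, hN₂s, ha₂, hN₂0⟩ : ∃ N₂ ∈ g, (∀ i j, j ≤ i → N₂ i j = 0) ∧ N₂ 0 1 = 0 ∧
      N₂ ≠ 0 := by
    refine ⟨(-M₂ 0 1) • M₁ + M₁ 0 1 • M₂, g.add_mem (g.smul_mem _ (h𝔫 hM₁))
      (g.smul_mem _ (h𝔫 hM₂)), ?_, ?_, ?_⟩
    · intro i j hij
      simp [hs _ hM₁ i j hij, hs _ hM₂ i j hij]
    · simp
      ring
    · intro h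
      rw [LinearIndependent.pair_iff] at hli
      exact hM₁a (hli _ _ (Subtype.ext h)).2
  have hd₁ : ∀ i, N₁ i i = 0 := fun i => hN₁s i i le_rfl
  have hd₂ : ∀ i, N₂ i i = 0 := fun i => hN₂s i i le_rfl
  obtain ⟨hspan, hA'⟩ := hbasis N₁ hN₁ N₂ hN₂ hd₁ hd₂ (by
    rw [LinearIndependent.pair_iff]
    intro s t hst
    have h0 : s = 0 := by
      have := congrFun (congrFun hst 0) 1
      simpa [ha₁, ha₂] using this
    rw [h0, zero_smul, zero_add, smul_eq_zero] at hst
    exact ⟨h0, hst.resolve_right hN₂0⟩)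
  have hline : ∀ N ∈ g, (∀ i j, j ≤ i → N i j = 0) → N 0 1 = 0 → ∃ c : ℂ, N = c • N₂ := by
    intro N hN hNs hN01
    rw [← hspan, Submodule.mem_span_range_iff_exists_fun] at hN
    obtain ⟨c, rfl⟩ := hN
    obtain ⟨e0, e1⟩ := hcoef N₁ N₂ hd₁ hd₂ c fun i => hNs i i le_rfl
    have e2 : c 2 = 0 := by simpa [e0, e1, ha₁, ha₂] using (hsum N₁ N₂ c 0 1).symm.trans hN01
    refine ⟨c 3, ?_⟩
    ext i j
    rw [hsum, e0, e1, e2, zero_mul, zero_mul, zero_mul, zero_add, zero_add, zero_add]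
    rfl
  obtain ⟨b₂, hbd, he₂⟩ : N₂ 1 2 = 0 ∧ N₁ 1 2 * N₂ 2 3 = 0 ∧
      N₂ 1 3 = N₁ 2 3 * N₂ 0 2 - N₁ 0 2 * N₂ 2 3 := by
    obtain ⟨κ, hκ⟩ := hline _ (hA.commutator_mem hN₁ hN₂)
      (fun i j hij => by
        rw [Matrix.sub_apply, Matrix.mul_apply_eq_zero_of_strict hN₁s hN₂s hij,
          Matrix.mul_apply_eq_zero_of_strict hN₂s hN₁s hij, sub_zero])
      (by
        rw [Matrix.sub_apply, Matrix.mul_apply, Matrix.mul_apply]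
        simp [Fin.sum_univ_four, hd₁, hd₂, hN₁s 2 1, hN₁s 3 1, hN₂s 2 1, hN₂s 3 1])
    exact commutator_strict hN₁s hN₂s ha₁ ha₂ hN₂0 hκ
  have hF : ∀ x, _ = _ := saitoDet_strict hS0 hS1 hN₁s hN₂s
  rw [b₂, ha₁, ha₂] at hF
  -- Here and for `N₂ 1 3`, vanishing would make `x₀²` divide the determinant. The relations from
  -- the commutator then force `N₁ 2 3` and `N₂ 0 2` to be nonzero, and the weight of `N₁` fixes `S`
  -- as (0, 1, 2, 3).
  have hb₁ : N₁ 1 2 ≠ 0 := by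
    intro hb
    refine hA'.saitoDet_ne_sq_mul 0 (K := fun x =>
      x 1 * (N₁ 0 2 * (x 0 * N₂ 0 3 + x 1 * N₂ 1 3 + x 2 * N₂ 2 3) -
          N₂ 0 2 * (x 0 * N₁ 0 3 + x 1 * N₁ 1 3 + x 2 * N₁ 2 3)) -
        S 2 * x 2 * (x 0 * N₂ 0 3 + x 1 * N₂ 1 3 + x 2 * N₂ 2 3) + S 3 * x 3 * x 0 * N₂ 0 2)
      ?_ fun x => ?_
    · exact ContDiffAt.analyticAt (ContDiff.contDiffAt (by fun_prop))
    · rw [hF, hb]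
      ring
  have hd₂' : N₂ 2 3 = 0 := (mul_eq_zero.1 hbd).resolve_left hb₁
  rw [hd₂', mul_zero, sub_zero] at he₂
  have he₂0 : N₂ 1 3 ≠ 0 := by
    intro he
    refine hA'.saitoDet_ne_sq_mul 0 (K := fun x =>
      x 1 * ((x 0 * N₁ 0 2 + x 1 * N₁ 1 2) * N₂ 0 3 -
          N₂ 0 2 * (x 0 * N₁ 0 3 + x 1 * N₁ 1 3 + x 2 * N₁ 2 3)) -
        S 2 * x 2 * x 0 * N₂ 0 3 + S 3 * x 3 * x 0 * N₂ 0 2)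
      ?_ fun x => ?_
    · exact ContDiffAt.analyticAt (ContDiff.contDiffAt (by fun_prop))
    · rw [hF, he, hd₂']
      ring
  have hd₁' : N₁ 2 3 ≠ 0 := by
    rw [he₂] at he₂0
    exact left_ne_zero_of_mul he₂0
  have hc₂ : N₂ 0 2 ≠ 0 := by
    rw [he₂] at he₂0
    exact right_ne_zero_of_mul he₂0
  have hS2 : S 2 = 2 := by
    have := hN₁w 1 2 hb₁
    rw [hS1] at this
    linear_combination -this
  have hS3 : S 3 = 3 := by
    have := hN₁w 2 3 hd₁'
    rw [hS2] at this
    linear_combination -this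
  have hz : ∀ i j, S i - S j ≠ -1 → N₁ i j = 0 := fun i j h => by
    by_contra h'
    exact h (hN₁w i j h')
  have c₁ : N₁ 0 2 = 0 := hz _ _ (by rw [hS0, hS2]; norm_num)
  have f₁ : N₁ 0 3 = 0 := hz _ _ (by rw [hS0, hS3]; norm_num)
  have e₁ : N₁ 1 3 = 0 := hz _ _ (by rw [hS1, hS3]; norm_num)
  refine ⟨_, hA.linearlyIsomorphic_cubic hb₁ hd₁' h1T ?_ ?_ ?_⟩
  · convert hS using 2
    ext i
    fin_cases i <;> simp [hS0, hS1, hS2, hS3]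
  · convert hN₁ using 1
    clear * - hN₁s ha₁ c₁ f₁ e₁
    ext i j
    rcases le_or_gt j i with hij | hij
    · rw [hN₁s i j hij]
      revert hij
      fin_cases i <;> fin_cases j <;> simp
    · revert hij
      fin_cases i <;> fin_cases j <;> simp [ha₁, c₁, f₁, e₁]
  -- The projection to weight -2 removes the remaining entry (0,3); the relation for `N₂ 1 3` gives
  -- the other coefficient.
  · convert g.smul_mem (N₂ 0 2)⁻¹ (hA.weight_component_mem hS hN₂ (-2)) using 1
    ext i j
    rcases le_or_gt j i with hij | hij
    · simp only [Matrix.smul_apply, Matrix.of_apply, hN₂s i j hij, ite_self, smul_zero]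
      revert hij
      fin_cases i <;> fin_cases j <;> simp
    · revert hij
      fin_cases i <;> fin_cases j <;> simp [hd₂', hS0, hS1, hS2, hS3, hc₂, he₂]
      all_goals norm_num
      all_goals field_simp

theorem exists_row₄ (hA : IsTriangularBasis D A) :
    ∃ r : TableRow 4, LinearlyIsomorphic D r.divisor := by
  obtain ⟨S, hS, hS0, hS1⟩ := hA.exists_weight_ne (m := 2)
  by_cases hU : ∀ u v : ℂ, Matrix.diagonal ![0, 0, u, v] ∈ Submodule.span ℂ (Set.range A) →
      u = 0 ∧ v = 0
  · exact hA.exists_row₄_of_forall_weight hS hS0 hS1 hU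
  · push Not at hU
    obtain ⟨u, v, h, huv⟩ := hU
    exact hA.exists_row₄_of_weight hS hS0 hS1 (fun h' => huv h'.1 h'.2) h

end IsTriangularBasis

/-! ### Lie algebras of dimension at most three -/

namespace LieAlgebra

variable {K L : Type*} [Field K] [LieRing L] [LieAlgebra K L]

theorem isSolvable_of_isSolvable_derivedSeries_one (h : IsSolvable (derivedSeries K L 1)) :
    IsSolvable L := by
  obtain ⟨k, hk⟩ := (isSolvable_iff K _).1 h
  rw [LieIdeal.derivedSeries_eq_bot_iff, derivedSeries_def, ← derivedSeriesOfIdeal_add] at hk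
  exact IsSolvable.mk (R := K) (k := k + 1) hk

theorem isSolvable_of_finrank_le_one [FiniteDimensional K L] (h : Module.finrank K L ≤ 1) :
    IsSolvable L := by
  obtain ⟨v, hv⟩ := finrank_le_one_iff.1 h
  have : IsLieAbelian L := ⟨fun x y => by
    obtain ⟨a, rfl⟩ := hv x
    obtain ⟨b, rfl⟩ := hv y
    simp⟩
  infer_instance

theorem derivedSeries_one_le_span {ι : Type*} [Fintype ι] (b : Module.Basis ι K L)
    (W : Submodule K L) (h : ∀ i j, ⁅b i, b j⁆ ∈ W) :
    (derivedSeries K L 1 : Submodule K L) ≤ W := by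
  rw [coe_derivedSeries_one_eq, Submodule.span_le]
  rintro _ ⟨x, y, rfl⟩
  rw [← b.sum_repr x, ← b.sum_repr y]
  simp only [sum_lie, lie_sum, smul_lie, lie_smul, SetLike.mem_coe]
  exact sum_mem fun i _ => W.smul_mem _ (sum_mem fun j _ => W.smul_mem _ (h _ _))

/-- In dimension two the derived algebra is spanned by the single bracket of two basis vectors. -/
theorem isSolvable_of_finrank_le_two [FiniteDimensional K L] (h : Module.finrank K L ≤ 2) :
    IsSolvable L := by
  rcases h.lt_or_eq with h | h
  · exact isSolvable_of_finrank_le_one (K := K) (by omega)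
  let b := Module.finBasisOfFinrankEq K L h
  refine isSolvable_of_isSolvable_derivedSeries_one (K := K)
    (isSolvable_of_finrank_le_one (K := K) ?_)
  refine (Submodule.finrank_mono (derivedSeries_one_le_span b (Submodule.span K {⁅b 0, b 1⁆})
    fun i j => ?_)).trans ((finrank_span_le_card _).trans (by simp))
  have h1 : ⁅b 0, b 1⁆ ∈ Submodule.span K {⁅b 0, b 1⁆} := Submodule.mem_span_singleton_self _
  fin_cases i <;> fin_cases j
  · simp
  · exact h1
  · have h2 := neg_mem h1
    rwa [lie_skew] at h2
  · simp

end LieAlgebra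

/-- The roots of the characteristic polynomial are 0, `u` and `-u` by the trace condition, and `u =
0` would make `φ` nilpotent. -/
theorem Module.End.exists_hasEigenvalue_neg {V : Type*} [AddCommGroup V] [Module ℂ V]
    [FiniteDimensional ℂ V] (h3 : Module.finrank ℂ V = 3) {φ : Module.End ℂ V}
    (htr : LinearMap.trace ℂ V φ = 0) (h0 : φ.HasEigenvalue 0) (hn : ¬ IsNilpotent φ) :
    ∃ c : ℂ, c ≠ 0 ∧ φ.HasEigenvalue c ∧ φ.HasEigenvalue (-c) := by
  let b := Module.finBasis ℂ V
  have hsum : φ.charpoly.roots.sum = 0 := by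
    rw [← LinearMap.charpoly_toMatrix φ b, ← Matrix.trace_eq_sum_roots_charpoly,
      ← LinearMap.trace_eq_matrix_trace, htr]
  have hdeg : φ.charpoly.natDegree = 3 := by rw [LinearMap.charpoly_natDegree, h3]
  have hcard : φ.charpoly.roots.card = 3 := by rw [IsAlgClosed.card_roots_eq_natDegree, hdeg]
  have hmem : ∀ c, φ.HasEigenvalue c ↔ c ∈ φ.charpoly.roots := fun c => by
    rw [Module.End.hasEigenvalue_iff_isRoot_charpoly, Polynomial.mem_roots φ.charpoly_monic.ne_zero]
  rw [hmem] at h0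
  obtain ⟨R, hR⟩ := Multiset.exists_cons_of_mem h0
  rw [hR, Multiset.card_cons] at hcard
  obtain ⟨u, v, rfl⟩ := Multiset.card_eq_two.1 (Nat.add_right_cancel hcard : R.card = 2)
  rw [hR] at hsum hmem
  have huv : v = -u := by
    simp only [Multiset.insert_eq_cons, Multiset.sum_cons, Multiset.sum_singleton, zero_add] at hsum
    exact eq_neg_of_add_eq_zero_right hsum
  subst huv
  refine ⟨u, ?_, (hmem _).2 (by simp), (hmem _).2 (by simp)⟩
  rintro rfl
  apply hn
  rw [LinearMap.isNilpotent_iff_charpoly, h3,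
    (IsAlgClosed.splits φ.charpoly).eq_prod_roots_of_monic φ.charpoly_monic, hR]
  simp [pow_succ, mul_assoc]

/-- Such an algebra is perfect, so every `ad x` has trace zero, and by Engel's theorem some `ad x`
is not nilpotent. Its eigenvalues are 0, `c`, `-c` with eigenvectors `x`, `e`, `f`. The bracket of
`e` and `f` commutes with `x`, hence is a multiple of `x`, nonzero by perfectness; rescaling gives
the triple. -/
theorem LieAlgebra.exists_isSl2Triple {L : Type*} [LieRing L] [LieAlgebra ℂ L]
    (h3 : Module.finrank ℂ L = 3) (hL : ¬ LieAlgebra.IsSolvable L) :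
    ∃ h e f : L, IsSl2Triple h e f := by
  have : FiniteDimensional ℂ L := Module.finite_of_finrank_eq_succ h3
  -- Perfectness: if the derived algebra had dimension at most two, it would be solvable, and so
  -- would be `L`.
  have hlt : ∀ W : Submodule ℂ L, (LieAlgebra.derivedSeries ℂ L 1 : Submodule ℂ L) ≤ W →
      3 ≤ Module.finrank ℂ W := by
    intro W hW
    by_contra! h
    refine hL (isSolvable_of_isSolvable_derivedSeries_one (K := ℂ)
      (isSolvable_of_finrank_le_two (K := ℂ) ?_))
    exact (Submodule.finrank_mono hW).trans (by omega)
  have htr : ∀ x : L, LinearMap.trace ℂ L (LieAlgebra.ad ℂ L x) = 0 := by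
    let W := LinearMap.ker ((LinearMap.trace ℂ L).comp
      (LieAlgebra.ad ℂ L : L →ₗ[ℂ] Module.End ℂ L))
    have hW : W = ⊤ := by
      refine Submodule.eq_top_of_finrank_eq (le_antisymm (Submodule.finrank_le _) ?_)
      rw [h3]
      refine hlt W ?_
      rw [LieAlgebra.coe_derivedSeries_one_eq, Submodule.span_le]
      rintro _ ⟨x, y, rfl⟩
      change LinearMap.trace ℂ L (LieAlgebra.ad ℂ L ⁅x, y⁆) = 0
      rw [LieHom.map_lie, LinearMap.trace_lie]
    intro x
    have : x ∈ W := by rw [hW]; trivial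
    exact this
  obtain ⟨x, hx⟩ : ∃ x : L, ¬ IsNilpotent (LieAlgebra.ad ℂ L x) := by
    by_contra! h
    have := (LieAlgebra.isNilpotent_iff_forall (R := ℂ)).2 h
    exact hL inferInstance
  have hx0 : x ≠ 0 := fun h => hx (by rw [h, map_zero]; exact IsNilpotent.zero)
  have hxv : (LieAlgebra.ad ℂ L x).HasEigenvector 0 x :=
    ⟨Module.End.mem_eigenspace_iff.2 (by simp), hx0⟩
  obtain ⟨c, hc, hc1, hc2⟩ := Module.End.exists_hasEigenvalue_neg h3 (htr x)
    (Module.End.hasEigenvalue_of_hasEigenvector hxv) hx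
  obtain ⟨e, he⟩ := hc1.exists_hasEigenvector
  obtain ⟨f, hf⟩ := hc2.exists_hasEigenvector
  have hxe : ⁅x, e⁆ = c • e := he.apply_eq_smul
  have hxf : ⁅x, f⁆ = (-c) • f := hf.apply_eq_smul
  have hli : LinearIndependent ℂ ![x, e, f] := by
    refine Module.End.eigenvectors_linearIndependent' (LieAlgebra.ad ℂ L x) ![0, c, -c] ?_ _ ?_
    · intro i j hij
      fin_cases i <;> fin_cases j <;> simp [hc, hc.symm, self_eq_neg, neg_eq_self] at hij ⊢
    · intro i
      fin_cases i
      exacts [hxv, he, hf]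
  let b : Module.Basis (Fin 3) ℂ L := basisOfLinearIndependentOfCardEqFinrank hli (by simp [h3])
  have hb : ⇑b = ![x, e, f] := coe_basisOfLinearIndependentOfCardEqFinrank _ _
  obtain ⟨a, ha⟩ : ∃ a : ℂ, ⁅e, f⁆ = a • x := by
    have h1 : ⁅x, ⁅e, f⁆⁆ = 0 := by
      rw [leibniz_lie, hxe, hxf, smul_lie, lie_smul, ← add_smul, add_neg_cancel, zero_smul]
    have h2 := b.sum_repr ⁅e, f⁆
    rw [Fin.sum_univ_three, hb] at h2
    simp only [Matrix.cons_val] at h2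
    rw [← h2, lie_add, lie_add, lie_smul, lie_smul, lie_smul, lie_self, hxe, hxf] at h1
    have h4 := (Fintype.linearIndependent_iff.1 hli)
      ![0, b.repr ⁅e, f⁆ 1 * c, b.repr ⁅e, f⁆ 2 * -c] (by
        rw [Fin.sum_univ_three]
        simpa [mul_smul] using h1)
    have h5 : b.repr ⁅e, f⁆ 1 = 0 := by simpa [hc] using h4 1
    have h6 : b.repr ⁅e, f⁆ 2 = 0 := by simpa [hc] using h4 2
    rw [h5, h6, zero_smul, zero_smul, add_zero, add_zero] at h2
    exact ⟨_, h2.symm⟩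
  have ha0 : a ≠ 0 := by
    rintro rfl
    rw [zero_smul] at ha
    have h1 := hlt (Submodule.span ℂ (Set.range ![e, f])) (derivedSeries_one_le_span b _ fun i j => by
      have me : e ∈ Submodule.span ℂ (Set.range ![e, f]) := Submodule.subset_span ⟨0, rfl⟩
      have mf : f ∈ Submodule.span ℂ (Set.range ![e, f]) := Submodule.subset_span ⟨1, rfl⟩
      rw [hb]
      fin_cases i <;> fin_cases j
      · simp
      · change ⁅x, e⁆ ∈ _
        rw [hxe]; exact Submodule.smul_mem _ _ me
      · change ⁅x, f⁆ ∈ _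
        rw [hxf]; exact Submodule.smul_mem _ _ mf
      · change ⁅e, x⁆ ∈ _
        rw [← lie_skew, hxe]; exact neg_mem (Submodule.smul_mem _ _ me)
      · simp
      · change ⁅e, f⁆ ∈ _
        rw [ha]; exact zero_mem _
      · change ⁅f, x⁆ ∈ _
        rw [← lie_skew, hxf]; exact neg_mem (Submodule.smul_mem _ _ mf)
      · change ⁅f, e⁆ ∈ _
        rw [← lie_skew, ha]; exact neg_mem (zero_mem _)
      · simp)
    have h2 := h1.trans (finrank_range_le_card (R := ℂ) ![e, f])
    simp at h2
  refine ⟨(2 / c) • x, e, (2 / (c * a)) • f, ?_, ?_, ?_, ?_⟩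
  · exact smul_ne_zero (by simp [hc]) hx0
  · rw [lie_smul, ha, smul_smul]
    congr 1
    field_simp
  · rw [smul_lie, hxe, smul_smul, div_mul_cancel₀ _ hc]
    norm_cast
  · rw [smul_lie, lie_smul, hxf, smul_smul, smul_smul, ← Nat.cast_smul_eq_nsmul ℂ, smul_smul, ← neg_smul]
    congr 1
    field_simp
    norm_num

/-! ### Non-solvable linear free divisors -/

namespace IsLinearBasis

variable {n : ℕ} {D : Set (Fin n → ℂ)} {A : Fin n → Matrix (Fin n) (Fin n) ℂ}

theorem finrank_lieSubalgebra (hA : IsLinearBasis D A) :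
    Module.finrank ℂ hA.lieSubalgebra = n := by
  have h := (LinearEquiv.ofSubmodule' (LinearMap.toMatrix' :
    ((Fin n → ℂ) →ₗ[ℂ] (Fin n → ℂ)) ≃ₗ[ℂ] _) (Submodule.span ℂ (Set.range A))).finrank_eq
  rw [hA.finrank_span] at h
  exact h

/-- The derived algebra has trace zero, so it does not contain the Euler vector field. -/
theorem finrank_derivedSeries_lt (hA : IsLinearBasis D A) (hn : 1 ≤ n) :
    Module.finrank ℂ (LieAlgebra.derivedSeries ℂ hA.lieSubalgebra 1) < n := by
  have h1 : (LieAlgebra.derivedSeries ℂ hA.lieSubalgebra 1 : Submodule ℂ hA.lieSubalgebra) ≤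
      LinearMap.ker ((LinearMap.trace ℂ (Fin n → ℂ)).comp hA.lieSubalgebra.toSubmodule.subtype) := by
    rw [LieAlgebra.coe_derivedSeries_one_eq, Submodule.span_le]
    rintro _ ⟨x, y, rfl⟩
    exact LinearMap.trace_lie x.1 y.1
  refine lt_of_le_of_lt (Submodule.finrank_mono h1) ?_
  refine lt_of_lt_of_eq (Submodule.finrank_lt fun h => ?_) hA.finrank_lieSubalgebra
  have h2 : (1 : Module.End ℂ (Fin n → ℂ)) ∈ hA.lieSubalgebra := by
    rw [hA.mem_lieSubalgebra, LinearMap.toMatrix'_one]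
    exact hA.one_mem
  have h3 : LinearMap.trace ℂ (Fin n → ℂ) 1 = 0 := by
    have : (⟨1, h2⟩ : hA.lieSubalgebra) ∈ LinearMap.ker ((LinearMap.trace ℂ (Fin n → ℂ)).comp
        hA.lieSubalgebra.toSubmodule.subtype) := by rw [h]; trivial
    exact this
  rw [LinearMap.trace_one, Module.finrank_fin_fun] at h3
  exact (Nat.cast_ne_zero.2 (by omega)) h3

theorem isSolvable_of_le_three (hA : IsLinearBasis D A) (hn : 1 ≤ n) (hn' : n ≤ 3) :
    LieAlgebra.IsSolvable hA.lieSubalgebra :=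
  LieAlgebra.isSolvable_of_isSolvable_derivedSeries_one (K := ℂ)
    (LieAlgebra.isSolvable_of_finrank_le_two (K := ℂ) (by
      have := hA.finrank_derivedSeries_lt hn
      omega))

/-- The derived algebra is not solvable and, missing the Euler field, has dimension exactly three.
-/
theorem exists_isSl2Triple {D : Set (Fin 4 → ℂ)} {A : Fin 4 → Matrix (Fin 4) (Fin 4) ℂ}
    (hA : IsLinearBasis D A) (hsol : ¬ LieAlgebra.IsSolvable hA.lieSubalgebra) :
    ∃ h e f : Module.End ℂ (Fin 4 → ℂ), IsSl2Triple h e f ∧ h ∈ hA.lieSubalgebra ∧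
      e ∈ hA.lieSubalgebra ∧ f ∈ hA.lieSubalgebra := by
  set I := LieAlgebra.derivedSeries ℂ hA.lieSubalgebra 1
  have hI : ¬ LieAlgebra.IsSolvable I := fun h =>
    hsol (LieAlgebra.isSolvable_of_isSolvable_derivedSeries_one (K := ℂ) h)
  have h3 : Module.finrank ℂ I = 3 := by
    have h1 : Module.finrank ℂ I < 4 := hA.finrank_derivedSeries_lt (by norm_num)
    by_contra h
    exact hI (LieAlgebra.isSolvable_of_finrank_le_two (K := ℂ) (by omega))
  obtain ⟨h, e, f, t⟩ := LieAlgebra.exists_isSl2Triple h3 hI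
  refine ⟨h.1.1, e.1.1, f.1.1, ⟨fun h0 => t.h_ne_zero (Subtype.ext (Subtype.ext h0)), ?_, ?_, ?_⟩,
    h.1.2, e.1.2, f.1.2⟩
  · exact congrArg (fun x : I => x.1.1) t.lie_e_f
  · exact congrArg (fun x : I => x.1.1) t.lie_h_e_nsmul
  · exact congrArg (fun x : I => x.1.1) t.lie_h_f_nsmul

end IsLinearBasis

/-! ### Four-dimensional representations of sl₂ -/

namespace IsSl2Triple

variable {V : Type*} [AddCommGroup V] [Module ℂ V]
  {h e f : Module.End ℂ V}

/-- Otherwise `ad h` would be nilpotent, but it has eigenvalue 2 on `e`. -/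
theorem not_isNilpotent_h (t : IsSl2Triple h e f) : ¬ IsNilpotent h := by
  intro hn
  have h1 := LieAlgebra.ad_nilpotent_of_nilpotent (R := ℂ) hn
  have h2 : (LieAlgebra.ad ℂ (Module.End ℂ V) h).HasEigenvalue 2 :=
    Module.End.hasEigenvalue_of_hasEigenvector (x := e)
      ⟨Module.End.mem_eigenspace_iff.2 (t.lie_h_e_smul ℂ), t.e_ne_zero⟩
  exact two_ne_zero (h2.isNilpotent_of_isNilpotent h1).eq_zero

theorem trace_eq_zero (t : IsSl2Triple h e f) : LinearMap.trace ℂ V h = 0 ∧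
    LinearMap.trace ℂ V e = 0 ∧ LinearMap.trace ℂ V f = 0 := by
  have h1 : LinearMap.trace ℂ V ((2 : ℂ) • e) = 0 := by
    rw [← t.lie_h_e_smul ℂ, LinearMap.trace_lie]
  have h2 : LinearMap.trace ℂ V (-((2 : ℂ) • f)) = 0 := by
    rw [← t.lie_lie_smul_f ℂ, LinearMap.trace_lie]
  refine ⟨by rw [← t.lie_e_f, LinearMap.trace_lie], ?_, ?_⟩
  · simpa using h1
  · simpa using h2

/-- The elements of the triple are eigenvectors of `ad h` with different eigenvalues, and the trace
separates them from the identity. -/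
theorem linearIndependent_one [FiniteDimensional ℂ V] [Nontrivial V] (t : IsSl2Triple h e f) :
    LinearIndependent ℂ ![1, h, e, f] := by
  have h1 : LinearIndependent ℂ ![h, e, f] := by
    refine Module.End.eigenvectors_linearIndependent' (LieAlgebra.ad ℂ (Module.End ℂ V) h)
      ![0, 2, -2] ?_ _ ?_
    · intro i j hij
      fin_cases i <;> fin_cases j <;> first | rfl | norm_num at hij
    · intro i
      fin_cases i
      · exact ⟨Module.End.mem_eigenspace_iff.2 (by simp), t.h_ne_zero⟩
      · exact ⟨Module.End.mem_eigenspace_iff.2 (t.lie_h_e_smul ℂ), t.e_ne_zero⟩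
      · exact ⟨Module.End.mem_eigenspace_iff.2 (by
          simpa using t.lie_lie_smul_f ℂ), t.f_ne_zero⟩
  obtain ⟨t1, t2, t3⟩ := t.trace_eq_zero
  rw [Fintype.linearIndependent_iff] at h1 ⊢
  intro c hc
  rw [Fin.sum_univ_four] at hc
  simp only [Matrix.cons_val] at hc
  have h0 : c 0 = 0 := by
    have := congrArg (LinearMap.trace ℂ V) hc
    simp only [map_add, map_smul, t1, t2, t3, mul_zero, add_zero, map_zero, smul_eq_mul,
      LinearMap.trace_one, mul_eq_zero] at this
    exact this.resolve_right (Nat.cast_ne_zero.2 Module.finrank_pos.ne')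
  rw [h0, zero_smul, zero_add] at hc
  have h2 := h1 ![c 1, c 2, c 3] (by rw [Fin.sum_univ_three]; exact hc)
  intro i
  fin_cases i
  exacts [h0, h2 0, h2 1, h2 2]

end IsSl2Triple

theorem Module.End.IsSemisimple.exists_basis {V : Type*} [AddCommGroup V] [Module ℂ V]
    [FiniteDimensional ℂ V] {S : Module.End ℂ V} (hS : S.IsSemisimple) {n : ℕ}
    (hn : Module.finrank ℂ V = n) :
    ∃ (u : Module.Basis (Fin n) ℂ V) (d : Fin n → ℂ), ∀ i, S (u i) = d i • u i := by
  classical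
  let eigenDecomp := DirectSum.isInternal_submodule_of_iSupIndep_of_iSup_eq_top
    S.eigenspaces_iSupIndep hS.iSup_eigenspace_eq_top
  let v := eigenDecomp.collectedBasis fun μ => Module.finBasis ℂ (S.eigenspace μ)
  have := FiniteDimensional.fintypeBasisIndex v
  let σ := Fintype.equivFinOfCardEq ((Module.finrank_eq_card_basis v).symm.trans hn)
  refine ⟨v.reindex σ, fun i => (σ.symm i).1, fun i => ?_⟩
  rw [Module.Basis.reindex_apply]
  exact Module.End.mem_eigenspace_iff.1 (eigenDecomp.collectedBasis_mem _ (σ.symm i))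

namespace IsLinearBasis

variable {n : ℕ} {D : Set (Fin n → ℂ)} {A : Fin n → Matrix (Fin n) (Fin n) ℂ}

theorem toMatrix_mem_span_conj (hA : IsLinearBasis D A)
    (u : Module.Basis (Fin n) ℂ (Fin n → ℂ)) {T : Module.End ℂ (Fin n → ℂ)} :
    LinearMap.toMatrix u u T ∈ Submodule.span ℂ (Set.range fun i =>
      ((u.toGL⁻¹ : GL (Fin n) ℂ) : Matrix (Fin n) (Fin n) ℂ) * A i *
        (u.toGL : Matrix (Fin n) (Fin n) ℂ)) ↔ T ∈ hA.lieSubalgebra := by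
  rw [mem_span_conj_iff, hA.mem_lieSubalgebra]
  have h := u.toGL_conj (LinearMap.toMatrix' T)
  rw [Matrix.toLin'_toMatrix'] at h
  rw [← h]
  simp only [Matrix.mul_assoc, Units.mul_inv_cancel_left, Units.mul_inv, mul_one]

/-- The Lie algebra of a linear free divisor contains the semisimple parts of its elements. -/
theorem mem_of_isSemisimple (hA : IsLinearBasis D A) {S N : Module.End ℂ (Fin n → ℂ)}
    (hS : S.IsSemisimple) (hN : IsNilpotent N) (hSN : Commute S N)
    (h : S + N ∈ hA.lieSubalgebra) : S ∈ hA.lieSubalgebra := by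
  obtain ⟨u, d, hd⟩ := hS.exists_basis (Module.finrank_fin_fun ℂ)
  have hSd : LinearMap.toMatrix u u S = Matrix.diagonal d := by
    ext i j
    rw [LinearMap.toMatrix_apply, hd, map_smul, Module.Basis.repr_self]
    by_cases hij : i = j
    · subst hij; simp
    · simp [hij]
  rw [← hA.toMatrix_mem_span_conj u, hSd]
  refine (hA.conj u.toGL).diagonal_mem (N := LinearMap.toMatrix u u N) ?_ ?_ ?_
  · exact hN.map (LinearMap.toMatrixAlgEquiv u)
  · rw [← hSd]
    exact hSN.map (LinearMap.toMatrixAlgEquiv u)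
  · rw [← hSd, ← map_add]
    exact (hA.toMatrix_mem_span_conj u).2 h

end IsLinearBasis

/-- The algebra is spanned by 1, `h`, `e`, `f` and contains both Jordan parts of `h`. The nilpotent
part commutes with `h`, so it lies in the span of 1 and `h`; having trace zero it is a multiple of
`h`, which is not nilpotent. So it vanishes and `h` is diagonalizable. -/
theorem IsLinearBasis.exists_basis_sl2 {D : Set (Fin 4 → ℂ)}
    {A : Fin 4 → Matrix (Fin 4) (Fin 4) ℂ} (hA : IsLinearBasis D A)
    {h e f : Module.End ℂ (Fin 4 → ℂ)} (t : IsSl2Triple h e f) (hh : h ∈ hA.lieSubalgebra)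
    (he : e ∈ hA.lieSubalgebra) (hf : f ∈ hA.lieSubalgebra) :
    ∃ (u : Module.Basis (Fin 4) ℂ (Fin 4 → ℂ)) (d : Fin 4 → ℂ), ∀ i, h (u i) = d i • u i := by
  obtain ⟨N, hNadj, S, hSadj, hN, hS, hNS⟩ := h.exists_isNilpotent_isSemisimple
  have hcomm : Commute h N :=
    Algebra.commute_of_mem_adjoin_self hNadj
  have hSN : Commute S N := by
    have : S = h - N := by rw [hNS]; abel
    rw [this]
    exact hcomm.sub_left (Commute.refl N)
  have hSmem : S ∈ hA.lieSubalgebra := hA.mem_of_isSemisimple hS hN hSN (by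
    rw [add_comm, ← hNS]; exact hh)
  have hNmem : N ∈ hA.lieSubalgebra := by
    have : N = h - S := by rw [hNS]; abel
    rw [this]
    exact sub_mem hh hSmem
  have h1 : (1 : Module.End ℂ (Fin 4 → ℂ)) ∈ hA.lieSubalgebra := by
    rw [hA.mem_lieSubalgebra, LinearMap.toMatrix'_one]
    exact hA.one_mem
  have hspan : Submodule.span ℂ (Set.range ![1, h, e, f]) = hA.lieSubalgebra.toSubmodule := by
    refine Submodule.eq_of_le_of_finrank_eq (Submodule.span_le.2 ?_) ?_
    · rintro _ ⟨i, rfl⟩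
      fin_cases i
      exacts [h1, hh, he, hf]
    · rw [finrank_span_eq_card t.linearIndependent_one]
      exact hA.finrank_lieSubalgebra.symm
  have hN0 : N = 0 := by
    have h2 : N ∈ Submodule.span ℂ (Set.range ![1, h, e, f]) := by rw [hspan]; exact hNmem
    obtain ⟨c, hc⟩ := (Submodule.mem_span_range_iff_exists_fun ℂ).1 h2
    rw [Fin.sum_univ_four] at hc
    simp only [Matrix.cons_val] at hc
    have h3 : ⁅h, N⁆ = 0 := by rw [Ring.lie_def, hcomm.eq, sub_self]
    rw [← hc, lie_add, lie_add, lie_add, lie_smul, lie_smul, lie_smul, lie_smul, lie_self,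
      t.lie_h_e_smul ℂ, t.lie_lie_smul_f ℂ] at h3
    have h4 := Fintype.linearIndependent_iff.1 t.linearIndependent_one ![0, 0, c 2 * 2, -(c 3 * 2)]
      (by
        rw [Fin.sum_univ_four]
        rw [← h3]
        simp [Ring.lie_def, mul_smul])
    have h5 : c 2 = 0 := by simpa using h4 2
    have h6 : c 3 = 0 := by simpa using h4 3
    rw [h5, h6, zero_smul, zero_smul, add_zero, add_zero] at hc
    have h7 : c 0 = 0 := by
      have h8 := (LinearMap.isNilpotent_trace_of_isNilpotent hN).eq_zero
      rw [← hc] at h8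
      simpa [t.trace_eq_zero.1] using h8
    rw [h7, zero_smul, zero_add] at hc
    by_cases h8 : c 1 = 0
    · rw [← hc, h8, zero_smul]
    · exfalso
      apply t.not_isNilpotent_h
      have : h = (c 1)⁻¹ • N := by rw [← hc, smul_smul, inv_mul_cancel₀ h8, one_smul]
      rw [this]
      exact hN.smul _
  rw [hN0, zero_add] at hNS
  rw [hNS]
  exact hS.exists_basis (Module.finrank_fin_fun ℂ)

namespace IsSl2Triple

theorem repr_eq_zero {V : Type*} [AddCommGroup V] [Module ℂ V] {n : ℕ}
    {h : Module.End ℂ V} {u : Module.Basis (Fin n) ℂ V} {d : Fin n → ℂ}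
    (hu : ∀ i, h (u i) = d i • u i) {x : V} {μ : ℂ} (hμ : h x = μ • x) {a : Fin n}
    (ha : d a ≠ μ) : u.repr x a = 0 := by
  have h1 : u.repr (h x) a = d a * u.repr x a := by
    conv_lhs => rw [← u.sum_repr x]
    simp only [map_sum, map_smul, hu, Module.Basis.repr_self, Finsupp.coe_finsetSum,
      Finset.sum_apply, Finsupp.smul_apply, smul_eq_mul]
    rw [Finset.sum_eq_single a]
    · simp [mul_comm]
    · intro b _ hb
      simp [hb]
    · simp
  rw [hμ, map_smul, Finsupp.smul_apply, smul_eq_mul] at h1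
  by_contra h0
  exact ha (mul_right_cancel₀ h0 h1.symm)

theorem exists_weight_eq {V : Type*} [AddCommGroup V] [Module ℂ V] {n : ℕ}
    {h : Module.End ℂ V} {u : Module.Basis (Fin n) ℂ V} {d : Fin n → ℂ}
    (hu : ∀ i, h (u i) = d i • u i) {x : V} {μ : ℂ} (hx : x ≠ 0) (hμ : h x = μ • x) :
    ∃ a, d a = μ := by
  by_contra! hne
  exact hx (u.ext_elem fun a => by rw [repr_eq_zero hu hμ (hne a), map_zero, Finsupp.zero_apply])

/-- The operator `e` raises weights by 2, and there is no such weight to receive the image of `x`.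
-/
theorem hasPrimitiveVectorWith {V : Type*} [AddCommGroup V] [Module ℂ V] {n : ℕ}
    {h e f : Module.End ℂ V} (t : IsSl2Triple h e f) {u : Module.Basis (Fin n) ℂ V}
    {d : Fin n → ℂ} (hu : ∀ i, h (u i) = d i • u i) {x : V} {μ : ℂ} (hx : x ≠ 0)
    (hμ : h x = μ • x) (hd : ∀ a, d a ≠ μ + 2) : HasPrimitiveVectorWith t x μ := by
  refine ⟨hx, hμ, ?_⟩
  by_contra h0
  obtain ⟨a, ha⟩ := exists_weight_eq hu h0 (μ := μ + 2) (by
    have := t.lie_h_pow_toEnd_e (m := x) (μ := μ) hμ 1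
    simpa using this)
  exact hd a ha

/-- The weights of a four-dimensional representation of `sl₂`. -/
theorem exists_weights {V : Type*} [AddCommGroup V] [Module ℂ V] {h e f : Module.End ℂ V}
    (t : IsSl2Triple h e f) {u : Module.Basis (Fin 4) ℂ V} {d : Fin 4 → ℂ}
    (hu : ∀ i, h (u i) = d i • u i) :
    ∃ (u : Module.Basis (Fin 4) ℂ V) (d : Fin 4 → ℂ), (∀ i, h (u i) = d i • u i) ∧
      (d = ![3, 1, -1, -3] ∨ d = ![2, 0, -2, 0] ∨ d = ![1, -1, 0, 0] ∨ d = ![1, -1, 1, -1]) := by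
  have : FiniteDimensional ℂ V := Module.Finite.of_basis u
  have hre : ∀ σ : Fin 4 → Fin 4, Function.Injective σ →
      (d ∘ σ = ![3, 1, -1, -3] ∨ d ∘ σ = ![2, 0, -2, 0] ∨ d ∘ σ = ![1, -1, 0, 0] ∨
        d ∘ σ = ![1, -1, 1, -1]) → ∃ (u : Module.Basis (Fin 4) ℂ V) (d : Fin 4 → ℂ),
      (∀ i, h (u i) = d i • u i) ∧ (d = ![3, 1, -1, -3] ∨ d = ![2, 0, -2, 0] ∨
        d = ![1, -1, 0, 0] ∨ d = ![1, -1, 1, -1]) := by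
    intro σ hσ hd
    refine ⟨u.reindex (Equiv.ofBijective σ (Finite.injective_iff_bijective.1 hσ)).symm, d ∘ σ,
      fun i => ?_, hd⟩
    rw [Module.Basis.reindex_apply, Equiv.symm_symm]
    exact hu (σ i)
  have hsum : d 0 + d 1 + d 2 + d 3 = 0 := by
    rw [← t.trace_eq_zero.1, LinearMap.trace_eq_matrix_trace ℂ u, Matrix.trace,
      Fin.sum_univ_four]
    simp [LinearMap.toMatrix_apply, hu]
  have hsum' : ∀ σ : Fin 4 → Fin 4, Function.Injective σ →
      d (σ 0) + d (σ 1) + d (σ 2) + d (σ 3) = 0 := by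
    intro σ hσ
    rw [← hsum, ← Fin.sum_univ_four d, ← Fin.sum_univ_four fun i => d (σ i)]
    exact (Equiv.ofBijective σ (Finite.injective_iff_bijective.1 hσ)).sum_comp d
  -- Weights are complex a priori, so real parts are compared. A weight whose real part is less than
  -- 2 below the maximum is primitive, hence a natural number.
  obtain ⟨a₀, ha₀⟩ := Finite.exists_max fun a => (d a).re
  have hprim : ∀ a, (d a₀).re < (d a).re + 2 → HasPrimitiveVectorWith t (u a) (d a) := by
    intro a ha
    refine t.hasPrimitiveVectorWith hu (u.ne_zero a) (hu a) fun b hb => ?_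
    have h1 := ha₀ b
    simp only [hb, Complex.add_re, Complex.re_ofNat] at h1
    linarith
  have P := hprim a₀ (by linarith)
  obtain ⟨m, hm⟩ := P.exists_nat
  have hnat : ∀ a, (d a₀).re < (d a).re + 2 → ∃ k : ℕ, d a = k ∧ k ≤ m := by
    intro a ha
    obtain ⟨k, hk⟩ := (hprim a ha).exists_nat
    refine ⟨k, hk, ?_⟩
    have h1 := ha₀ a
    rw [hk, hm] at h1
    simpa using h1
  -- The string `m, m - 2, …, -m` consists of distinct weights, so `m ≤ 3`; the trace of `h`
  -- controls the weights outside the string.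
  have hex : ∀ i : Fin (m + 1), ∃ a, d a = m - 2 * i := fun i =>
    exists_weight_eq hu (P.pow_toEnd_f_ne_zero_of_eq_nat hm (Nat.le_of_lt_succ i.2)) (by
      rw [← hm]
      exact P.lie_h_pow_toEnd_f i)
  choose s hs using hex
  have hsinj : Function.Injective s := by
    intro i j hij
    have h1 := hs i
    rw [hij, hs j] at h1
    have h2 : (j : ℂ) = i := by linear_combination (-1 / 2 : ℂ) * h1
    exact Fin.ext (by exact_mod_cast h2.symm)
  have hm3 : m ≤ 3 := by
    have := Fintype.card_le_of_injective s hsinj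
    simp only [Fintype.card_fin] at this
    omega
  have hd : ∀ c : Fin 4 → ℂ, ∀ σ : Fin 4 → Fin 4, d (σ 0) = c 0 → d (σ 1) = c 1 → d (σ 2) = c 2 →
      d (σ 3) = c 3 → d ∘ σ = c := by
    intro c σ h0 h1 h2 h3
    ext i
    fin_cases i
    exacts [h0, h1, h2, h3]
  interval_cases m
  · exfalso
    apply t.h_ne_zero
    have h1 : ∀ a, (d a).re ≤ 0 := fun a => by
      have := ha₀ a
      rw [hm] at this
      simpa using this
    have h2 : (d 0).re + (d 1).re + (d 2).re + (d 3).re = 0 := by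
      have := congrArg Complex.re hsum
      simpa using this
    have h3 : ∀ a, (d a).re = 0 := by
      have := h1 0
      have := h1 1
      have := h1 2
      have := h1 3
      intro a
      fin_cases a <;> simp only [Fin.zero_eta, Fin.mk_one, Fin.reduceFinMk] <;> linarith
    refine u.ext fun a => ?_
    obtain ⟨k, hk, hk0⟩ := hnat a (by rw [h3, h3]; norm_num)
    rw [hu, hk, Nat.le_zero.1 hk0]
    simp
  · have e0 : d (s 0) = 1 := by rw [hs]; simp
    have e1 : d (s 1) = -1 := by rw [hs]; norm_num
    obtain ⟨p, q, hpq⟩ : ∃ p q, Function.Injective ![s 0, s 1, p, q] := by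
      have key : ∀ a b : Fin 4, a ≠ b → ∃ p q, Function.Injective ![a, b, p, q] := by decide
      exact key _ _ (hsinj.ne (by decide))
    have h1 := hsum' _ hpq
    simp only [Matrix.cons_val, e0, e1, add_neg_cancel, zero_add] at h1
    have hq : d q = -d p := eq_neg_of_add_eq_zero_right h1
    -- The two weights outside the string 1, -1 are opposite, and one of them has real part above
    -- -1; that one is 0 or 1.
    by_cases hp : -1 < (d p).re
    · obtain ⟨k, hk, hk1⟩ := hnat p (by rw [hm]; simp; linarith)
      interval_cases k
      · exact hre _ hpq (Or.inr (Or.inr (Or.inl (hd _ _ e0 e1 (by simpa using hk)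
          (by simpa [hk] using hq)))))
      · exact hre _ hpq (Or.inr (Or.inr (Or.inr (hd _ _ e0 e1 (by simpa using hk)
          (by simpa [hk] using hq)))))
    · obtain ⟨k, hk, hk1⟩ := hnat q (by rw [hm, hq]; simp; linarith)
      have hqp : Function.Injective ![s 0, s 1, q, p] := by
        have key : ∀ a b p q : Fin 4, Function.Injective ![a, b, p, q] →
            Function.Injective ![a, b, q, p] := by decide
        exact key _ _ _ _ hpq
      have hp' : d p = -d q := by rw [hq, neg_neg]
      interval_cases k
      · exact hre _ hqp (Or.inr (Or.inr (Or.inl (hd _ _ e0 e1 (by simpa using hk)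
          (by simpa [hk] using hp')))))
      · exact hre _ hqp (Or.inr (Or.inr (Or.inr (hd _ _ e0 e1 (by simpa using hk)
          (by simpa [hk] using hp')))))
  · have e0 : d (s 0) = 2 := by rw [hs]; simp
    have e1 : d (s 1) = 0 := by rw [hs]; norm_num
    have e2 : d (s 2) = -2 := by rw [hs]; norm_num
    obtain ⟨p, hp⟩ : ∃ p, Function.Injective ![s 0, s 1, s 2, p] := by
      have key : ∀ a b c : Fin 4, a ≠ b → a ≠ c → b ≠ c →
          ∃ p, Function.Injective ![a, b, c, p] := by decide
      exact key _ _ _ (hsinj.ne (by decide)) (hsinj.ne (by decide)) (hsinj.ne (by decide))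
    have h1 := hsum' _ hp
    simp only [Matrix.cons_val, e0, e1, e2] at h1
    exact hre _ hp (Or.inr (Or.inl (hd _ _ e0 e1 e2 (by
      simp only [Matrix.cons_val]; linear_combination h1))))
  · have e0 : d (s 0) = 3 := by rw [hs]; simp
    have e1 : d (s 1) = 1 := by rw [hs]; norm_num
    have e2 : d (s 2) = -1 := by rw [hs]; norm_num
    have e3 : d (s 3) = -3 := by rw [hs]; norm_num
    exact hre s hsinj (Or.inl (hd _ _ e0 e1 e2 e3))

end IsSl2Triple

theorem LinearMap.toMatrix_eq_of_forall {n : ℕ} {V : Type*} [AddCommGroup V] [Module ℂ V]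
    (c : Module.Basis (Fin n) ℂ V) {T : Module.End ℂ V} {M : Matrix (Fin n) (Fin n) ℂ}
    (h : ∀ j, T (c j) = ∑ a, M a j • c a) : LinearMap.toMatrix c c T = M := by
  ext i j
  rw [LinearMap.toMatrix_apply, h, Module.Basis.repr_sum_self]

theorem IsLinearBasis.conj_sl2 {D : Set (Fin 4 → ℂ)} {A : Fin 4 → Matrix (Fin 4) (Fin 4) ℂ}
    (hA : IsLinearBasis D A) {h e f : Module.End ℂ (Fin 4 → ℂ)} (t : IsSl2Triple h e f)
    (hh : h ∈ hA.lieSubalgebra) (he : e ∈ hA.lieSubalgebra) (hf : f ∈ hA.lieSubalgebra)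
    (c : Module.Basis (Fin 4) ℂ (Fin 4 → ℂ)) :
    IsLinearBasis (vecMulEquiv c.toGL '' D) ![1, LinearMap.toMatrix c c h,
      LinearMap.toMatrix c c e, LinearMap.toMatrix c c f] := by
  refine ((hA.conj c.toGL).of_linearIndependent (fun i => ?_) ?_).2
  · fin_cases i
    · exact (hA.conj c.toGL).one_mem
    · exact (hA.toMatrix_mem_span_conj c).2 hh
    · exact (hA.toMatrix_mem_span_conj c).2 he
    · exact (hA.toMatrix_mem_span_conj c).2 hf
  · have key := t.linearIndependent_one.map' (LinearMap.toMatrix c c).toLinearMap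
      (LinearEquiv.ker _)
    have h1 : ⇑(LinearMap.toMatrix c c).toLinearMap ∘ ![1, h, e, f] =
        ![1, LinearMap.toMatrix c c h, LinearMap.toMatrix c c e, LinearMap.toMatrix c c f] := by
      funext i
      fin_cases i
      · exact LinearMap.toMatrix_one c
      · rfl
      · rfl
      · rfl
    rwa [h1] at key

namespace IsSl2Triple

variable {V : Type*} [AddCommGroup V] [Module ℂ V] {h e f : Module.End ℂ V}

theorem e_apply_f (t : IsSl2Triple h e f) (x : V) : e (f x) = h x + f (e x) := by
  have h1 := congrArg (fun T : Module.End ℂ V => T x) t.lie_e_f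
  have h2 : e (f x) - f (e x) = h x := h1
  rw [← h2, sub_add_cancel]

theorem h_apply_e (t : IsSl2Triple h e f) {x : V} {μ : ℂ} (hx : h x = μ • x) :
    h (e x) = (μ + 2) • e x := by
  simpa using t.lie_h_pow_toEnd_e (m := x) (μ := μ) hx 1

theorem h_apply_f (t : IsSl2Triple h e f) {x : V} {μ : ℂ} (hx : h x = μ • x) :
    h (f x) = (μ - 2) • f x := by
  have h1 := t.symm.lie_h_pow_toEnd_e (m := x) (μ := -μ) (by
    change -(h x) = _
    rw [hx, neg_smul]) 1
  have h2 : -(h (f x)) = (-μ + 2) • f x := by simpa using h1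
  rw [← neg_neg (h (f x)), h2, ← neg_smul]
  congr 1
  ring

/-- A nontrivial representation of dimension two with trivial complement. -/
theorem saitoDet_eq_zero_of_weights (t : IsSl2Triple h e f) {u : Module.Basis (Fin 4) ℂ V}
    (hu : ∀ i, h (u i) = (![1, -1, 0, 0] : Fin 4 → ℂ) i • u i) (x : Fin 4 → ℂ) :
    saitoDet ![1, LinearMap.toMatrix u u h, LinearMap.toMatrix u u e,
      LinearMap.toMatrix u u f] x = 0 := by
  have hH : LinearMap.toMatrix u u h = Matrix.diagonal ![1, -1, 0, 0] := by
    refine LinearMap.toMatrix_eq_of_forall u fun j => ?_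
    rw [hu, Finset.sum_eq_single j]
    · simp
    · intro b _ hb
      simp [hb]
    · simp
  have hE : ∀ a b, (![1, -1, 0, 0] : Fin 4 → ℂ) a ≠ (![1, -1, 0, 0] : Fin 4 → ℂ) b + 2 →
      LinearMap.toMatrix u u e a b = 0 := fun a b hab => by
    rw [LinearMap.toMatrix_apply]
    exact repr_eq_zero hu (t.h_apply_e (hu b)) hab
  have hF : ∀ a b, (![1, -1, 0, 0] : Fin 4 → ℂ) a ≠ (![1, -1, 0, 0] : Fin 4 → ℂ) b - 2 →
      LinearMap.toMatrix u u f a b = 0 := fun a b hab => by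
    rw [LinearMap.toMatrix_apply]
    exact repr_eq_zero hu (t.h_apply_f (hu b)) hab
  -- Neither 2 nor -2 is a weight, so `e` and `f` kill the weight-zero vectors. The last two columns
  -- of the coefficient matrix then have entries only in the Euler row and are dependent.
  have hE2 : ∀ a, LinearMap.toMatrix u u e a 2 = 0 := fun a => hE a 2 (by
    fin_cases a <;> simp <;> norm_num)
  have hE3 : ∀ a, LinearMap.toMatrix u u e a 3 = 0 := fun a => hE a 3 (by
    fin_cases a <;> simp <;> norm_num)
  have hF2 : ∀ a, LinearMap.toMatrix u u f a 2 = 0 := fun a => hF a 2 (by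
    fin_cases a <;> simp <;> norm_num)
  have hF3 : ∀ a, LinearMap.toMatrix u u f a 3 = 0 := fun a => hF a 3 (by
    fin_cases a <;> simp <;> norm_num)
  have v2 : ∀ M : Matrix (Fin 4) (Fin 4) ℂ, (∀ a, M a 2 = 0) → (x ᵥ* M) 2 = 0 := fun M hM =>
    by simp [Matrix.vecMul, dotProduct, hM]
  have v3 : ∀ M : Matrix (Fin 4) (Fin 4) ℂ, (∀ a, M a 3 = 0) → (x ᵥ* M) 3 = 0 := fun M hM =>
    by simp [Matrix.vecMul, dotProduct, hM]
  rw [saitoDet, Matrix.det_fin_four]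
  simp only [Matrix.of_apply, Matrix.cons_val, Matrix.vecMul_one, hH, Matrix.vecMul_diagonal,
    v2 _ hE2, v2 _ hF2, v3 _ hE3, v3 _ hF3]
  ring

/-- A three-dimensional irreducible representation with trivial complement. -/
theorem exists_basis_adjoint (t : IsSl2Triple h e f) {u : Module.Basis (Fin 4) ℂ V}
    (hu : ∀ i, h (u i) = (![2, 0, -2, 0] : Fin 4 → ℂ) i • u i) :
    ∃ c : Module.Basis (Fin 4) ℂ V, LinearMap.toMatrix c c h = Matrix.diagonal ![2, 0, -2, 0] ∧
      LinearMap.toMatrix c c e = !![0, 2, 0, 0; 0, 0, 2, 0; 0, 0, 0, 0; 0, 0, 0, 0] ∧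
      LinearMap.toMatrix c c f = !![0, 0, 0, 0; 1, 0, 0, 0; 0, 1, 0, 0; 0, 0, 0, 0] := by
  have : FiniteDimensional ℂ V := Module.Finite.of_basis u
  have hu0 : h (u 0) = (2 : ℂ) • u 0 := hu 0
  have hu1 : h (u 1) = (0 : ℂ) • u 1 := hu 1
  have hu3 : h (u 3) = (0 : ℂ) • u 3 := hu 3
  have P₀ : HasPrimitiveVectorWith t (u 0) (2 : ℂ) :=
    t.hasPrimitiveVectorWith hu (u.ne_zero 0) hu0 fun a => by
      fin_cases a <;> simp <;> norm_num
  have he0 : e (u 0) = 0 := P₀.lie_e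
  -- On the two-dimensional space of weight zero, `e` takes values in the line of `u 0`, so it has a
  -- kernel. This yields the trivial summand without complete reducibility.
  obtain ⟨x, hx0, hhx, hex⟩ : ∃ x, x ≠ 0 ∧ h x = (0 : ℂ) • x ∧ e x = 0 := by
    have hw : ∀ y, h y = (0 : ℂ) • y → ∃ α : ℂ, e y = α • u 0 := by
      intro y hy
      have h1 := t.h_apply_e hy
      refine ⟨u.repr (e y) 0, ?_⟩
      conv_lhs => rw [← u.sum_repr (e y)]
      refine Finset.sum_eq_single 0 (fun b _ hb => ?_) (by simp)
      rw [repr_eq_zero hu h1, zero_smul]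
      fin_cases b <;> simp at hb ⊢ <;> norm_num
    obtain ⟨α₁, h₁⟩ := hw _ hu1
    obtain ⟨α₃, h₃⟩ := hw _ hu3
    by_cases hα : α₁ = 0
    · exact ⟨u 1, u.ne_zero 1, hu1, by rw [h₁, hα, zero_smul]⟩
    · refine ⟨u 3 - (α₃ / α₁) • u 1, ?_, ?_, ?_⟩
      · intro h0
        have h2 := congrArg (fun y => u.repr y 3) h0
        simp at h2
      · rw [map_sub, map_smul, hu1, hu3]
        simp
      · rw [map_sub, map_smul, h₁, h₃, smul_smul, div_mul_cancel₀ _ hα, sub_self]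
  have Px : HasPrimitiveVectorWith t x (0 : ℂ) := ⟨hx0, hhx, hex⟩
  have hfx : f x = 0 := by simpa using Px.pow_toEnd_f_eq_zero_of_eq_nat (n := 0) (by simp)
  have hf3 : f (f (f (u 0))) = 0 := by
    simpa [pow_succ'] using P₀.pow_toEnd_f_eq_zero_of_eq_nat (n := 2) (by simp)
  have hh1 : h (f (u 0)) = (0 : ℂ) • f (u 0) := by
    have := t.h_apply_f hu0
    rwa [sub_self] at this
  have hh2 : h (f (f (u 0))) = (-2 : ℂ) • f (f (u 0)) := by
    have := t.h_apply_f hh1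
    rwa [zero_sub] at this
  have he1 : e (f (u 0)) = (2 : ℂ) • u 0 := by rw [t.e_apply_f, hu0, he0, LinearMap.map_zero f, add_zero]
  have he2 : e (f (f (u 0))) = (2 : ℂ) • f (u 0) := by
    rw [t.e_apply_f, hh1, he1, zero_smul, zero_add, map_smul]
  have hli : LinearIndependent ℂ ![u 0, f (u 0), f (f (u 0)), x] := by
    rw [Fintype.linearIndependent_iff]
    intro c hc
    rw [Fin.sum_univ_four] at hc
    simp only [Matrix.cons_val] at hc
    have k1 := congrArg e hc
    simp only [map_add, map_smul, he0, he1, he2, hex, smul_zero, zero_add, add_zero,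
      map_zero] at k1
    have k2 := congrArg e k1
    simp only [map_add, map_smul, he0, he1, smul_zero, zero_add, map_zero, smul_smul,
      smul_eq_zero, u.ne_zero 0, or_false, mul_eq_zero, OfNat.ofNat_ne_zero] at k2
    simp only [k2, zero_smul, add_zero, smul_smul, zero_mul, smul_eq_zero, u.ne_zero 0, or_false,
      mul_eq_zero, OfNat.ofNat_ne_zero] at k1
    rw [k1, k2, zero_smul, zero_smul, add_zero, add_zero] at hc
    have k0 := congrArg h hc
    simp only [map_add, map_smul, hu0, hhx, zero_smul, smul_zero, add_zero, map_zero, smul_smul,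
      smul_eq_zero, u.ne_zero 0, or_false, mul_eq_zero, OfNat.ofNat_ne_zero] at k0
    rw [k0, zero_smul, zero_add, smul_eq_zero] at hc
    intro i
    fin_cases i
    exacts [k0, k1, k2, hc.resolve_right hx0]
  let c : Module.Basis (Fin 4) ℂ V := basisOfLinearIndependentOfCardEqFinrank hli
    (Module.finrank_eq_card_basis u).symm
  have hc : ⇑c = ![u 0, f (u 0), f (f (u 0)), x] := coe_basisOfLinearIndependentOfCardEqFinrank _ _
  refine ⟨c, ?_, ?_, ?_⟩
  · refine LinearMap.toMatrix_eq_of_forall c fun j => ?_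
    rw [hc, Fin.sum_univ_four]
    fin_cases j <;> simp [hu0, hh1, hh2, hhx]
  · refine LinearMap.toMatrix_eq_of_forall c fun j => ?_
    rw [hc, Fin.sum_univ_four]
    fin_cases j <;> simp [he0, he1, he2, hex]
  · refine LinearMap.toMatrix_eq_of_forall c fun j => ?_
    rw [hc, Fin.sum_univ_four]
    fin_cases j <;> simp [hf3, hfx]

/-- Two copies of the standard representation. -/
theorem exists_basis_standard (t : IsSl2Triple h e f) {u : Module.Basis (Fin 4) ℂ V}
    (hu : ∀ i, h (u i) = (![1, -1, 1, -1] : Fin 4 → ℂ) i • u i) :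
    ∃ c : Module.Basis (Fin 4) ℂ V, LinearMap.toMatrix c c h = Matrix.diagonal ![1, 1, -1, -1] ∧
      LinearMap.toMatrix c c e = !![0, 0, 1, 0; 0, 0, 0, 1; 0, 0, 0, 0; 0, 0, 0, 0] ∧
      LinearMap.toMatrix c c f = !![0, 0, 0, 0; 0, 0, 0, 0; 1, 0, 0, 0; 0, 1, 0, 0] := by
  have : FiniteDimensional ℂ V := Module.Finite.of_basis u
  have hu0 : h (u 0) = (1 : ℂ) • u 0 := hu 0
  have hu2 : h (u 2) = (1 : ℂ) • u 2 := hu 2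
  have hP : ∀ y, y ≠ 0 → h y = (1 : ℂ) • y → e y = 0 ∧ f (f y) = 0 ∧ h (f y) = (-1 : ℂ) • f y ∧
      e (f y) = y := by
    intro y hy0 hy
    have P : HasPrimitiveVectorWith t y (1 : ℂ) :=
      t.hasPrimitiveVectorWith hu hy0 hy fun a => by fin_cases a <;> simp <;> norm_num
    have he : e y = 0 := P.lie_e
    refine ⟨he, ?_, ?_, ?_⟩
    · simpa [pow_succ'] using P.pow_toEnd_f_eq_zero_of_eq_nat (n := 1) (by simp)
    · rw [t.h_apply_f hy]
      norm_num
    · rw [t.e_apply_f, hy, he, LinearMap.map_zero f, add_zero, one_smul]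
  obtain ⟨he0, hff0, hhf0, hef0⟩ := hP _ (u.ne_zero 0) hu0
  obtain ⟨he2, hff2, hhf2, hef2⟩ := hP _ (u.ne_zero 2) hu2
  have hpair : ∀ a b : ℂ, a • u 0 + b • u 2 = 0 → a = 0 ∧ b = 0 := by
    intro a b hab
    have h0 := congrArg (fun y => u.repr y 0) hab
    have h2 := congrArg (fun y => u.repr y 2) hab
    exact ⟨by simpa using h0, by simpa using h2⟩
  have hli : LinearIndependent ℂ ![u 0, u 2, f (u 0), f (u 2)] := by
    rw [Fintype.linearIndependent_iff]
    intro c hc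
    rw [Fin.sum_univ_four] at hc
    simp only [Matrix.cons_val] at hc
    have k1 := congrArg e hc
    simp only [map_add, map_smul, he0, he2, hef0, hef2, smul_zero, zero_add, map_zero] at k1
    -- Applying `e` removes the highest weight vectors and maps the other two back to them, so the
    -- coefficients vanish in pairs.
    obtain ⟨c2, c3⟩ := hpair _ _ k1
    rw [c2, c3, zero_smul, zero_smul, add_zero, add_zero] at hc
    obtain ⟨c0, c1⟩ := hpair _ _ hc
    intro i
    fin_cases i
    exacts [c0, c1, c2, c3]
  let c : Module.Basis (Fin 4) ℂ V := basisOfLinearIndependentOfCardEqFinrank hli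
    (Module.finrank_eq_card_basis u).symm
  have hc : ⇑c = ![u 0, u 2, f (u 0), f (u 2)] := coe_basisOfLinearIndependentOfCardEqFinrank _ _
  refine ⟨c, ?_, ?_, ?_⟩
  · refine LinearMap.toMatrix_eq_of_forall c fun j => ?_
    rw [hc, Fin.sum_univ_four]
    fin_cases j <;> simp [hu0, hu2, hhf0, hhf2]
  · refine LinearMap.toMatrix_eq_of_forall c fun j => ?_
    rw [hc, Fin.sum_univ_four]
    fin_cases j <;> simp [he0, he2, hef0, hef2]
  · refine LinearMap.toMatrix_eq_of_forall c fun j => ?_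
    rw [hc, Fin.sum_univ_four]
    fin_cases j <;> simp [hff0, hff2]

/-- The irreducible four-dimensional representation. -/
theorem exists_basis_binaryCubic (t : IsSl2Triple h e f) {u : Module.Basis (Fin 4) ℂ V}
    (hu : ∀ i, h (u i) = (![3, 1, -1, -3] : Fin 4 → ℂ) i • u i) :
    ∃ c : Module.Basis (Fin 4) ℂ V, LinearMap.toMatrix c c h = Matrix.diagonal ![3, 1, -1, -3] ∧
      LinearMap.toMatrix c c e = !![0, 3, 0, 0; 0, 0, 2, 0; 0, 0, 0, 1; 0, 0, 0, 0] ∧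
      LinearMap.toMatrix c c f = !![0, 0, 0, 0; 1, 0, 0, 0; 0, 2, 0, 0; 0, 0, 3, 0] := by
  have : FiniteDimensional ℂ V := Module.Finite.of_basis u
  have hu0 : h (u 0) = (3 : ℂ) • u 0 := hu 0
  have P : HasPrimitiveVectorWith t (u 0) (3 : ℂ) :=
    t.hasPrimitiveVectorWith hu (u.ne_zero 0) hu0 fun a => by
      fin_cases a <;> simp <;> norm_num
  set c1 := f (u 0) with hc1
  -- Divided powers of `f`, chosen so that the matrices become those of the binary cubics in the
  -- table.
  set c2 := (1 / 2 : ℂ) • f c1 with hc2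
  set c3 := (1 / 3 : ℂ) • f c2 with hc3
  have hf1 : f c1 = (2 : ℂ) • c2 := by rw [hc2, smul_smul]; norm_num
  have hf2 : f c2 = (3 : ℂ) • c3 := by rw [hc3, smul_smul]; norm_num
  have hf3 : f c3 = 0 := by
    have h1 := P.pow_toEnd_f_eq_zero_of_eq_nat (n := 3) (by simp)
    have h2 : f (f (f c1)) = 0 := by simpa [pow_succ'] using h1
    rw [hc3, hc2, map_smul, map_smul, map_smul, h2, smul_zero, smul_zero]
  have hh1 : h c1 = (1 : ℂ) • c1 := by rw [hc1, t.h_apply_f hu0]; norm_num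
  have hh2 : h c2 = (-1 : ℂ) • c2 := by
    rw [hc2, map_smul, t.h_apply_f hh1, smul_comm]; norm_num
  have hh3 : h c3 = (-3 : ℂ) • c3 := by
    rw [hc3, map_smul, t.h_apply_f hh2, smul_comm]; norm_num
  have he0 : e (u 0) = 0 := P.lie_e
  have he1 : e c1 = (3 : ℂ) • u 0 := by rw [hc1, t.e_apply_f, hu0, he0, LinearMap.map_zero f, add_zero]
  have he2 : e c2 = (2 : ℂ) • c1 := by
    rw [hc2, map_smul, t.e_apply_f, hh1, he1, map_smul, ← hc1, ← add_smul, smul_smul]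
    norm_num
  have he3 : e c3 = c2 := by
    rw [hc3, map_smul, t.e_apply_f, hh2, he2, map_smul, hf1]
    module
  have hli : LinearIndependent ℂ ![u 0, c1, c2, c3] := by
    have n1 : c1 ≠ 0 := fun h0 => by
      rw [h0, map_zero] at he1
      exact smul_ne_zero (by norm_num) (u.ne_zero 0) he1.symm
    have n2 : c2 ≠ 0 := fun h0 => by
      rw [h0, map_zero] at he2
      exact smul_ne_zero (by norm_num) n1 he2.symm
    have n3 : c3 ≠ 0 := fun h0 => by
      rw [h0, map_zero] at he3
      exact n2 he3.symm
    refine Module.End.eigenvectors_linearIndependent' h ![3, 1, -1, -3] ?_ _ fun i => ?_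
    · intro i j hij
      fin_cases i <;> fin_cases j <;> first | rfl | norm_num at hij
    · rw [Module.End.hasEigenvector_iff, Module.End.mem_eigenspace_iff]
      fin_cases i
      exacts [⟨hu0, u.ne_zero 0⟩, ⟨hh1, n1⟩, ⟨hh2, n2⟩, ⟨hh3, n3⟩]
  let c : Module.Basis (Fin 4) ℂ V := basisOfLinearIndependentOfCardEqFinrank hli
    (Module.finrank_eq_card_basis u).symm
  have hc : ⇑c = ![u 0, c1, c2, c3] := coe_basisOfLinearIndependentOfCardEqFinrank _ _
  refine ⟨c, ?_, ?_, ?_⟩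
  · refine LinearMap.toMatrix_eq_of_forall c fun j => ?_
    rw [hc, Fin.sum_univ_four]
    fin_cases j <;> simp [hu0, hh1, hh2, hh3]
  · refine LinearMap.toMatrix_eq_of_forall c fun j => ?_
    rw [hc, Fin.sum_univ_four]
    fin_cases j <;> simp [he0, he1, he2, he3]
  · refine LinearMap.toMatrix_eq_of_forall c fun j => ?_
    rw [hc, Fin.sum_univ_four]
    fin_cases j <;> simp [hf1, hf2, hf3, ← hc1]

end IsSl2Triple

/-! ### Excluding all representations but the binary cubics -/

theorem hasSimpleZerosOnGeneralLines_det_two : HasSimpleZerosOnGeneralLines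
    fun x : Fin 4 → ℂ => x 0 * x 3 - x 1 * x 2 := by
  have := hasSimpleZerosOnGeneralLines_of_exists
    (q := (MvPolynomial.X 0 * MvPolynomial.X 3 - MvPolynomial.X 1 * MvPolynomial.X 2 :
      MvPolynomial (Fin 4) ℂ)) (d := 2)
    (v := ![1, 0, 0, 1]) (x₀ := ![0, 1, 1, 0]) (P := Polynomial.X ^ 2 - 1)
    (((MvPolynomial.isHomogeneous_X ℂ 0).mul (MvPolynomial.isHomogeneous_X ℂ 3)).sub
      ((MvPolynomial.isHomogeneous_X ℂ 1).mul (MvPolynomial.isHomogeneous_X ℂ 2)))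
    two_ne_zero (by simp) (fun s => by simp; ring) (fun s hs => by
      have h1 : s ^ 2 - 1 = 0 := by simpa using hs
      have h2 : s ≠ 0 := by
        rintro rfl
        norm_num at h1
      simpa using h2)
  simpa using this

namespace IsLinearBasis

/-- The determinant is `2 (x₀x₃ - x₁x₂)²`: the quadric is the right set, but the fields are not a
basis for it. -/
theorem false_of_standard {D : Set (Fin 4 → ℂ)} (hA : IsLinearBasis D
    ![1, Matrix.diagonal ![1, 1, -1, -1], !![0, 0, 1, 0; 0, 0, 0, 1; 0, 0, 0, 0; 0, 0, 0, 0],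
      !![0, 0, 0, 0; 0, 0, 0, 0; 1, 0, 0, 0; 0, 1, 0, 0]]) : False := by
  refine hA.not_eventually_eq_sq_mul (p := ![1, 0, 0, 0]) (w := Pi.single 3 1)
    (q := fun x => x 0 * x 3 - x 1 * x 2) (k := fun _ => 2)
    (hasSimpleZerosOnGeneralLines_det_two.isReducedEquationAt _) (by simp) ?_ analyticAt_const
    (Eventually.of_forall fun x => ?_)
  · have hX : ∀ i, HasFDerivAt (fun x : Fin 4 → ℂ => x i)
        (ContinuousLinearMap.proj (R := ℂ) (φ := fun _ : Fin 4 => ℂ) i) ![1, 0, 0, 0] := fun i =>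
      (ContinuousLinearMap.proj (R := ℂ) (φ := fun _ : Fin 4 => ℂ) i).hasFDerivAt
    have hd : HasFDerivAt (fun x : Fin 4 → ℂ => x 0 * x 3 - x 1 * x 2) _ ![1, 0, 0, 0] :=
      ((hX 0).mul (hX 3)).sub ((hX 1).mul (hX 2))
    rw [hd.fderiv]
    simp
  · rw [saitoDet, Matrix.det_fin_four]
    simp [Matrix.vecMul, dotProduct, Fin.sum_univ_four]
    ring

/-- The three fields of sl₂ live on the three-dimensional summand and annihilate its invariant
quadratic form, so they are dependent and the determinant vanishes identically. -/
theorem false_of_adjoint {D : Set (Fin 4 → ℂ)} (hA : IsLinearBasis D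
    ![1, Matrix.diagonal ![2, 0, -2, 0], !![0, 2, 0, 0; 0, 0, 2, 0; 0, 0, 0, 0; 0, 0, 0, 0],
      !![0, 0, 0, 0; 1, 0, 0, 0; 0, 1, 0, 0; 0, 0, 0, 0]]) : False := by
  obtain ⟨x, hx⟩ := hA.exists_saitoDet_ne_zero
  refine hx ?_
  rw [saitoDet, Matrix.det_fin_four]
  simp [Matrix.vecMul, dotProduct, Fin.sum_univ_four]
  exact Or.inr (by ring)

/-- The coordinates already agree with those of the table; its diagonal fields are 3/2 times the
Euler field plus or minus half of `h`. -/
theorem linearlyIsomorphic_discriminant {D : Set (Fin 4 → ℂ)} (hA : IsLinearBasis D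
    ![1, Matrix.diagonal ![3, 1, -1, -3], !![0, 3, 0, 0; 0, 0, 2, 0; 0, 0, 0, 1; 0, 0, 0, 0],
      !![0, 0, 0, 0; 1, 0, 0, 0; 0, 2, 0, 0; 0, 0, 3, 0]]) :
    LinearlyIsomorphic D TableRow.discriminant.divisor := by
  set A : Fin 4 → Matrix (Fin 4) (Fin 4) ℂ := ![1, Matrix.diagonal ![3, 1, -1, -3],
    !![0, 3, 0, 0; 0, 0, 2, 0; 0, 0, 0, 1; 0, 0, 0, 0],
    !![0, 0, 0, 0; 1, 0, 0, 0; 0, 2, 0, 0; 0, 0, 3, 0]] with hdef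
  have hmem : ∀ i, A i ∈ Submodule.span ℂ (Set.range A) := fun i =>
    Submodule.subset_span ⟨i, rfl⟩
  refine hA.linearlyIsomorphic .discriminant 1 fun i =>
    ⟨TableRow.discriminant.basis i, ?_, by simp⟩
  have hs := fun a b => add_mem (Submodule.smul_mem _ (a : ℂ) (hmem 0))
    (Submodule.smul_mem _ (b : ℂ) (hmem 1))
  fin_cases i
  · change TableRow.discriminant.basis 0 ∈ _
    convert hs (3 / 2) (1 / 2) using 1
    ext i j
    fin_cases i <;> fin_cases j <;>
      norm_num [TableRow.basis, TableRow.element, hdef, Pi.single_apply]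
    all_goals decide
  · change TableRow.discriminant.basis 1 ∈ _
    convert hmem 2 using 1
    ext i j
    fin_cases i <;> fin_cases j <;> simp [TableRow.basis, TableRow.element, hdef]
  · change TableRow.discriminant.basis 2 ∈ _
    convert hmem 3 using 1
    ext i j
    fin_cases i <;> fin_cases j <;> simp [TableRow.basis, TableRow.element, hdef]
  · change TableRow.discriminant.basis 3 ∈ _
    convert hs (3 / 2) (-1 / 2) using 1
    ext i j
    fin_cases i <;> fin_cases j <;>
      norm_num [TableRow.basis, TableRow.element, hdef, Pi.single_apply]
    all_goals decide

theorem exists_row_of_not_isSolvable {D : Set (Fin 4 → ℂ)}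
    {A : Fin 4 → Matrix (Fin 4) (Fin 4) ℂ} (hA : IsLinearBasis D A)
    (hsol : ¬ LieAlgebra.IsSolvable hA.lieSubalgebra) :
    ∃ r : TableRow 4, LinearlyIsomorphic D r.divisor := by
  obtain ⟨h, e, f, t, hh, he, hf⟩ := hA.exists_isSl2Triple hsol
  obtain ⟨u, d, hu⟩ := hA.exists_basis_sl2 t hh he hf
  obtain ⟨u, d, hu, rfl | rfl | rfl | rfl⟩ := IsSl2Triple.exists_weights t hu
  · obtain ⟨c, hc1, hc2, hc3⟩ := t.exists_basis_binaryCubic hu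
    have hC := hA.conj_sl2 t hh he hf c
    rw [hc1, hc2, hc3] at hC
    exact ⟨_, (IsLinearBasis.linearlyIsomorphic_conj D c.toGL).trans
      hC.linearlyIsomorphic_discriminant⟩
  · obtain ⟨c, hc1, hc2, hc3⟩ := t.exists_basis_adjoint hu
    have hC := hA.conj_sl2 t hh he hf c
    rw [hc1, hc2, hc3] at hC
    exact hC.false_of_adjoint.elim
  · obtain ⟨x, hx⟩ := (hA.conj_sl2 t hh he hf u).exists_saitoDet_ne_zero
    exact (hx (t.saitoDet_eq_zero_of_weights hu x)).elim
  · obtain ⟨c, hc1, hc2, hc3⟩ := t.exists_basis_standard hu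
    have hC := hA.conj_sl2 t hh he hf c
    rw [hc1, hc2, hc3] at hC
    exact hC.false_of_standard.elim

end IsLinearBasis

theorem IsLinearFreeDivisor.exists_row {n : ℕ} (hn : 1 ≤ n) (hn' : n ≤ 4) {D : Set (Fin n → ℂ)}
    (hD : IsLinearFreeDivisor D) : ∃ r : TableRow n, LinearlyIsomorphic D r.divisor := by
  obtain ⟨hred, A, hA'⟩ := hD
  have hA : IsLinearBasis D A := ⟨hred, hA'⟩
  by_cases hsol : LieAlgebra.IsSolvable hA.lieSubalgebra
  · obtain ⟨D', A', hDD', hA'⟩ := hA.exists_isTriangularBasis hsol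
    have key : ∃ r : TableRow n, LinearlyIsomorphic D' r.divisor := by
      interval_cases n
      · exact hA'.toIsLinearBasis.exists_row₁
      · exact hA'.exists_row₂
      · exact hA'.exists_row₃
      · exact hA'.exists_row₄
    exact key.imp fun r hr => hDD'.trans hr
  · rcases hn'.lt_or_eq with h | rfl
    · exact absurd (hA.isSolvable_of_le_three hn (by omega)) hsol
    · exact hA.exists_row_of_not_isSolvable hsol

theorem mainTheorem3 :
    (∀ n : ℕ, 1 ≤ n → n ≤ 4 → ∀ D : Set (Fin n → ℂ),
      (IsLinearFreeDivisor D ↔ ∃ r : TableRow n, LinearlyIsomorphic D r.divisor)) ∧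
    (∀ (n : ℕ) (r s : TableRow n), LinearlyIsomorphic r.divisor s.divisor → r = s) ∧
    (∀ (n : ℕ) (r : TableRow n),
      (∀ p : Fin n → ℂ, IsReducedEquationAt r.divisor p r.equation) ∧
      IsLogarithmicBasis r.divisor (fun i v => r.matrix v i) ∧
      ∃ 𝔤 : LieSubalgebra ℂ (Matrix (Fin n) (Fin n) ℂ),
        IsLieAlgebraOfDivisor r.divisor 𝔤 ∧
        r.HasLieAlgebra 𝔤 ∧
        (IsReductiveMatrixAlgebra 𝔤 ↔ r.ListedReductive)) := by
  refine ⟨fun n hn hn' D => ⟨fun hD => hD.exists_row hn hn', ?_⟩,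
    fun n r s h => TableRow.eq_of_linearlyIsomorphic h, fun n r => ?_⟩
  · rintro ⟨r, hr⟩
    exact r.isLinearFreeDivisor.of_linearlyIsomorphic hr.symm
  · obtain ⟨𝔤, h𝔤, h⟩ := r.exists_isLieAlgebraOfDivisor
    exact ⟨r.isReducedEquationAt, r.isLogarithmicBasis, 𝔤, h𝔤, r.hasLieAlgebra h,
      r.isReductive_iff h⟩
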